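/- **Proposition 4.1 (compactness).** Let $\gamma>1$, $\kappa=\frac{(\gamma-1)^2}{4\gamma}$, $\theta=\frac{\gamma-1}{2}$. There is an exponent $\beta=\beta(\gamma)>2$ such that the following holds. *Setting.* Let $A\in C^2(\mathbb R)$ satisfy $0<A_0\le A\le A_1<\infty$, with $A',A''$ bounded and $A'\in L^1(\mathbb R)$. Let $\rho_\pm\ge 0$ and $m_\pm\in\mathbb R$, and put $u_\pm=m_\pm/\rho_\pm$ if $\rho_\pm\neq0$, $u_\pm=0$ otherwise. Let $L_0>1$ and let $\bar\rho,\bar u$ be smooth monotone functions on $\mathbb R$ with $(\bar\rho,\bar u)=(\rho_+,u_+)$ for $x\ge L_0$ and $(\bar\rho,\bar u)=(\rho_-,u_-)$ for $x\le -L_0$. Let $\varepsilon$ run through a sequence of positive numbers tending to $0$ and, for each such $\varepsilon$, let $\delta=\delta(\varepsilon)>0$, $a=a(\varepsilon)<-L_0$, $b=b(\varepsilon)>L_0$ with $\delta\to0$, $a\to-\infty$, $b\to\infty$ as $\varepsilon\to 0$, and $$\frac{\delta|a|^\beta}{\varepsilon}\le M,\qquad \varepsilon|b-a|\le M,$$ with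 $M$ independent of $\varepsilon$. Let $p_\delta(\rho)=\kappa\rho^\gamma+\delta\rho^2$ and $h_\delta(\rho)=\rho\int_0^\rho\frac{p_\delta(s)}{s^2}\,ds$. Let $(\rho^\varepsilon,m^\varepsilon)$ be the viscous approximate solutions, that is, solutions of class $C^{2,1}([0,\infty)\times[a,b])$ with $\rho^\varepsilon>0$ of $$\begin{cases}\rho^\varepsilon_t+m^\varepsilon_x+\frac{A'}{A}m^\varepsilon=\varepsilon\big(\rho^\varepsilon_{xx}+\frac{A'}{A}\rho^\varepsilon_x\big),\\[1mm] m^\varepsilon_t+\big(\frac{(m^\varepsilon)^2}{\rho^\varepsilon}+p_\delta(\rho^\varepsilon)\big)_x+\frac{A'}{A}\frac{(m^\varepsilon)^2}{\rho^\varepsilon}=\varepsilon\big(m^\varepsilon_x+\frac{A'}{A}m^\varepsilon\big)_x\end{cases}$$ in $(0,\infty)\times(a,b)$, with initial data $(\rho^\varepsilon_0,m^\varepsilon_0)$ and constant Dirichlet data $(\rho^\varepsilon_-,m^\varepsilon_-)$ at $x=a$ and $(\rho^\varepsilon_+,m^\varepsilon_+)$ at $x=b$. Here $\rho^\varepsilon_\pm>0$,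 $(\rho^\varepsilon_\pm,m^\varepsilon_\pm)\to(\rho_\pm,m_\pm)$ as $\varepsilon\to0$, and the boundary velocities $m^\varepsilon_\pm/\rho^\varepsilon_\pm$ are bounded uniformly in $\varepsilon$ (which is automatic if $\rho_\pm>0$). Suppose finally that the initial relative energies are uniformly bounded: $$\sup_{\varepsilon}\int_a^b\Big(\tfrac12\rho_0^\varepsilon\Big|\frac{m_0^\varepsilon}{\rho_0^\varepsilon}-\bar u\Big|^2+h_\delta(\rho_0^\varepsilon)-h_\delta(\bar\rho)-h_\delta'(\bar\rho)(\rho_0^\varepsilon-\bar\rho)\Big)A\,dx<\infty .$$ *Claim.* For $\psi\in C_c^\infty(\mathbb R)$ let $(\eta,q)$ be the entropy pair generated by $\psi$, $$\eta(\rho,m)=\rho\int_{-1}^{1}\psi\big(\tfrac m\rho+\rho^\theta s\big)(1-s^2)^{\frac{3-\gamma}{2(\gamma-1)}}ds,\qquad q(\rho,m)=\rho\int_{-1}^{1}\big(\tfrac m\rho+\theta\rho^\theta s\big)\psi\big(\tfrac m\rho+\rho^\theta s\big)(1-s^2)^{\frac{3-\gamma}{2(\gamma-1)}}ds .$$ Then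 the entropy dissipation measures $\eta(\rho^\varepsilon,m^\varepsilon)_t+q(\rho^\varepsilon,m^\varepsilon)_x$ lie in a compact subset of $H^{-1}_{loc}$: for every bounded open set $\Omega\subset(0,\infty)\times\mathbb R$ there is a compact subset of $H^{-1}(\Omega)=(H^1_0(\Omega))^*$ that contains the distributions $\eta(\rho^\varepsilon,m^\varepsilon)_t+q(\rho^\varepsilon,m^\varepsilon)_x$ on $\Omega$ for all $\varepsilon$ of the sequence with $\Omega\subset(0,\infty)\times(a(\varepsilon),b(\varepsilon))$. -/

import Mathlib

open Real Set Filter Topology MeasureTheory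
open scoped ContDiff

noncomputable section

namespace Nozzle

/-! ### The viscous approximate problem on a bounded interval -/

/-- The scaling constant `κ = (γ - 1)² / (4 γ)` of the polytropic pressure law. -/
def kappa (γ : ℝ) : ℝ := (γ - 1) ^ 2 / (4 * γ)

/-- The exponent `θ = (γ - 1) / 2`. -/
def theta (γ : ℝ) : ℝ := (γ - 1) / 2

/-- The modified pressure `p_δ(r) = κ r^γ + δ r²`. -/
def pressure (γ δ r : ℝ) : ℝ := kappa γ * r ^ γ + δ * r ^ 2

/-- The modified internal energy `h_δ(r) = r ∫₀^r p_δ(s) / s² ds`, with the integral evaluated. -/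
def internalEnergy (γ δ r : ℝ) : ℝ := kappa γ / (γ - 1) * r ^ γ + δ * r ^ 2

/-- The relative mechanical energy density of the state `(r, m)`, with velocity `m / r`, with
respect to the reference density `rbar` and the reference velocity `ubar`. -/
def relEnergy (γ δ r m rbar ubar : ℝ) : ℝ :=
  1 / 2 * r * (m / r - ubar) ^ 2 +
    (internalEnergy γ δ r - internalEnergy γ δ rbar -
      deriv (internalEnergy γ δ) rbar * (r - rbar))

/-- The cross-sectional area: `A ∈ C²(ℝ)` is bounded above and bounded below by a positive
constant, `A'` and `A''` are bounded, and `A' ∈ L¹(ℝ)`. -/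
structure IsArea (A : ℝ → ℝ) : Prop where
  contDiff : ContDiff ℝ 2 A
  lower : ∃ A₀ : ℝ, 0 < A₀ ∧ ∀ x, A₀ ≤ A x
  bounded : ∃ A₂ : ℝ, ∀ x, A x ≤ A₂ ∧ |deriv A x| ≤ A₂ ∧ |deriv (deriv A) x| ≤ A₂
  integrable : Integrable (deriv A)

/-- A smooth monotone profile on `ℝ` which equals `l` for `x ≤ -L₀` and `r` for `x ≥ L₀`. -/
structure IsProfile (L₀ l r : ℝ) (f : ℝ → ℝ) : Prop where
  contDiff : ContDiff ℝ ∞ f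
  monotone : Monotone f ∨ Antitone f
  left : ∀ x, x ≤ -L₀ → f x = l
  right : ∀ x, L₀ ≤ x → f x = r

/-- `f(t, x)` is of class `C^{2,1}` up to the boundary of `[0, ∞) × [a, b]`:
`f`, `f_t`, `f_x` and `f_xx` exist (one-sided at the boundary) and are continuous there. -/
def IsC21 (a b : ℝ) (f : ℝ → ℝ → ℝ) : Prop :=
  ∃ ft fx fxx : ℝ → ℝ → ℝ,
    ContinuousOn (fun z : ℝ × ℝ => f z.1 z.2) (Ici 0 ×ˢ Icc a b) ∧
    ContinuousOn (fun z : ℝ × ℝ => ft z.1 z.2) (Ici 0 ×ˢ Icc a b) ∧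
    ContinuousOn (fun z : ℝ × ℝ => fx z.1 z.2) (Ici 0 ×ˢ Icc a b) ∧
    ContinuousOn (fun z : ℝ × ℝ => fxx z.1 z.2) (Ici 0 ×ˢ Icc a b) ∧
    ∀ t ∈ Ici (0 : ℝ), ∀ x ∈ Icc a b,
      HasDerivWithinAt (fun s => f s x) (ft t x) (Ici 0) t ∧
      HasDerivWithinAt (f t) (fx t x) (Icc a b) x ∧
      HasDerivWithinAt (fx t) (fxx t x) (Icc a b) x

/-- `(ρ, m)` is a global classical solution with positive density of the viscous approximate
system on `[0, ∞) × [a, b]`, with initial data `(ρ₀, m₀)` and constant Dirichlet data `(ρl, ml)`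
at `x = a` and `(ρr, mr)` at `x = b`. -/
structure IsApproxSolution (γ : ℝ) (A : ℝ → ℝ) (ε δ a b : ℝ) (ρ₀ m₀ : ℝ → ℝ)
    (ρl ml ρr mr : ℝ) (ρ m : ℝ → ℝ → ℝ) : Prop where
  regular_rho : IsC21 a b ρ
  regular_m : IsC21 a b m
  pos : ∀ t, 0 ≤ t → ∀ x ∈ Icc a b, 0 < ρ t x
  continuity : ∀ t, 0 < t → ∀ x ∈ Ioo a b,
    deriv (fun s => ρ s x) t + deriv (m t) x + deriv A x / A x * m t x =
      ε * (deriv (deriv (ρ t)) x + deriv A x / A x * deriv (ρ t) x)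
  momentum : ∀ t, 0 < t → ∀ x ∈ Ioo a b,
    deriv (fun s => m s x) t
        + deriv (fun y => m t y ^ 2 / ρ t y + pressure γ δ (ρ t y)) x
        + deriv A x / A x * (m t x ^ 2 / ρ t x) =
      ε * deriv (fun y => deriv (m t) y + deriv A y / A y * m t y) x
  initial : ∀ x ∈ Icc a b, ρ 0 x = ρ₀ x ∧ m 0 x = m₀ x
  left : ∀ t, 0 ≤ t → ρ t a = ρl ∧ m t a = ml
  right : ∀ t, 0 ≤ t → ρ t b = ρr ∧ m t b = mr

/-! ### Weak entropy pairs -/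

/-- The weak entropy generated by `ψ`. The weight `[1 - s²]₊^((3 - γ) / (2 (γ - 1)))` is supported
in `[-1, 1]`, so that the integral runs over this interval. -/
def entropy (γ : ℝ) (ψ : ℝ → ℝ) (r m : ℝ) : ℝ :=
  r * ∫ s in (-1 : ℝ)..1,
    ψ (m / r + r ^ theta γ * s) * (1 - s ^ 2) ^ ((3 - γ) / (2 * (γ - 1)))

/-- The entropy flux generated by `ψ`. -/
def entropyFlux (γ : ℝ) (ψ : ℝ → ℝ) (r m : ℝ) : ℝ :=
  r * ∫ s in (-1 : ℝ)..1,
    (m / r + theta γ * r ^ theta γ * s) * ψ (m / r + r ^ theta γ * s) *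
      (1 - s ^ 2) ^ ((3 - γ) / (2 * (γ - 1)))

/-! ### The space `H⁻¹(Ω)` of an open set of the `(t, x)`-plane -/

/-- `φ ∈ C_c^∞(Ω)`. -/
structure IsTest (Ω : Set (ℝ × ℝ)) (φ : ℝ × ℝ → ℝ) : Prop where
  contDiff : ContDiff ℝ ∞ φ
  compact : HasCompactSupport φ
  subset : tsupport φ ⊆ Ω

/-- The partial derivative in `t`. -/
def partialT (φ : ℝ × ℝ → ℝ) (z : ℝ × ℝ) : ℝ := fderiv ℝ φ z (1, 0)

/-- The partial derivative in `x`. -/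
def partialX (φ : ℝ × ℝ → ℝ) (z : ℝ × ℝ) : ℝ := fderiv ℝ φ z (0, 1)

/-- The function `(φ, φ_t, φ_x)`; its `L²` norm is the `H¹` norm of `φ`. -/
def jet (φ : ℝ × ℝ → ℝ) (z : ℝ × ℝ) : EuclideanSpace ℝ (Fin 3) :=
  !₂[φ z, partialT φ z, partialX φ z]

theorem jet_zero : jet (fun _ => 0) = 0 := by
  ext z i
  fin_cases i <;> simp [jet, partialT, partialX]

theorem jet_add {φ χ : ℝ × ℝ → ℝ} (hφ : ContDiff ℝ ∞ φ) (hχ : ContDiff ℝ ∞ χ) :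
    jet (fun z => φ z + χ z) = fun z => jet φ z + jet χ z := by
  have h1 : Differentiable ℝ φ := hφ.differentiable (by simp)
  have h2 : Differentiable ℝ χ := hχ.differentiable (by simp)
  funext z
  ext i
  fin_cases i <;> simp [jet, partialT, partialX, fderiv_fun_add (h1 z) (h2 z)]

theorem jet_smul (c : ℝ) {φ : ℝ × ℝ → ℝ} (hφ : ContDiff ℝ ∞ φ) :
    jet (fun z => c * φ z) = fun z => c • jet φ z := by
  have h1 : Differentiable ℝ φ := hφ.differentiable (by simp)
  funext z
  ext i
  fin_cases i <;> simp [jet, partialT, partialX, fderiv_const_mul (h1 z) c]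

/-- The test functions on `Ω`, with their first derivatives, as a subspace of `L²`. -/
def testJets (Ω : Set (ℝ × ℝ)) :
    Submodule ℝ (Lp (EuclideanSpace ℝ (Fin 3)) 2 (volume : Measure (ℝ × ℝ))) where
  carrier := {v | ∃ φ, IsTest Ω φ ∧ v =ᵐ[volume] jet φ}
  zero_mem' := by
    refine ⟨fun _ => 0, ⟨contDiff_const, ?_, ?_⟩, ?_⟩
    · exact HasCompactSupport.zero
    · have : tsupport (fun _ : ℝ × ℝ => (0 : ℝ)) = ∅ := tsupport_eq_empty_iff.2 rfl
      rw [this]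
      exact empty_subset _
    · rw [jet_zero]
      exact Lp.coeFn_zero _ _ _
  add_mem' := by
    rintro v w ⟨φ, hφ, hv⟩ ⟨χ, hχ, hw⟩
    refine ⟨fun z => φ z + χ z, ⟨hφ.contDiff.add hχ.contDiff, hφ.compact.add hχ.compact, ?_⟩, ?_⟩
    · exact (tsupport_add φ χ).trans (union_subset hφ.subset hχ.subset)
    · rw [jet_add hφ.contDiff hχ.contDiff]
      filter_upwards [Lp.coeFn_add v w, hv, hw] with z h1 h2 h3
      rw [h1, Pi.add_apply, h2, h3]
  smul_mem' := by
    rintro c v ⟨φ, hφ, hv⟩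
    refine ⟨fun z => c * φ z, ⟨contDiff_const.mul hφ.contDiff, hφ.compact.mul_left, ?_⟩, ?_⟩
    · exact (closure_mono (Function.support_const_smul_subset c φ)).trans hφ.subset
    · rw [jet_smul c hφ.contDiff]
      filter_upwards [Lp.coeFn_smul c v, hv] with z h1 h2
      rw [h1, Pi.smul_apply, h2]

/-- The Sobolev space `H¹₀(Ω)`, the closure of `C_c^∞(Ω)` in the `H¹` norm; a function `v` is
represented by the element `(v, v_t, v_x)` of `L²`. -/
def H10 (Ω : Set (ℝ × ℝ)) :
    Submodule ℝ (Lp (EuclideanSpace ℝ (Fin 3)) 2 (volume : Measure (ℝ × ℝ))) :=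
  (testJets Ω).topologicalClosure

/-- The space `H⁻¹(Ω)`, the dual of `H¹₀(Ω)`, with the dual norm. -/
abbrev Hm1 (Ω : Set (ℝ × ℝ)) : Type := StrongDual ℝ (H10 Ω)

/-- The element `T` of `H⁻¹(Ω)` is the distribution `η_t + q_x` on `Ω`: its value at each test
function `φ` (given as the element `v` of `H¹₀(Ω)`) is `-∫_Ω (η φ_t + q φ_x)`. -/
def IsDivergence (Ω : Set (ℝ × ℝ)) (η q : ℝ × ℝ → ℝ) (T : Hm1 Ω) : Prop :=
  ∀ φ, IsTest Ω φ → ∀ v : H10 Ω,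
    ((v : Lp (EuclideanSpace ℝ (Fin 3)) 2 (volume : Measure (ℝ × ℝ))) =ᵐ[volume] jet φ) →
      T v = -∫ z in Ω, (η z * partialT φ z + q z * partialX φ z)

end Nozzle

end

/-! Along the flow the entropy pair obeys η_t + q_x = ε η_xx + μ. The production μ gathers the
geometric terms with A'/A, the defect 2δ ρ ρ_x η_m of the artificial pressure, and ε times the
Hessian of η applied to the gradient of the state (`Flow.etaT_add_fluxX`). Three facts imply
compactness in H⁻¹ on bounded sets: μ is bounded in L¹, ε η_x and ε q_x tend to zero in L¹, and η²,
q² are uniformly integrable. No L^∞ bound on the solutions is available, so all three must come from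
integral estimates.

Energy. The mechanical energy is taken relative to a reference obtained by interpolating the
coefficients of four constant states: the Dirichlet states at the two ends and the limit states in
between. At x = a and x = b the reference is the boundary state itself, so the factors of ρ_x and
m_x in the energy flux vanish and no boundary derivative has to be estimated. The sources are at
most the energy size times a weight k + |A'| + ε, which is bounded and has bounded integral because
A' is integrable and ε(b - a) ≤ M. Grönwall's inequality then bounds the energy and ε times the
dissipation (`Flow.energy_estimate`, `Flow.energy_bounds`).

Density. The dissipation controls the oscillation of ρ^γ, hence ε∫∫ρ³. With this, multiplying the
integrated momentum equation by ρ gives a local L^(γ+1) bound (`Flow.integral_rpow_le`). The part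
ρ^(γ-2) ρ_x² of the dissipation may degenerate at vacuum; the renormalized equation for log(1 + ρ)
compensates with a bound for ε^(3/2) ∫∫ |∂_x log(1 + ρ)|² (`Flow.integral_logGradient_le`).

Entropy. Since ψ has compact support, its kernel averages vanish unless |u| ≤ L + ρ^θ, so a factor u
costs at most L + ρ^θ. Hence the derivatives of η and q are controlled by the quantities above, and
ε η_x, ε q_x are O(ε^(1/4)) in L¹ (`Flow.mul_gradient_le`, `Flow.abs_production_le`). Moreover the
kernel measure of the s with |u + ρ^θ s| ≤ L tends to zero as ρ → ∞, uniformly in u. Therefore η and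
q are o(ρ^((γ+1)/2)), and the L^(γ+1) bound yields uniform integrability of their squares
(`exists_excess_le`).

Compactness. The bound of `Balance.abs_action_le` is quantitative. A test function φ of H¹ norm at
most one is replaced by χ = τ sin(φ/τ), so that μ contributes at most Cτ. The error (1 - cos(φ/τ))∇φ
is harmless: against the part of η, q below height k it costs (k/τ)‖φ‖ in L², and against the excess
it is uniformly small. The term ε η_x χ_x cannot be estimated directly, since ε η_x is small in L¹
only; a translation by some |y| ≤ ε, found by the mean value theorem, turns it into a difference of
values of η, small in L². By a Poincaré inequality on a fine grid ‖φ‖ is small up to finitely many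
averages. So, for large n, the functionals are uniformly small up to finitely many fixed
functionals, which means total boundedness (`exists_totallyBounded_near`,
`isCompact_closure_of_near`). -/

noncomputable section
namespace Nozzle

/-! ### Calculus on strips -/

/-- The logarithmic derivative `A' / A` of the area. -/
def slope (A : ℝ → ℝ) (x : ℝ) : ℝ := deriv A x / A x

/-- The derivative of `A' / A`. -/
def slope' (A : ℝ → ℝ) (x : ℝ) : ℝ := deriv (deriv A) x / A x - (deriv A x / A x) ^ 2

namespace IsArea
variable {A : ℝ → ℝ}

theorem pos (hA : IsArea A) (x : ℝ) : 0 < A x := by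
  obtain ⟨A₀, h0, h⟩ := hA.lower
  exact h0.trans_le (h x)

theorem hasDerivAt (hA : IsArea A) (x : ℝ) : HasDerivAt A (deriv A x) x :=
  (hA.contDiff.differentiable (by norm_num) x).hasDerivAt

theorem contDiff_deriv (hA : IsArea A) : ContDiff ℝ 1 (deriv A) :=
  (contDiff_succ_iff_deriv.1 (show ContDiff ℝ (1 + 1) A by
    simpa [one_add_one_eq_two] using hA.contDiff)).2.2

theorem hasDerivAt_deriv (hA : IsArea A) (x : ℝ) :
    HasDerivAt (deriv A) (deriv (deriv A) x) x :=
  (hA.contDiff_deriv.differentiable (by norm_num) x).hasDerivAt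

theorem continuous (hA : IsArea A) : Continuous A := hA.contDiff.continuous

theorem continuous_deriv (hA : IsArea A) : Continuous (deriv A) := hA.contDiff_deriv.continuous

theorem continuous_deriv2 (hA : IsArea A) : Continuous (deriv (deriv A)) :=
  hA.contDiff_deriv.continuous_deriv (by norm_num)

theorem hasDerivAt_slope (hA : IsArea A) (x : ℝ) : HasDerivAt (slope A) (slope' A x) x := by
  have h := (hA.hasDerivAt_deriv x).div (hA.hasDerivAt x) (hA.pos x).ne'
  refine h.congr_deriv ?_
  have := (hA.pos x).ne'
  unfold slope'
  field_simp

theorem continuous_slope (hA : IsArea A) : Continuous (slope A) :=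
  hA.continuous_deriv.div hA.continuous fun x => (hA.pos x).ne'

theorem continuous_slope' (hA : IsArea A) : Continuous (slope' A) :=
  (hA.continuous_deriv2.div hA.continuous fun x => (hA.pos x).ne').sub
    (hA.continuous_slope.pow 2)

end IsArea

/-- The derivative of the modified pressure. -/
def pressure' (γ δ r : ℝ) : ℝ := kappa γ * (γ * r ^ (γ - 1)) + 2 * δ * r

theorem hasDerivAt_pressure {γ : ℝ} (δ : ℝ) {r : ℝ} (hr : 0 < r) :
    HasDerivAt (pressure γ δ) (pressure' γ δ r) r := by
  have h1 := (Real.hasDerivAt_rpow_const (p := γ) (Or.inl hr.ne')).const_mul (kappa γ)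
  have h2 := (hasDerivAt_pow 2 r).const_mul δ
  refine (h1.add h2).congr_deriv ?_
  unfold pressure'
  norm_num
  ring

/-- A classical solution with positive density of the viscous approximate system, together with its
derivatives, all of them extended continuously to the plane. -/
structure Flow (γ : ℝ) (A : ℝ → ℝ) (ε δ a b : ℝ) where
  (r rt rx rxx m mt mx mxx : ℝ → ℝ → ℝ)
  cont_r : Continuous fun z : ℝ × ℝ => r z.1 z.2
  cont_rt : Continuous fun z : ℝ × ℝ => rt z.1 z.2
  cont_rx : Continuous fun z : ℝ × ℝ => rx z.1 z.2
  cont_rxx : Continuous fun z : ℝ × ℝ => rxx z.1 z.2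
  cont_m : Continuous fun z : ℝ × ℝ => m z.1 z.2
  cont_mt : Continuous fun z : ℝ × ℝ => mt z.1 z.2
  cont_mx : Continuous fun z : ℝ × ℝ => mx z.1 z.2
  cont_mxx : Continuous fun z : ℝ × ℝ => mxx z.1 z.2
  pos : ∀ t x, 0 < r t x
  hrt : ∀ t, 0 < t → ∀ x ∈ Ioo a b, HasDerivAt (fun s => r s x) (rt t x) t
  hrx : ∀ t, 0 < t → ∀ x ∈ Ioo a b, HasDerivAt (r t) (rx t x) x
  hrxx : ∀ t, 0 < t → ∀ x ∈ Ioo a b, HasDerivAt (rx t) (rxx t x) x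
  hmt : ∀ t, 0 < t → ∀ x ∈ Ioo a b, HasDerivAt (fun s => m s x) (mt t x) t
  hmx : ∀ t, 0 < t → ∀ x ∈ Ioo a b, HasDerivAt (m t) (mx t x) x
  hmxx : ∀ t, 0 < t → ∀ x ∈ Ioo a b, HasDerivAt (mx t) (mxx t x) x
  continuity : ∀ t, 0 < t → ∀ x ∈ Ioo a b,
    rt t x = -mx t x - slope A x * m t x + ε * (rxx t x + slope A x * rx t x)
  momentum : ∀ t, 0 < t → ∀ x ∈ Ioo a b,
    mt t x = -(2 * m t x * mx t x / r t x - m t x ^ 2 * rx t x / r t x ^ 2)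
      - pressure' γ δ (r t x) * rx t x - slope A x * (m t x ^ 2 / r t x)
      + ε * (mxx t x + slope' A x * m t x + slope A x * mx t x)

/-- The retraction of the line onto `[a, b]`. -/
def clamp (a b x : ℝ) : ℝ := max a (min x b)

theorem continuous_clamp (a b : ℝ) : Continuous (clamp a b) := by
  unfold clamp; fun_prop

theorem clamp_mem {a b : ℝ} (hab : a ≤ b) (x : ℝ) : clamp a b x ∈ Icc a b :=
  ⟨le_max_left _ _, max_le hab (min_le_right _ _)⟩

theorem clamp_of_mem {a b x : ℝ} (hx : x ∈ Icc a b) : clamp a b x = x := by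
  unfold clamp
  rw [min_eq_left hx.2, max_eq_right hx.1]

theorem continuous_extend {a b : ℝ} (hab : a ≤ b) {f : ℝ → ℝ → ℝ}
    (hf : ContinuousOn (fun z : ℝ × ℝ => f z.1 z.2) (Ici 0 ×ˢ Icc a b)) :
    Continuous fun z : ℝ × ℝ => f (max z.1 0) (clamp a b z.2) := by
  have hc := continuous_clamp a b
  refine hf.comp_continuous (f := fun z : ℝ × ℝ => (max z.1 0, clamp a b z.2)) (by fun_prop) ?_
  intro z
  exact ⟨le_max_right z.1 0, clamp_mem hab _⟩

theorem hasDerivAt_extend_fst {a b : ℝ} {f : ℝ → ℝ → ℝ} {d t x : ℝ} (ht : 0 < t)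
    (hx : x ∈ Icc a b) (h : HasDerivWithinAt (fun s => f s x) d (Ici 0) t) :
    HasDerivAt (fun s => f (max s 0) (clamp a b x)) d t := by
  rw [clamp_of_mem hx]
  refine (h.hasDerivAt (Ici_mem_nhds ht)).congr_of_eventuallyEq ?_
  filter_upwards [lt_mem_nhds ht] with s hs
  rw [max_eq_left hs.le]

theorem hasDerivAt_extend_snd {a b : ℝ} {f : ℝ → ℝ → ℝ} {d t x : ℝ} (ht : 0 < t)
    (hx : x ∈ Ioo a b) (h : HasDerivWithinAt (f t) d (Icc a b) x) :
    HasDerivAt (fun y => f (max t 0) (clamp a b y)) d x := by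
  rw [max_eq_left ht.le]
  refine (h.hasDerivAt (Icc_mem_nhds hx.1 hx.2)).congr_of_eventuallyEq ?_
  filter_upwards [Ioo_mem_nhds hx.1 hx.2] with y hy
  rw [clamp_of_mem (Ioo_subset_Icc_self hy)]

/-- All functions are composed with the retraction of the plane onto [0, ∞) × [a, b]. Continuity and
positivity then hold everywhere and integrals need no domain bookkeeping. The retraction is the
identity near interior points, so the equations survive exactly there. -/
theorem IsApproxSolution.exists_flow {γ : ℝ} {A : ℝ → ℝ} (hA : IsArea A) {ε δ a b : ℝ}
    (hab : a ≤ b) {ρ₀ m₀ : ℝ → ℝ} {ρl ml ρr mr : ℝ} {ρ m : ℝ → ℝ → ℝ}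
    (h : IsApproxSolution γ A ε δ a b ρ₀ m₀ ρl ml ρr mr ρ m) :
    ∃ F : Flow γ A ε δ a b,
      ∀ t, 0 ≤ t → ∀ x ∈ Icc a b, F.r t x = ρ t x ∧ F.m t x = m t x := by
  obtain ⟨rt, rx, rxx, hr, hrt, hrx, hrxx, hrd⟩ := h.regular_rho
  obtain ⟨mt, mx, mxx, hm, hmt, hmx, hmxx, hmd⟩ := h.regular_m
  have nn : ∀ t : ℝ, 0 < t → t ∈ Ici (0 : ℝ) := fun t ht => ht.le
  have hrx' : ∀ t, 0 < t → ∀ x ∈ Ioo a b, HasDerivAt (ρ t) (rx t x) x := fun t ht x hx =>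
    ((hrd t (nn t ht) x (Ioo_subset_Icc_self hx)).2.1).hasDerivAt (Icc_mem_nhds hx.1 hx.2)
  have hmx' : ∀ t, 0 < t → ∀ x ∈ Ioo a b, HasDerivAt (m t) (mx t x) x := fun t ht x hx =>
    ((hmd t (nn t ht) x (Ioo_subset_Icc_self hx)).2.1).hasDerivAt (Icc_mem_nhds hx.1 hx.2)
  have hrxx' : ∀ t, 0 < t → ∀ x ∈ Ioo a b, HasDerivAt (rx t) (rxx t x) x := fun t ht x hx =>
    ((hrd t (nn t ht) x (Ioo_subset_Icc_self hx)).2.2).hasDerivAt (Icc_mem_nhds hx.1 hx.2)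
  have hmxx' : ∀ t, 0 < t → ∀ x ∈ Ioo a b, HasDerivAt (mx t) (mxx t x) x := fun t ht x hx =>
    ((hmd t (nn t ht) x (Ioo_subset_Icc_self hx)).2.2).hasDerivAt (Icc_mem_nhds hx.1 hx.2)
  have hrt' : ∀ t, 0 < t → ∀ x ∈ Ioo a b, HasDerivAt (fun s => ρ s x) (rt t x) t :=
    fun t ht x hx =>
    ((hrd t (nn t ht) x (Ioo_subset_Icc_self hx)).1).hasDerivAt (Ici_mem_nhds ht)
  have hmt' : ∀ t, 0 < t → ∀ x ∈ Ioo a b, HasDerivAt (fun s => m s x) (mt t x) t :=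
    fun t ht x hx =>
    ((hmd t (nn t ht) x (Ioo_subset_Icc_self hx)).1).hasDerivAt (Ici_mem_nhds ht)
  have E : ∀ {f : ℝ → ℝ → ℝ} {t x : ℝ}, 0 < t → x ∈ Ioo a b →
      f (max t 0) (clamp a b x) = f t x := fun {f t x} ht hx => by
    rw [max_eq_left ht.le, clamp_of_mem (Ioo_subset_Icc_self hx)]
  refine ⟨{
    r := fun t x => ρ (max t 0) (clamp a b x)
    rt := fun t x => rt (max t 0) (clamp a b x)
    rx := fun t x => rx (max t 0) (clamp a b x)
    rxx := fun t x => rxx (max t 0) (clamp a b x)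
    m := fun t x => m (max t 0) (clamp a b x)
    mt := fun t x => mt (max t 0) (clamp a b x)
    mx := fun t x => mx (max t 0) (clamp a b x)
    mxx := fun t x => mxx (max t 0) (clamp a b x)
    cont_r := continuous_extend hab hr
    cont_rt := continuous_extend hab hrt
    cont_rx := continuous_extend hab hrx
    cont_rxx := continuous_extend hab hrxx
    cont_m := continuous_extend hab hm
    cont_mt := continuous_extend hab hmt
    cont_mx := continuous_extend hab hmx
    cont_mxx := continuous_extend hab hmxx
    pos := fun t x => h.pos _ (le_max_right _ _) _ (clamp_mem hab x)
    hrt := fun t ht x hx => by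
      rw [E (f := rt) ht hx]
      exact hasDerivAt_extend_fst ht (Ioo_subset_Icc_self hx)
        (hrd t (nn t ht) x (Ioo_subset_Icc_self hx)).1
    hrx := fun t ht x hx => by
      rw [E (f := rx) ht hx]
      exact hasDerivAt_extend_snd ht hx (hrd t (nn t ht) x (Ioo_subset_Icc_self hx)).2.1
    hrxx := fun t ht x hx => by
      rw [E (f := rxx) ht hx]
      exact hasDerivAt_extend_snd ht hx (hrd t (nn t ht) x (Ioo_subset_Icc_self hx)).2.2
    hmt := fun t ht x hx => by
      rw [E (f := mt) ht hx]
      exact hasDerivAt_extend_fst ht (Ioo_subset_Icc_self hx)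
        (hmd t (nn t ht) x (Ioo_subset_Icc_self hx)).1
    hmx := fun t ht x hx => by
      rw [E (f := mx) ht hx]
      exact hasDerivAt_extend_snd ht hx (hmd t (nn t ht) x (Ioo_subset_Icc_self hx)).2.1
    hmxx := fun t ht x hx => by
      rw [E (f := mxx) ht hx]
      exact hasDerivAt_extend_snd ht hx (hmd t (nn t ht) x (Ioo_subset_Icc_self hx)).2.2
    continuity := fun t ht x hx => ?_
    momentum := fun t ht x hx => ?_ }, fun t ht x hx => ?_⟩
  · simp only [E ht hx]
    have := h.continuity t ht x hx
    have hd : deriv (deriv (ρ t)) x = rxx t x := by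
      refine ((hrxx' t ht x hx).congr_of_eventuallyEq ?_).deriv
      filter_upwards [Ioo_mem_nhds hx.1 hx.2] with y hy
      exact (hrx' t ht y hy).deriv
    rw [(hrt' t ht x hx).deriv, (hmx' t ht x hx).deriv, (hrx' t ht x hx).deriv, hd] at this
    unfold slope
    linarith
  · simp only [E ht hx]
    have := h.momentum t ht x hx
    have hp : 0 < ρ t x := h.pos t ht.le x (Ioo_subset_Icc_self hx)
    have hd : deriv (fun y => m t y ^ 2 / ρ t y + pressure γ δ (ρ t y)) x =
        (2 * m t x * mx t x / ρ t x - m t x ^ 2 * rx t x / ρ t x ^ 2)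
          + pressure' γ δ (ρ t x) * rx t x := by
      have h1 := ((hmx' t ht x hx).pow 2).div (hrx' t ht x hx) hp.ne'
      have h2 := (hasDerivAt_pressure (γ := γ) δ hp).comp x (hrx' t ht x hx)
      refine ((h1.add h2).congr_deriv ?_).deriv
      simp only [Pi.pow_apply]
      field_simp
      ring
    have hd2 : deriv (fun y => deriv (m t) y + deriv A y / A y * m t y) x =
        mxx t x + slope' A x * m t x + slope A x * mx t x := by
      have h1 := (hmxx' t ht x hx).add ((hA.hasDerivAt_slope x).mul (hmx' t ht x hx))
      rw [add_assoc]
      refine (h1.congr_of_eventuallyEq ?_).deriv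
      filter_upwards [Ioo_mem_nhds hx.1 hx.2] with y hy
      rw [(hmx' t ht y hy).deriv]
      rfl
    rw [(hmt' t ht x hx).deriv, hd, hd2] at this
    unfold slope at *
    linarith
  · simp only [max_eq_left ht, clamp_of_mem hx, and_self]

/-! #### Integration on strips -/

section Param
variable {f g : ℝ → ℝ → ℝ} {a b : ℝ}

theorem continuous_integral_fst (hf : Continuous fun z : ℝ × ℝ => f z.1 z.2) (c d : ℝ) :
    Continuous fun t => ∫ x in c..d, f t x :=
  intervalIntegral.continuous_parametric_intervalIntegral_of_continuous' hf c d

theorem integral_swap_of_continuous (hf : Continuous fun z : ℝ × ℝ => f z.1 z.2) (t s c d : ℝ) :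
    ∫ τ in t..s, ∫ x in c..d, f τ x = ∫ x in c..d, ∫ τ in t..s, f τ x :=
  MeasureTheory.intervalIntegral_intervalIntegral_swap (F := f)
    ((hf.continuousOn.integrableOn_compact (isCompact_uIcc.prod isCompact_uIcc)).mono_set
      (prod_mono uIoc_subset_uIcc uIoc_subset_uIcc))

/-- The derivatives of a flow are known only in the open strip, while the integrals reach its
boundary; continuity up to the endpoints bridges the gap. -/
theorem integral_eq_sub_of_interior {φ φ' : ℝ → ℝ} (hφ : Continuous φ) (hφ' : Continuous φ')
    (h : ∀ x ∈ Ioo a b, HasDerivAt φ (φ' x) x) {c d : ℝ} (hac : a ≤ c) (hcd : c ≤ d)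
    (hdb : d ≤ b) : ∫ x in c..d, φ' x = φ d - φ c :=
  intervalIntegral.integral_eq_sub_of_hasDerivAt_of_le hcd hφ.continuousOn
    (fun x hx => h x ⟨hac.trans_lt hx.1, hx.2.trans_le hdb⟩) (hφ'.intervalIntegrable _ _)

/-- The derivative of an integral over part of a strip in which the integrand is differentiable. -/
theorem hasDerivAt_integral_fst (hf : Continuous fun z : ℝ × ℝ => f z.1 z.2)
    (hg : Continuous fun z : ℝ × ℝ => g z.1 z.2)
    (h : ∀ t, 0 < t → ∀ x ∈ Ioo a b, HasDerivAt (fun s => f s x) (g t x) t)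
    {c d : ℝ} (hac : a ≤ c) (hcd : c ≤ d) (hdb : d ≤ b) {t : ℝ} (ht : 0 < t) :
    HasDerivAt (fun s => ∫ x in c..d, f s x) (∫ x in c..d, g t x) t := by
  have hG := continuous_integral_fst hg c d
  -- By Fubini the increment in time is the time integral of a continuous function, which the
  -- fundamental theorem differentiates. Both endpoints are positive, so the whole time segment
  -- stays where the derivative exists.
  have key : ∀ s, 0 < s → ∫ x in c..d, f s x =
      (∫ x in c..d, f t x) + ∫ τ in t..s, ∫ x in c..d, g τ x := by
    intro s hs
    have h1 : ∫ τ in t..s, ∫ x in c..d, g τ x = ∫ x in c..d, ∫ τ in t..s, g τ x := by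
      exact integral_swap_of_continuous hg t s c d
    have h2 : ∀ x ∈ Ioo c d, ∫ τ in t..s, g τ x = f s x - f t x := by
      intro x hx
      refine intervalIntegral.integral_eq_sub_of_hasDerivAt (f := fun s => f s x) (fun τ hτ => ?_) ?_
      · refine h τ ?_ x ⟨hac.trans_lt hx.1, hx.2.trans_le hdb⟩
        exact lt_of_lt_of_le (lt_min ht hs) hτ.1
      · exact Continuous.intervalIntegrable (by fun_prop) _ _
    rw [h1, intervalIntegral.integral_congr_Ioo_of_le hcd h2]
    rw [intervalIntegral.integral_sub]
    · ring
    · exact Continuous.intervalIntegrable (by fun_prop) _ _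
    · exact Continuous.intervalIntegrable (by fun_prop) _ _
  have h3 : HasDerivAt (fun s => (∫ x in c..d, f t x) + ∫ τ in t..s, ∫ x in c..d, g τ x)
      (∫ x in c..d, g t x) t :=
    (intervalIntegral.integral_hasDerivAt_right (hG.intervalIntegrable _ _)
      hG.stronglyMeasurable.stronglyMeasurableAtFilter hG.continuousAt).const_add _
  refine h3.congr_of_eventuallyEq ?_
  filter_upwards [lt_mem_nhds ht] with s hs
  exact key s hs

end Param

/-! ### The energy estimate -/

/-- The derivative of the internal energy. -/
def enthalpy (γ δ r : ℝ) : ℝ := kappa γ / (γ - 1) * (γ * r ^ (γ - 1)) + 2 * δ * r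

/-- The second derivative of the internal energy. -/
def enthalpy' (γ δ r : ℝ) : ℝ := kappa γ * γ * r ^ (γ - 2) + 2 * δ

theorem kappa_pos {γ : ℝ} (hγ : 1 < γ) : 0 < kappa γ := by
  unfold kappa
  have : 0 < γ - 1 := by linarith
  positivity

theorem hasDerivAt_internalEnergy {γ : ℝ} (hγ : 1 < γ) (δ r : ℝ) :
    HasDerivAt (internalEnergy γ δ) (enthalpy γ δ r) r := by
  have h1 := (Real.hasDerivAt_rpow_const (x := r) (p := γ) (Or.inr hγ.le)).const_mul
    (kappa γ / (γ - 1))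
  have h2 := (hasDerivAt_pow 2 r).const_mul δ
  refine (h1.add h2).congr_deriv ?_
  unfold enthalpy
  norm_num
  ring

theorem hasDerivAt_enthalpy {γ : ℝ} (hγ : 1 < γ) (δ : ℝ) {r : ℝ} (hr : 0 < r) :
    HasDerivAt (enthalpy γ δ) (enthalpy' γ δ r) r := by
  have h1 := ((Real.hasDerivAt_rpow_const (p := γ - 1) (Or.inl hr.ne')).const_mul γ).const_mul
    (kappa γ / (γ - 1))
  have h2 := (hasDerivAt_id r).const_mul (2 * δ)
  refine (h1.add h2).congr_deriv ?_
  have : γ - 1 ≠ 0 := by linarith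
  unfold enthalpy'
  rw [show γ - 1 - 1 = γ - 2 by ring]
  field_simp

/-- This relation, p' = r h'', is what makes the mechanical energy an entropy of the inviscid
system; it cancels the pressure terms in the energy balance. -/
theorem pressure'_eq {γ : ℝ} (δ : ℝ) {r : ℝ} (hr : 0 < r) :
    pressure' γ δ r = r * enthalpy' γ δ r := by
  unfold pressure' enthalpy'
  have : r ^ (γ - 1) = r * r ^ (γ - 2) := by
    rw [mul_comm, ← Real.rpow_add_one hr.ne']; congr 1; ring
  rw [this]; ring

/-- The point of this form is that the reference state enters only through three coefficients, in an
affine way. Reference states can therefore be interpolated at the level of these coefficients. -/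
theorem relEnergy_eq {γ : ℝ} (hγ : 1 < γ) (δ : ℝ) {r : ℝ} (hr : 0 < r) (m rb ub : ℝ) :
    relEnergy γ δ r m rb ub = m ^ 2 / (2 * r) + internalEnergy γ δ r
      - (enthalpy γ δ rb - ub ^ 2 / 2) * r - ub * m
      + (enthalpy γ δ rb * rb - internalEnergy γ δ rb) := by
  unfold relEnergy
  rw [(hasDerivAt_internalEnergy hγ δ rb).deriv]
  field_simp
  ring

/-- A quantity comparable with the mechanical energy density. -/
def size (γ δ r m : ℝ) : ℝ := r + m ^ 2 / r + r ^ γ + δ * r ^ 2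

theorem exists_mul_le_rpow {γ : ℝ} (hγ : 1 < γ) (K : ℝ) {c : ℝ} (hc : 0 < c) :
    ∃ C, 0 ≤ C ∧ ∀ r, 0 < r → K * r ≤ c * r ^ γ + C := by
  obtain hK | hK := le_or_gt K 0
  · refine ⟨0, le_rfl, fun r hr => ?_⟩
    have : 0 ≤ c * r ^ γ := by positivity
    nlinarith
  -- The positive solution of K r = c r^γ, beyond which the power dominates.
  set r₀ := (K / c) ^ (1 / (γ - 1)) with hr₀
  have h0 : 0 < r₀ := by positivity
  refine ⟨K * r₀, by positivity, fun r hr => ?_⟩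
  obtain h | h := le_or_gt r r₀
  · have : 0 ≤ c * r ^ γ := by positivity
    nlinarith
  · have h1 : r₀ ^ (γ - 1) = K / c := by
      rw [hr₀, ← Real.rpow_mul (by positivity), one_div_mul_cancel (by linarith), Real.rpow_one]
    have h2 : r₀ ^ (γ - 1) ≤ r ^ (γ - 1) := Real.rpow_le_rpow h0.le h.le (by linarith)
    have h3 : r ^ γ = r ^ (γ - 1) * r := by
      rw [← Real.rpow_add_one hr.ne']; congr 1; ring
    rw [h1, div_le_iff₀ hc] at h2
    rw [h3]
    have := mul_le_mul_of_nonneg_right h2 hr.le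
    nlinarith [mul_pos hK h0]

/-- Convexity of r ↦ r^γ, in the form of Bernoulli's inequality for r / rb. A vacuum reference state
is treated separately, and the δ part is exactly δ(r - rb)². -/
theorem relEnergy_nonneg {γ : ℝ} (hγ : 1 < γ) {δ r rb : ℝ} (hδ : 0 ≤ δ) (hr : 0 < r)
    (hrb : 0 ≤ rb) (m ub : ℝ) : 0 ≤ relEnergy γ δ r m rb ub := by
  unfold relEnergy
  rw [(hasDerivAt_internalEnergy hγ δ rb).deriv]
  have hk : 0 < kappa γ / (γ - 1) := div_pos (kappa_pos hγ) (by linarith)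
  have key : rb ^ γ + γ * rb ^ (γ - 1) * (r - rb) ≤ r ^ γ := by
    obtain rfl | h := hrb.eq_or_lt
    · rw [Real.zero_rpow (by linarith), Real.zero_rpow (by linarith)]
      have : 0 ≤ r ^ γ := by positivity
      simpa
    · have h1 := one_add_mul_self_le_rpow_one_add (s := r / rb - 1)
        (by have : 0 < r / rb := by positivity
            linarith) hγ.le
      rw [add_sub_cancel, Real.div_rpow hr.le hrb, le_div_iff₀ (by positivity)] at h1
      refine le_trans (le_of_eq ?_) h1
      have : rb ^ γ = rb ^ (γ - 1) * rb := by
        rw [← Real.rpow_add_one h.ne']; congr 1; ring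
      rw [this]
      field_simp
  have h2 : 0 ≤ 1 / 2 * r * (m / r - ub) ^ 2 := by positivity
  unfold internalEnergy enthalpy
  nlinarith [mul_nonneg hδ (sq_nonneg (r - rb)), mul_le_mul_of_nonneg_left key hk.le]

theorem size_nonneg {γ δ r : ℝ} (hδ : 0 ≤ δ) (hr : 0 < r) (m : ℝ) : 0 ≤ size γ δ r m := by
  unfold size; positivity

/-- Coercivity: part of m²/r absorbs the linear term in m, and half of the power r^γ absorbs the
terms linear in r. The constant is uniform in δ because δ r² occurs with coefficient one on both
sides. -/
theorem size_le_relEnergy {γ : ℝ} (hγ : 1 < γ) (B : ℝ) : ∃ C, 1 ≤ C ∧ ∀ δ r m rb ub,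
    0 < δ → δ ≤ B → 0 < r → 0 ≤ rb → rb ≤ B → |ub| ≤ B →
      size γ δ r m ≤ C * (1 + relEnergy γ δ r m rb ub) := by
  have hk : 0 < kappa γ / (γ - 1) := div_pos (kappa_pos hγ) (by linarith)
  set c := kappa γ / (γ - 1) with hc
  -- In this coefficient, 1 produces the summand r of `size`, B²/2 remains after completing the
  -- square in the kinetic part, and the rest bounds h_δ' at the reference density.
  obtain ⟨C₁, hC₁, h1⟩ := exists_mul_le_rpow hγ (1 + B ^ 2 / 2 + (c * (γ * B ^ (γ - 1)) + 2 * B * B))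
    (half_pos hk)
  refine ⟨(4 + 2 / c) * (1 + C₁), ?_, ?_⟩
  · have : 0 < 2 / c := by positivity
    nlinarith [mul_nonneg this.le hC₁]
  intro δ r m rb ub hδ hδB hr hrb hrbB hub
  have hE := relEnergy_nonneg hγ hδ.le hr hrb m ub
  have hB : 0 ≤ B := hrb.trans hrbB
  have hub2 : ub ^ 2 ≤ B ^ 2 := sq_le_sq' (abs_le.1 hub).1 (abs_le.1 hub).2
  have h2 : rb ^ (γ - 1) ≤ B ^ (γ - 1) := Real.rpow_le_rpow hrb hrbB (by linarith)
  have h3 : enthalpy γ δ rb ≤ c * (γ * B ^ (γ - 1)) + 2 * B * B := by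
    unfold enthalpy
    gcongr
  have h4 : enthalpy γ δ rb * rb - internalEnergy γ δ rb
      = kappa γ * rb ^ γ + δ * rb ^ 2 := by
    have h5 : rb ^ (γ - 1) * rb = rb ^ γ := by
      obtain rfl | h := hrb.eq_or_lt
      · rw [Real.zero_rpow (by linarith : γ ≠ 0)]; simp
      · rw [← Real.rpow_add_one h.ne']; congr 1; ring
    unfold enthalpy internalEnergy
    have : γ - 1 ≠ 0 := by linarith
    rw [← h5]
    field_simp
    ring
  have hkin : m ^ 2 / (2 * r) - ub * m ≥ 1 / 4 * (m ^ 2 / r) - ub ^ 2 * r := by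
    have : m ^ 2 / (2 * r) - ub * m - (1 / 4 * (m ^ 2 / r) - ub ^ 2 * r)
      = (m / 2 - ub * r) ^ 2 / r := by field_simp; ring
    have h6 : 0 ≤ (m / 2 - ub * r) ^ 2 / r := by positivity
    linarith
  have h6 := h1 r hr
  have hP : 0 ≤ kappa γ * rb ^ γ + δ * rb ^ 2 := by
    have := (kappa_pos hγ).le
    positivity
  have key : r + 1 / 4 * (m ^ 2 / r) + c / 2 * r ^ γ + δ * r ^ 2 ≤
      relEnergy γ δ r m rb ub + C₁ := by
    rw [relEnergy_eq hγ δ hr, h4]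
    have h7 := mul_le_mul_of_nonneg_right h3 hr.le
    have h8 := mul_le_mul_of_nonneg_right hub2 hr.le
    have : internalEnergy γ δ r = c * r ^ γ + δ * r ^ 2 := rfl
    rw [this]
    nlinarith
  have e1 : (0:ℝ) ≤ m ^ 2 / r := by positivity
  have e2 : (0:ℝ) ≤ r ^ γ := by positivity
  have e3 : (0:ℝ) ≤ δ * r ^ 2 := by positivity
  have e4 : 0 < 2 / c := by positivity
  have e5 : 2 / c * (c / 2 * r ^ γ) = r ^ γ := by field_simp
  have h9 : size γ δ r m ≤ (4 + 2 / c) * (relEnergy γ δ r m rb ub + C₁) := by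
    refine le_trans ?_ (mul_le_mul_of_nonneg_left key (by positivity))
    unfold size
    have : 0 ≤ 2 / c * (r + 1 / 4 * (m ^ 2 / r) + δ * r ^ 2) := by positivity
    nlinarith
  refine h9.trans ?_
  rw [mul_assoc]
  refine mul_le_mul_of_nonneg_left ?_ (by positivity)
  nlinarith

/-- Together with the coercivity bound this makes energies relative to different bounded states
comparable up to additive constants, which is needed for the initial energy. -/
theorem relEnergy_le_size {γ : ℝ} (hγ : 1 < γ) (B : ℝ) : ∃ C, 1 ≤ C ∧ ∀ δ r m rb ub,
    0 < δ → δ ≤ B → 0 < r → 0 ≤ rb → rb ≤ B → |ub| ≤ B →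
      relEnergy γ δ r m rb ub ≤ C * (1 + size γ δ r m) := by
  have hk : 0 < kappa γ / (γ - 1) := div_pos (kappa_pos hγ) (by linarith)
  set c := kappa γ / (γ - 1) with hc
  obtain hB | hB := lt_or_ge B 0
  · exact ⟨1, le_rfl, fun δ r m rb ub _ _ _ h h' => absurd (h.trans h') (by linarith)⟩
  set P := (c * (γ * B ^ (γ - 1)) + 2 * B * B) * B with hP
  have hP0 : 0 ≤ P := by positivity
  refine ⟨1 + B ^ 2 + c + P, by nlinarith [sq_nonneg B], ?_⟩
  intro δ r m rb ub hδ hδB hr hrb hrbB hub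
  have hub2 : ub ^ 2 ≤ B ^ 2 := sq_le_sq' (abs_le.1 hub).1 (abs_le.1 hub).2
  have h2 : rb ^ (γ - 1) ≤ B ^ (γ - 1) := Real.rpow_le_rpow hrb hrbB (by linarith)
  have h0 : 0 ≤ enthalpy γ δ rb := by unfold enthalpy; positivity
  have h3 : enthalpy γ δ rb * rb ≤ P := by
    unfold enthalpy
    rw [hP]
    gcongr
  have h4 : 0 ≤ internalEnergy γ δ rb := by unfold internalEnergy; positivity
  have hkin : m ^ 2 / (2 * r) - ub * m ≤ m ^ 2 / r + ub ^ 2 / 2 * r := by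
    have : m ^ 2 / r + ub ^ 2 / 2 * r - (m ^ 2 / (2 * r) - ub * m) = (m + ub * r) ^ 2 / (2 * r) := by
      field_simp; ring
    have h6 : 0 ≤ (m + ub * r) ^ 2 / (2 * r) := by positivity
    linarith
  rw [relEnergy_eq hγ δ hr]
  have e0 : internalEnergy γ δ r = c * r ^ γ + δ * r ^ 2 := rfl
  have e1 : (0:ℝ) ≤ m ^ 2 / r := by positivity
  have e2 : (0:ℝ) ≤ r ^ γ := by positivity
  have e3 : (0:ℝ) ≤ δ * r ^ 2 := by positivity
  have h7 := mul_le_mul_of_nonneg_right hub2 hr.le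
  have h8 := mul_nonneg h0 hr.le
  have h9 : m ^ 2 / r + B ^ 2 * r + c * r ^ γ + δ * r ^ 2 + P ≤
      (1 + B ^ 2 + c + P) * (1 + size γ δ r m) := by
    unfold size
    nlinarith [mul_nonneg (sq_nonneg B) e1, mul_nonneg (sq_nonneg B) e2,
      mul_nonneg (sq_nonneg B) e3, mul_nonneg hk.le e1, mul_nonneg hk.le e3,
      mul_nonneg hk.le hr.le, mul_nonneg hP0 e1, mul_nonneg hP0 e2, mul_nonneg hP0 e3,
      mul_nonneg hP0 hr.le, sq_nonneg B]
  rw [e0]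
  nlinarith

/-! ### The mechanical energy balance with variable coefficients -/

namespace Flow
variable {γ : ℝ} {A : ℝ → ℝ} {ε δ a b : ℝ} (F : Flow γ A ε δ a b)

/-- The derivative of the velocity. -/
def ux (t x : ℝ) : ℝ := (F.mx t x - F.m t x / F.r t x * F.rx t x) / F.r t x

/-- The energy relative to the reference functions `Z`, `v`, `P`. -/
def energy (Z v P : ℝ → ℝ) (t x : ℝ) : ℝ :=
  F.m t x ^ 2 / (2 * F.r t x) + internalEnergy γ δ (F.r t x) - Z x * F.r t x - v x * F.m t x + P x

/-- The time derivative of the energy. -/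
def energyT (Z v : ℝ → ℝ) (t x : ℝ) : ℝ :=
  (enthalpy γ δ (F.r t x) - F.m t x ^ 2 / (2 * F.r t x ^ 2) - Z x) * F.rt t x
    + (F.m t x / F.r t x - v x) * F.mt t x

/-- The energy dissipation density. -/
def dissipation (t x : ℝ) : ℝ :=
  enthalpy' γ δ (F.r t x) * F.rx t x ^ 2 + F.r t x * F.ux t x ^ 2

/-- The total energy flux. -/
def energyFlux (Z Z' v v' : ℝ → ℝ) (t x : ℝ) : ℝ :=
  ε * (enthalpy γ δ (F.r t x) - F.m t x ^ 2 / (2 * F.r t x ^ 2) - Z x) * A x * F.rx t x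
    + ε * (F.m t x / F.r t x - v x) * A x * F.mx t x
    + ε * A x * (Z' x * F.r t x + v' x * F.m t x)
    - A x * (F.m t x ^ 3 / (2 * F.r t x ^ 2) + F.m t x * enthalpy γ δ (F.r t x))
    + Z x * A x * F.m t x
    + v x * A x * (F.m t x ^ 2 / F.r t x + pressure γ δ (F.r t x))

/-- The source terms in the energy balance. -/
def energySource (Z' Z'' v v' v'' : ℝ → ℝ) (t x : ℝ) : ℝ :=
  -ε * ((deriv A x * Z' x + A x * Z'' x) * F.r t x + (deriv A x * v' x + A x * v'' x) * F.m t x)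
    - Z' x * A x * F.m t x - v' x * A x * (F.m t x ^ 2 / F.r t x)
    - (v' x * A x + v x * deriv A x) * pressure γ δ (F.r t x)
    + ε * (F.m t x / F.r t x - v x) * A x * slope' A x * F.m t x

/-- The continuity equation is multiplied by A(h' - u²/2 - Z), the momentum equation by A(u - v),
and the results are added. The viscous terms produce the Hessian of the energy, that is the
dissipation, while derivatives of Z, v and A are left as sources. Once the equations are substituted
and p' = r h'' is used, the identity is algebraic. -/
theorem hasDerivAt_energyFlux (hγ : 1 < γ) (hA : IsArea A) {Z Z' Z'' v v' v'' : ℝ → ℝ}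
    (hZ : ∀ x, HasDerivAt Z (Z' x) x) (hZ' : ∀ x, HasDerivAt Z' (Z'' x) x)
    (hv : ∀ x, HasDerivAt v (v' x) x) (hv' : ∀ x, HasDerivAt v' (v'' x) x)
    {t x : ℝ} (ht : 0 < t) (hx : x ∈ Ioo a b) :
    HasDerivAt (F.energyFlux Z Z' v v' t)
      (A x * F.energyT Z v t x + ε * A x * F.dissipation t x
        - F.energySource Z' Z'' v v' v'' t x) x := by
  have hp := F.pos t x
  have hr := F.hrx t ht x hx
  have hrx := F.hrxx t ht x hx
  have hm := F.hmx t ht x hx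
  have hmx := F.hmxx t ht x hx
  have dA := hA.hasDerivAt x
  have dH := (hasDerivAt_enthalpy hγ δ hp).comp x hr
  have dp := (hasDerivAt_pressure (γ := γ) δ hp).comp x hr
  have n2 : 2 * F.r t x ^ 2 ≠ 0 := by positivity
  have d1 := (((((dH.sub ((hm.pow 2).div ((hr.pow 2).const_mul 2) n2)).sub (hZ x)).const_mul ε).mul
    dA).mul hrx)
  have d2 := (((hm.div hr hp.ne').sub (hv x)).const_mul ε).mul dA |>.mul hmx
  have d3 := (dA.const_mul ε).mul (((hZ' x).mul hr).add ((hv' x).mul hm))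
  have d4 := dA.mul (((hm.pow 3).div ((hr.pow 2).const_mul 2) n2).add (hm.mul dH))
  have d5 := ((hZ x).mul dA).mul hm
  have d6 := ((hv x).mul dA).mul (((hm.pow 2).div hr hp.ne').add dp)
  have := ((((d1.add d2).add d3).sub d4).add d5).add d6
  refine this.congr_deriv ?_
  have hA0 := (hA.pos x).ne'
  simp only [Pi.pow_apply, Pi.mul_apply, Pi.sub_apply, Pi.add_apply, Pi.div_apply,
    Function.comp_apply, Nat.cast_ofNat, Nat.add_one_sub_one, pow_one]
  unfold energyT dissipation energySource ux
  rw [F.continuity t ht x hx, F.momentum t ht x hx, pressure'_eq δ hp]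
  unfold slope slope'
  generalize enthalpy γ δ (F.r t x) = H
  generalize enthalpy' γ δ (F.r t x) = H2
  generalize pressure γ δ (F.r t x) = p
  field_simp
  ring

theorem hasDerivAt_energy (hγ : 1 < γ) (Z v P : ℝ → ℝ) {t x : ℝ} (ht : 0 < t) (hx : x ∈ Ioo a b) :
    HasDerivAt (fun s => F.energy Z v P s x) (F.energyT Z v t x) t := by
  have hp := F.pos t x
  have hr := F.hrt t ht x hx
  have hm := F.hmt t ht x hx
  have dh := (hasDerivAt_internalEnergy hγ δ (F.r t x)).comp t hr
  have n2 : 2 * F.r t x ≠ 0 := by positivity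
  have := (((((hm.pow 2).div (hr.const_mul 2) n2).add dh).sub (hr.const_mul (Z x))).sub
    (hm.const_mul (v x))).add_const (P x)
  refine this.congr_deriv ?_
  simp only [Pi.pow_apply]
  unfold energyT
  field_simp
  norm_num
  ring

end Flow

namespace Flow
variable {γ : ℝ} {A : ℝ → ℝ} {ε δ a b : ℝ} (F : Flow γ A ε δ a b)

theorem r_ne_zero (t x : ℝ) : F.r t x ≠ 0 := (F.pos t x).ne'

theorem cont_rpow (p : ℝ) : Continuous fun z : ℝ × ℝ => F.r z.1 z.2 ^ p :=
  F.cont_r.rpow_const fun _ => Or.inl (F.r_ne_zero _ _)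

theorem cont_u : Continuous fun z : ℝ × ℝ => F.m z.1 z.2 / F.r z.1 z.2 :=
  F.cont_m.div F.cont_r fun _ => F.r_ne_zero _ _

theorem cont_ux : Continuous fun z : ℝ × ℝ => F.ux z.1 z.2 :=
  (F.cont_mx.sub (F.cont_u.mul F.cont_rx)).div F.cont_r fun _ => F.r_ne_zero _ _

theorem cont_kinetic : Continuous fun z : ℝ × ℝ => F.m z.1 z.2 ^ 2 / F.r z.1 z.2 :=
  (F.cont_m.pow 2).div F.cont_r fun _ => F.r_ne_zero _ _

theorem cont_pressure : Continuous fun z : ℝ × ℝ => pressure γ δ (F.r z.1 z.2) :=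
  ((F.cont_rpow γ).const_mul _).add ((F.cont_r.pow 2).const_mul _)

theorem cont_size : Continuous fun z : ℝ × ℝ => size γ δ (F.r z.1 z.2) (F.m z.1 z.2) :=
  ((F.cont_r.add F.cont_kinetic).add (F.cont_rpow γ)).add ((F.cont_r.pow 2).const_mul _)

theorem cont_energy {Z v P : ℝ → ℝ} (hZ : Continuous Z) (hv : Continuous v) (hP : Continuous P) :
    Continuous fun z : ℝ × ℝ => F.energy Z v P z.1 z.2 := by
  have h1 := F.cont_r
  have h2 := F.cont_m
  have h3 : Continuous fun z : ℝ × ℝ => F.m z.1 z.2 ^ 2 / (2 * F.r z.1 z.2) :=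
    (F.cont_m.pow 2).div (h1.const_mul 2) fun z => by have := F.pos z.1 z.2; positivity
  have h4 : Continuous fun z : ℝ × ℝ => internalEnergy γ δ (F.r z.1 z.2) :=
    ((F.cont_rpow γ).const_mul _).add ((F.cont_r.pow 2).const_mul _)
  unfold energy
  fun_prop

theorem cont_enthalpy : Continuous fun z : ℝ × ℝ => enthalpy γ δ (F.r z.1 z.2) :=
  (((F.cont_rpow (γ - 1)).const_mul _).const_mul _).add (F.cont_r.const_mul _)

theorem cont_energyT {Z v : ℝ → ℝ} (hZ : Continuous Z) (hv : Continuous v) :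
    Continuous fun z : ℝ × ℝ => F.energyT Z v z.1 z.2 := by
  have h1 := F.cont_rt
  have h2 := F.cont_mt
  have h3 : Continuous fun z : ℝ × ℝ => F.m z.1 z.2 ^ 2 / (2 * F.r z.1 z.2 ^ 2) :=
    (F.cont_m.pow 2).div ((F.cont_r.pow 2).const_mul 2) fun z => by
      have := F.pos z.1 z.2; positivity
  have h4 := F.cont_enthalpy
  have h5 := F.cont_u
  unfold energyT
  fun_prop

theorem cont_dissipation : Continuous fun z : ℝ × ℝ => F.dissipation z.1 z.2 := by
  have h1 := F.cont_rx
  have h2 := F.cont_ux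
  have h3 := F.cont_r
  have h4 : Continuous fun z : ℝ × ℝ => enthalpy' γ δ (F.r z.1 z.2) :=
    ((F.cont_rpow (γ - 2)).const_mul _).add continuous_const
  unfold dissipation
  fun_prop

theorem dissipation_nonneg (hγ : 1 < γ) (hδ : 0 ≤ δ) (t x : ℝ) : 0 ≤ F.dissipation t x := by
  have h1 := F.pos t x
  have h2 := kappa_pos hγ
  unfold dissipation enthalpy'
  positivity

theorem cont_energyFlux (hA : IsArea A) {Z Z' v v' : ℝ → ℝ} (hZ : Continuous Z)
    (hZ' : Continuous Z') (hv : Continuous v) (hv' : Continuous v') :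
    Continuous fun z : ℝ × ℝ => F.energyFlux Z Z' v v' z.1 z.2 := by
  have h1 := F.cont_r
  have h2 := F.cont_rx
  have h3 := F.cont_m
  have h4 := F.cont_mx
  have h5 := F.cont_u
  have h6 := F.cont_enthalpy
  have h7 := F.cont_pressure
  have h8 := F.cont_kinetic
  have h9 := hA.continuous
  have h10 : Continuous fun z : ℝ × ℝ => F.m z.1 z.2 ^ 2 / (2 * F.r z.1 z.2 ^ 2) :=
    (F.cont_m.pow 2).div ((F.cont_r.pow 2).const_mul 2) fun z => by
      have := F.pos z.1 z.2; positivity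
  have h11 : Continuous fun z : ℝ × ℝ => F.m z.1 z.2 ^ 3 / (2 * F.r z.1 z.2 ^ 2) :=
    (F.cont_m.pow 3).div ((F.cont_r.pow 2).const_mul 2) fun z => by
      have := F.pos z.1 z.2; positivity
  unfold energyFlux
  fun_prop

theorem cont_energySource (hA : IsArea A) {Z' Z'' v v' v'' : ℝ → ℝ}
    (hZ' : Continuous Z') (hZ'' : Continuous Z'') (hv : Continuous v) (hv' : Continuous v')
    (hv'' : Continuous v'') :
    Continuous fun z : ℝ × ℝ => F.energySource Z' Z'' v v' v'' z.1 z.2 := by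
  have h1 := F.cont_r
  have h3 := F.cont_m
  have h5 := F.cont_u
  have h7 := F.cont_pressure
  have h8 := F.cont_kinetic
  have h9 := hA.continuous
  have h10 := hA.continuous_deriv
  have h11 := hA.continuous_slope'
  unfold energySource
  fun_prop

theorem abs_m_le (t x : ℝ) : |F.m t x| ≤ (F.r t x + F.m t x ^ 2 / F.r t x) / 2 := by
  have hp := F.pos t x
  have h : (F.r t x + F.m t x ^ 2 / F.r t x) / 2 - |F.m t x|
      = (F.r t x - |F.m t x|) ^ 2 / (2 * F.r t x) := by
    rw [← sq_abs (F.m t x)]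
    field_simp
    ring
  have : 0 ≤ (F.r t x - |F.m t x|) ^ 2 / (2 * F.r t x) := by positivity
  linarith

theorem abs_signed_sum_le {p q r s w P Q R S W : ℝ} (hp : |p| ≤ P) (hq : |q| ≤ Q) (hr : |r| ≤ R)
    (hs : |s| ≤ S) (hw : |w| ≤ W) : |-p - q - r - s + w| ≤ P + Q + R + S + W := by
  rw [abs_le] at *
  constructor <;> linarith

-- Every source term contains a derivative of Z or v (bounded by k), the factor A' in front of the
-- pressure, or an explicit ε in front of a bounded coefficient. What remains in each is at most a
-- multiple of `size`, since m, m²/r and p are.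
set_option maxHeartbeats 600000 in
theorem energySource_le (hγ : 1 < γ) (hA : IsArea A) {B : ℝ}
    (hδ : 0 < δ) (hε : 0 < ε) (hε1 : ε ≤ 1) {Z' Z'' v v' v'' : ℝ → ℝ} {x k : ℝ}
    (hAx : A x ≤ B) (hA' : |deriv A x| ≤ B) (hs : |slope' A x| ≤ B)
    (hv : |v x| ≤ B) (hZ' : |Z' x| ≤ B * k) (hZ'' : |Z'' x| ≤ B * k)
    (hv' : |v' x| ≤ B * k) (hv'' : |v'' x| ≤ B * k) (hk : 0 ≤ k) (t : ℝ) :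
    |F.energySource Z' Z'' v v' v'' t x| ≤
      (9 + kappa γ) * (1 + B) ^ 3 * (k + |deriv A x| + ε) * size γ δ (F.r t x) (F.m t x) := by
  have hp := F.pos t x
  have hB : 0 ≤ B := (abs_nonneg _).trans hA'
  have hA0 := (hA.pos x).le
  have hκ := (kappa_pos hγ).le
  set D := size γ δ (F.r t x) (F.m t x) with hD
  have e1 : 0 ≤ F.m t x ^ 2 / F.r t x := by positivity
  have e2 : 0 ≤ F.r t x ^ γ := by positivity
  have e3 : 0 ≤ δ * F.r t x ^ 2 := by positivity
  have hDe : D = F.r t x + F.m t x ^ 2 / F.r t x + F.r t x ^ γ + δ * F.r t x ^ 2 := rfl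
  have hD0 : 0 ≤ D := size_nonneg hδ.le hp _
  have hm : |F.m t x| ≤ D := by linarith [F.abs_m_le t x]
  have hr : |F.r t x| ≤ D := by rw [abs_of_pos hp]; linarith
  have hkin : |F.m t x ^ 2 / F.r t x| ≤ D := by rw [abs_of_nonneg e1]; linarith
  have hpr : |pressure γ δ (F.r t x)| ≤ (kappa γ + 1) * D := by
    unfold pressure
    rw [abs_of_nonneg (by positivity)]
    have := mul_le_mul_of_nonneg_left (show F.r t x ^ γ ≤ D by linarith) hκ
    linarith
  have hAabs : |A x| ≤ B := by rw [abs_of_nonneg hA0]; exact hAx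
  have eabs : |ε| = ε := abs_of_pos hε
  have hBk : 0 ≤ B * k := by positivity
  have t1 : |ε * ((deriv A x * Z' x + A x * Z'' x) * F.r t x
      + (deriv A x * v' x + A x * v'' x) * F.m t x)| ≤ 4 * B * (B * k) * D := by
    have h1 : |deriv A x * Z' x + A x * Z'' x| ≤ B * (B * k) + B * (B * k) :=
      (abs_add_le _ _).trans (by rw [abs_mul, abs_mul]; gcongr)
    have h2 : |deriv A x * v' x + A x * v'' x| ≤ B * (B * k) + B * (B * k) :=
      (abs_add_le _ _).trans (by rw [abs_mul, abs_mul]; gcongr)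
    rw [abs_mul, eabs]
    calc _ ≤ 1 * ((B * (B * k) + B * (B * k)) * D + (B * (B * k) + B * (B * k)) * D) := by
          gcongr
          refine (abs_add_le _ _).trans ?_
          rw [abs_mul, abs_mul]
          gcongr
      _ = _ := by ring
  have t2 : |Z' x * A x * F.m t x| ≤ B * k * B * D := by
    rw [abs_mul, abs_mul]; gcongr
  have t3 : |v' x * A x * (F.m t x ^ 2 / F.r t x)| ≤ B * k * B * D := by
    rw [abs_mul, abs_mul]; gcongr
  have t4 : |(v' x * A x + v x * deriv A x) * pressure γ δ (F.r t x)| ≤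
      (B * k * B + B * |deriv A x|) * ((kappa γ + 1) * D) := by
    rw [abs_mul]
    gcongr
    refine (abs_add_le _ _).trans ?_
    rw [abs_mul, abs_mul]
    gcongr
  have t5 : |ε * (F.m t x / F.r t x - v x) * A x * slope' A x * F.m t x| ≤
      ε * B * B * (D + B * D) := by
    have : ε * (F.m t x / F.r t x - v x) * A x * slope' A x * F.m t x =
      ε * A x * slope' A x * (F.m t x ^ 2 / F.r t x - v x * F.m t x) := by field_simp
    rw [this, abs_mul, abs_mul, abs_mul, eabs]
    gcongr
    refine (abs_sub _ _).trans ?_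
    rw [abs_mul]
    gcongr
  have tri : |F.energySource Z' Z'' v v' v'' t x| ≤ 4 * B * (B * k) * D + B * k * B * D
      + B * k * B * D + (B * k * B + B * |deriv A x|) * ((kappa γ + 1) * D)
      + ε * B * B * (D + B * D) := by
    unfold energySource
    rw [neg_mul]
    exact abs_signed_sum_le t1 t2 t3 t4 t5
  refine tri.trans ?_
  have q1 : 0 ≤ |deriv A x| := abs_nonneg _
  have b0 : (1 + B) ^ 3 = 1 + 3 * B + 3 * B ^ 2 + B ^ 3 := by ring
  have b4 := pow_nonneg hB 2
  have b5 := pow_nonneg hB 3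
  have b2 : B ^ 2 ≤ (1 + B) ^ 3 := by linarith
  have b1 : B ≤ (1 + B) ^ 3 := by linarith
  have b3 : B ^ 2 * (1 + B) ≤ (1 + B) ^ 3 := by linarith
  calc _ = (7 + kappa γ) * (k * D) * B ^ 2 + (kappa γ + 1) * (|deriv A x| * D) * B
        + ε * D * (B ^ 2 * (1 + B)) := by ring
    _ ≤ (9 + kappa γ) * (k * D) * (1 + B) ^ 3 + (9 + kappa γ) * (|deriv A x| * D) * (1 + B) ^ 3
        + (9 + kappa γ) * (ε * D) * (1 + B) ^ 3 := by
      have : 0 ≤ (8 + kappa γ) * (ε * D) * (1 + B) ^ 3 := by positivity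
      have : ε * D * (B ^ 2 * (1 + B)) ≤ ε * D * (1 + B) ^ 3 := by gcongr
      have : (7 + kappa γ) * (k * D) * B ^ 2 ≤ (9 + kappa γ) * (k * D) * (1 + B) ^ 3 := by
        gcongr; norm_num
      have : (kappa γ + 1) * (|deriv A x| * D) * B ≤
          (9 + kappa γ) * (|deriv A x| * D) * (1 + B) ^ 3 := by
        gcongr ?_ * _ * ?_; linarith
      linarith
    _ = _ := by ring

end Flow

/-- Grönwall's inequality, with a dissipation term. -/
theorem gronwall_dissipation {y y' d : ℝ → ℝ} {K T Y : ℝ} (hK : 0 ≤ K) (hT : 0 ≤ T)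
    (hy : Continuous y) (hd : Continuous d) (hd0 : ∀ t, 0 ≤ d t)
    (hy' : ∀ t, 0 < t → HasDerivAt y (y' t) t) (hy0 : ∀ t, 0 ≤ y t)
    (h : ∀ t, 0 < t → y' t + d t ≤ K * (1 + y t)) (hY : y 0 ≤ Y) :
    (∀ t ∈ Icc 0 T, y t ≤ exp (K * T) * (1 + Y)) ∧
      ∫ t in (0 : ℝ)..T, d t ≤ Y + K * (1 + exp (K * T) * (1 + Y)) * T := by
  have h1 : ∀ t ∈ Icc 0 T, y t ≤ exp (K * T) * (1 + Y) := by
    have hanti : AntitoneOn (fun t => exp (-(K * t)) * (1 + y t)) (Icc 0 T) := by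
      have hder : ∀ t, 0 < t → HasDerivAt (fun t => exp (-(K * t)) * (1 + y t))
          (exp (-(K * t)) * -(K * 1) * (1 + y t) + exp (-(K * t)) * y' t) t := fun t ht =>
        (((hasDerivAt_id t).const_mul K).neg.exp).mul ((hy' t ht).const_add 1)
      refine antitoneOn_of_deriv_nonpos (convex_Icc _ _) (by fun_prop) ?_ ?_
      · intro t ht
        rw [interior_Icc] at ht
        exact (hder t ht.1).differentiableAt.differentiableWithinAt
      · intro t ht
        rw [interior_Icc] at ht
        rw [(hder t ht.1).deriv]
        have := h t ht.1
        have := hd0 t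
        nlinarith [exp_pos (-(K * t))]
    intro t ht
    have := hanti ⟨le_rfl, hT⟩ ht ht.1
    simp only [mul_zero, neg_zero, exp_zero, one_mul] at this
    rw [exp_neg, inv_mul_le_iff₀ (exp_pos _)] at this
    have h2 : exp (K * t) ≤ exp (K * T) := exp_le_exp.2 (mul_le_mul_of_nonneg_left ht.2 hK)
    have h3 : exp (K * t) * (1 + y 0) ≤ exp (K * T) * (1 + Y) := by
      have := hy0 0
      gcongr
    linarith
  refine ⟨h1, ?_⟩
  set M := exp (K * T) * (1 + Y) with hM
  -- The bound M just obtained turns the differential inequality into y' + d ≤ K(1 + M), which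
  -- integrates to the dissipation bound.
  have hanti : AntitoneOn (fun t => y t + (∫ s in (0:ℝ)..t, d s) - K * (1 + M) * t) (Icc 0 T) := by
    have hder : ∀ t, 0 < t → HasDerivAt (fun t => y t + (∫ s in (0:ℝ)..t, d s) - K * (1 + M) * t)
        (y' t + d t - K * (1 + M) * 1) t := fun t ht =>
      ((hy' t ht).add (intervalIntegral.integral_hasDerivAt_right (hd.intervalIntegrable _ _)
        hd.stronglyMeasurable.stronglyMeasurableAtFilter hd.continuousAt)).sub
        ((hasDerivAt_id t).const_mul _)
    refine antitoneOn_of_deriv_nonpos (convex_Icc _ _) ?_ ?_ ?_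
    · have : Continuous fun t => ∫ s in (0:ℝ)..t, d s :=
        intervalIntegral.continuous_primitive (fun _ _ => hd.intervalIntegrable _ _) 0
      fun_prop
    · intro t ht
      rw [interior_Icc] at ht
      exact (hder t ht.1).differentiableAt.differentiableWithinAt
    · intro t ht
      rw [interior_Icc] at ht
      rw [(hder t ht.1).deriv]
      have := h t ht.1
      have := h1 t ⟨ht.1.le, ht.2.le⟩
      nlinarith
  have := hanti ⟨le_rfl, hT⟩ ⟨hT, le_rfl⟩ hT
  simp only [intervalIntegral.integral_same, mul_zero] at this
  have := hy0 T
  linarith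

/-- The energy estimate relative to general reference functions. -/
theorem Flow.energy_estimate {γ : ℝ} (hγ : 1 < γ) {A₀ : ℝ} (hA₀ : 0 < A₀) (B T : ℝ) (hT : 0 ≤ T) :
    ∃ C, 0 ≤ C ∧ ∀ {A : ℝ → ℝ} {ε δ a b : ℝ} (F : Flow γ A ε δ a b) (Z Z' Z'' v v' v'' P k : ℝ → ℝ),
      IsArea A → (∀ x, A₀ ≤ A x) → 0 < ε → 0 < δ → a ≤ b →
      (∀ x, HasDerivAt Z (Z' x) x) → (∀ x, HasDerivAt Z' (Z'' x) x) →
      (∀ x, HasDerivAt v (v' x) x) → (∀ x, HasDerivAt v' (v'' x) x) →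
      Continuous Z'' → Continuous v'' → Continuous P → Continuous k → (∀ x, 0 ≤ k x) →
      (∀ x, k x + |deriv A x| + ε ≤ B) → ∫ x in a..b, (k x + |deriv A x| + ε) ≤ B →
      (∀ t, 0 < t → |F.energyFlux Z Z' v v' t b - F.energyFlux Z Z' v v' t a| ≤ B) →
      (∀ t x, |F.energySource Z' Z'' v v' v'' t x| ≤
        B * (k x + |deriv A x| + ε) * size γ δ (F.r t x) (F.m t x)) →
      (∀ t x, 0 ≤ F.energy Z v P t x) →
      (∀ t x, size γ δ (F.r t x) (F.m t x) ≤ B * (1 + F.energy Z v P t x)) →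
      ∫ x in a..b, A x * F.energy Z v P 0 x ≤ B →
      (∀ t ∈ Icc 0 T, ∫ x in a..b, A x * F.energy Z v P t x ≤ C) ∧
        ε * ∫ t in (0 : ℝ)..T, ∫ x in a..b, A x * F.dissipation t x ≤ C := by
  -- The three parts come from the boundary flux, from the integral of the source weight times B²,
  -- and from the supremum of that weight times the energy; A₀ converts the energy into A times the
  -- energy.
  set K := B + B ^ 3 + B ^ 3 / A₀ with hK
  refine ⟨max 0 (max (exp (K * T) * (1 + B)) (B + K * (1 + exp (K * T) * (1 + B)) * T)),
    le_max_left _ _, ?_⟩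
  intro A ε δ a b F Z Z' Z'' v v' v'' P k hA hAl hε hδ hab hZ hZ' hv hv' cZ'' cv'' cP ck hk0 hkB
    hkint hJ hsrc hE0 hsize hinit
  have cZ : Continuous Z := continuous_iff_continuousAt.2 fun x => (hZ x).continuousAt
  have cZ' : Continuous Z' := continuous_iff_continuousAt.2 fun x => (hZ' x).continuousAt
  have cv : Continuous v := continuous_iff_continuousAt.2 fun x => (hv x).continuousAt
  have cv' : Continuous v' := continuous_iff_continuousAt.2 fun x => (hv' x).continuousAt
  have hB : 0 ≤ B := by
    have := hkB 0
    have := hk0 0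
    have := abs_nonneg (deriv A 0)
    linarith
  have cA := hA.continuous
  have cA' := hA.continuous_deriv
  have cE := F.cont_energy cZ cv cP
  have cET := F.cont_energyT cZ cv
  have cD := F.cont_dissipation
  have cS := F.cont_energySource hA cZ' cZ'' cv cv' cv''
  have cJ := F.cont_energyFlux hA cZ cZ' cv cv'
  have sl : ∀ {f : ℝ → ℝ → ℝ}, Continuous (fun z : ℝ × ℝ => f z.1 z.2) → ∀ t, Continuous (f t) :=
    fun hf t => hf.comp (by fun_prop : Continuous fun x : ℝ => (t, x))
  have cAE : Continuous fun z : ℝ × ℝ => A z.2 * F.energy Z v P z.1 z.2 := by fun_prop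
  have cAET : Continuous fun z : ℝ × ℝ => A z.2 * F.energyT Z v z.1 z.2 := by fun_prop
  have cAD : Continuous fun z : ℝ × ℝ => A z.2 * F.dissipation z.1 z.2 := by fun_prop
  have hy' : ∀ t, 0 < t → HasDerivAt (fun s => ∫ x in a..b, A x * F.energy Z v P s x)
      (∫ x in a..b, A x * F.energyT Z v t x) t := fun t ht =>
    hasDerivAt_integral_fst (f := fun t x => A x * F.energy Z v P t x)
      (g := fun t x => A x * F.energyT Z v t x) cAE cAET
      (fun t ht x hx => (F.hasDerivAt_energy hγ Z v P ht hx).const_mul _) le_rfl hab le_rfl ht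
  have hnn : ∀ t, 0 ≤ ∫ x in a..b, A x * F.energy Z v P t x := fun t =>
    intervalIntegral.integral_nonneg hab fun x _ => mul_nonneg (hA.pos x).le (hE0 t x)
  have main := gronwall_dissipation (y := fun s => ∫ x in a..b, A x * F.energy Z v P s x)
    (d := fun t => ε * ∫ x in a..b, A x * F.dissipation t x) (K := K) (T := T) (Y := B)
    (by positivity) hT (continuous_integral_fst (f := fun t x => A x * F.energy Z v P t x) cAE a b)
    ((continuous_integral_fst (f := fun t x => A x * F.dissipation t x) cAD a b).const_mul ε)
    (fun t => mul_nonneg hε.le (intervalIntegral.integral_nonneg hab fun x _ =>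
      mul_nonneg (hA.pos x).le (F.dissipation_nonneg hγ hδ.le t x))) hy' hnn ?_ hinit
  · rw [intervalIntegral.integral_const_mul] at main
    exact ⟨fun t ht => (main.1 t ht).trans ((le_max_left _ _).trans (le_max_right _ _)),
      main.2.trans ((le_max_right _ _).trans (le_max_right _ _))⟩
  intro t ht
  have c1 := sl (f := fun t x => A x * F.energyT Z v t x) cAET t
  have c2 := sl (f := fun t x => A x * F.dissipation t x) cAD t
  have c3 := sl (f := fun t x => F.energySource Z' Z'' v v' v'' t x) cS t
  have c4 := sl (f := fun t x => F.energy Z v P t x) cE t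
  have c5 := sl (f := fun t x => A x * F.energy Z v P t x) cAE t
  have hftc : ∫ x in a..b, (A x * F.energyT Z v t x + ε * A x * F.dissipation t x
        - F.energySource Z' Z'' v v' v'' t x) =
      F.energyFlux Z Z' v v' t b - F.energyFlux Z Z' v v' t a :=
    integral_eq_sub_of_interior (a := a) (b := b) (sl (f := F.energyFlux Z Z' v v') cJ t)
      (by simp only [mul_assoc]; fun_prop)
      (fun x hx => F.hasDerivAt_energyFlux hγ hA hZ hZ' hv hv' ht hx) le_rfl hab le_rfl
  have hsplit : ∫ x in a..b, (A x * F.energyT Z v t x + ε * A x * F.dissipation t x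
        - F.energySource Z' Z'' v v' v'' t x) = (∫ x in a..b, A x * F.energyT Z v t x)
        + ε * (∫ x in a..b, A x * F.dissipation t x)
        - ∫ x in a..b, F.energySource Z' Z'' v v' v'' t x := by
    simp only [mul_assoc]
    rw [intervalIntegral.integral_sub, intervalIntegral.integral_add,
      intervalIntegral.integral_const_mul]
    all_goals exact Continuous.intervalIntegrable (by fun_prop) _ _
  have hS : ∫ x in a..b, F.energySource Z' Z'' v v' v'' t x ≤
      B ^ 3 + B ^ 3 / A₀ * ∫ x in a..b, A x * F.energy Z v P t x := by
    -- After size ≤ B(1 + E), the constant 1 is paired with the integral of the weight and E with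
    -- its supremum. This is why the weight is required both bounded and integrable.
    have hpt : ∀ x ∈ Icc a b, F.energySource Z' Z'' v v' v'' t x ≤
        B ^ 2 * (k x + |deriv A x| + ε) + B ^ 3 / A₀ * (A x * F.energy Z v P t x) := by
      intro x _
      have h1 := (le_abs_self _).trans (hsrc t x)
      have h0 : 0 ≤ k x + |deriv A x| + ε := by
        have := hk0 x
        positivity
      have h2 := hsize t x
      have h3 := hE0 t x
      have h4 : F.energy Z v P t x ≤ A x * F.energy Z v P t x / A₀ := by
        rw [le_div_iff₀ hA₀, mul_comm]
        exact mul_le_mul_of_nonneg_right (hAl x) h3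
      calc _ ≤ B * (k x + |deriv A x| + ε) * (B * (1 + F.energy Z v P t x)) :=
            h1.trans (by gcongr)
        _ = B ^ 2 * (k x + |deriv A x| + ε)
            + B ^ 2 * (k x + |deriv A x| + ε) * F.energy Z v P t x := by ring
        _ ≤ B ^ 2 * (k x + |deriv A x| + ε)
            + B ^ 2 * B * (A x * F.energy Z v P t x / A₀) := by
          gcongr
          exact hkB x
        _ = _ := by ring
    have cabs : Continuous fun x => |deriv A x| := cA'.abs
    refine (intervalIntegral.integral_mono_on hab (c3.intervalIntegrable _ _)
      (Continuous.intervalIntegrable (by fun_prop) _ _) hpt).trans ?_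
    rw [intervalIntegral.integral_add (Continuous.intervalIntegrable (by fun_prop) _ _)
      (Continuous.intervalIntegrable (by fun_prop) _ _), intervalIntegral.integral_const_mul,
      intervalIntegral.integral_const_mul]
    have := mul_le_mul_of_nonneg_left hkint (sq_nonneg B)
    linarith
  have := (le_abs_self _).trans (hJ t ht)
  have h0 := hnn t
  have e1 : 0 ≤ B ^ 3 / A₀ := by positivity
  have e2 : 0 ≤ (B + B ^ 3) * ∫ x in a..b, A x * F.energy Z v P t x := by positivity
  rw [hK]
  linarith

/-! ### Interpolated reference states -/

theorem deriv_smoothTransition_eq_zero {y : ℝ} (hy : y ≤ 0 ∨ 1 ≤ y) :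
    deriv smoothTransition y = 0 := by
  obtain h | h := hy
  -- An extremal value is attained at y; the argument includes the endpoints 0 and 1 of the
  -- transition.
  · refine IsLocalMin.deriv_eq_zero (Eventually.of_forall fun z => ?_)
    rw [smoothTransition.zero_of_nonpos h]
    exact smoothTransition.nonneg z
  · refine IsLocalMax.deriv_eq_zero (Eventually.of_forall fun z => ?_)
    rw [smoothTransition.one_of_one_le h]
    exact smoothTransition.le_one z

theorem deriv2_smoothTransition_eq_zero {y : ℝ} (hy : y < 0 ∨ 1 < y) :
    deriv (deriv smoothTransition) y = 0 := by
  have : deriv smoothTransition =ᶠ[𝓝 y] fun _ => 0 := by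
    obtain h | h := hy
    · filter_upwards [Iio_mem_nhds h] with z hz
      exact deriv_smoothTransition_eq_zero (Or.inl (le_of_lt hz))
    · filter_upwards [Ioi_mem_nhds h] with z hz
      exact deriv_smoothTransition_eq_zero (Or.inr (le_of_lt hz))
  rw [this.deriv_eq]
  simp

theorem contDiff_deriv_smoothTransition : ContDiff ℝ 1 (deriv smoothTransition) :=
  (contDiff_succ_iff_deriv.1 (show ContDiff ℝ (1 + 1) smoothTransition from
    smoothTransition.contDiff (n := 2))).2.2

theorem hasDerivAt_smoothTransition (y : ℝ) :
    HasDerivAt smoothTransition (deriv smoothTransition y) y :=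
  ((smoothTransition.contDiff (n := 1)).differentiable (by norm_num) y).hasDerivAt

theorem hasDerivAt_deriv_smoothTransition (y : ℝ) :
    HasDerivAt (deriv smoothTransition) (deriv (deriv smoothTransition) y) y :=
  (contDiff_deriv_smoothTransition.differentiable (by norm_num) y).hasDerivAt

theorem continuous_deriv_smoothTransition : Continuous (deriv smoothTransition) :=
  contDiff_deriv_smoothTransition.continuous

theorem continuous_deriv2_smoothTransition : Continuous (deriv (deriv smoothTransition)) :=
  contDiff_deriv_smoothTransition.continuous_deriv (by norm_num)

/-- Both derivatives live on [0, 1]. The majorant (1 + y²)⁻¹ is chosen because it is smooth and has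
integral at most π over every interval, so its translates form a weight whose integral does not
depend on a and b. -/
theorem exists_bound_smoothTransition : ∃ S, 0 ≤ S ∧ ∀ y,
    |deriv smoothTransition y| ≤ S * (1 + y ^ 2)⁻¹ ∧
      |deriv (deriv smoothTransition) y| ≤ S * (1 + y ^ 2)⁻¹ := by
  obtain ⟨S₁, h1⟩ := isCompact_Icc.exists_bound_of_continuousOn
    (s := Icc (0:ℝ) 1) continuous_deriv_smoothTransition.continuousOn
  obtain ⟨S₂, h2⟩ := isCompact_Icc.exists_bound_of_continuousOn
    (s := Icc (0:ℝ) 1) continuous_deriv2_smoothTransition.continuousOn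
  have hS : 0 ≤ max S₁ S₂ := (norm_nonneg _).trans ((h1 0 (by simp)).trans (le_max_left _ _))
  refine ⟨2 * max S₁ S₂, by positivity, fun y => ?_⟩
  by_cases hy : y ∈ Icc (0:ℝ) 1
  · have hy2 : max S₁ S₂ ≤ 2 * max S₁ S₂ * (1 + y ^ 2)⁻¹ := by
      rw [← div_eq_mul_inv, le_div_iff₀ (by positivity)]
      have : y ^ 2 ≤ 1 := by nlinarith [hy.1, hy.2]
      nlinarith
    exact ⟨(h1 y hy).trans ((le_max_left _ _).trans hy2), (h2 y hy).trans ((le_max_right _ _).trans hy2)⟩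
  · have hy' : y < 0 ∨ 1 < y := by
      by_contra! h
      exact hy ⟨h.1, h.2⟩
    rw [deriv_smoothTransition_eq_zero (hy'.imp le_of_lt le_of_lt),
      deriv2_smoothTransition_eq_zero hy', abs_zero]
    have : 0 ≤ 2 * max S₁ S₂ * (1 + y ^ 2)⁻¹ := by positivity
    exact ⟨this, this⟩

/-- The smooth interpolation of four values, with transitions in `[a, a + 1]`, `[0, 1]`
and `[b - 1, b]`. -/
def interp (a b : ℝ) (f : Fin 4 → ℝ) (x : ℝ) : ℝ :=
  f 0 + (f 1 - f 0) * smoothTransition (x - a) + (f 2 - f 1) * smoothTransition x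
    + (f 3 - f 2) * smoothTransition (x - b + 1)

/-- The derivative of `interp`. -/
def interp' (a b : ℝ) (f : Fin 4 → ℝ) (x : ℝ) : ℝ :=
  (f 1 - f 0) * deriv smoothTransition (x - a) + (f 2 - f 1) * deriv smoothTransition x
    + (f 3 - f 2) * deriv smoothTransition (x - b + 1)

/-- The second derivative of `interp`. -/
def interp'' (a b : ℝ) (f : Fin 4 → ℝ) (x : ℝ) : ℝ :=
  (f 1 - f 0) * deriv (deriv smoothTransition) (x - a)
    + (f 2 - f 1) * deriv (deriv smoothTransition) x
    + (f 3 - f 2) * deriv (deriv smoothTransition) (x - b + 1)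

/-- An integrable weight that is bounded below in the transition regions. -/
def weight (a b x : ℝ) : ℝ :=
  (1 + (x - a) ^ 2)⁻¹ + (1 + x ^ 2)⁻¹ + (1 + (x - b + 1) ^ 2)⁻¹

section Interp
variable {a b : ℝ} (f : Fin 4 → ℝ)

theorem hasDerivAt_interp (x : ℝ) : HasDerivAt (interp a b f) (interp' a b f x) x := by
  have h1 := ((hasDerivAt_smoothTransition (x - a)).comp_sub_const x a).const_mul (f 1 - f 0)
  have h2 := (hasDerivAt_smoothTransition x).const_mul (f 2 - f 1)
  have h3 : HasDerivAt (fun x => smoothTransition (x - b + 1))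
      (deriv smoothTransition (x - b + 1)) x := by
    have := (hasDerivAt_smoothTransition (x - (b - 1))).comp_sub_const x (b - 1)
    simpa only [sub_sub_eq_add_sub, sub_add_eq_add_sub] using this
  exact ((h1.const_add (f 0)).add h2).add (h3.const_mul (f 3 - f 2))

theorem hasDerivAt_interp' (x : ℝ) : HasDerivAt (interp' a b f) (interp'' a b f x) x := by
  have h1 := ((hasDerivAt_deriv_smoothTransition (x - a)).comp_sub_const x a).const_mul (f 1 - f 0)
  have h2 := (hasDerivAt_deriv_smoothTransition x).const_mul (f 2 - f 1)
  have h3 : HasDerivAt (fun x => deriv smoothTransition (x - b + 1))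
      (deriv (deriv smoothTransition) (x - b + 1)) x := by
    have := (hasDerivAt_deriv_smoothTransition (x - (b - 1))).comp_sub_const x (b - 1)
    simpa only [sub_sub_eq_add_sub, sub_add_eq_add_sub] using this
  exact (h1.add h2).add (h3.const_mul (f 3 - f 2))

theorem continuous_interp'' : Continuous (interp'' a b f) := by
  have := continuous_deriv2_smoothTransition
  unfold interp''
  fun_prop

theorem continuous_interp : Continuous (interp a b f) :=
  continuous_iff_continuousAt.2 fun x => (hasDerivAt_interp f x).continuousAt

theorem continuous_weight : Continuous (weight a b) := by
  unfold weight
  refine ((Continuous.inv₀ (by fun_prop) fun x => ?_).add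
    (Continuous.inv₀ (by fun_prop) fun x => ?_)).add (Continuous.inv₀ (by fun_prop) fun x => ?_)
  all_goals positivity

theorem weight_nonneg (x : ℝ) : 0 ≤ weight a b x := by unfold weight; positivity

theorem weight_le (x : ℝ) : weight a b x ≤ 3 := by
  have h : ∀ y : ℝ, (1 + y ^ 2)⁻¹ ≤ 1 := fun y => inv_le_one_of_one_le₀ (by nlinarith [sq_nonneg y])
  unfold weight
  linarith [h (x - a), h x, h (x - b + 1)]

theorem integral_weight_le : ∫ x in a..b, weight a b x ≤ 3 * π := by
  have h0 : ∀ c d : ℝ, ∫ x in c..d, (1 + x ^ 2)⁻¹ ≤ π := by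
    intro c d
    rw [integral_inv_one_add_sq]
    linarith [arctan_lt_pi_div_two d, neg_pi_div_two_lt_arctan c]
  have hc : Continuous fun y : ℝ => (1 + y ^ 2)⁻¹ :=
    Continuous.inv₀ (by fun_prop) fun x => by positivity
  have h1 : ∫ x in a..b, (1 + (x - a) ^ 2)⁻¹ ≤ π := by
    rw [intervalIntegral.integral_comp_sub_right (fun y => (1 + y ^ 2)⁻¹)]
    exact h0 _ _
  have h3 : ∫ x in a..b, (1 + (x - b + 1) ^ 2)⁻¹ ≤ π := by
    have : ∀ x : ℝ, (1 + (x - b + 1) ^ 2)⁻¹ = (1 + (x - (b - 1)) ^ 2)⁻¹ := fun x => by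
      congr 3; ring
    simp only [this]
    rw [intervalIntegral.integral_comp_sub_right (fun y => (1 + y ^ 2)⁻¹)]
    exact h0 _ _
  unfold weight
  rw [intervalIntegral.integral_add, intervalIntegral.integral_add]
  · linarith [h0 a b]
  · exact (hc.comp (by fun_prop : Continuous fun x : ℝ => x - a)).intervalIntegrable _ _
  · exact hc.intervalIntegrable _ _
  · exact ((hc.comp (by fun_prop : Continuous fun x : ℝ => x - a)).add hc).intervalIntegrable _ _
  · exact (hc.comp (by fun_prop : Continuous fun x : ℝ => x - b + 1)).intervalIntegrable _ _

theorem abs_interp'_le {B S : ℝ} (hf : ∀ i, |f i| ≤ B)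
    (h : ∀ y, |deriv smoothTransition y| ≤ S * (1 + y ^ 2)⁻¹) (x : ℝ) :
    |interp' a b f x| ≤ 2 * B * S * weight a b x := by
  have hB : 0 ≤ B := (abs_nonneg _).trans (hf 0)
  have hd : ∀ i j, |f i - f j| ≤ 2 * B := fun i j =>
    (abs_sub _ _).trans (by linarith [hf i, hf j])
  unfold interp' weight
  calc _ ≤ 2 * B * (S * (1 + (x - a) ^ 2)⁻¹) + 2 * B * (S * (1 + x ^ 2)⁻¹)
        + 2 * B * (S * (1 + (x - b + 1) ^ 2)⁻¹) := by
        refine (abs_add_le _ _).trans (add_le_add ((abs_add_le _ _).trans (add_le_add ?_ ?_)) ?_)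
        all_goals
          rw [abs_mul]
          exact mul_le_mul (hd _ _) (h _) (abs_nonneg _) (by positivity)
    _ = _ := by ring

theorem abs_interp''_le {B S : ℝ} (hf : ∀ i, |f i| ≤ B)
    (h : ∀ y, |deriv (deriv smoothTransition) y| ≤ S * (1 + y ^ 2)⁻¹) (x : ℝ) :
    |interp'' a b f x| ≤ 2 * B * S * weight a b x := by
  have hB : 0 ≤ B := (abs_nonneg _).trans (hf 0)
  have hd : ∀ i j, |f i - f j| ≤ 2 * B := fun i j =>
    (abs_sub _ _).trans (by linarith [hf i, hf j])
  unfold interp'' weight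
  calc _ ≤ 2 * B * (S * (1 + (x - a) ^ 2)⁻¹) + 2 * B * (S * (1 + x ^ 2)⁻¹)
        + 2 * B * (S * (1 + (x - b + 1) ^ 2)⁻¹) := by
        refine (abs_add_le _ _).trans (add_le_add ((abs_add_le _ _).trans (add_le_add ?_ ?_)) ?_)
        all_goals
          rw [abs_mul]
          exact mul_le_mul (hd _ _) (h _) (abs_nonneg _) (by positivity)
    _ = _ := by ring

/-- Interpolated values are convex combinations. -/
theorem exists_interp_eq (ha : a ≤ -1) (hb : 2 ≤ b) (x : ℝ) : ∃ w : Fin 4 → ℝ,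
    (∀ i, 0 ≤ w i) ∧ ∑ i, w i = 1 ∧ ∀ f, interp a b f x = ∑ i, w i * f i := by
  -- The weights are the successive drops of 1 ≥ s(x - a) ≥ s(x) ≥ s(x - b + 1) ≥ 0, so they are
  -- nonnegative and telescope to 1.
  refine ⟨![1 - smoothTransition (x - a), smoothTransition (x - a) - smoothTransition x,
    smoothTransition x - smoothTransition (x - b + 1), smoothTransition (x - b + 1)], ?_, ?_, ?_⟩
  · have h1 : smoothTransition x ≤ smoothTransition (x - a) :=
      smoothTransition.monotone (by linarith)
    have h2 : smoothTransition (x - b + 1) ≤ smoothTransition x :=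
      smoothTransition.monotone (by linarith)
    intro i
    fin_cases i
    · simpa using smoothTransition.le_one (x - a)
    · simpa using h1
    · simpa using h2
    · exact smoothTransition.nonneg _
  · rw [Fin.sum_univ_four]
    simp
  · intro f
    rw [Fin.sum_univ_four]
    simp only [interp, Matrix.cons_val]
    ring

theorem interp_left (ha : a ≤ -1) (hb : 2 ≤ b) : interp a b f a = f 0 := by
  unfold interp
  rw [sub_self, smoothTransition.zero, smoothTransition.zero_of_nonpos (by linarith : a ≤ 0),
    smoothTransition.zero_of_nonpos (by linarith : a - b + 1 ≤ 0)]
  ring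

theorem interp_right (ha : a ≤ -1) (hb : 2 ≤ b) : interp a b f b = f 3 := by
  unfold interp
  rw [smoothTransition.one_of_one_le (by linarith : 1 ≤ b - a),
    smoothTransition.one_of_one_le (by linarith : 1 ≤ b),
    smoothTransition.one_of_one_le (by linarith : 1 ≤ b - b + 1)]
  ring

theorem interp'_left (ha : a ≤ -1) (hb : 2 ≤ b) : interp' a b f a = 0 := by
  unfold interp'
  rw [deriv_smoothTransition_eq_zero (Or.inl (by linarith : a - a ≤ 0)),
    deriv_smoothTransition_eq_zero (Or.inl (by linarith : a ≤ 0)),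
    deriv_smoothTransition_eq_zero (Or.inl (by linarith : a - b + 1 ≤ 0))]
  ring

theorem interp'_right (ha : a ≤ -1) (hb : 2 ≤ b) : interp' a b f b = 0 := by
  unfold interp'
  rw [deriv_smoothTransition_eq_zero (Or.inr (by linarith : 1 ≤ b - a)),
    deriv_smoothTransition_eq_zero (Or.inr (by linarith : 1 ≤ b)),
    deriv_smoothTransition_eq_zero (Or.inr (by linarith : 1 ≤ b - b + 1))]
  ring

theorem interp_middle_left {x : ℝ} (h1 : a + 1 ≤ x) (h2 : x ≤ 0) (h3 : x ≤ b - 1) :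
    interp a b f x = f 1 := by
  unfold interp
  rw [smoothTransition.one_of_one_le (by linarith : 1 ≤ x - a),
    smoothTransition.zero_of_nonpos h2,
    smoothTransition.zero_of_nonpos (by linarith : x - b + 1 ≤ 0)]
  ring

theorem interp_middle_right {x : ℝ} (h1 : a + 1 ≤ x) (h2 : 1 ≤ x) (h3 : x ≤ b - 1) :
    interp a b f x = f 2 := by
  unfold interp
  rw [smoothTransition.one_of_one_le (by linarith : 1 ≤ x - a),
    smoothTransition.one_of_one_le h2,
    smoothTransition.zero_of_nonpos (by linarith : x - b + 1 ≤ 0)]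
  ring

end Interp

/-- The coefficient of the density in the relative energy. -/
def refZ (γ δ : ℝ) (rb ub : Fin 4 → ℝ) (i : Fin 4) : ℝ := enthalpy γ δ (rb i) - ub i ^ 2 / 2

/-- The constant term of the relative energy. -/
def refP (γ δ : ℝ) (rb : Fin 4 → ℝ) (i : Fin 4) : ℝ :=
  enthalpy γ δ (rb i) * rb i - internalEnergy γ δ (rb i)

namespace Flow
variable {γ : ℝ} {A : ℝ → ℝ} {ε δ a b : ℝ} (F : Flow γ A ε δ a b)

/-- The energy relative to four interpolated constant states. -/
def interpEnergy (rb ub : Fin 4 → ℝ) (t x : ℝ) : ℝ :=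
  F.energy (interp a b (refZ γ δ rb ub)) (interp a b ub) (interp a b (refP γ δ rb)) t x

/-- Affineness in the coefficients turns interpolation of coefficients into interpolation of
energies, so nonnegativity and coercivity pass from constant states. Interpolating h_δ' at the four
states, rather than composing h_δ' with a density profile, also keeps the coefficient smooth when a
limit state is vacuum. -/
theorem interpEnergy_eq (hγ : 1 < γ) (rb ub : Fin 4 → ℝ) (t x : ℝ) :
    F.interpEnergy rb ub t x =
      interp a b (fun i => relEnergy γ δ (F.r t x) (F.m t x) (rb i) (ub i)) x := by
  simp only [relEnergy_eq hγ δ (F.pos t x)]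
  unfold interpEnergy energy interp refZ refP
  ring

end Flow

theorem IsArea.exists_bounds {A : ℝ → ℝ} (hA : IsArea A) : ∃ A₀ Q : ℝ, 0 < A₀ ∧ 0 ≤ Q ∧
    (∀ x, A₀ ≤ A x) ∧ (∀ x, A x ≤ Q) ∧ (∀ x, |deriv A x| ≤ Q) ∧ (∀ x, |slope A x| ≤ Q) ∧
    (∀ x, |slope' A x| ≤ Q) ∧ ∀ a b : ℝ, a ≤ b → ∫ x in a..b, |deriv A x| ≤ Q := by
  obtain ⟨A₀, h0, h1⟩ := hA.lower
  obtain ⟨A₂, h2⟩ := hA.bounded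
  have hA2 : 0 ≤ A₂ := h0.le.trans ((h1 0).trans (h2 0).1)
  have hI : 0 ≤ ∫ x, |deriv A x| := integral_nonneg fun x => abs_nonneg _
  have hs : ∀ x, |slope A x| ≤ A₂ / A₀ := fun x => by
    unfold slope
    rw [abs_div, abs_of_pos (hA.pos x)]
    exact div_le_div₀ hA2 (h2 x).2.1 h0 (h1 x)
  have hs' : ∀ x, |slope' A x| ≤ A₂ / A₀ + (A₂ / A₀) ^ 2 := fun x => by
    unfold slope'
    refine (abs_sub _ _).trans (add_le_add ?_ ?_)
    · rw [abs_div, abs_of_pos (hA.pos x)]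
      exact div_le_div₀ hA2 (h2 x).2.2 h0 (h1 x)
    · rw [abs_pow]
      exact pow_le_pow_left₀ (abs_nonneg _) (hs x) 2
  have q0 : 0 ≤ A₂ / A₀ := by positivity
  have q1 : 0 ≤ (A₂ / A₀) ^ 2 := by positivity
  refine ⟨A₀, A₂ + A₂ / A₀ + (A₂ / A₀) ^ 2 + ∫ x, |deriv A x|, h0, by positivity, h1,
    fun x => ?_, fun x => ?_, fun x => ?_, fun x => ?_, fun a b hab => ?_⟩
  · linarith [(h2 x).1]
  · linarith [(h2 x).2.1]
  · linarith [hs x]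
  · linarith [hs' x]
  · rw [intervalIntegral.integral_of_le hab]
    have := setIntegral_le_integral (s := Ioc a b) hA.integrable.abs
      (ae_of_all _ fun x => abs_nonneg _)
    linarith

/-! ### Uniform energy bounds for the approximate problem -/

namespace Flow

/-- At an endpoint the reference state is the Dirichlet state. The factors h' - u²/2 - Z and u - v
of ρ_x and m_x then vanish, as do Z' and v', so that the flux is a function of the bounded boundary
values only. -/
theorem abs_energyFlux_le {γ : ℝ} (hγ : 1 < γ) {A : ℝ → ℝ} {ε δ a b : ℝ} (F : Flow γ A ε δ a b)
    {B Q H : ℝ} {Z Z' v v' : ℝ → ℝ} {t x rb ub : ℝ} (hδ : 0 ≤ δ) (hδB : δ ≤ B) (hrb : rb ≤ B)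
    (hub : |ub| ≤ B) (hA0 : 0 ≤ A x) (hAQ : A x ≤ Q)
    (hH : kappa γ / (γ - 1) * (γ * B ^ (γ - 1)) + 2 * B * B ≤ H)
    (hr : F.r t x = rb) (hm : F.m t x = rb * ub) (hZ : Z x = enthalpy γ δ rb - ub ^ 2 / 2)
    (hv : v x = ub) (hZ' : Z' x = 0) (hv' : v' x = 0) :
    |F.energyFlux Z Z' v v' t x| ≤
      Q * (B ^ 4 + B * B * H) + (H + B ^ 2) * Q * (B * B) + B * Q * (B ^ 3 + (kappa γ * B ^ γ + B ^ 3)) := by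
  have hp : 0 < rb := hr ▸ F.pos t x
  have hB : 0 ≤ B := hp.le.trans hrb
  have hQ : 0 ≤ Q := hA0.trans hAQ
  have hκ := (kappa_pos hγ).le
  have hk : 0 < kappa γ / (γ - 1) := div_pos (kappa_pos hγ) (by linarith)
  have he0 : 0 ≤ enthalpy γ δ rb := by unfold enthalpy; positivity
  have he : enthalpy γ δ rb ≤ H := by
    refine le_trans ?_ hH
    unfold enthalpy
    have : rb ^ (γ - 1) ≤ B ^ (γ - 1) := Real.rpow_le_rpow hp.le hrb (by linarith)
    gcongr
  have hpr : |pressure γ δ rb| ≤ kappa γ * B ^ γ + B ^ 3 := by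
    unfold pressure
    rw [abs_of_nonneg (by positivity)]
    have h1 : rb ^ γ ≤ B ^ γ := Real.rpow_le_rpow hp.le hrb (by linarith)
    have h2 : δ * rb ^ 2 ≤ B * B ^ 2 := by gcongr
    have : kappa γ * rb ^ γ ≤ kappa γ * B ^ γ := by gcongr
    linarith
  have h0 : F.energyFlux Z Z' v v' t x =
      -(A x * (rb * ub ^ 3 / 2 + rb * ub * enthalpy γ δ rb))
      + (enthalpy γ δ rb - ub ^ 2 / 2) * A x * (rb * ub)
      + ub * A x * (rb * ub ^ 2 + pressure γ δ rb) := by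
    unfold energyFlux
    rw [hr, hm, hZ, hv, hZ', hv']
    field_simp
    ring
  have arb : |rb| ≤ B := by rw [abs_of_pos hp]; exact hrb
  have aA : |A x| ≤ Q := by rw [abs_of_nonneg hA0]; exact hAQ
  have ae : |enthalpy γ δ rb| ≤ H := by rw [abs_of_nonneg he0]; exact he
  have hH0 : 0 ≤ H := he0.trans he
  rw [h0]
  refine (abs_add_le _ _).trans (add_le_add ((abs_add_le _ _).trans (add_le_add ?_ ?_)) ?_)
  · rw [abs_neg, abs_mul]
    gcongr
    refine (abs_add_le _ _).trans (add_le_add ?_ ?_)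
    · rw [abs_div, abs_mul, abs_pow, abs_two]
      have : |rb| * |ub| ^ 3 ≤ B * B ^ 3 := by gcongr
      have := abs_nonneg rb
      have : 0 ≤ |rb| * |ub| ^ 3 := by positivity
      nlinarith
    · rw [abs_mul, abs_mul]
      gcongr
  · have hsub : |enthalpy γ δ rb - ub ^ 2 / 2| ≤ H + B ^ 2 := by
      refine (abs_sub _ _).trans (add_le_add ae ?_)
      rw [abs_div, abs_pow, abs_two]
      have : |ub| ^ 2 ≤ B ^ 2 := by gcongr
      nlinarith [sq_nonneg |ub|]
    rw [abs_mul, abs_mul, abs_mul]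
    gcongr
  · rw [abs_mul, abs_mul]
    gcongr
    refine (abs_add_le _ _).trans (add_le_add ?_ hpr)
    rw [abs_mul, abs_pow]
    calc |rb| * |ub| ^ 2 ≤ B * B ^ 2 := by gcongr
      _ = B ^ 3 := by ring

theorem continuous_slice {f : ℝ → ℝ → ℝ} (hf : Continuous fun z : ℝ × ℝ => f z.1 z.2) (t : ℝ) :
    Continuous (f t) :=
  hf.comp (by fun_prop : Continuous fun x : ℝ => (t, x))

set_option maxHeartbeats 1000000 in
/-- The energy estimate for solutions of the approximate problem. -/
theorem energy_bounds {γ : ℝ} (hγ : 1 < γ) {A : ℝ → ℝ} (hA : IsArea A) (B L₀ T : ℝ) (hT : 0 ≤ T)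
    (hL : 1 ≤ L₀) :
    ∃ C, 0 ≤ C ∧ ∀ {ε δ a b : ℝ} (F : Flow γ A ε δ a b) (rb ub : Fin 4 → ℝ) (ρbar ubar : ℝ → ℝ),
      0 < ε → ε ≤ 1 → 0 < δ → δ ≤ B → a ≤ -1 → 2 ≤ b → ε * (b - a) ≤ B →
      (∀ i, 0 ≤ rb i) → (∀ i, rb i ≤ B) → (∀ i, |ub i| ≤ B) →
      Continuous ρbar → Continuous ubar → (∀ x, 0 ≤ ρbar x) → (∀ x, ρbar x ≤ B) →
      (∀ x, |ubar x| ≤ B) → (∀ x, x ≤ -L₀ → ρbar x = rb 1 ∧ ubar x = ub 1) →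
      (∀ x, L₀ ≤ x → ρbar x = rb 2 ∧ ubar x = ub 2) →
      (∀ t, 0 < t → F.r t a = rb 0 ∧ F.m t a = rb 0 * ub 0) →
      (∀ t, 0 < t → F.r t b = rb 3 ∧ F.m t b = rb 3 * ub 3) →
      ∫ x in a..b, relEnergy γ δ (F.r 0 x) (F.m 0 x) (ρbar x) (ubar x) * A x ≤ B →
      (∀ t ∈ Icc 0 T, ∀ c d, a ≤ c → c ≤ d → d ≤ b →
        ∫ x in c..d, size γ δ (F.r t x) (F.m t x) ≤ C * (1 + (d - c))) ∧
      ε * ∫ t in (0 : ℝ)..T, ∫ x in a..b, F.dissipation t x ≤ C := by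
  obtain ⟨A₀, Q, hA₀, hQ, hAl, hAu, hA', hs, hs', hAi⟩ := hA.exists_bounds
  obtain ⟨S, hS, hSb⟩ := exists_bound_smoothTransition
  obtain ⟨C₁, hC₁, h1⟩ := size_le_relEnergy hγ B
  obtain ⟨C₂, hC₂, h2⟩ := relEnergy_le_size hγ B
  obtain hB | hB := lt_or_ge B 0
  · exact ⟨0, le_rfl, fun F rb ub _ _ _ _ _ _ _ _ _ h h' => absurd ((h 0).trans (h' 0)) (by linarith)⟩
  set H := kappa γ / (γ - 1) * (γ * B ^ (γ - 1)) + 2 * B * B with hH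
  have hκ := (kappa_pos hγ).le
  have hk : 0 < kappa γ / (γ - 1) := div_pos (kappa_pos hγ) (by linarith)
  have hH0 : 0 ≤ H := by positivity
  set BZ := H + B ^ 2 with hBZ
  set Q₁ := Q + B + 2 * B * S + 2 * BZ * S with hQ₁
  set J₀ := Q * (B ^ 4 + B * B * H) + (H + B ^ 2) * Q * (B * B)
    + B * Q * (B ^ 3 + (kappa γ * B ^ γ + B ^ 3)) with hJ₀
  -- Passing from the energy relative to the given profiles to `size`, and from `size` to the
  -- interpolated energy, costs C₂(1 + C₁(1 + R)) ≤ K(1 + R).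
  set K := C₂ * (1 + C₁) with hK
  set I₀ := K * B + K * (2 + L₀ ^ 2) * Q * (3 * π) with hI₀
  -- One constant for all requirements of `Flow.energy_estimate`: the source bound, the fluxes at
  -- both ends, coercivity, the initial energy, the supremum 4 + Q of the weight (3 + Q + 1), and
  -- its integral 3π + Q + B.
  set B' := (9 + kappa γ) * (1 + Q₁) ^ 3 + 2 * J₀ + C₁ + I₀ + (4 + Q) + (3 * π + Q + B) with hB'
  have hπ := pi_pos
  have p1 : 0 ≤ (9 + kappa γ) * (1 + Q₁) ^ 3 := by positivity
  have p2 : 0 ≤ J₀ := by positivity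
  have p3 : 0 ≤ I₀ := by positivity
  have p4 : 0 ≤ 3 * π + Q + B := by positivity
  have hK1 : 1 ≤ K := by
    have := mul_nonneg (by linarith : 0 ≤ C₂) (by linarith : 0 ≤ C₁)
    linarith
  have p5 : 0 ≤ 2 * B * S := by positivity
  have p6 : 0 ≤ 2 * BZ * S := by positivity
  have b1 : (9 + kappa γ) * (1 + Q₁) ^ 3 ≤ B' := by linarith
  have b2 : 2 * J₀ ≤ B' := by linarith
  have b3 : C₁ ≤ B' := by linarith
  have b4 : I₀ ≤ B' := by linarith
  have b5 : 4 + Q ≤ B' := by linarith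
  have b6 : 3 * π + Q + B ≤ B' := by linarith
  have q1 : Q ≤ Q₁ := by linarith
  have q2 : B ≤ Q₁ := by linarith
  have q3 : 2 * B * S ≤ Q₁ := by linarith
  have q4 : 2 * BZ * S ≤ Q₁ := by linarith
  have q0 : 0 ≤ B' := by linarith
  clear_value B' Q₁
  clear hB' hQ₁
  obtain ⟨C, hC, hest⟩ := Flow.energy_estimate hγ hA₀ B' T hT
  refine ⟨B' + B' * C / A₀ + C / A₀, by positivity, ?_⟩
  intro ε δ a b F rb ub ρbar ubar hε hε1 hδ hδB ha hb hεab hrb hrbB hub cρ cu hρ0 hρB huB hleft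
    hright hbl hbr hinit
  have hab : a ≤ b := by linarith
  set Zf := refZ γ δ rb ub with hZf
  set Pf := refP γ δ rb with hPf
  have hZB : ∀ i, |Zf i| ≤ BZ := by
    intro i
    have h3 : enthalpy γ δ (rb i) ≤ H := by
      unfold enthalpy
      have : rb i ^ (γ - 1) ≤ B ^ (γ - 1) :=
        Real.rpow_le_rpow (hrb i) (hrbB i) (by linarith)
      have := hrbB i
      have := hrb i
      rw [hH]
      gcongr
    have h4 : 0 ≤ enthalpy γ δ (rb i) := by
      have := hrb i
      unfold enthalpy
      positivity
    have h5 : ub i ^ 2 ≤ B ^ 2 := sq_le_sq' (abs_le.1 (hub i)).1 (abs_le.1 (hub i)).2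
    have h6 := sq_nonneg (ub i)
    simp only [hZf, refZ]
    rw [abs_le]
    constructor <;> linarith
  have hE0 : ∀ t x, 0 ≤ F.interpEnergy rb ub t x := by
    intro t x
    obtain ⟨w, hw, -, hwf⟩ := exists_interp_eq ha hb x
    rw [F.interpEnergy_eq hγ, hwf]
    exact Finset.sum_nonneg fun i _ =>
      mul_nonneg (hw i) (relEnergy_nonneg hγ hδ.le (F.pos t x) (hrb i) _ _)
  have hsize : ∀ t x, size γ δ (F.r t x) (F.m t x) ≤ C₁ * (1 + F.interpEnergy rb ub t x) := by
    intro t x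
    obtain ⟨w, hw, hw1, hwf⟩ := exists_interp_eq ha hb x
    rw [F.interpEnergy_eq hγ, hwf]
    calc size γ δ (F.r t x) (F.m t x) = ∑ i, w i * size γ δ (F.r t x) (F.m t x) := by
          rw [← Finset.sum_mul, hw1, one_mul]
      _ ≤ ∑ i, w i * (C₁ * (1 + relEnergy γ δ (F.r t x) (F.m t x) (rb i) (ub i))) :=
          Finset.sum_le_sum fun i _ => mul_le_mul_of_nonneg_left
            (h1 _ _ _ _ _ hδ hδB (F.pos t x) (hrb i) (hrbB i) (hub i)) (hw i)
      _ = C₁ * (∑ i, w i + ∑ i, w i * relEnergy γ δ (F.r t x) (F.m t x) (rb i) (ub i)) := by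
          rw [← Finset.sum_add_distrib, Finset.mul_sum]
          exact Finset.sum_congr rfl fun i _ => by ring
      _ = _ := by rw [hw1]
  have hEsize : ∀ t x, F.interpEnergy rb ub t x ≤ C₂ * (1 + size γ δ (F.r t x) (F.m t x)) := by
    intro t x
    obtain ⟨w, hw, hw1, hwf⟩ := exists_interp_eq ha hb x
    rw [F.interpEnergy_eq hγ, hwf]
    calc ∑ i, w i * relEnergy γ δ (F.r t x) (F.m t x) (rb i) (ub i)
        ≤ ∑ i, w i * (C₂ * (1 + size γ δ (F.r t x) (F.m t x))) :=
          Finset.sum_le_sum fun i _ => mul_le_mul_of_nonneg_left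
            (h2 _ _ _ _ _ hδ hδB (F.pos t x) (hrb i) (hrbB i) (hub i)) (hw i)
      _ = _ := by rw [← Finset.sum_mul, hw1, one_mul]
  have cE : Continuous fun z : ℝ × ℝ => F.interpEnergy rb ub z.1 z.2 :=
    F.cont_energy (continuous_interp _) (continuous_interp _) (continuous_interp _)
  have cA := hA.continuous
  have cA' := hA.continuous_deriv
  have hfin := hest F (interp a b Zf) (interp' a b Zf) (interp'' a b Zf) (interp a b ub)
    (interp' a b ub) (interp'' a b ub) (interp a b Pf) (weight a b) hA hAl hε hδ hab
    (hasDerivAt_interp _) (hasDerivAt_interp' _) (hasDerivAt_interp _) (hasDerivAt_interp' _)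
    (continuous_interp'' _) (continuous_interp'' _) (continuous_interp _) continuous_weight
    weight_nonneg ?_ ?_ ?_ ?_ hE0 ?_ ?_
  · obtain ⟨f1, f2⟩ := hfin
    clear hJ₀ hI₀ hH hest
    have q1 : 0 ≤ B' * C / A₀ := by positivity
    have q2 : 0 ≤ C / A₀ := by positivity
    constructor
    · intro t ht c d hac hcd hdb
      have cEt := continuous_slice cE t
      have cSt := continuous_slice (f := fun t x => size γ δ (F.r t x) (F.m t x)) F.cont_size t
      have i1 : ∫ x in c..d, A x * F.interpEnergy rb ub t x ≤ C := by
        refine le_trans ?_ (f1 t ht)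
        refine intervalIntegral.integral_mono_interval hac hcd hdb ?_ ?_
        · exact ae_of_all _ fun x => mul_nonneg (hA.pos x).le (hE0 t x)
        · exact Continuous.intervalIntegrable (by fun_prop) _ _
      have i2 : ∫ x in c..d, size γ δ (F.r t x) (F.m t x) ≤
          ∫ x in c..d, (B' + B' / A₀ * (A x * F.interpEnergy rb ub t x)) := by
        refine intervalIntegral.integral_mono_on hcd (cSt.intervalIntegrable _ _)
          (Continuous.intervalIntegrable (by fun_prop) _ _) fun x _ => ?_
        have h3 : F.interpEnergy rb ub t x ≤ A x * F.interpEnergy rb ub t x / A₀ := by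
          rw [le_div_iff₀ hA₀, mul_comm]
          exact mul_le_mul_of_nonneg_right (hAl x) (hE0 t x)
        calc _ ≤ C₁ * (1 + F.interpEnergy rb ub t x) := hsize t x
          _ ≤ B' * (1 + A x * F.interpEnergy rb ub t x / A₀) := by
            have := hE0 t x
            gcongr
          _ = _ := by ring
      rw [intervalIntegral.integral_add (by simp)
        (Continuous.intervalIntegrable (by fun_prop) _ _), intervalIntegral.integral_const_mul,
        intervalIntegral.integral_const, smul_eq_mul] at i2
      have i3 := mul_le_mul_of_nonneg_left i1 (by positivity : 0 ≤ B' / A₀)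
      have i4 : B' / A₀ * C = B' * C / A₀ := by ring
      have i5 : 0 ≤ d - c := by linarith
      have i6 := mul_nonneg (add_nonneg q1 q2) i5
      have i7 : (B' + B' * C / A₀ + C / A₀) * (1 + (d - c)) = B' + B' * C / A₀ + C / A₀
        + (d - c) * B' + (B' * C / A₀ + C / A₀) * (d - c) := by ring
      rw [i7]
      linarith
    · have cD := F.cont_dissipation
      have i1 : ∫ t in (0:ℝ)..T, ∫ x in a..b, F.dissipation t x ≤
          ∫ t in (0:ℝ)..T, A₀⁻¹ * ∫ x in a..b, A x * F.dissipation t x := by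
        have cAD : Continuous fun z : ℝ × ℝ => A z.2 * F.dissipation z.1 z.2 := by fun_prop
        refine intervalIntegral.integral_mono_on hT
          ((continuous_integral_fst (f := fun t x => F.dissipation t x) cD a b).intervalIntegrable _ _)
          (((continuous_integral_fst (f := fun t x => A x * F.dissipation t x) cAD a b).const_mul
            _).intervalIntegrable _ _) fun t _ => ?_
        rw [← intervalIntegral.integral_const_mul]
        have cDt := continuous_slice cD t
        refine intervalIntegral.integral_mono_on hab (cDt.intervalIntegrable _ _)
          (Continuous.intervalIntegrable (by fun_prop) _ _) fun x _ => ?_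
        rw [inv_mul_eq_div, le_div_iff₀ hA₀, mul_comm]
        exact mul_le_mul_of_nonneg_right (hAl x) (F.dissipation_nonneg hγ hδ.le t x)
      rw [intervalIntegral.integral_const_mul] at i1
      have i2 := mul_le_mul_of_nonneg_left i1 hε.le
      have i3 : ε * (A₀⁻¹ * ∫ t in (0:ℝ)..T, ∫ x in a..b, A x * F.dissipation t x) =
        (ε * ∫ t in (0:ℝ)..T, ∫ x in a..b, A x * F.dissipation t x) / A₀ := by
        field_simp
      have i4 := div_le_div_of_nonneg_right f2 hA₀.le
      linarith
  · intro x
    have := weight_le (a := a) (b := b) x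
    have := hA' x
    linarith
  · have cw := continuous_weight (a := a) (b := b)
    have cabs : Continuous fun x => |deriv A x| := cA'.abs
    rw [intervalIntegral.integral_add (Continuous.intervalIntegrable (by fun_prop) _ _) (by simp),
      intervalIntegral.integral_add (Continuous.intervalIntegrable (by fun_prop) _ _)
      (Continuous.intervalIntegrable (by fun_prop) _ _), intervalIntegral.integral_const, smul_eq_mul]
    have := integral_weight_le (a := a) (b := b)
    have := hAi a b hab
    rw [mul_comm] at hεab
    linarith
  · intro t ht
    have j1 := F.abs_energyFlux_le hγ (Z := interp a b Zf) (Z' := interp' a b Zf)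
      (v := interp a b ub) (v' := interp' a b ub) hδ.le hδB (hrbB 0) (hub 0) (hA.pos a).le (hAu a)
      le_rfl (hbl t ht).1 (hbl t ht).2 (interp_left _ ha hb) (interp_left _ ha hb)
      (interp'_left _ ha hb) (interp'_left _ ha hb)
    have j2 := F.abs_energyFlux_le hγ (Z := interp a b Zf) (Z' := interp' a b Zf)
      (v := interp a b ub) (v' := interp' a b ub) hδ.le hδB (hrbB 3) (hub 3) (hA.pos b).le (hAu b)
      le_rfl (hbr t ht).1 (hbr t ht).2 (interp_right _ ha hb) (interp_right _ ha hb)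
      (interp'_right _ ha hb) (interp'_right _ ha hb)
    have := abs_sub (F.energyFlux (interp a b Zf) (interp' a b Zf) (interp a b ub)
      (interp' a b ub) t b) (F.energyFlux (interp a b Zf) (interp' a b Zf) (interp a b ub)
      (interp' a b ub) t a)
    rw [← hJ₀] at j1 j2
    clear hJ₀ hI₀ hH
    linarith
  · intro t x
    have w0 := weight_nonneg (a := a) (b := b) x
    clear hJ₀ hI₀ hH hest
    have q5 : |interp a b ub x| ≤ B := by
      obtain ⟨w, hw, hw1, hwf⟩ := exists_interp_eq ha hb x
      rw [hwf]
      refine (Finset.abs_sum_le_sum_abs _ _).trans ?_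
      calc ∑ i, |w i * ub i| ≤ ∑ i, w i * B := Finset.sum_le_sum fun i _ => by
            rw [abs_mul, abs_of_nonneg (hw i)]
            exact mul_le_mul_of_nonneg_left (hub i) (hw i)
        _ = B := by rw [← Finset.sum_mul, hw1, one_mul]
    have := F.energySource_le hγ hA (B := Q₁) hδ hε hε1 (Z' := interp' a b Zf)
      (Z'' := interp'' a b Zf) (v := interp a b ub) (v' := interp' a b ub) (v'' := interp'' a b ub)
      (x := x) (k := weight a b x) ((hAu x).trans q1) ((hA' x).trans q1)
      ((hs' x).trans q1) (q5.trans q2)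
      ((abs_interp'_le _ hZB (fun y => (hSb y).1) x).trans (by gcongr))
      ((abs_interp''_le _ hZB (fun y => (hSb y).2) x).trans (by gcongr))
      ((abs_interp'_le _ hub (fun y => (hSb y).1) x).trans (by gcongr))
      ((abs_interp''_le _ hub (fun y => (hSb y).2) x).trans (by gcongr)) w0 t
    refine this.trans ?_
    have := size_nonneg (γ := γ) hδ.le (F.pos t x) (F.m t x)
    have := abs_nonneg (deriv A x)
    gcongr
  · intro t x
    refine (hsize t x).trans (mul_le_mul_of_nonneg_right b3 ?_)
    have := hE0 t x
    linarith
  · clear hJ₀ hH hest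
    have cR : Continuous fun x => relEnergy γ δ (F.r 0 x) (F.m 0 x) (ρbar x) (ubar x) := by
      have c1 := continuous_slice F.cont_r 0
      have c2 := continuous_slice F.cont_m 0
      have c3 : Continuous fun x => F.m 0 x ^ 2 / (2 * F.r 0 x) :=
        (c2.pow 2).div (c1.const_mul 2) fun x => by have := F.pos 0 x; positivity
      have c4 : Continuous (internalEnergy γ δ) := continuous_iff_continuousAt.2 fun x =>
        (hasDerivAt_internalEnergy hγ δ x).continuousAt
      have c5 : Continuous (enthalpy γ δ) :=
        (((Real.continuous_rpow_const (by linarith : (0:ℝ) ≤ γ - 1)).const_mul _).const_mul _).add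
          (continuous_id.const_mul _)
      simp only [relEnergy_eq hγ δ (F.pos 0 _)]
      fun_prop
    have cE' := continuous_slice cE 0
    have cw := continuous_weight (a := a) (b := b)
    -- Away from the end layers and from [-L₀, L₀] the interpolated reference and the given profiles
    -- are the same constant state, and the energies agree. On the remaining set, of bounded length,
    -- they are comparable up to a constant, and there `weight` is at least 1/(2 + L₀²), so the
    -- constant is absorbed into an integrable term.
    have hpt : ∀ x ∈ Icc a b, A x * F.interpEnergy rb ub 0 x ≤
        K * (relEnergy γ δ (F.r 0 x) (F.m 0 x) (ρbar x) (ubar x) * A x)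
          + K * (2 + L₀ ^ 2) * Q * weight a b x := by
      intro x hx
      set R := relEnergy γ δ (F.r 0 x) (F.m 0 x) (ρbar x) (ubar x) with hR
      have hR0 : 0 ≤ R := relEnergy_nonneg hγ hδ.le (F.pos 0 x) (hρ0 x) _ _
      have w0 := weight_nonneg (a := a) (b := b) x
      have hpt2 : F.interpEnergy rb ub 0 x ≤ K * R + K * (2 + L₀ ^ 2) * weight a b x := by
        have hmid : F.interpEnergy rb ub 0 x ≤ R → F.interpEnergy rb ub 0 x ≤
            K * R + K * (2 + L₀ ^ 2) * weight a b x := by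
          intro h
          have h3 : 0 ≤ K * (2 + L₀ ^ 2) * weight a b x := by positivity
          have h4 := mul_le_mul_of_nonneg_right hK1 hR0
          linarith
        have htr : 1 ≤ (2 + L₀ ^ 2) * weight a b x → F.interpEnergy rb ub 0 x ≤
            K * R + K * (2 + L₀ ^ 2) * weight a b x := by
          intro h
          have e1 := hEsize 0 x
          have e2 := h1 _ _ (F.m 0 x) _ _ hδ hδB (F.pos 0 x) (hρ0 x) (hρB x) (huB x)
          rw [← hR] at e2
          calc _ ≤ C₂ * (1 + C₁ * (1 + R)) := e1.trans (by gcongr)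
            _ ≤ C₂ * ((1 + C₁) * (1 + R)) := by
              refine mul_le_mul_of_nonneg_left ?_ (by linarith)
              linarith
            _ = K * R + K * 1 := by rw [hK]; ring
            _ ≤ K * R + K * ((2 + L₀ ^ 2) * weight a b x) := by gcongr
            _ = _ := by ring
        have i0 : ∀ y : ℝ, 0 ≤ (1 + y ^ 2)⁻¹ := fun y => by positivity
        have tr : ∀ y : ℝ, 1 + y ^ 2 ≤ 2 + L₀ ^ 2 → (1 + y ^ 2)⁻¹ ≤ weight a b x →
            1 ≤ (2 + L₀ ^ 2) * weight a b x := by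
          intro y hy hw
          have : 1 = (1 + y ^ 2) * (1 + y ^ 2)⁻¹ := by
            rw [mul_inv_cancel₀]; positivity
          calc (1 : ℝ) = (1 + y ^ 2) * (1 + y ^ 2)⁻¹ := this
            _ ≤ _ := by have := i0 y; gcongr
        by_cases c1 : x ≤ a + 1
        · refine htr (tr (x - a) ?_ ?_)
          · have := pow_le_one₀ (n := 2) (by linarith [hx.1] : 0 ≤ x - a) (by linarith)
            have := sq_nonneg L₀
            linarith
          · unfold weight; linarith [i0 x, i0 (x - b + 1)]
        by_cases c2 : b - 1 ≤ x
        · refine htr (tr (x - b + 1) ?_ ?_)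
          · have := pow_le_one₀ (n := 2) (by linarith : 0 ≤ x - b + 1) (by linarith [hx.2])
            have := sq_nonneg L₀
            linarith
          · unfold weight; linarith [i0 x, i0 (x - a)]
        push Not at c1 c2
        by_cases c3 : x ≤ -L₀
        · refine hmid (le_of_eq ?_)
          rw [F.interpEnergy_eq hγ, interp_middle_left _ c1.le (by linarith) c2.le, hR,
            (hleft x c3).1, (hleft x c3).2]
        by_cases c4 : L₀ ≤ x
        · refine hmid (le_of_eq ?_)
          rw [F.interpEnergy_eq hγ, interp_middle_right _ c1.le (by linarith) c2.le, hR,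
            (hright x c4).1, (hright x c4).2]
        push Not at c3 c4
        refine htr (tr x ?_ ?_)
        · have : x ^ 2 ≤ L₀ ^ 2 := sq_le_sq' c3.le c4.le
          linarith
        · unfold weight; linarith [i0 (x - b + 1), i0 (x - a)]
      have hA0 := (hA.pos x).le
      calc _ ≤ A x * (K * R + K * (2 + L₀ ^ 2) * weight a b x) := by gcongr
        _ = K * (R * A x) + K * (2 + L₀ ^ 2) * A x * weight a b x := by ring
        _ ≤ _ := by
          have := hAu x
          gcongr
    have hmono : ∫ x in a..b, A x * F.interpEnergy rb ub 0 x ≤ ∫ x in a..b,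
        (K * (relEnergy γ δ (F.r 0 x) (F.m 0 x) (ρbar x) (ubar x) * A x)
          + K * (2 + L₀ ^ 2) * Q * weight a b x) := intervalIntegral.integral_mono_on hab
      (Continuous.intervalIntegrable (by fun_prop) _ _)
      (Continuous.intervalIntegrable (by fun_prop) _ _) hpt
    rw [intervalIntegral.integral_add (Continuous.intervalIntegrable (by fun_prop) _ _)
      (Continuous.intervalIntegrable (by fun_prop) _ _), intervalIntegral.integral_const_mul,
      intervalIntegral.integral_const_mul] at hmono
    have m1 := mul_le_mul_of_nonneg_left hinit (by linarith : 0 ≤ K)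
    have m2 := mul_le_mul_of_nonneg_left (integral_weight_le (a := a) (b := b))
      (by positivity : 0 ≤ K * (2 + L₀ ^ 2) * Q)
    refine hmono.trans ((add_le_add m1 m2).trans ?_)
    rw [← hI₀]
    exact b4

end Flow

/-! ### Local estimates -/

/-- A smooth cutoff function which equals `1` on `[-(R - 1), R - 1]` and vanishes outside
`[-R, R]`, with bounds on its derivatives. -/
structure IsCutoff (R Q : ℝ) (w w' w'' : ℝ → ℝ) : Prop where
  hw : ∀ x, HasDerivAt w (w' x) x
  hw' : ∀ x, HasDerivAt w' (w'' x) x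
  cont : Continuous w''
  nonneg : ∀ x, 0 ≤ w x
  le_one : ∀ x, w x ≤ 1
  bound' : ∀ x, |w' x| ≤ Q
  bound'' : ∀ x, |w'' x| ≤ Q
  eq_one : ∀ x ∈ Icc (-(R - 1)) (R - 1), w x = 1
  left : w (-R) = 0
  right : w R = 0
  left' : w' (-R) = 0
  right' : w' R = 0

/-- A product of two transitions of unit length, one at each end; hence the derivative bounds do not
depend on R. -/
theorem exists_cutoff : ∃ Q, 0 ≤ Q ∧ ∀ R, 1 ≤ R → ∃ w w' w'', IsCutoff R Q w w' w'' := by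
  obtain ⟨S, hS, hb⟩ := exists_bound_smoothTransition
  have hi : ∀ y : ℝ, S * (1 + y ^ 2)⁻¹ ≤ S := fun y =>
    mul_le_of_le_one_right hS (inv_le_one_of_one_le₀ (by nlinarith [sq_nonneg y]))
  have h1 : ∀ y, |deriv smoothTransition y| ≤ S := fun y => (hb y).1.trans (hi y)
  have h2 : ∀ y, |deriv (deriv smoothTransition) y| ≤ S := fun y => (hb y).2.trans (hi y)
  have h0 : ∀ y, |smoothTransition y| ≤ 1 := fun y => by
    rw [abs_of_nonneg (smoothTransition.nonneg y)]; exact smoothTransition.le_one y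
  refine ⟨2 * S + 2 * S ^ 2, by positivity, fun R hR => ?_⟩
  set s := smoothTransition with hs
  have d1 : ∀ x, HasDerivAt (fun x => s (x + R)) (deriv s (x + R)) x := fun x => by
    simpa using (hasDerivAt_smoothTransition (x + R)).comp_add_const x R
  have d1' : ∀ x, HasDerivAt (fun x => deriv s (x + R)) (deriv (deriv s) (x + R)) x := fun x => by
    simpa using (hasDerivAt_deriv_smoothTransition (x + R)).comp_add_const x R
  have d2 : ∀ x, HasDerivAt (fun x => s (R - x)) (-deriv s (R - x)) x := fun x =>
    (hasDerivAt_smoothTransition (R - x)).comp_const_sub R x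
  have d2' : ∀ x, HasDerivAt (fun x => deriv s (R - x)) (-deriv (deriv s) (R - x)) x := fun x =>
    (hasDerivAt_deriv_smoothTransition (R - x)).comp_const_sub R x
  have c0 : Continuous s := smoothTransition.continuous
  have c1 : Continuous (deriv s) := continuous_deriv_smoothTransition
  have c2 : Continuous (deriv (deriv s)) := continuous_deriv2_smoothTransition
  refine ⟨fun x => s (x + R) * s (R - x),
    fun x => deriv s (x + R) * s (R - x) + s (x + R) * -deriv s (R - x),
    fun x => deriv (deriv s) (x + R) * s (R - x) + deriv s (x + R) * -deriv s (R - x)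
      + (deriv s (x + R) * -deriv s (R - x) + s (x + R) * - -deriv (deriv s) (R - x)), ?_⟩
  constructor
  · exact fun x => (d1 x).mul (d2 x)
  · exact fun x => ((d1' x).mul (d2 x)).add ((d1 x).mul (d2' x).neg)
  · fun_prop
  · exact fun x => mul_nonneg (smoothTransition.nonneg _) (smoothTransition.nonneg _)
  · exact fun x => mul_le_one₀ (smoothTransition.le_one _) (smoothTransition.nonneg _)
      (smoothTransition.le_one _)
  · intro x
    calc _ ≤ S * 1 + 1 * S := by
          refine (abs_add_le _ _).trans (add_le_add ?_ ?_)
          · rw [abs_mul]; exact mul_le_mul (h1 _) (h0 _) (abs_nonneg _) hS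
          · rw [abs_mul, abs_neg]; exact mul_le_mul (h0 _) (h1 _) (abs_nonneg _) zero_le_one
      _ ≤ _ := by nlinarith [sq_nonneg S]
  · intro x
    calc _ ≤ (S * 1 + S * S) + (S * S + 1 * S) := by
          refine (abs_add_le _ _).trans (add_le_add ((abs_add_le _ _).trans (add_le_add ?_ ?_))
            ((abs_add_le _ _).trans (add_le_add ?_ ?_)))
          · rw [abs_mul]; exact mul_le_mul (h2 _) (h0 _) (abs_nonneg _) hS
          · rw [abs_mul, abs_neg]; exact mul_le_mul (h1 _) (h1 _) (abs_nonneg _) hS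
          · rw [abs_mul, abs_neg]; exact mul_le_mul (h1 _) (h1 _) (abs_nonneg _) hS
          · rw [abs_mul, neg_neg]; exact mul_le_mul (h0 _) (h2 _) (abs_nonneg _) zero_le_one
      _ = _ := by ring
  · intro x hx
    simp only [hs]
    rw [smoothTransition.one_of_one_le (by linarith [hx.1]),
      smoothTransition.one_of_one_le (by linarith [hx.2]), one_mul]
  · simp [hs]
  · simp [hs]
  · simp only [neg_add_cancel, sub_neg_eq_add]
    rw [deriv_smoothTransition_eq_zero (Or.inl le_rfl),
      deriv_smoothTransition_eq_zero (Or.inr (by linarith : 1 ≤ R + R))]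
    ring
  · simp only [sub_self]
    rw [deriv_smoothTransition_eq_zero (Or.inl le_rfl),
      deriv_smoothTransition_eq_zero (Or.inr (by linarith : 1 ≤ R + R))]
    ring

namespace IsCutoff
variable {R Q : ℝ} {w w' w'' : ℝ → ℝ}

theorem continuous' (h : IsCutoff R Q w w' w'') : Continuous w' :=
  continuous_iff_continuousAt.2 fun x => (h.hw' x).continuousAt

theorem continuous (h : IsCutoff R Q w w' w'') : Continuous w :=
  continuous_iff_continuousAt.2 fun x => (h.hw x).continuousAt

theorem abs_le_one (h : IsCutoff R Q w w' w'') (x : ℝ) : |w x| ≤ 1 := by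
  rw [abs_of_nonneg (h.nonneg x)]; exact h.le_one x

end IsCutoff

/-- Monotonicity of iterated integrals of continuous functions. -/
theorem integral_integral_mono {f g : ℝ → ℝ → ℝ} (hf : Continuous fun z : ℝ × ℝ => f z.1 z.2)
    (hg : Continuous fun z : ℝ × ℝ => g z.1 z.2) {T c d : ℝ} (hT : 0 ≤ T) (hcd : c ≤ d)
    (h : ∀ t ∈ Ioo 0 T, ∀ x ∈ Icc c d, f t x ≤ g t x) :
    ∫ t in (0 : ℝ)..T, ∫ x in c..d, f t x ≤ ∫ t in (0 : ℝ)..T, ∫ x in c..d, g t x := by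
  refine intervalIntegral.integral_mono_on_of_le_Ioo hT
    ((continuous_integral_fst hf c d).intervalIntegrable _ _)
    ((continuous_integral_fst hg c d).intervalIntegrable _ _) fun t ht => ?_
  exact intervalIntegral.integral_mono_on hcd ((Flow.continuous_slice hf t).intervalIntegrable _ _)
    ((Flow.continuous_slice hg t).intervalIntegrable _ _) fun x hx => h t ht x hx

/-! ### Density bounds by the dissipation -/

namespace Flow
variable {γ : ℝ} {A : ℝ → ℝ} {ε δ a b : ℝ}

/-- The bounds on `[0, T] × [-R, R]` provided by the energy estimate. -/
structure EnergyBounded (F : Flow γ A ε δ a b) (T R C : ℝ) : Prop where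
  left : a ≤ -R
  right : R ≤ b
  size : ∀ t ∈ Icc 0 T, ∫ x in -R..R, size γ δ (F.r t x) (F.m t x) ≤ C
  diss : ε * ∫ t in (0 : ℝ)..T, ∫ x in -R..R, F.dissipation t x ≤ C

theorem mul_sq_le_dissipation (F : Flow γ A ε δ a b) (hδ : 0 ≤ δ) (t x : ℝ) :
    kappa γ * γ * (F.r t x ^ (γ - 2) * F.rx t x ^ 2) ≤ F.dissipation t x := by
  have := F.pos t x
  unfold dissipation enthalpy'
  have h1 : 0 ≤ 2 * δ * F.rx t x ^ 2 := by positivity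
  have h2 : 0 ≤ F.r t x * F.ux t x ^ 2 := by positivity
  linarith

theorem rpow_le_size (F : Flow γ A ε δ a b) (hδ : 0 ≤ δ) (t x : ℝ) :
    F.r t x ^ γ ≤ Nozzle.size γ δ (F.r t x) (F.m t x) := by
  have := F.pos t x
  unfold Nozzle.size
  have h1 : 0 ≤ F.m t x ^ 2 / F.r t x := by positivity
  have h2 : 0 ≤ δ * F.r t x ^ 2 := by positivity
  linarith

theorem r_le_size (F : Flow γ A ε δ a b) (hδ : 0 ≤ δ) (t x : ℝ) :
    F.r t x ≤ Nozzle.size γ δ (F.r t x) (F.m t x) := by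
  have := F.pos t x
  unfold Nozzle.size
  have h1 : 0 ≤ F.m t x ^ 2 / F.r t x := by positivity
  have h2 : 0 ≤ δ * F.r t x ^ 2 := by positivity
  have h3 : 0 ≤ F.r t x ^ γ := by positivity
  linarith

theorem abs_m_le_size (F : Flow γ A ε δ a b) (hδ : 0 ≤ δ) (t x : ℝ) :
    |F.m t x| ≤ Nozzle.size γ δ (F.r t x) (F.m t x) := by
  have := F.pos t x
  refine (F.abs_m_le t x).trans ?_
  unfold Nozzle.size
  have h1 : 0 ≤ F.m t x ^ 2 / F.r t x := by positivity
  have h2 : 0 ≤ δ * F.r t x ^ 2 := by positivity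
  have h3 : 0 ≤ F.r t x ^ γ := by positivity
  linarith

theorem kinetic_le_size (F : Flow γ A ε δ a b) (hδ : 0 ≤ δ) (t x : ℝ) :
    F.m t x ^ 2 / F.r t x ≤ Nozzle.size γ δ (F.r t x) (F.m t x) := by
  have := F.pos t x
  unfold Nozzle.size
  have h2 : 0 ≤ δ * F.r t x ^ 2 := by positivity
  have h3 : 0 ≤ F.r t x ^ γ := by positivity
  linarith

theorem pressure_le_size (F : Flow γ A ε δ a b) (hγ : 1 < γ) (hδ : 0 ≤ δ) (t x : ℝ) :
    pressure γ δ (F.r t x) ≤ (kappa γ + 1) * Nozzle.size γ δ (F.r t x) (F.m t x) := by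
  have hp := F.pos t x
  have h1 : 0 ≤ F.m t x ^ 2 / F.r t x := by positivity
  have h3 : 0 ≤ F.r t x ^ γ := by positivity
  have h4 := mul_le_mul_of_nonneg_left (F.rpow_le_size hδ t x) (kappa_pos hγ).le
  have h5 : δ * F.r t x ^ 2 ≤ Nozzle.size γ δ (F.r t x) (F.m t x) := by
    unfold Nozzle.size; linarith
  unfold pressure
  linarith

/-- The pointwise bound for the density by the dissipation. -/
theorem rpow_le_of_dissipation (hγ : 1 < γ) (F : Flow γ A ε δ a b) (hδ : 0 ≤ δ) {T R C : ℝ}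
    (hR : 1 ≤ R) (h : F.EnergyBounded T R C) {t : ℝ} (ht : t ∈ Ioc 0 T) {x : ℝ}
    (hx : x ∈ Icc (-R) R) :
    F.r t x ^ γ ≤ (C + γ / 2 * (C + (kappa γ * γ)⁻¹)) *
      √(1 + ∫ y in -R..R, F.dissipation t y) := by
  have hκ := kappa_pos hγ
  have hRR : -R ≤ R := by linarith
  set d := ∫ y in -R..R, F.dissipation t y with hd
  have hd0 : 0 ≤ d := intervalIntegral.integral_nonneg hRR fun y _ =>
    F.dissipation_nonneg hγ hδ t y
  -- Weight for Young's inequality: l ∫ r^γ and l⁻¹ d are both of order l, so the total variation of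
  -- r^γ is O(√(1 + d)).
  set l := √(1 + d) with hl
  have hl1 : 1 ≤ l := Real.one_le_sqrt.2 (by linarith)
  have hl2 : l ^ 2 = 1 + d := Real.sq_sqrt (by linarith)
  have cP : Continuous fun y => F.r t y ^ γ := continuous_slice (f := fun t y => F.r t y ^ γ) (F.cont_rpow γ) t
  have crx : Continuous (F.rx t) := continuous_slice F.cont_rx t
  have cP1 : Continuous fun y => F.r t y ^ (γ - 1) := continuous_slice (f := fun t y => F.r t y ^ (γ - 1)) (F.cont_rpow (γ - 1)) t
  have cP2 : Continuous fun y => F.r t y ^ (γ - 2) := continuous_slice (f := fun t y => F.r t y ^ (γ - 2)) (F.cont_rpow (γ - 2)) t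
  have cD : Continuous (F.dissipation t) := continuous_slice F.cont_dissipation t
  have cS : Continuous fun y => Nozzle.size γ δ (F.r t y) (F.m t y) :=
    continuous_slice (f := fun t y => Nozzle.size γ δ (F.r t y) (F.m t y)) F.cont_size t
  have hPC : ∫ y in -R..R, F.r t y ^ γ ≤ C :=
    (intervalIntegral.integral_mono_on hRR (cP.intervalIntegrable _ _) (cS.intervalIntegrable _ _)
      fun y _ => F.rpow_le_size hδ t y).trans (h.size t ⟨ht.1.le, ht.2⟩)
  have hP0 : 0 ≤ ∫ y in -R..R, F.r t y ^ γ := intervalIntegral.integral_nonneg hRR fun y _ => by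
    have := F.pos t y
    positivity
  set X := ∫ y in -R..R, |F.rx t y * (γ * F.r t y ^ (γ - 1))| with hX
  have hXle : X ≤ γ / 2 * (C + (kappa γ * γ)⁻¹) * l := by
    have hpt : ∀ y ∈ Icc (-R) R, |F.rx t y * (γ * F.r t y ^ (γ - 1))| ≤
        γ / 2 * (l * F.r t y ^ γ + l⁻¹ * ((kappa γ * γ)⁻¹ * F.dissipation t y)) := by
      intro y _
      have hp := F.pos t y
      have e1 : F.r t y ^ (γ - 1) = F.r t y ^ (γ - 2) * F.r t y := by
        rw [← Real.rpow_add_one hp.ne']; congr 1; ring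
      have e2 : F.r t y ^ γ = F.r t y ^ (γ - 2) * F.r t y ^ 2 := by
        rw [← Real.rpow_natCast, ← Real.rpow_add hp]; congr 1; norm_num
      have e3 : F.r t y ^ (γ - 2) * F.rx t y ^ 2 ≤ (kappa γ * γ)⁻¹ * F.dissipation t y := by
        rw [inv_mul_eq_div, le_div_iff₀ (by positivity), mul_comm]
        exact F.mul_sq_le_dissipation hδ t y
      have e4 : 0 < F.r t y ^ (γ - 2) := by positivity
      have e5 : 2 * (F.r t y * |F.rx t y|) ≤ l * F.r t y ^ 2 + l⁻¹ * F.rx t y ^ 2 := by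
        have : l * F.r t y ^ 2 + l⁻¹ * F.rx t y ^ 2 - 2 * (F.r t y * |F.rx t y|) =
            l⁻¹ * (l * F.r t y - |F.rx t y|) ^ 2 := by
          rw [sub_sq, sq_abs]
          field_simp
          ring
        have h6 : 0 ≤ l⁻¹ * (l * F.r t y - |F.rx t y|) ^ 2 := by positivity
        linarith
      rw [abs_mul, abs_of_pos (by positivity : 0 < γ * F.r t y ^ (γ - 1)), e1, e2]
      calc |F.rx t y| * (γ * (F.r t y ^ (γ - 2) * F.r t y)) =
            γ / 2 * F.r t y ^ (γ - 2) * (2 * (F.r t y * |F.rx t y|)) := by ring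
        _ ≤ γ / 2 * F.r t y ^ (γ - 2) * (l * F.r t y ^ 2 + l⁻¹ * F.rx t y ^ 2) := by gcongr
        _ = γ / 2 * (l * (F.r t y ^ (γ - 2) * F.r t y ^ 2)
              + l⁻¹ * (F.r t y ^ (γ - 2) * F.rx t y ^ 2)) := by ring
        _ ≤ _ := by gcongr
    have hmono : X ≤ ∫ y in -R..R,
        γ / 2 * (l * F.r t y ^ γ + l⁻¹ * ((kappa γ * γ)⁻¹ * F.dissipation t y)) :=
      intervalIntegral.integral_mono_on hRR (Continuous.intervalIntegrable (by fun_prop) _ _)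
        (Continuous.intervalIntegrable (by fun_prop) _ _) hpt
    rw [intervalIntegral.integral_const_mul, intervalIntegral.integral_add
      (Continuous.intervalIntegrable (by fun_prop) _ _)
      (Continuous.intervalIntegrable (by fun_prop) _ _), intervalIntegral.integral_const_mul,
      intervalIntegral.integral_const_mul, intervalIntegral.integral_const_mul, ← hd] at hmono
    refine hmono.trans ?_
    have hdl : l⁻¹ * d ≤ l := by
      rw [inv_mul_le_iff₀ (by linarith)]
      nlinarith
    calc γ / 2 * (l * (∫ y in -R..R, F.r t y ^ γ) + l⁻¹ * ((kappa γ * γ)⁻¹ * d))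
        = γ / 2 * (l * (∫ y in -R..R, F.r t y ^ γ) + (kappa γ * γ)⁻¹ * (l⁻¹ * d)) := by ring
      _ ≤ γ / 2 * (l * C + (kappa γ * γ)⁻¹ * l) := by gcongr
      _ = _ := by ring
  -- The value at x differs from that at any y by at most the total variation X; averaging over y
  -- brings in the energy bound for ∫ r^γ.
  have hdiff : ∀ y ∈ Icc (-R) R, F.r t x ^ γ ≤ F.r t y ^ γ + X := by
    intro y hy
    have hder : ∀ z ∈ Ioo a b, HasDerivAt (fun z => F.r t z ^ γ)
        (F.rx t z * (γ * F.r t z ^ (γ - 1))) z := fun z hz => by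
      have := (F.hrx t ht.1 z hz).rpow_const (p := γ) (Or.inl (F.r_ne_zero t z))
      exact this.congr_deriv (by ring)
    have cder : Continuous fun z => F.rx t z * (γ * F.r t z ^ (γ - 1)) := by fun_prop
    have hsub : ∀ c d, -R ≤ c → c ≤ d → d ≤ R →
        |∫ z in c..d, F.rx t z * (γ * F.r t z ^ (γ - 1))| ≤ X := by
      intro c d h1 h2 h3
      refine (intervalIntegral.abs_integral_le_integral_abs h2).trans ?_
      exact intervalIntegral.integral_mono_interval h1 h2 h3 (ae_of_all _ fun z => abs_nonneg _)
        (cder.abs.intervalIntegrable _ _)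
    obtain hxy | hxy := le_total x y
    · have e := integral_eq_sub_of_interior cP cder hder (h.left.trans hx.1) hxy (hy.2.trans h.right)
      have := hsub x y hx.1 hxy hy.2
      rw [e] at this
      linarith [(abs_le.1 this).1]
    · have e := integral_eq_sub_of_interior cP cder hder (h.left.trans hy.1) hxy (hx.2.trans h.right)
      have := hsub y x hy.1 hxy hx.2
      rw [e] at this
      linarith [(abs_le.1 this).2]
  have hint := intervalIntegral.integral_mono_on hRR (μ := volume)
    (f := fun _ => F.r t x ^ γ) (by simp)
    (Continuous.intervalIntegrable (by fun_prop : Continuous fun y => F.r t y ^ γ + X) _ _) hdiff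
  rw [intervalIntegral.integral_add (cP.intervalIntegrable _ _) (by simp),
    intervalIntegral.integral_const, intervalIntegral.integral_const, smul_eq_mul, smul_eq_mul]
    at hint
  have hrx : 0 < F.r t x ^ γ := by have := F.pos t x; positivity
  have hC : 0 ≤ C := hP0.trans hPC
  -- Otherwise r^γ would exceed C on an interval of length 2R ≥ 1, against the bound on its
  -- integral.
  have hfin : F.r t x ^ γ ≤ C + X := by
    by_contra hcon
    push Not at hcon
    nlinarith
  calc _ ≤ C + X := hfin
    _ ≤ C * l + γ / 2 * (C + (kappa γ * γ)⁻¹) * l := by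
      have := le_mul_of_one_le_right hC hl1
      linarith
    _ = _ := by ring

/-- In (r^γ)³ two factors are estimated pointwise by O(1 + d), with d the space integral of the
dissipation at time t, and the third by the energy. Integration in time costs one dissipation
integral, whence the factor ε; and r³ ≤ 1 + (r^γ)³ since γ > 1. The bound serves to control ε r²
u_x. -/
theorem integral_cube_le (hγ : 1 < γ) (C T R : ℝ) (hT : 0 ≤ T) (hR : 1 ≤ R) :
    ∃ C', 0 ≤ C' ∧ ∀ {A : ℝ → ℝ} {ε δ a b : ℝ} (F : Flow γ A ε δ a b), 0 < ε → ε ≤ 1 → 0 ≤ δ →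
      F.EnergyBounded T R C → ε * ∫ t in (0 : ℝ)..T, ∫ x in -R..R, F.r t x ^ 3 ≤ C' := by
  set c := C + γ / 2 * (C + (kappa γ * γ)⁻¹) with hc
  refine ⟨|T * (2 * R)| + c ^ 2 * |C| * (T + |C|), by positivity, ?_⟩
  intro A ε δ a b F hε hε1 hδ h
  have hRR : -R ≤ R := by linarith
  have c3 : Continuous fun z : ℝ × ℝ => F.r z.1 z.2 ^ 3 := F.cont_r.pow 3
  have cD := continuous_integral_fst (f := fun t x => F.dissipation t x) F.cont_dissipation (-R) R
  have hpt : ∀ t ∈ Ioo 0 T, ∫ x in -R..R, F.r t x ^ 3 ≤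
      2 * R + c ^ 2 * |C| * (1 + ∫ y in -R..R, F.dissipation t y) := by
    intro t ht
    have hd0 : 0 ≤ ∫ y in -R..R, F.dissipation t y :=
      intervalIntegral.integral_nonneg hRR fun y _ => F.dissipation_nonneg hγ hδ t y
    set d := ∫ y in -R..R, F.dissipation t y with hd
    have cP : Continuous fun y => F.r t y ^ γ := continuous_slice (f := fun t y => F.r t y ^ γ) (F.cont_rpow γ) t
    have cS : Continuous fun y => Nozzle.size γ δ (F.r t y) (F.m t y) :=
      continuous_slice (f := fun t y => Nozzle.size γ δ (F.r t y) (F.m t y)) F.cont_size t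
    have hPC : ∫ y in -R..R, F.r t y ^ γ ≤ |C| :=
      (intervalIntegral.integral_mono_on hRR (cP.intervalIntegrable _ _) (cS.intervalIntegrable _ _)
        fun y _ => F.rpow_le_size hδ t y).trans ((h.size t ⟨ht.1.le, ht.2.le⟩).trans (le_abs_self C))
    have hpt2 : ∀ x ∈ Icc (-R) R, F.r t x ^ 3 ≤ 1 + c ^ 2 * (1 + d) * F.r t x ^ γ := by
      intro x hx
      have hp := F.pos t x
      have h1 := F.rpow_le_of_dissipation hγ hδ hR h ⟨ht.1, ht.2.le⟩ hx
      rw [← hc, ← hd] at h1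
      have hrg : 0 < F.r t x ^ γ := by positivity
      have h2 : (F.r t x ^ γ) ^ 2 ≤ c ^ 2 * (1 + d) := by
        calc (F.r t x ^ γ) ^ 2 ≤ (c * √(1 + d)) ^ 2 := by gcongr
          _ = _ := by rw [mul_pow, Real.sq_sqrt (by linarith)]
      have h3 : (F.r t x ^ γ) ^ 3 ≤ c ^ 2 * (1 + d) * F.r t x ^ γ := by
        calc (F.r t x ^ γ) ^ 3 = (F.r t x ^ γ) ^ 2 * F.r t x ^ γ := by ring
          _ ≤ _ := by gcongr
      obtain h4 | h4 := le_total (F.r t x) 1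
      · have : F.r t x ^ 3 ≤ 1 := pow_le_one₀ hp.le h4
        have : 0 ≤ (F.r t x ^ γ) ^ 3 := by positivity
        linarith
      · have h5 : F.r t x ≤ F.r t x ^ γ := by
          simpa using Real.rpow_le_rpow_of_exponent_le h4 hγ.le
        have : F.r t x ^ 3 ≤ (F.r t x ^ γ) ^ 3 := by gcongr
        linarith
    have hmono := intervalIntegral.integral_mono_on hRR (μ := volume)
      ((continuous_slice (f := fun t x => F.r t x ^ 3) c3 t).intervalIntegrable _ _)
      (Continuous.intervalIntegrable
        (by fun_prop : Continuous fun x => 1 + c ^ 2 * (1 + d) * F.r t x ^ γ) _ _) hpt2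
    rw [intervalIntegral.integral_add (by simp)
      (Continuous.intervalIntegrable (by fun_prop) _ _), intervalIntegral.integral_const_mul,
      intervalIntegral.integral_const, smul_eq_mul] at hmono
    have : c ^ 2 * (1 + d) * (∫ y in -R..R, F.r t y ^ γ) ≤ c ^ 2 * (1 + d) * |C| := by gcongr
    linarith
  have hmono := intervalIntegral.integral_mono_on_of_le_Ioo (μ := volume) hT
    ((continuous_integral_fst (f := fun t x => F.r t x ^ 3) c3 (-R) R).intervalIntegrable _ _)
    (Continuous.intervalIntegrable (by fun_prop) _ _) hpt
  rw [intervalIntegral.integral_add (by simp) (Continuous.intervalIntegrable (by fun_prop) _ _),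
    intervalIntegral.integral_const, intervalIntegral.integral_const_mul,
    intervalIntegral.integral_add (by simp) (Continuous.intervalIntegrable (by fun_prop) _ _),
    intervalIntegral.integral_const, smul_eq_mul, smul_eq_mul, sub_zero, mul_one] at hmono
  have h1 := mul_le_mul_of_nonneg_left hmono hε.le
  have h2 := h.diss.trans (le_abs_self C)
  have h3 : ε * (T * (2 * R)) ≤ |T * (2 * R)| := by
    have : 0 ≤ T * (2 * R) := by positivity
    rw [abs_of_nonneg this]
    exact mul_le_of_le_one_left this hε1
  have h4 : ε * T ≤ T := mul_le_of_le_one_left hT hε1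
  have h5 : 0 ≤ c ^ 2 * |C| := by positivity
  have h6 := mul_le_mul_of_nonneg_left (add_le_add h4 h2) h5
  calc _ ≤ _ := h1
    _ = ε * (T * (2 * R)) + c ^ 2 * |C| * (ε * T + ε * ∫ t in (0 : ℝ)..T, ∫ x in -R..R,
        F.dissipation t x) := by ring
    _ ≤ _ := add_le_add h3 h6

end Flow

/-! ### The local bound for the density in L^(γ+1) -/

namespace Flow
variable {γ : ℝ} {A : ℝ → ℝ} {ε δ a b : ℝ} (F : Flow γ A ε δ a b)

/-- The size of the state at a point. -/
def sz (t x : ℝ) : ℝ := Nozzle.size γ δ (F.r t x) (F.m t x)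

theorem cont_sz : Continuous fun z : ℝ × ℝ => F.sz z.1 z.2 := F.cont_size

/-- The primitive `∫_c^x w f(t, y) dy`. -/
def primitive (w : ℝ → ℝ) (f : ℝ → ℝ → ℝ) (c t x : ℝ) : ℝ := ∫ y in c..x, w y * f t y

theorem continuous_primitive {w : ℝ → ℝ} {f : ℝ → ℝ → ℝ} (hw : Continuous w)
    (hf : Continuous fun z : ℝ × ℝ => f z.1 z.2) (c : ℝ) :
    Continuous fun z : ℝ × ℝ => primitive w f c z.1 z.2 := by
  unfold primitive
  refine intervalIntegral.continuous_parametric_intervalIntegral_of_continuous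
    (f := fun (z : ℝ × ℝ) y => w y * f z.1 y) ?_ continuous_snd
  have : Continuous fun p : (ℝ × ℝ) × ℝ => f p.1.1 p.2 :=
    hf.comp (by fun_prop : Continuous fun p : (ℝ × ℝ) × ℝ => (p.1.1, p.2))
  exact (hw.comp continuous_snd).mul this

theorem hasDerivAt_primitive_snd {w : ℝ → ℝ} {f : ℝ → ℝ → ℝ} (hw : Continuous w)
    (hf : Continuous fun z : ℝ × ℝ => f z.1 z.2) (c t x : ℝ) :
    HasDerivAt (primitive w f c t) (w x * f t x) x := by
  have h : Continuous fun y => w y * f t y := hw.mul (continuous_slice hf t)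
  exact intervalIntegral.integral_hasDerivAt_right (h.intervalIntegrable _ _)
    h.stronglyMeasurable.stronglyMeasurableAtFilter h.continuousAt

theorem abs_primitive_le {w : ℝ → ℝ} {f g : ℝ → ℝ → ℝ} {R K : ℝ} {t x : ℝ} (hw : Continuous w)
    (hf : Continuous fun z : ℝ × ℝ => f z.1 z.2) (hg : Continuous fun z : ℝ × ℝ => g z.1 z.2)
    (h : ∀ y, |w y * f t y| ≤ K * g t y) (hx : x ∈ Icc (-R) R) :
    |primitive w f (-R) t x| ≤ K * ∫ y in -R..R, g t y := by
  have c1 : Continuous fun y => w y * f t y := hw.mul (continuous_slice hf t)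
  have c2 := continuous_slice hg t
  refine (intervalIntegral.abs_integral_le_integral_abs hx.1).trans ?_
  rw [← intervalIntegral.integral_const_mul]
  refine (intervalIntegral.integral_mono_interval le_rfl hx.1 hx.2
    (ae_of_all _ fun y => abs_nonneg _) (c1.abs.intervalIntegrable _ _)).trans ?_
  exact intervalIntegral.integral_mono_on (hx.1.trans hx.2) (c1.abs.intervalIntegrable _ _)
    ((c2.const_mul K).intervalIntegrable _ _) fun y _ => h y

/-- The source term in the localized momentum balance. -/
def momentumSource (w w' w'' : ℝ → ℝ) (t y : ℝ) : ℝ :=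
  w' y * (F.m t y ^ 2 / F.r t y + pressure γ δ (F.r t y) - ε * slope A y * F.m t y)
    + ε * w'' y * F.m t y - w y * slope A y * (F.m t y ^ 2 / F.r t y)

/-- The localized momentum flux. -/
def momentumFlux (w w' : ℝ → ℝ) (t y : ℝ) : ℝ :=
  w y * (F.m t y ^ 2 / F.r t y + pressure γ δ (F.r t y) - ε * F.mx t y - ε * slope A y * F.m t y)
    + ε * w' y * F.m t y

theorem cont_momentumSource (hA : IsArea A) {w w' w'' : ℝ → ℝ} (hw : Continuous w)
    (hw' : Continuous w') (hw'' : Continuous w'') :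
    Continuous fun z : ℝ × ℝ => F.momentumSource w w' w'' z.1 z.2 := by
  have h1 := F.cont_m
  have h2 := F.cont_kinetic
  have h3 := F.cont_pressure
  have h4 := hA.continuous_slope
  unfold momentumSource
  fun_prop

theorem cont_momentumFlux (hA : IsArea A) {w w' : ℝ → ℝ} (hw : Continuous w)
    (hw' : Continuous w') : Continuous fun z : ℝ × ℝ => F.momentumFlux w w' z.1 z.2 := by
  have h1 := F.cont_m
  have h2 := F.cont_kinetic
  have h3 := F.cont_pressure
  have h4 := hA.continuous_slope
  have h5 := F.cont_mx
  unfold momentumFlux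
  fun_prop

/-- The momentum equation times w, with the derivative moved onto the cutoff. Integrated from -R,
where w and w' vanish, it expresses ∫ w m_t through pointwise fluxes and an integral of lower order
terms. -/
theorem hasDerivAt_momentumFlux (hA : IsArea A) {w w' w'' : ℝ → ℝ}
    (hw : ∀ x, HasDerivAt w (w' x) x) (hw' : ∀ x, HasDerivAt w' (w'' x) x) {t x : ℝ} (ht : 0 < t)
    (hx : x ∈ Ioo a b) :
    HasDerivAt (F.momentumFlux w w' t) (F.momentumSource w w' w'' t x - w x * F.mt t x) x := by
  have hp := F.pos t x
  have hr := F.hrx t ht x hx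
  have hm := F.hmx t ht x hx
  have hmx := F.hmxx t ht x hx
  have dp := (hasDerivAt_pressure (γ := γ) δ hp).comp x hr
  have := ((hw x).mul (((((hm.pow 2).div hr hp.ne').add dp).sub (hmx.const_mul ε)).sub
    (((hA.hasDerivAt_slope x).const_mul ε).mul hm))).add (((hw' x).const_mul ε).mul hm)
  refine this.congr_deriv ?_
  simp only [Pi.pow_apply, Pi.mul_apply, Pi.sub_apply, Pi.add_apply, Pi.div_apply,
    Function.comp_apply, Nat.cast_ofNat, Nat.add_one_sub_one, pow_one]
  unfold momentumSource
  rw [F.momentum t ht x hx]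
  field_simp
  ring

/-- The flux in the localized balance for `r ∫ w m`. -/
def crossFlux (w w' : ℝ → ℝ) (R t x : ℝ) : ℝ :=
  w x * primitive w F.m (-R) t x * (F.m t x - ε * F.rx t x)
    + ε * (w' x - slope A x * w x) * primitive w F.m (-R) t x * F.r t x

/-- The source in the localized balance for `r ∫ w m`. -/
def crossSource (w w' w'' : ℝ → ℝ) (R t x : ℝ) : ℝ :=
  (w' x - slope A x * w x) * primitive w F.m (-R) t x * F.m t x
    + ε * F.r t x * (w'' x - slope' A x * w x - slope A x * w' x) * primitive w F.m (-R) t x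
    + ε * w x ^ 2 * F.r t x ^ 2 * F.ux t x
    + w x * F.r t x * primitive (fun _ => 1) (F.momentumSource w w' w'') (-R) t x

theorem cont_crossSource (hA : IsArea A) {w w' w'' : ℝ → ℝ} (hw : Continuous w)
    (hw' : Continuous w') (hw'' : Continuous w'') (R : ℝ) :
    Continuous fun z : ℝ × ℝ => F.crossSource w w' w'' R z.1 z.2 := by
  have h1 := F.cont_m
  have h2 := F.cont_r
  have h3 := F.cont_ux
  have h4 := hA.continuous_slope
  have h5 := hA.continuous_slope'
  have h6 := continuous_primitive hw F.cont_m (-R)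
  have h7 := continuous_primitive (continuous_const (y := (1 : ℝ)))
    (F.cont_momentumSource hA hw hw' hw'') (-R)
  unfold crossSource
  fun_prop

theorem cont_crossFlux (hA : IsArea A) {w w' : ℝ → ℝ} (hw : Continuous w)
    (hw' : Continuous w') (R : ℝ) :
    Continuous fun z : ℝ × ℝ => F.crossFlux w w' R z.1 z.2 := by
  have h1 := F.cont_m
  have h2 := F.cont_r
  have h3 := F.cont_rx
  have h4 := hA.continuous_slope
  have h6 := continuous_primitive hw F.cont_m (-R)
  unfold crossFlux
  fun_prop

/-- The localized product of the density with the primitive of the momentum. -/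
def crossDensity (w : ℝ → ℝ) (R t x : ℝ) : ℝ := w x * (F.r t x * primitive w F.m (-R) t x)

/-- The time derivative of `crossDensity`. -/
def crossDensityT (w : ℝ → ℝ) (R t x : ℝ) : ℝ :=
  w x * (F.rt t x * primitive w F.m (-R) t x + F.r t x * primitive w F.mt (-R) t x)

/-- The localized product of density and pressure. -/
def weightedPressure (w : ℝ → ℝ) (t x : ℝ) : ℝ := w x ^ 2 * F.r t x * pressure γ δ (F.r t x)

theorem cont_crossDensity {w : ℝ → ℝ} (hw : Continuous w) (R : ℝ) :
    Continuous fun z : ℝ × ℝ => F.crossDensity w R z.1 z.2 := by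
  have h2 := F.cont_r
  have h6 := continuous_primitive hw F.cont_m (-R)
  unfold crossDensity
  fun_prop

theorem cont_crossDensityT {w : ℝ → ℝ} (hw : Continuous w) (R : ℝ) :
    Continuous fun z : ℝ × ℝ => F.crossDensityT w R z.1 z.2 := by
  have h2 := F.cont_r
  have h3 := F.cont_rt
  have h6 := continuous_primitive hw F.cont_m (-R)
  have h7 := continuous_primitive hw F.cont_mt (-R)
  unfold crossDensityT
  fun_prop

theorem cont_weightedPressure {w : ℝ → ℝ} (hw : Continuous w) :
    Continuous fun z : ℝ × ℝ => F.weightedPressure w z.1 z.2 := by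
  have h2 := F.cont_r
  have h3 := F.cont_pressure
  unfold weightedPressure
  fun_prop

/-- The continuity equation is multiplied by w ∫ w m and the integrated momentum equation by w r.
The convective contributions w² m² cancel, leaving the pressure term w² r p with a sign. The viscous
terms with r m_x and m r_x combine into ε w² r² u_x. -/
theorem hasDerivAt_crossFlux (hA : IsArea A) {R Q : ℝ} {w w' w'' : ℝ → ℝ}
    (h : IsCutoff R Q w w' w'') (haR : a ≤ -R) (hRb : R ≤ b) {t x : ℝ} (ht : 0 < t)
    (hx : x ∈ Ioo (-R) R) :
    HasDerivAt (F.crossFlux w w' R t) (F.crossSource w w' w'' R t x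
      - F.weightedPressure w t x - F.crossDensityT w R t x) x := by
  have hxab : x ∈ Ioo a b := ⟨haR.trans_lt hx.1, hx.2.trans_le hRb⟩
  have hp := F.pos t x
  have hr := F.hrx t ht x hxab
  have hm := F.hmx t ht x hxab
  have hrx := F.hrxx t ht x hxab
  have hS := hasDerivAt_primitive_snd h.continuous F.cont_m (-R) t x
  have hSt : primitive w F.mt (-R) t x = -F.momentumFlux w w' t x +
      primitive (fun _ => 1) (F.momentumSource w w' w'') (-R) t x := by
    have c1 := continuous_slice (F.cont_momentumSource hA h.continuous h.continuous' h.cont) t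
    have c2 := continuous_slice F.cont_mt t
    have c3 := h.continuous
    have e := integral_eq_sub_of_interior (a := a) (b := b)
      (continuous_slice (F.cont_momentumFlux hA h.continuous h.continuous') t)
      (by fun_prop : Continuous fun x => F.momentumSource w w' w'' t x - w x * F.mt t x)
      (fun y hy => F.hasDerivAt_momentumFlux hA h.hw h.hw' ht hy) haR hx.1.le
      (hx.2.le.trans hRb)
    rw [intervalIntegral.integral_sub (c1.intervalIntegrable _ _)
      (Continuous.intervalIntegrable (by fun_prop) _ _)] at e
    have e0 : F.momentumFlux w w' t (-R) = 0 := by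
      unfold momentumFlux
      rw [h.left, h.left']
      ring
    rw [e0] at e
    unfold primitive
    simp only [one_mul]
    linarith
  have := (((h.hw x).mul hS).mul (hm.sub (hrx.const_mul ε))).add
    (((((h.hw' x).sub ((hA.hasDerivAt_slope x).mul (h.hw x))).const_mul ε).mul hS).mul hr)
  refine this.congr_deriv ?_
  simp only [Pi.mul_apply, Pi.sub_apply]
  unfold weightedPressure crossDensityT
  rw [hSt, F.continuity t ht x hxab]
  unfold crossSource momentumFlux ux
  field_simp
  ring

theorem abs_momentumSource_le (hγ : 1 < γ) (hε : 0 < ε) (hε1 : ε ≤ 1) (hδ : 0 ≤ δ) {R Q Qa : ℝ}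
    {w w' w'' : ℝ → ℝ} (h : IsCutoff R Q w w' w'') (hs : ∀ x, |slope A x| ≤ Qa) (t y : ℝ) :
    |F.momentumSource w w' w'' t y| ≤
      (Q * (kappa γ + 3 + Qa) + Qa) * Nozzle.size γ δ (F.r t y) (F.m t y) := by
  have hp := F.pos t y
  have hQ : 0 ≤ Q := (abs_nonneg _).trans (h.bound' 0)
  have hQa : 0 ≤ Qa := (abs_nonneg _).trans (hs 0)
  have hκ := (kappa_pos hγ).le
  set D := Nozzle.size γ δ (F.r t y) (F.m t y) with hD
  have hD0 : 0 ≤ D := size_nonneg hδ hp _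
  have e1 : |F.m t y ^ 2 / F.r t y| ≤ D := by
    rw [abs_of_nonneg (by positivity)]; exact F.kinetic_le_size hδ t y
  have e2 : |pressure γ δ (F.r t y)| ≤ (kappa γ + 1) * D := by
    rw [abs_of_nonneg (by unfold pressure; positivity)]; exact F.pressure_le_size hγ hδ t y
  have e3 : |F.m t y| ≤ D := F.abs_m_le_size hδ t y
  have eε : |ε| ≤ 1 := by rw [abs_of_pos hε]; exact hε1
  unfold momentumSource
  calc _ ≤ Q * (D + (kappa γ + 1) * D + 1 * Qa * D) + 1 * Q * D + 1 * Qa * D := by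
        refine (abs_sub _ _).trans (add_le_add ((abs_add_le _ _).trans (add_le_add ?_ ?_)) ?_)
        · rw [abs_mul]
          refine mul_le_mul (h.bound' y) ?_ (abs_nonneg _) hQ
          refine (abs_sub _ _).trans (add_le_add ((abs_add_le _ _).trans (add_le_add e1 e2)) ?_)
          rw [abs_mul, abs_mul]
          have := hs y
          gcongr
        · rw [abs_mul, abs_mul]
          have := h.bound'' y
          gcongr
        · rw [abs_mul, abs_mul]
          have := hs y
          have := h.abs_le_one y
          gcongr
    _ = _ := by ring

/-- The primitives are bounded uniformly in x by the energy, so almost every term is linear in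
`size`. The exception ε r² u_x is split as r³ + r u_x², both of which are controlled after
multiplication by ε and integration. -/
theorem abs_crossSource_le (hγ : 1 < γ) (hε : 0 < ε) (hε1 : ε ≤ 1) (hδ : 0 ≤ δ) {R Q Qa T C : ℝ}
    (hA : IsArea A) {w w' w'' : ℝ → ℝ} (h : IsCutoff R Q w w' w'') (hs : ∀ x, |slope A x| ≤ Qa)
    (hs' : ∀ x, |slope' A x| ≤ Qa) (hE : F.EnergyBounded T R C) {t x : ℝ} (ht : t ∈ Icc 0 T)
    (hx : x ∈ Icc (-R) R) :
    |F.crossSource w w' w'' R t x| ≤ (((Q + Qa) * C + (Q + Qa + Qa * Q) * C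
      + (Q * (kappa γ + 3 + Qa) + Qa) * C) * Nozzle.size γ δ (F.r t x) (F.m t x))
      + ε * (F.r t x ^ 3 + F.dissipation t x) := by
  have hp := F.pos t x
  have hQ : 0 ≤ Q := (abs_nonneg _).trans (h.bound' 0)
  have hQa : 0 ≤ Qa := (abs_nonneg _).trans (hs 0)
  have hκ := (kappa_pos hγ).le
  have cS := F.cont_sz
  have hRR : -R ≤ R := hx.1.trans hx.2
  have hIC := hE.size t ht
  have hC : 0 ≤ C := (intervalIntegral.integral_nonneg hRR fun y _ =>
    size_nonneg hδ (F.pos t y) (F.m t y)).trans hIC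
  have hS : |primitive w F.m (-R) t x| ≤ C := by
    refine (abs_primitive_le (K := 1) h.continuous F.cont_m cS (fun y => ?_) hx).trans
      (by rw [one_mul]; exact hIC)
    rw [abs_mul]
    exact mul_le_mul (h.abs_le_one y) (F.abs_m_le_size hδ t y) (abs_nonneg _) zero_le_one
  have hL : |primitive (fun _ => 1) (F.momentumSource w w' w'') (-R) t x| ≤
      (Q * (kappa γ + 3 + Qa) + Qa) * C := by
    refine (abs_primitive_le continuous_const
      (F.cont_momentumSource hA h.continuous h.continuous' h.cont) cS (fun y => ?_) hx).trans
      (mul_le_mul_of_nonneg_left hIC (by positivity))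
    rw [one_mul]
    exact F.abs_momentumSource_le hγ hε hε1 hδ h hs t y
  set D := Nozzle.size γ δ (F.r t x) (F.m t x) with hD
  have hD0 : 0 ≤ D := size_nonneg hδ hp _
  have er : |F.r t x| ≤ D := by rw [abs_of_pos hp]; exact F.r_le_size hδ t x
  have em : |F.m t x| ≤ D := F.abs_m_le_size hδ t x
  have eε : |ε| ≤ 1 := by rw [abs_of_pos hε]; exact hε1
  have ew := h.abs_le_one x
  have es := hs x
  have es' := hs' x
  have eb := h.bound' x
  have eb' := h.bound'' x
  have hdiss : F.r t x ^ 2 * |F.ux t x| ≤ F.r t x ^ 3 + F.dissipation t x := by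
    have h1 : F.r t x * F.ux t x ^ 2 ≤ F.dissipation t x := by
      have : 0 ≤ enthalpy' γ δ (F.r t x) * F.rx t x ^ 2 := by unfold enthalpy'; positivity
      unfold dissipation; linarith
    have h2 : F.r t x ^ 3 + F.r t x * F.ux t x ^ 2 - 2 * (F.r t x ^ 2 * |F.ux t x|) =
        F.r t x * (F.r t x - |F.ux t x|) ^ 2 := by
      rw [sub_sq, sq_abs]; ring
    have h3 : 0 ≤ F.r t x * (F.r t x - |F.ux t x|) ^ 2 := by positivity
    have h4 : 0 ≤ F.r t x ^ 2 * |F.ux t x| := by positivity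
    linarith
  unfold crossSource
  calc _ ≤ (Q + Qa * 1) * C * D + 1 * D * (Q + Qa * 1 + Qa * Q) * C
        + ε * 1 * (F.r t x ^ 3 + F.dissipation t x)
        + 1 * D * ((Q * (kappa γ + 3 + Qa) + Qa) * C) := by
        refine (abs_add_le _ _).trans (add_le_add ((abs_add_le _ _).trans (add_le_add
          ((abs_add_le _ _).trans (add_le_add ?_ ?_)) ?_)) ?_)
        · rw [abs_mul, abs_mul]
          have : |w' x - slope A x * w x| ≤ Q + Qa * 1 := by
            refine (abs_sub _ _).trans (add_le_add eb ?_)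
            rw [abs_mul]; gcongr
          gcongr
        · rw [abs_mul, abs_mul, abs_mul]
          have : |w'' x - slope' A x * w x - slope A x * w' x| ≤ Q + Qa * 1 + Qa * Q := by
            refine (abs_sub _ _).trans (add_le_add ((abs_sub _ _).trans (add_le_add eb' ?_)) ?_)
            · rw [abs_mul]; gcongr
            · rw [abs_mul]; gcongr
          gcongr
        · rw [mul_assoc, abs_mul, abs_mul, abs_mul, abs_of_pos hε,
            abs_of_nonneg (by positivity : 0 ≤ F.r t x ^ 2)]
          have : |w x ^ 2| ≤ 1 := by rw [abs_pow]; exact pow_le_one₀ (abs_nonneg _) ew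
          gcongr
        · rw [abs_mul, abs_mul]
          gcongr
    _ = _ := by ring

set_option maxHeartbeats 400000 in
/-- The density is locally bounded in `L^(γ + 1)`. -/
theorem integral_rpow_le (hγ : 1 < γ) (hA : IsArea A) (C T R : ℝ) (hT : 0 ≤ T) (hR : 1 ≤ R) :
    ∃ C', 0 ≤ C' ∧ ∀ {ε δ a b : ℝ} (F : Flow γ A ε δ a b), 0 < ε → ε ≤ 1 → 0 ≤ δ →
      F.EnergyBounded T R C →
      ∫ t in (0 : ℝ)..T, ∫ x in -(R - 1)..R - 1, F.r t x ^ (γ + 1) ≤ C' := by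
  obtain ⟨C₃, hC₃, h3⟩ := integral_cube_le hγ C T R hT hR
  obtain ⟨Q, hQ, hcut⟩ := exists_cutoff
  obtain ⟨w, w', w'', hw⟩ := hcut R hR
  obtain ⟨A₀, Qa, -, hQa, -, -, -, hs, hs', -⟩ := hA.exists_bounds
  set K := (Q + Qa) * |C| + (Q + Qa + Qa * Q) * |C| + (Q * (kappa γ + 3 + Qa) + Qa) * |C| with hK
  have hκ := kappa_pos hγ
  have hK0 : 0 ≤ K := by positivity
  refine ⟨(kappa γ)⁻¹ * (T * (K * |C|) + (C₃ + |C|) + 2 * (|C| * |C|)), by positivity, ?_⟩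
  intro ε δ a b F hε hε1 hδ hE0
  have hRR : -R ≤ R := by linarith
  have hE : F.EnergyBounded T R |C| := ⟨hE0.left, hE0.right,
    fun t ht => (hE0.size t ht).trans (le_abs_self C), hE0.diss.trans (le_abs_self C)⟩
  have cS := F.cont_sz
  have cw := hw.continuous
  have cX := F.cont_crossSource hA hw.continuous hw.continuous' hw.cont R
  have cY := F.cont_crossDensity cw R
  have cYt := F.cont_crossDensityT cw R
  have cG := F.cont_weightedPressure cw
  set Y := fun t => ∫ x in -R..R, F.crossDensity w R t x with hY
  have hYd : ∀ t, 0 < t → HasDerivAt Y (∫ x in -R..R, F.crossDensityT w R t x) t := by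
    intro t ht
    refine hasDerivAt_integral_fst (a := -R) (b := R) cY cYt (fun s hs x hx => ?_) le_rfl hRR
      le_rfl ht
    have h1 := F.hrt s hs x ⟨hE.left.trans_lt hx.1, hx.2.trans_le hE.right⟩
    have cm : Continuous fun z : ℝ × ℝ => w z.2 * F.m z.1 z.2 :=
      (cw.comp continuous_snd).mul F.cont_m
    have cmt : Continuous fun z : ℝ × ℝ => w z.2 * F.mt z.1 z.2 :=
      (cw.comp continuous_snd).mul F.cont_mt
    have h2 : HasDerivAt (fun s => primitive w F.m (-R) s x) (primitive w F.mt (-R) s x) s :=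
      hasDerivAt_integral_fst (f := fun t x => w x * F.m t x)
        (g := fun t x => w x * F.mt t x) (a := -R) (b := R) cm cmt (fun τ hτ y hy =>
        (F.hmt τ hτ y ⟨hE.left.trans_lt hy.1, hy.2.trans_le hE.right⟩).const_mul _) le_rfl
        hx.1.le hx.2.le hs
    exact (h1.mul h2).const_mul (w x)
  have hYb : ∀ t ∈ Icc 0 T, |Y t| ≤ |C| * |C| := by
    intro t ht
    have hpt : ∀ x ∈ Icc (-R) R, |F.crossDensity w R t x| ≤ |C| * F.sz t x := by
      intro x hx
      have hS : |primitive w F.m (-R) t x| ≤ |C| := by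
        refine (abs_primitive_le (K := 1) hw.continuous F.cont_m cS (fun y => ?_) hx).trans
          (by rw [one_mul]; exact hE.size t ht)
        rw [abs_mul]
        exact mul_le_mul (hw.abs_le_one y) (F.abs_m_le_size hδ t y) (abs_nonneg _) zero_le_one
      have hrs : F.r t x ≤ F.sz t x := F.r_le_size hδ t x
      have hp := F.pos t x
      have := hw.abs_le_one x
      unfold crossDensity
      rw [abs_mul, abs_mul, abs_of_pos hp]
      have := hp.le.trans hrs
      calc _ ≤ 1 * (F.sz t x * |C|) := by gcongr
        _ = _ := by ring
    refine (intervalIntegral.abs_integral_le_integral_abs hRR).trans ?_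
    refine (intervalIntegral.integral_mono_on hRR
      ((continuous_slice cY t).abs.intervalIntegrable _ _)
      (((continuous_slice cS t).const_mul |C|).intervalIntegrable _ _) hpt).trans ?_
    rw [intervalIntegral.integral_const_mul]
    exact mul_le_mul_of_nonneg_left (hE.size t ht) (abs_nonneg _)
  -- The flux vanishes at ±R together with w and w', so integrating the balance in x leaves no
  -- boundary term.
  have hslice : ∀ t ∈ Ioo 0 T, ∫ x in -R..R, F.weightedPressure w t x =
      (∫ x in -R..R, F.crossSource w w' w'' R t x) - ∫ x in -R..R,
        F.crossDensityT w R t x := by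
    intro t ht
    have c1 := continuous_slice cX t
    have c2 := continuous_slice cG t
    have c3 := continuous_slice cYt t
    have e := integral_eq_sub_of_interior (a := -R) (b := R)
      (continuous_slice (F.cont_crossFlux hA hw.continuous hw.continuous' R) t)
      (φ' := fun x => F.crossSource w w' w'' R t x - F.weightedPressure w t x
        - F.crossDensityT w R t x) ((c1.sub c2).sub c3)
      (fun x hx => F.hasDerivAt_crossFlux hA hw hE.left hE.right ht.1 hx) le_rfl hRR le_rfl
    have e1 : F.crossFlux w w' R t R = 0 := by
      unfold crossFlux; rw [hw.right, hw.right']; ring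
    have e2 : F.crossFlux w w' R t (-R) = 0 := by
      unfold crossFlux; rw [hw.left, hw.left']; ring
    rw [e1, e2, sub_zero, intervalIntegral.integral_sub (Continuous.intervalIntegrable (by fun_prop) _ _)
      (c3.intervalIntegrable _ _), intervalIntegral.integral_sub (c1.intervalIntegrable _ _)
      (c2.intervalIntegrable _ _)] at e
    linarith
  have cI1 := continuous_integral_fst cX (-R) R
  have cI2 := continuous_integral_fst cYt (-R) R
  have htot : ∫ t in (0:ℝ)..T, ∫ x in -R..R, F.weightedPressure w t x =
      (∫ t in (0:ℝ)..T, ∫ x in -R..R, F.crossSource w w' w'' R t x) - (Y T - Y 0) := by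
    rw [intervalIntegral.integral_congr_Ioo_of_le hT hslice,
      intervalIntegral.integral_sub (cI1.intervalIntegrable _ _) (cI2.intervalIntegrable _ _),
      integral_eq_sub_of_interior (a := 0) (b := T) (continuous_integral_fst cY (-R) R) cI2
        (fun t ht => hYd t ht.1) le_rfl hT le_rfl]
  have c3' : Continuous fun z : ℝ × ℝ => F.r z.1 z.2 ^ 3 := F.cont_r.pow 3
  have cD := F.cont_dissipation
  have hsrc : ∫ t in (0:ℝ)..T, ∫ x in -R..R, F.crossSource w w' w'' R t x ≤
      T * (K * |C|) + (C₃ + |C|) := by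
    have hm := integral_integral_mono cX (g := fun t x => K * F.sz t x
      + ε * (F.r t x ^ 3 + F.dissipation t x)) (by fun_prop) hT hRR (fun t ht x hx =>
        (le_abs_self _).trans (F.abs_crossSource_le hγ hε hε1 hδ hA hw hs hs' hE
          ⟨ht.1.le, ht.2.le⟩ hx))
    refine hm.trans ?_
    have hin : ∀ t ∈ Icc 0 T, ∫ x in -R..R, (K * F.sz t x
        + ε * (F.r t x ^ 3 + F.dissipation t x)) ≤ K * |C| + ((ε * ∫ x in -R..R, F.r t x ^ 3)
          + ε * ∫ x in -R..R, F.dissipation t x) := by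
      intro t ht
      have c1 := continuous_slice cS t
      have c2 := continuous_slice (f := fun t x => F.r t x ^ 3) c3' t
      have c4 := continuous_slice cD t
      rw [intervalIntegral.integral_add ((c1.const_mul K).intervalIntegrable _ _)
        (Continuous.intervalIntegrable (by fun_prop) _ _), intervalIntegral.integral_const_mul,
        intervalIntegral.integral_const_mul, intervalIntegral.integral_add
        (c2.intervalIntegrable _ _) (c4.intervalIntegrable _ _)]
      have h5 : K * ∫ x in -R..R, F.sz t x ≤ K * |C| :=
        mul_le_mul_of_nonneg_left (hE.size t ht) hK0
      rw [mul_add]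
      linarith
    have cJ1 := continuous_integral_fst (f := fun t x => F.r t x ^ 3) c3' (-R) R
    have cJ2 := continuous_integral_fst cD (-R) R
    refine (intervalIntegral.integral_mono_on hT
      ((continuous_integral_fst (f := fun t x => K * F.sz t x
        + ε * (F.r t x ^ 3 + F.dissipation t x)) (by fun_prop) (-R) R).intervalIntegrable _ _)
      (Continuous.intervalIntegrable (by fun_prop) _ _) hin).trans ?_
    rw [intervalIntegral.integral_add (by simp)
      (Continuous.intervalIntegrable (by fun_prop) _ _),
      intervalIntegral.integral_add ((cJ1.const_mul ε).intervalIntegrable _ _)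
      ((cJ2.const_mul ε).intervalIntegrable _ _), intervalIntegral.integral_const,
      intervalIntegral.integral_const_mul, intervalIntegral.integral_const_mul, sub_zero,
      smul_eq_mul]
    have := h3 F hε hε1 hδ hE0
    have := hE.diss
    linarith
  -- On the inner interval w = 1, and dropping the nonnegative δ part of the pressure gives κ
  -- r^(γ+1) ≤ r p.
  have hlow : ∫ t in (0:ℝ)..T, ∫ x in -(R - 1)..R - 1, F.r t x ^ (γ + 1) ≤
      (kappa γ)⁻¹ * ∫ t in (0:ℝ)..T, ∫ x in -R..R, F.weightedPressure w t x := by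
    have cg := F.cont_rpow (γ + 1)
    have cI := continuous_integral_fst (f := fun t x => F.r t x ^ (γ + 1)) cg (-(R - 1)) (R - 1)
    have cI' := continuous_integral_fst cG (-R) R
    rw [← intervalIntegral.integral_const_mul]
    refine intervalIntegral.integral_mono_on hT (cI.intervalIntegrable _ _)
      ((cI'.const_mul _).intervalIntegrable _ _) fun t _ => ?_
    have c1 := continuous_slice cG t
    have hm1 : ∫ x in -(R - 1)..R - 1, F.r t x ^ (γ + 1) ≤ ∫ x in -(R - 1)..R - 1,
        (kappa γ)⁻¹ * F.weightedPressure w t x := by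
      refine intervalIntegral.integral_mono_on (by linarith)
        ((continuous_slice (f := fun t x => F.r t x ^ (γ + 1)) cg t).intervalIntegrable _ _)
        ((c1.const_mul _).intervalIntegrable _ _) fun x hx => ?_
      have hp := F.pos t x
      unfold weightedPressure
      rw [hw.eq_one x hx, Real.rpow_add_one hp.ne', inv_mul_eq_div, le_div_iff₀ hκ]
      unfold pressure
      have : 0 ≤ F.r t x * (δ * F.r t x ^ 2) := by positivity
      linarith
    refine hm1.trans ?_
    rw [intervalIntegral.integral_const_mul]
    refine mul_le_mul_of_nonneg_left ?_ (by positivity)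
    refine intervalIntegral.integral_mono_interval (by linarith) (by linarith) (by linarith)
      (ae_of_all _ fun x => ?_) (c1.intervalIntegrable _ _)
    have hp := F.pos t x
    simp only [Pi.zero_apply]
    unfold weightedPressure pressure
    positivity
  refine hlow.trans (mul_le_mul_of_nonneg_left ?_ (by positivity))
  rw [htot]
  have h1 := hYb T ⟨hT, le_rfl⟩
  have h2 := hYb 0 ⟨le_rfl, hT⟩
  have := (abs_le.1 h1).1
  have := (abs_le.1 h2).2
  linarith

end Flow

namespace Flow
variable {γ : ℝ} {A : ℝ → ℝ} {ε δ a b : ℝ} (F : Flow γ A ε δ a b)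

/-! ### The weighted bound for the derivative of the density -/

theorem cont_log : Continuous fun z : ℝ × ℝ => Real.log (1 + F.r z.1 z.2) :=
  (continuous_const.add F.cont_r).log fun z => by
    have := F.pos z.1 z.2
    show 1 + F.r z.1 z.2 ≠ 0
    positivity

theorem cont_inv_one_add : Continuous fun z : ℝ × ℝ => (1 + F.r z.1 z.2)⁻¹ :=
  (continuous_const.add F.cont_r).inv₀ fun z => by
    have := F.pos z.1 z.2
    show 1 + F.r z.1 z.2 ≠ 0
    positivity

/-- The localized density `w log (1 + r)`. -/
def logDensity (w : ℝ → ℝ) (t x : ℝ) : ℝ := w x * Real.log (1 + F.r t x)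

/-- The time derivative of `logDensity`. -/
def logDensityT (w : ℝ → ℝ) (t x : ℝ) : ℝ := w x * ((1 + F.r t x)⁻¹ * F.rt t x)

/-- The squared derivative of `log (1 + r)`. -/
def logGradient (t x : ℝ) : ℝ := ((1 + F.r t x)⁻¹ * F.rx t x) ^ 2

/-- The flux in the balance for `logDensity`. -/
def logFlux (w w' : ℝ → ℝ) (t x : ℝ) : ℝ :=
  ε * (w x * ((1 + F.r t x)⁻¹ * F.rx t x)) - w x * (F.m t x / F.r t x) * Real.log (1 + F.r t x)
    - ε * (w' x * Real.log (1 + F.r t x)) + ε * (slope A x * w x * Real.log (1 + F.r t x))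

/-- The source in the balance for `logDensity`. -/
def logSource (w w' w'' : ℝ → ℝ) (t x : ℝ) : ℝ :=
  -(w' x * ((F.m t x / F.r t x) * Real.log (1 + F.r t x)))
    - w x * (F.ux t x * (Real.log (1 + F.r t x) - (1 + F.r t x)⁻¹ * F.r t x))
    + w x * (1 + F.r t x)⁻¹ * slope A x * F.m t x
    + ε * (slope' A x * w x + slope A x * w' x - w'' x) * Real.log (1 + F.r t x)

theorem cont_logDensity {w : ℝ → ℝ} (hw : Continuous w) :
    Continuous fun z : ℝ × ℝ => F.logDensity w z.1 z.2 := by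
  have h1 := F.cont_log
  unfold logDensity
  fun_prop

theorem cont_logDensityT {w : ℝ → ℝ} (hw : Continuous w) :
    Continuous fun z : ℝ × ℝ => F.logDensityT w z.1 z.2 := by
  have h1 := F.cont_inv_one_add
  have h2 := F.cont_rt
  unfold logDensityT
  fun_prop

theorem cont_logGradient : Continuous fun z : ℝ × ℝ => F.logGradient z.1 z.2 := by
  have h1 := F.cont_inv_one_add
  have h2 := F.cont_rx
  unfold logGradient
  fun_prop

theorem cont_logFlux (hA : IsArea A) {w w' : ℝ → ℝ} (hw : Continuous w) (hw' : Continuous w') :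
    Continuous fun z : ℝ × ℝ => F.logFlux w w' z.1 z.2 := by
  have h1 := F.cont_inv_one_add
  have h2 := F.cont_rx
  have h3 := F.cont_log
  have h4 := F.cont_u
  have h5 := hA.continuous_slope
  unfold logFlux
  fun_prop

theorem cont_logSource (hA : IsArea A) {w w' w'' : ℝ → ℝ} (hw : Continuous w)
    (hw' : Continuous w') (hw'' : Continuous w'') :
    Continuous fun z : ℝ × ℝ => F.logSource w w' w'' z.1 z.2 := by
  have h1 := F.cont_inv_one_add
  have h2 := F.cont_ux
  have h3 := F.cont_log
  have h4 := F.cont_u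
  have h5 := hA.continuous_slope
  have h6 := hA.continuous_slope'
  have h7 := F.cont_m
  have h8 := F.cont_r
  unfold logSource
  fun_prop

/-- The continuity equation renormalized by log(1 + r). The second derivative of this concave
function is minus the square of the first, so viscosity produces ε |∂_x log(1 + r)|² with a fixed
sign. The weight (1 + r)⁻² does not vanish at vacuum, whereas r^(γ-2) does if γ > 2. -/
theorem hasDerivAt_logFlux (hA : IsArea A) {w w' w'' : ℝ → ℝ} (hw : ∀ x, HasDerivAt w (w' x) x)
    (hw' : ∀ x, HasDerivAt w' (w'' x) x) {t x : ℝ} (ht : 0 < t) (hx : x ∈ Ioo a b) :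
    HasDerivAt (F.logFlux w w' t) (F.logDensityT w t x + F.logSource w w' w'' t x
      - ε * (w x * F.logGradient t x)) x := by
  have hp := F.pos t x
  have hp1 : 1 + F.r t x ≠ 0 := by positivity
  have hr := F.hrx t ht x hx
  have hm := F.hmx t ht x hx
  have hrx := F.hrxx t ht x hx
  have h1 := hr.const_add 1
  have hi := h1.inv hp1
  have hl := h1.log hp1
  have := (((((hw x).mul (hi.mul hrx)).const_mul ε).sub
    (((hw x).mul (hm.div hr hp.ne')).mul hl)).sub (((hw' x).mul hl).const_mul ε)).add
    ((((hA.hasDerivAt_slope x).mul (hw x)).mul hl).const_mul ε)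
  refine this.congr_deriv ?_
  simp only [Pi.mul_apply, Pi.inv_apply, Pi.div_apply]
  unfold logDensityT logSource logGradient ux
  rw [F.continuity t ht x hx]
  field_simp
  ring

/-- All terms are bounded by `size` except r |u_x|, for which 2√ε r |u_x| ≤ r + ε r u_x².
Multiplying by the remaining √ε gives the gain. -/
theorem abs_logSource_le (hγ : 1 < γ) (hε : 0 < ε) (hε1 : ε ≤ 1) (hδ : 0 ≤ δ) {R Q Qa : ℝ}
    {w w' w'' : ℝ → ℝ} (h : IsCutoff R Q w w' w'') (hs : ∀ x, |slope A x| ≤ Qa)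
    (hs' : ∀ x, |slope' A x| ≤ Qa) (t x : ℝ) :
    ε * |F.logSource w w' w'' t x| ≤
      √ε * ((2 * Q + 2 * Qa + Qa * Q + 1) * F.sz t x + ε * F.dissipation t x) := by
  have hp := F.pos t x
  have hQ : 0 ≤ Q := (abs_nonneg _).trans (h.bound' 0)
  have hQa : 0 ≤ Qa := (abs_nonneg _).trans (hs 0)
  set D := F.sz t x with hD
  have hD0 : 0 ≤ D := size_nonneg hδ hp _
  have er : F.r t x ≤ D := F.r_le_size hδ t x
  have em : |F.m t x| ≤ D := F.abs_m_le_size hδ t x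
  have eε : |ε| ≤ 1 := by rw [abs_of_pos hε]; exact hε1
  have ew := h.abs_le_one x
  have hl0 : 0 ≤ Real.log (1 + F.r t x) := Real.log_nonneg (by linarith)
  have hl : Real.log (1 + F.r t x) ≤ F.r t x := by
    have := Real.log_le_sub_one_of_pos (by positivity : 0 < 1 + F.r t x)
    linarith
  have hla : |Real.log (1 + F.r t x)| ≤ D := by rw [abs_of_nonneg hl0]; linarith
  have hi0 : 0 ≤ (1 + F.r t x)⁻¹ := by positivity
  have hi1 : |(1 + F.r t x)⁻¹| ≤ 1 := by
    rw [abs_of_nonneg hi0]; exact inv_le_one_of_one_le₀ (by linarith)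
  have hu : |F.m t x / F.r t x * Real.log (1 + F.r t x)| ≤ D := by
    rw [abs_mul, abs_div, abs_of_pos hp, abs_of_nonneg hl0]
    refine le_trans ?_ em
    rw [div_mul_eq_mul_div, div_le_iff₀ hp]
    gcongr
  have hd : |Real.log (1 + F.r t x) - (1 + F.r t x)⁻¹ * F.r t x| ≤ F.r t x := by
    have h1 : (1 + F.r t x)⁻¹ * F.r t x ≤ F.r t x :=
      mul_le_of_le_one_left hp.le (inv_le_one_of_one_le₀ (by linarith))
    have h2 : 0 ≤ (1 + F.r t x)⁻¹ * F.r t x := by positivity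
    rw [abs_le]
    constructor <;> linarith
  have h1 : |F.logSource w w' w'' t x| ≤
      (2 * Q + 2 * Qa + Qa * Q) * D + F.r t x * |F.ux t x| := by
    unfold logSource
    calc _ ≤ Q * D + 1 * (|F.ux t x| * F.r t x) + 1 * 1 * Qa * D
          + 1 * (Qa * 1 + Qa * Q + Q) * D := by
          refine (abs_add_le _ _).trans (add_le_add ((abs_add_le _ _).trans (add_le_add
            ((abs_sub _ _).trans (add_le_add ?_ ?_)) ?_)) ?_)
          · rw [abs_neg, abs_mul]
            exact mul_le_mul (h.bound' x) hu (abs_nonneg _) hQ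
          · rw [abs_mul, abs_mul]
            gcongr
          · rw [abs_mul, abs_mul, abs_mul]
            have := hs x
            gcongr
          · rw [abs_mul, abs_mul]
            have : |slope' A x * w x + slope A x * w' x - w'' x| ≤ Qa * 1 + Qa * Q + Q := by
              refine (abs_sub _ _).trans (add_le_add ((abs_add_le _ _).trans
                (add_le_add ?_ ?_)) (h.bound'' x))
              · rw [abs_mul]
                have := hs' x
                gcongr
              · rw [abs_mul]
                exact mul_le_mul (hs x) (h.bound' x) (abs_nonneg _) hQa
            gcongr
      _ = _ := by ring
  have hdiss : F.r t x * F.ux t x ^ 2 ≤ F.dissipation t x := by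
    have : 0 ≤ enthalpy' γ δ (F.r t x) * F.rx t x ^ 2 := by
      have := (kappa_pos hγ).le
      unfold enthalpy'
      positivity
    unfold dissipation; linarith
  obtain ⟨s, hs0, rfl⟩ : ∃ s, 0 < s ∧ s ^ 2 = ε := ⟨√ε, Real.sqrt_pos.2 hε, Real.sq_sqrt hε.le⟩
  rw [Real.sqrt_sq hs0.le]
  have hs1 : s ≤ 1 := by
    by_contra! hc
    nlinarith
  have h3 : s * (F.r t x * |F.ux t x|) ≤ D + s ^ 2 * F.dissipation t x := by
    have e : F.r t x + s ^ 2 * (F.r t x * F.ux t x ^ 2) - 2 * (s * (F.r t x * |F.ux t x|)) =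
        F.r t x * (1 - s * |F.ux t x|) ^ 2 := by
      rw [sub_sq, mul_pow, sq_abs]; ring
    have e3 : 0 ≤ F.r t x * (1 - s * |F.ux t x|) ^ 2 := by positivity
    have e4 : 0 ≤ s * (F.r t x * |F.ux t x|) := by positivity
    have e5 : s ^ 2 * (F.r t x * F.ux t x ^ 2) ≤ s ^ 2 * F.dissipation t x := by gcongr
    linarith
  calc s ^ 2 * |F.logSource w w' w'' t x|
      ≤ s ^ 2 * ((2 * Q + 2 * Qa + Qa * Q) * D + F.r t x * |F.ux t x|) := by gcongr
    _ = s * (s * ((2 * Q + 2 * Qa + Qa * Q) * D) + s * (F.r t x * |F.ux t x|)) := by ring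
    _ ≤ s * (1 * ((2 * Q + 2 * Qa + Qa * Q) * D) + (D + s ^ 2 * F.dissipation t x)) := by
        gcongr
    _ = _ := by ring

/-- The squared derivative of `log (1 + r)` is of order `ε ^ (-3 / 2)` in `L¹`. -/
theorem integral_logGradient_le (hγ : 1 < γ) (hA : IsArea A) (C T R : ℝ) (hT : 0 ≤ T) (hR : 1 ≤ R) :
    ∃ C', 0 ≤ C' ∧ ∀ {ε δ a b : ℝ} (F : Flow γ A ε δ a b), 0 < ε → ε ≤ 1 → 0 ≤ δ →
      F.EnergyBounded T R C →
      ε ^ 2 * ∫ t in (0 : ℝ)..T, ∫ x in -(R - 1)..R - 1, F.logGradient t x ≤ C' * √ε := by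
  obtain ⟨Q, hQ, hcut⟩ := exists_cutoff
  obtain ⟨w, w', w'', hw⟩ := hcut R hR
  obtain ⟨A₀, Qa, -, hQa, -, -, -, hs, hs', -⟩ := hA.exists_bounds
  set K := 2 * Q + 2 * Qa + Qa * Q + 1 with hK
  have hK0 : 0 ≤ K := by positivity
  refine ⟨T * (K * |C|) + |C| + |C|, by positivity, ?_⟩
  intro ε δ a b F hε hε1 hδ hE0
  have hRR : -R ≤ R := by linarith
  have hE : F.EnergyBounded T R |C| := ⟨hE0.left, hE0.right,
    fun t ht => (hE0.size t ht).trans (le_abs_self C), hE0.diss.trans (le_abs_self C)⟩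
  have cS := F.cont_sz
  have cD := F.cont_dissipation
  have cw := hw.continuous
  have cX := F.cont_logSource hA hw.continuous hw.continuous' hw.cont
  have cY := F.cont_logDensity cw
  have cYt := F.cont_logDensityT cw
  have cG := F.cont_logGradient
  have cWG : Continuous fun z : ℝ × ℝ => w z.2 * F.logGradient z.1 z.2 := by fun_prop
  have hG0 : ∀ t x, 0 ≤ F.logGradient t x := fun t x => sq_nonneg _
  set Y := fun t => ∫ x in -R..R, F.logDensity w t x with hY
  have hYd : ∀ t, 0 < t → HasDerivAt Y (∫ x in -R..R, F.logDensityT w t x) t := by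
    intro t ht
    refine hasDerivAt_integral_fst (a := -R) (b := R) cY cYt (fun s hs x hx => ?_) le_rfl hRR
      le_rfl ht
    have h1 := F.hrt s hs x ⟨hE.left.trans_lt hx.1, hx.2.trans_le hE.right⟩
    have hp := F.pos s x
    refine (((h1.const_add 1).log (by positivity)).const_mul (w x)).congr_deriv ?_
    unfold logDensityT
    ring
  have hlog : ∀ t x, 0 ≤ Real.log (1 + F.r t x) ∧ Real.log (1 + F.r t x) ≤ F.sz t x := by
    intro t x
    have hp := F.pos t x
    have := Real.log_le_sub_one_of_pos (by positivity : 0 < 1 + F.r t x)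
    have e : F.r t x ≤ F.sz t x := F.r_le_size hδ t x
    exact ⟨Real.log_nonneg (by linarith), by linarith⟩
  have hY0 : ∀ t, 0 ≤ Y t := fun t => intervalIntegral.integral_nonneg hRR fun x _ =>
    mul_nonneg (hw.nonneg x) (hlog t x).1
  have hYb : ∀ t ∈ Icc 0 T, Y t ≤ |C| := by
    intro t ht
    refine (intervalIntegral.integral_mono_on hRR
      ((continuous_slice cY t).intervalIntegrable _ _)
      ((continuous_slice cS t).intervalIntegrable _ _) fun x _ => ?_).trans (hE.size t ht)
    unfold logDensity
    exact (mul_le_of_le_one_left (hlog t x).1 (hw.le_one x)).trans (hlog t x).2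
  have hslice : ∀ t ∈ Ioo 0 T, ε * ∫ x in -R..R, w x * F.logGradient t x =
      (∫ x in -R..R, F.logDensityT w t x) + ∫ x in -R..R, F.logSource w w' w'' t x := by
    intro t ht
    have c1 := continuous_slice cYt t
    have c2 := continuous_slice cX t
    have c3 := continuous_slice cG t
    have e := integral_eq_sub_of_interior (a := -R) (b := R)
      (continuous_slice (F.cont_logFlux hA hw.continuous hw.continuous') t)
      (φ' := fun x => F.logDensityT w t x + F.logSource w w' w'' t x
      - ε * (w x * F.logGradient t x)) (by fun_prop)
      (fun x hx => F.hasDerivAt_logFlux hA hw.hw hw.hw' ht.1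
        ⟨hE.left.trans_lt hx.1, hx.2.trans_le hE.right⟩) le_rfl hRR le_rfl
    have e1 : F.logFlux w w' t R = 0 := by
      unfold logFlux; rw [hw.right, hw.right']; ring
    have e2 : F.logFlux w w' t (-R) = 0 := by
      unfold logFlux; rw [hw.left, hw.left']; ring
    rw [e1, e2, sub_zero, intervalIntegral.integral_sub
      (Continuous.intervalIntegrable (by fun_prop) _ _)
      (Continuous.intervalIntegrable (by fun_prop) _ _), intervalIntegral.integral_add
      (c1.intervalIntegrable _ _) (c2.intervalIntegrable _ _),
      intervalIntegral.integral_const_mul] at e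
    linarith
  have cI1 := continuous_integral_fst cX (-R) R
  have cI2 := continuous_integral_fst cYt (-R) R
  have cI3 := continuous_integral_fst (f := fun t x => w x * F.logGradient t x) cWG (-R) R
  -- Since 0 ≤ log(1 + r) ≤ r, the increment of Y is controlled by the mass alone.
  have htot : ε * ∫ t in (0:ℝ)..T, ∫ x in -R..R, w x * F.logGradient t x =
      (Y T - Y 0) + ∫ t in (0:ℝ)..T, ∫ x in -R..R, F.logSource w w' w'' t x := by
    rw [← intervalIntegral.integral_const_mul,
      intervalIntegral.integral_congr_Ioo_of_le hT hslice,
      intervalIntegral.integral_add (cI2.intervalIntegrable _ _) (cI1.intervalIntegrable _ _),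
      integral_eq_sub_of_interior (a := 0) (b := T) (continuous_integral_fst cY (-R) R) cI2
        (fun t ht => hYd t ht.1) le_rfl hT le_rfl]
  have hsrc : ε * ∫ t in (0:ℝ)..T, ∫ x in -R..R, F.logSource w w' w'' t x ≤
      √ε * (T * (K * |C|) + |C|) := by
    have hm := integral_integral_mono (f := fun t x => ε * F.logSource w w' w'' t x)
      (g := fun t x => √ε * (K * F.sz t x + ε * F.dissipation t x)) (by fun_prop) (by fun_prop)
      hT hRR (fun t _ x _ => (mul_le_mul_of_nonneg_left (le_abs_self _) hε.le).trans
        (F.abs_logSource_le hγ hε hε1 hδ hw hs hs' t x))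
    simp only [intervalIntegral.integral_const_mul] at hm
    refine hm.trans (mul_le_mul_of_nonneg_left ?_ (Real.sqrt_nonneg _))
    have hin : ∀ t ∈ Icc 0 T, ∫ x in -R..R, (K * F.sz t x + ε * F.dissipation t x) ≤
        K * |C| + ε * ∫ x in -R..R, F.dissipation t x := by
      intro t ht
      have c1 := continuous_slice cS t
      have c4 := continuous_slice cD t
      rw [intervalIntegral.integral_add (Continuous.intervalIntegrable (by fun_prop) _ _)
        (Continuous.intervalIntegrable (by fun_prop) _ _), intervalIntegral.integral_const_mul,
        intervalIntegral.integral_const_mul]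
      have h5 : K * ∫ x in -R..R, F.sz t x ≤ K * |C| :=
        mul_le_mul_of_nonneg_left (hE.size t ht) hK0
      linarith
    have cJ2 := continuous_integral_fst cD (-R) R
    refine (intervalIntegral.integral_mono_on hT
      ((continuous_integral_fst (f := fun t x => K * F.sz t x + ε * F.dissipation t x)
        (by fun_prop) (-R) R).intervalIntegrable _ _)
      (Continuous.intervalIntegrable (by fun_prop) _ _) hin).trans ?_
    rw [intervalIntegral.integral_add (by simp)
      (Continuous.intervalIntegrable (by fun_prop) _ _), intervalIntegral.integral_const,
      intervalIntegral.integral_const_mul, sub_zero, smul_eq_mul]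
    have := hE.diss
    linarith
  have hlow : ∫ t in (0:ℝ)..T, ∫ x in -(R - 1)..R - 1, F.logGradient t x ≤
      ∫ t in (0:ℝ)..T, ∫ x in -R..R, w x * F.logGradient t x := by
    refine intervalIntegral.integral_mono_on hT
      ((continuous_integral_fst cG _ _).intervalIntegrable _ _)
      (cI3.intervalIntegrable _ _) fun t _ => ?_
    have c1 := continuous_slice (f := fun t x => w x * F.logGradient t x) cWG t
    rw [intervalIntegral.integral_congr_Ioo_of_le (by linarith)
      (g := fun x => w x * F.logGradient t x) fun x hx => by
        simp only []
        rw [hw.eq_one x ⟨hx.1.le, hx.2.le⟩, one_mul]]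
    exact intervalIntegral.integral_mono_interval (by linarith) (by linarith) (by linarith)
      (ae_of_all _ fun x => mul_nonneg (hw.nonneg x) (hG0 t x)) (c1.intervalIntegrable _ _)
  have hεs : ε ≤ √ε := Real.le_sqrt_of_sq_le (by nlinarith)
  have hT' := hYb T ⟨hT, le_rfl⟩
  calc _ ≤ ε ^ 2 * ∫ t in (0:ℝ)..T, ∫ x in -R..R, w x * F.logGradient t x := by gcongr
    _ = ε * (Y T - Y 0) + ε * ∫ t in (0:ℝ)..T, ∫ x in -R..R, F.logSource w w' w'' t x := by
        rw [← mul_add, ← htot]; ring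
    _ ≤ √ε * |C| + √ε * (T * (K * |C|) + |C|) := by
        refine add_le_add ?_ hsrc
        have := hY0 0
        calc ε * (Y T - Y 0) ≤ ε * |C| := by gcongr; linarith
          _ ≤ √ε * |C| := by gcongr
    _ = _ := by ring

end Flow

/-! ### Averages against the entropy kernel -/

/-- The exponent of the entropy kernel. -/
def kernelExp (γ : ℝ) : ℝ := (3 - γ) / (2 * (γ - 1))

theorem kernelExp_gt (hγ : 1 < γ) : -1 < kernelExp γ := by
  unfold kernelExp
  rw [lt_div_iff₀ (by linarith)]
  linarith

theorem theta_pos (hγ : 1 < γ) : 0 < theta γ := by unfold theta; linarith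

/-- With λ the kernel exponent, 2θ(λ + 1) = 1 + θ. This fixes the constants in the integration by
parts below, on which the entropy equation rests. -/
theorem theta_mul_kernelExp (hγ : 1 < γ) : theta γ * (2 * (kernelExp γ + 1)) = 1 + theta γ := by
  unfold theta kernelExp
  have : γ - 1 ≠ 0 := by linarith
  field_simp
  ring

/-- The exponent exceeds -1. When it is negative, one of the factors of (1 - s)(1 + s) is at least 1
on each half of the interval, so a single endpoint singularity dominates there. -/
theorem intervalIntegrable_kernel (hγ : 1 < γ) :
    IntervalIntegrable (fun s : ℝ => (1 - s ^ 2) ^ kernelExp γ) volume (-1) 1 := by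
  have h1 : IntervalIntegrable (fun s : ℝ => (1 - s) ^ kernelExp γ) volume (-1) 1 := by
    have := (intervalIntegral.intervalIntegrable_rpow' (kernelExp_gt hγ) (a := 0) (b := 2))
    have := (this.comp_sub_left 1).symm
    norm_num at this
    exact this
  have h2 : IntervalIntegrable (fun s : ℝ => (1 + s) ^ kernelExp γ) volume (-1) 1 := by
    have := (intervalIntegral.intervalIntegrable_rpow' (kernelExp_gt hγ) (a := 0) (b := 2))
    have := this.comp_add_left 1
    norm_num at this
    exact this
  have h3 := (h1.add h2).add (intervalIntegrable_const (c := (1 : ℝ)))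
  have hm : Measurable fun s : ℝ => (1 - s ^ 2) ^ kernelExp γ := by fun_prop
  refine h3.mono_fun hm.aestronglyMeasurable ?_
  rw [uIoc_of_le (by norm_num)]
  refine (ae_restrict_iff' measurableSet_Ioc).2 ?_
  have hne : ∀ᵐ s : ℝ, s ≠ 1 := by simp [ae_iff]
  filter_upwards [hne] with s hs1 hs
  have ha : 0 < 1 - s := by
    have := lt_of_le_of_ne hs.2 hs1
    linarith
  have hb : 0 < 1 + s := by linarith [hs.1]
  have ea : 0 < (1 - s) ^ kernelExp γ := Real.rpow_pos_of_pos ha _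
  have eb : 0 < (1 + s) ^ kernelExp γ := Real.rpow_pos_of_pos hb _
  have hc : 0 < 1 - s ^ 2 := by nlinarith
  rw [Real.norm_of_nonneg (Real.rpow_nonneg hc.le _), Real.norm_of_nonneg (by positivity)]
  rcases le_or_gt 0 (kernelExp γ) with h | h
  · have : (1 - s ^ 2) ^ kernelExp γ ≤ 1 := Real.rpow_le_one hc.le (by nlinarith [sq_nonneg s]) h
    linarith
  · rcases le_total 0 s with h0 | h0
    · have : (1 - s ^ 2) ^ kernelExp γ ≤ (1 - s) ^ kernelExp γ :=
        Real.rpow_le_rpow_of_nonpos ha (by nlinarith) h.le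
      linarith
    · have : (1 - s ^ 2) ^ kernelExp γ ≤ (1 + s) ^ kernelExp γ :=
        Real.rpow_le_rpow_of_nonpos hb (by nlinarith) h.le
      linarith

/-- The measure `[1 - s²]₊^λ ds` on the line. -/
def kernelMeasure (γ : ℝ) : Measure ℝ :=
  (volume.restrict (Ioc (-1) 1)).withDensity fun s => ENNReal.ofReal ((1 - s ^ 2) ^ kernelExp γ)

theorem isFiniteMeasure_kernelMeasure (hγ : 1 < γ) : IsFiniteMeasure (kernelMeasure γ) := by
  have h := (intervalIntegrable_iff_integrableOn_Ioc_of_le (by norm_num)).1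
    (intervalIntegrable_kernel hγ)
  exact isFiniteMeasure_withDensity_ofReal h.2

theorem ae_kernelMeasure (γ : ℝ) : ∀ᵐ s ∂kernelMeasure γ, |s| ≤ 1 := by
  refine (withDensity_absolutelyContinuous _ _).ae_le ?_
  filter_upwards [ae_restrict_mem measurableSet_Ioc] with s hs
  exact abs_le.2 ⟨hs.1.le, hs.2⟩

theorem integral_kernelMeasure (g : ℝ → ℝ) :
    ∫ s, g s ∂kernelMeasure γ = ∫ s in (-1 : ℝ)..1, g s * (1 - s ^ 2) ^ kernelExp γ := by
  have hm : Measurable fun s : ℝ => ENNReal.ofReal ((1 - s ^ 2) ^ kernelExp γ) := by fun_prop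
  unfold kernelMeasure
  rw [integral_withDensity_eq_integral_toReal_smul hm (ae_of_all _ fun _ => ENNReal.ofReal_lt_top),
    intervalIntegral.integral_of_le (by norm_num)]
  refine setIntegral_congr_fun measurableSet_Ioc fun s hs => ?_
  have : 0 ≤ 1 - s ^ 2 := by nlinarith [hs.1, hs.2]
  simp only [smul_eq_mul]
  rw [ENNReal.toReal_ofReal (Real.rpow_nonneg this _), mul_comm]

/-- The average `∫ s^j f(U + V s) [1 - s²]₊^λ ds`. -/
def kernelMean (γ : ℝ) (j : ℕ) (f : ℝ → ℝ) (U V : ℝ) : ℝ :=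
  ∫ s, s ^ j * f (U + V * s) ∂kernelMeasure γ

/-- A bounded continuous function, supported in a bounded interval. -/
structure IsBump (L M : ℝ) (f : ℝ → ℝ) : Prop where
  cont : Continuous f
  nonneg : 0 ≤ L
  bound : ∀ x, |f x| ≤ M
  eq_zero : ∀ x, L < |x| → f x = 0

namespace IsBump
variable {γ L M : ℝ} {f : ℝ → ℝ}

theorem M_nonneg (h : IsBump L M f) : 0 ≤ M := (abs_nonneg _).trans (h.bound 0)

theorem integrable (hγ : 1 < γ) (h : IsBump L M f) (j : ℕ) (U V : ℝ) :
    Integrable (fun s => s ^ j * f (U + V * s)) (kernelMeasure γ) := by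
  have := isFiniteMeasure_kernelMeasure hγ
  have hc := h.cont
  refine Integrable.of_bound (C := M) (by fun_prop : Continuous _).aestronglyMeasurable ?_
  filter_upwards [ae_kernelMeasure γ] with s hs
  rw [norm_mul, norm_pow]
  calc _ ≤ 1 * M := mul_le_mul (pow_le_one₀ (norm_nonneg _) hs) (h.bound _) (abs_nonneg _)
        zero_le_one
    _ = M := one_mul M

theorem continuous_kernelMean (hγ : 1 < γ) (h : IsBump L M f) (j : ℕ) :
    Continuous fun z : ℝ × ℝ => kernelMean γ j f z.1 z.2 := by
  have := isFiniteMeasure_kernelMeasure hγ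
  have hc := h.cont
  refine continuous_of_dominated (bound := fun _ => M) (fun z => ?_) (fun z => ?_)
    (integrable_const M) (ae_of_all _ fun s => by fun_prop)
  · exact (by fun_prop : Continuous _).aestronglyMeasurable
  · filter_upwards [ae_kernelMeasure γ] with s hs
    rw [norm_mul, norm_pow]
    calc _ ≤ 1 * M := mul_le_mul (pow_le_one₀ (norm_nonneg _) hs) (h.bound _) (abs_nonneg _)
          zero_le_one
      _ = M := one_mul M

/-- The average of a bump function tends to zero as the interval spreads. -/
theorem abs_kernelMean_le (hγ : 1 < γ) (h : IsBump L M f) (j : ℕ) (U V : ℝ) :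
    |kernelMean γ j f U V| ≤ M * (kernelMeasure γ).real {s | |U + V * s| ≤ L} := by
  have := isFiniteMeasure_kernelMeasure hγ
  have hm : MeasurableSet {s : ℝ | |U + V * s| ≤ L} :=
    measurableSet_le (by fun_prop) measurable_const
  have e : kernelMean γ j f U V =
      ∫ s in {s | |U + V * s| ≤ L}, s ^ j * f (U + V * s) ∂kernelMeasure γ := by
    refine (setIntegral_eq_integral_of_forall_compl_eq_zero fun s hs => ?_).symm
    rw [h.eq_zero _ (not_le.1 hs), mul_zero]
  rw [e, ← Real.norm_eq_abs]
  refine norm_setIntegral_le_of_norm_le_const_ae' (measure_lt_top _ _) ?_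
  filter_upwards [ae_kernelMeasure γ] with s hs _
  rw [norm_mul, norm_pow]
  calc _ ≤ 1 * M := mul_le_mul (pow_le_one₀ (norm_nonneg _) hs) (h.bound _) (abs_nonneg _)
        zero_le_one
    _ = M := one_mul M

theorem abs_kernelMean_le' (hγ : 1 < γ) (h : IsBump L M f) (j : ℕ) (U V : ℝ) :
    |kernelMean γ j f U V| ≤ M * (kernelMeasure γ).real univ := by
  have := isFiniteMeasure_kernelMeasure hγ
  exact (h.abs_kernelMean_le hγ j U V).trans
    (mul_le_mul_of_nonneg_left (measureReal_mono (subset_univ _)) h.M_nonneg)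

/-- The average vanishes unless |U| ≤ L + |V|, by the support of f, so the factor U costs at most L
+ |V|. The small measure is kept next to |V|: this is what makes the entropy flux of lower order for
large densities. -/
theorem abs_mul_kernelMean_le (hγ : 1 < γ) (h : IsBump L M f) (j : ℕ) (U V : ℝ) :
    |U * kernelMean γ j f U V| ≤
      M * (L * (kernelMeasure γ).real univ + |V| * (kernelMeasure γ).real {s | |U + V * s| ≤ L}) := by
  have := isFiniteMeasure_kernelMeasure hγ
  have hM := h.M_nonneg
  have hL := h.nonneg
  have hU : |U| * (kernelMeasure γ).real {s | |U + V * s| ≤ L} ≤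
      (L + |V|) * (kernelMeasure γ).real {s | |U + V * s| ≤ L} := by
    by_cases hc : |U| ≤ L + |V|
    · gcongr
    · have : (kernelMeasure γ).real {s | |U + V * s| ≤ L} = 0 := by
        rw [measureReal_eq_zero_iff]
        refine measure_mono_null ?_ (ae_iff.1 (ae_kernelMeasure γ))
        intro s hs h1
        refine hc ?_
        have h2 : |V * s| ≤ |V| := by
          rw [abs_mul]; exact mul_le_of_le_one_right (abs_nonneg _) h1
        have h3 : |U| ≤ |U + V * s| + |V * s| := by
          have := abs_sub (U + V * s) (V * s)
          simpa using this
        have h4 : |U + V * s| ≤ L := hs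
        linarith
      rw [this]
      simp
  rw [abs_mul]
  calc |U| * |kernelMean γ j f U V|
      ≤ |U| * (M * (kernelMeasure γ).real {s | |U + V * s| ≤ L}) := by
        gcongr; exact h.abs_kernelMean_le hγ j U V
    _ = M * (|U| * (kernelMeasure γ).real {s | |U + V * s| ≤ L}) := by ring
    _ ≤ M * ((L + |V|) * (kernelMeasure γ).real {s | |U + V * s| ≤ L}) := by gcongr
    _ = M * (L * (kernelMeasure γ).real {s | |U + V * s| ≤ L}
          + |V| * (kernelMeasure γ).real {s | |U + V * s| ≤ L}) := by ring
    _ ≤ _ := by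
        gcongr
        · exact measure_ne_top _ _
        · exact subset_univ _

/-- Differentiation under the integral sign jointly in (U, V), then the chain rule along a curve.
The differential of U + V s is (1, s), so a derivative in V raises the power of s by one. Domination
is by a constant because the kernel measure is finite and |s| ≤ 1 on it. -/
theorem hasDerivAt_kernelMean (hγ : 1 < γ) {L' M' : ℝ} {f' : ℝ → ℝ} (h : IsBump L M f)
    (h' : IsBump L' M' f') (hf : ∀ x, HasDerivAt f (f' x) x) (j : ℕ) {U V : ℝ → ℝ} {U' V' x : ℝ}
    (hU : HasDerivAt U U' x) (hV : HasDerivAt V V' x) :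
    HasDerivAt (fun y => kernelMean γ j f (U y) (V y))
      (U' * kernelMean γ j f' (U x) (V x) + V' * kernelMean γ (j + 1) f' (U x) (V x)) x := by
  have := isFiniteMeasure_kernelMeasure hγ
  have hc := h.cont
  have hc' := h'.cont
  have hM' := h'.M_nonneg
  obtain ⟨D, hDs⟩ : ∃ D : ℝ → (ℝ × ℝ →L[ℝ] ℝ), D = fun s =>
    ContinuousLinearMap.fst ℝ ℝ ℝ + s • ContinuousLinearMap.snd ℝ ℝ ℝ := ⟨_, rfl⟩
  have cD : Continuous D := by rw [hDs]; fun_prop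
  have hD : ∀ᵐ s ∂kernelMeasure γ, ∀ z : ℝ × ℝ,
      ‖(s ^ j * f' (z.1 + z.2 * s)) • D s‖ ≤ M' * 2 := by
    filter_upwards [ae_kernelMeasure γ] with s hs z
    rw [norm_smul, norm_mul, norm_pow]
    have e1 : ‖s‖ ^ j * ‖f' (z.1 + z.2 * s)‖ ≤ 1 * M' :=
      mul_le_mul (pow_le_one₀ (norm_nonneg _) hs) (h'.bound _) (norm_nonneg _) zero_le_one
    have e2 : ‖D s‖ ≤ 2 := by
      rw [hDs]
      refine (norm_add_le _ _).trans ?_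
      rw [norm_smul]
      have i1 := ContinuousLinearMap.norm_fst_le ℝ ℝ ℝ
      have i2 := ContinuousLinearMap.norm_snd_le ℝ ℝ ℝ
      have i3 : ‖s‖ * ‖ContinuousLinearMap.snd ℝ ℝ ℝ‖ ≤ 1 * 1 :=
        mul_le_mul hs i2 (norm_nonneg _) zero_le_one
      linarith
    rw [one_mul] at e1
    exact mul_le_mul e1 e2 (norm_nonneg _) hM'
  have hcont : ∀ z : ℝ × ℝ, Continuous fun s => (s ^ j * f' (z.1 + z.2 * s)) • D s :=
    fun z => by fun_prop
  have hd : ∀ s (z : ℝ × ℝ), HasFDerivAt (fun z : ℝ × ℝ => s ^ j * f (z.1 + z.2 * s))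
      ((s ^ j * f' (z.1 + z.2 * s)) • D s) z := by
    intro s z
    have h1 : HasFDerivAt (fun z : ℝ × ℝ => z.1 + z.2 * s) (D s) z := by
      have := (ContinuousLinearMap.fst ℝ ℝ ℝ + s • ContinuousLinearMap.snd ℝ ℝ ℝ).hasFDerivAt
        (x := z)
      rw [hDs]
      refine this.congr_of_eventuallyEq (Eventually.of_forall fun y => ?_)
      simp [mul_comm]
    have h2 := ((hf (z.1 + z.2 * s)).comp_hasFDerivAt z h1).const_mul (s ^ j)
    rw [smul_smul] at h2
    exact h2
  have key : HasFDerivAt (fun z : ℝ × ℝ => ∫ s, s ^ j * f (z.1 + z.2 * s) ∂kernelMeasure γ)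
      (∫ s, (s ^ j * f' (U x + V x * s)) • D s ∂kernelMeasure γ) (U x, V x) := by
    have hmeas : ∀ z : ℝ × ℝ, AEStronglyMeasurable (fun s => s ^ j * f (z.1 + z.2 * s))
        (kernelMeasure γ) := fun z => (by fun_prop : Continuous _).aestronglyMeasurable
    have := hasFDerivAt_integral_of_dominated_of_fderiv_le (𝕜 := ℝ) (μ := kernelMeasure γ)
      (F := fun (z : ℝ × ℝ) s => s ^ j * f (z.1 + z.2 * s)) (x₀ := (U x, V x))
      (F' := fun z s => (s ^ j * f' (z.1 + z.2 * s)) • D s)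
      (bound := fun _ => M' * 2) (s := univ) univ_mem (Eventually.of_forall hmeas)
      (h.integrable hγ j (U x) (V x)) (hcont _).aestronglyMeasurable
      (hD.mono fun s hs z _ => hs z) (integrable_const _) (ae_of_all _ fun s z _ => hd s z)
    exact this
  have hcurve : HasDerivAt (fun y => (U y, V y)) (U', V') x := hU.prodMk hV
  have hfin := key.comp_hasDerivAt x hcurve
  refine hfin.congr_deriv ?_
  have hint : Integrable (fun s => (s ^ j * f' (U x + V x * s)) • D s) (kernelMeasure γ) :=
    Integrable.of_bound (hcont (U x, V x)).aestronglyMeasurable (M' * 2)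
      (hD.mono fun s hs => hs (U x, V x))
  rw [ContinuousLinearMap.integral_apply hint]
  unfold kernelMean
  rw [← integral_const_mul, ← integral_const_mul, ← integral_add
    ((h'.integrable hγ j _ _).const_mul _) ((h'.integrable hγ (j + 1) _ _).const_mul _)]
  refine integral_congr_ae (ae_of_all _ fun s => ?_)
  simp [hDs]
  ring

/-- Integration by parts against the entropy kernel. -/
theorem kernelMean_one_eq (hγ : 1 < γ) {L' M' : ℝ} {f' : ℝ → ℝ} (h : IsBump L M f)
    (h' : IsBump L' M' f') (hf : ∀ x, HasDerivAt f (f' x) x) (U V : ℝ) :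
    (1 + theta γ) * kernelMean γ 1 f U V =
      theta γ * V * (kernelMean γ 0 f' U V - kernelMean γ 2 f' U V) := by
  have hl := kernelExp_gt hγ
  have hc := h.cont
  have hc' := h'.cont
  have hk := intervalIntegrable_kernel hγ
  have hi : ∀ g : ℝ → ℝ, Continuous g → IntervalIntegrable
      (fun s : ℝ => g s * (1 - s ^ 2) ^ kernelExp γ) volume (-1) 1 := fun g hg =>
    hk.continuousOn_mul hg.continuousOn
  -- The integrand is the derivative of (1 - s²)^(λ+1) f(U + V s), with λ the kernel exponent. This
  -- function vanishes at s = ±1 because λ + 1 > 0.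
  have e : ∫ s in (-1 : ℝ)..1, (V * ((s ^ 0 * f' (U + V * s) - s ^ 2 * f' (U + V * s))
      * (1 - s ^ 2) ^ kernelExp γ)
      - 2 * (kernelExp γ + 1) * (s ^ 1 * f (U + V * s) * (1 - s ^ 2) ^ kernelExp γ)) = 0 := by
    have hprim : ContinuousOn (fun s : ℝ => (1 - s ^ 2) ^ (kernelExp γ + 1) * f (U + V * s))
        (Icc (-1) 1) := by
      refine ContinuousOn.mul (ContinuousOn.rpow_const (by fun_prop) fun s _ =>
        Or.inr (by linarith)) (by fun_prop)
    have := intervalIntegral.integral_eq_sub_of_hasDerivAt_of_le (by norm_num) hprim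
      (f' := fun s => V * ((s ^ 0 * f' (U + V * s) - s ^ 2 * f' (U + V * s))
      * (1 - s ^ 2) ^ kernelExp γ)
      - 2 * (kernelExp γ + 1) * (s ^ 1 * f (U + V * s) * (1 - s ^ 2) ^ kernelExp γ)) ?_ ?_
    · rw [this]
      have h0 : kernelExp γ + 1 ≠ 0 := by linarith
      norm_num [Real.zero_rpow h0]
    · intro s hs
      have hp : 0 < 1 - s ^ 2 := by nlinarith [hs.1, hs.2]
      have d1 : HasDerivAt (fun s : ℝ => 1 - s ^ 2) (-(2 * s)) s := by
        simpa using (hasDerivAt_pow 2 s).const_sub 1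
      have d2 := d1.rpow_const (p := kernelExp γ + 1) (Or.inl hp.ne')
      have d3 : HasDerivAt (fun s : ℝ => f (U + V * s)) (f' (U + V * s) * V) s := by
        have := (hf (U + V * s)).comp s (((hasDerivAt_id s).const_mul V).const_add U)
        simpa [Function.comp_def] using this
      refine (d2.mul d3).congr_deriv ?_
      rw [add_sub_cancel_right, Real.rpow_add_one hp.ne']
      ring
    · exact ((hi _ (by fun_prop)).const_mul V).sub ((hi _ (by fun_prop)).const_mul _)
  rw [intervalIntegral.integral_sub ((hi _ (by fun_prop)).const_mul V)
    ((hi _ (by fun_prop)).const_mul _), intervalIntegral.integral_const_mul,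
    intervalIntegral.integral_const_mul] at e
  have e2 : ∫ s in (-1 : ℝ)..1, (s ^ 0 * f' (U + V * s) - s ^ 2 * f' (U + V * s))
      * (1 - s ^ 2) ^ kernelExp γ = kernelMean γ 0 f' U V - kernelMean γ 2 f' U V := by
    unfold kernelMean
    rw [← integral_sub (h'.integrable hγ 0 U V) (h'.integrable hγ 2 U V), integral_kernelMeasure]
  have e3 : ∫ s in (-1 : ℝ)..1, s ^ 1 * f (U + V * s) * (1 - s ^ 2) ^ kernelExp γ =
      kernelMean γ 1 f U V := by
    unfold kernelMean
    rw [integral_kernelMeasure]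
  rw [e2, e3] at e
  have := theta_mul_kernelExp hγ
  linear_combination (-theta γ) * e - kernelMean γ 1 f U V * this

end IsBump

/-- Uniform smallness of the kernel measure of the set where `U + V s` is bounded. -/
theorem exists_kernelMeasure_le (hγ : 1 < γ) (L : ℝ) {c : ℝ} (hc : 0 < c) :
    ∃ V₀, 0 < V₀ ∧ ∀ U V, V₀ ≤ V → (kernelMeasure γ).real {s | |U + V * s| ≤ L} ≤ c := by
  have hfin : ∫⁻ s in Ioc (-1 : ℝ) 1, ENNReal.ofReal ((1 - s ^ 2) ^ kernelExp γ) ≠ ⊤ := by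
    have := isFiniteMeasure_kernelMeasure hγ
    have e := measure_ne_top (kernelMeasure γ) univ
    unfold kernelMeasure at e
    rwa [withDensity_apply _ MeasurableSet.univ, Measure.restrict_univ] at e
  -- Absolute continuity of the integral: a set of small length has small kernel measure. The set in
  -- question lies in an interval of length 2|L|/V, whatever U is.
  obtain ⟨d, hd, h⟩ := exists_pos_setLIntegral_lt_of_measure_lt hfin
    (ENNReal.ofReal_pos.2 hc).ne'
  obtain ⟨e, he0, hed⟩ := ENNReal.lt_iff_exists_nnreal_btwn.1 hd
  have he : (0 : ℝ) < e := by exact_mod_cast he0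
  refine ⟨2 * (|L| + 1) / e, by positivity, fun U V hV => ?_⟩
  have hV0 : 0 < V := lt_of_lt_of_le (by positivity) hV
  have hm : MeasurableSet {s : ℝ | |U + V * s| ≤ L} :=
    measurableSet_le (by fun_prop) measurable_const
  have hsub : {s : ℝ | |U + V * s| ≤ L} ⊆ Icc ((-|L| - U) / V) ((|L| - U) / V) := by
    intro s hs
    have h1 : |U + V * s| ≤ |L| := le_trans hs (le_abs_self L)
    have h2 := abs_le.1 h1
    constructor
    · rw [div_le_iff₀ hV0]; linarith [h2.1]
    · rw [le_div_iff₀ hV0]; linarith [h2.2]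
  have hlt : (volume.restrict (Ioc (-1 : ℝ) 1)) {s : ℝ | |U + V * s| ≤ L} < d := by
    refine lt_of_le_of_lt ?_ hed
    refine (Measure.restrict_apply_le _ _).trans ((measure_mono hsub).trans ?_)
    rw [Real.volume_Icc, ← ENNReal.ofReal_coe_nnreal]
    refine ENNReal.ofReal_le_ofReal ?_
    rw [← sub_div, div_le_iff₀ hV0]
    rw [div_le_iff₀ he] at hV
    linarith
  have := h _ hlt
  unfold Measure.real kernelMeasure
  rw [withDensity_apply _ hm]
  exact ENNReal.toReal_le_of_le_ofReal hc.le this.le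

theorem isBump_of_compact {f : ℝ → ℝ} (hf : Continuous f) (hc : HasCompactSupport f) :
    ∃ L M, IsBump L M f := by
  obtain ⟨M, hM⟩ := hf.bounded_above_of_compact_support hc
  obtain ⟨L, hL⟩ := hc.isCompact.isBounded.subset_closedBall 0
  refine ⟨max L 0, M, hf, le_max_right _ _, hM, fun x hx => ?_⟩
  by_contra hne
  have := hL (subset_tsupport f hne)
  rw [mem_closedBall_zero_iff, Real.norm_eq_abs] at this
  exact absurd (this.trans (le_max_left _ _)) (not_le.2 hx)

/-! ### The balance law of a weak entropy -/

/-- A function with two derivatives, all of them bump functions. -/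
structure IsGenerator (L M : ℝ) (f f' f'' : ℝ → ℝ) : Prop where
  b0 : IsBump L M f
  b1 : IsBump L M f'
  b2 : IsBump L M f''
  d0 : ∀ x, HasDerivAt f (f' x) x
  d1 : ∀ x, HasDerivAt f' (f'' x) x

theorem IsBump.mono {L M L' M' : ℝ} {f : ℝ → ℝ} (h : IsBump L M f) (hL : L ≤ L') (hM : M ≤ M') :
    IsBump L' M' f :=
  ⟨h.cont, h.nonneg.trans hL, fun x => (h.bound x).trans hM, fun x hx => h.eq_zero x (hL.trans_lt hx)⟩

theorem exists_isGenerator {ψ : ℝ → ℝ} (hψ : ContDiff ℝ ∞ ψ) (hc : HasCompactSupport ψ) :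
    ∃ L M, IsGenerator L M ψ (deriv ψ) (deriv (deriv ψ)) := by
  have c1 : ContDiff ℝ ∞ (deriv ψ) := (contDiff_infty_iff_deriv.1 hψ).2
  have c2 : ContDiff ℝ ∞ (deriv (deriv ψ)) := (contDiff_infty_iff_deriv.1 c1).2
  obtain ⟨L₀, M₀, h0⟩ := isBump_of_compact hψ.continuous hc
  obtain ⟨L₁, M₁, h1⟩ := isBump_of_compact c1.continuous hc.deriv
  obtain ⟨L₂, M₂, h2⟩ := isBump_of_compact c2.continuous hc.deriv.deriv
  refine ⟨max L₀ (max L₁ L₂), max M₀ (max M₁ M₂), h0.mono ?_ ?_, h1.mono ?_ ?_, h2.mono ?_ ?_,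
    fun x => (hψ.differentiable (by simp) x).hasDerivAt,
    fun x => (c1.differentiable (by simp) x).hasDerivAt⟩ <;> simp

theorem entropy_eq (γ : ℝ) (ψ : ℝ → ℝ) (r m : ℝ) :
    entropy γ ψ r m = r * kernelMean γ 0 ψ (m / r) (r ^ theta γ) := by
  unfold entropy kernelMean
  rw [integral_kernelMeasure]
  simp only [pow_zero, one_mul]
  rfl

theorem entropyFlux_eq (hγ : 1 < γ) {L M : ℝ} {ψ : ℝ → ℝ} (h : IsBump L M ψ) (r m : ℝ) :
    entropyFlux γ ψ r m = r * (m / r * kernelMean γ 0 ψ (m / r) (r ^ theta γ)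
      + theta γ * r ^ theta γ * kernelMean γ 1 ψ (m / r) (r ^ theta γ)) := by
  unfold entropyFlux kernelMean
  rw [← integral_const_mul, ← integral_const_mul, ← integral_add
    ((h.integrable hγ 0 _ _).const_mul _) ((h.integrable hγ 1 _ _).const_mul _),
    integral_kernelMeasure]
  unfold kernelExp
  congr 1
  refine intervalIntegral.integral_congr fun s _ => ?_
  ring

namespace Flow
variable {γ : ℝ} {A : ℝ → ℝ} {ε δ a b : ℝ} (F : Flow γ A ε δ a b)

/-- The kernel average of `g` at a point of the flow. -/
def mean (j : ℕ) (g : ℝ → ℝ) (t x : ℝ) : ℝ :=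
  kernelMean γ j g (F.m t x / F.r t x) (F.r t x ^ theta γ)

/-- The entropy. -/
def eta (f : ℝ → ℝ) (t x : ℝ) : ℝ := F.r t x * F.mean 0 f t x

/-- The entropy flux. -/
def flux (f : ℝ → ℝ) (t x : ℝ) : ℝ :=
  F.r t x * (F.m t x / F.r t x * F.mean 0 f t x
    + theta γ * F.r t x ^ theta γ * F.mean 1 f t x)

/-- The derivative of the entropy with respect to the density at constant velocity. -/
def etaR (f f' : ℝ → ℝ) (t x : ℝ) : ℝ :=
  F.mean 0 f t x + theta γ * F.r t x ^ theta γ * F.mean 1 f' t x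

/-- The derivative of the entropy in `x`. -/
def etaX (f f' : ℝ → ℝ) (t x : ℝ) : ℝ :=
  F.etaR f f' t x * F.rx t x + F.r t x * F.mean 0 f' t x * F.ux t x

/-- The derivative of the entropy flux in `x`. -/
def fluxX (f f' : ℝ → ℝ) (t x : ℝ) : ℝ :=
  (F.m t x / F.r t x * F.etaR f f' t x
      + theta γ ^ 2 * (F.r t x ^ theta γ) ^ 2 * F.mean 0 f' t x) * F.rx t x
    + (F.r t x * F.etaR f f' t x + F.m t x * F.mean 0 f' t x) * F.ux t x

/-- The derivative of the entropy in `t`. -/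
def etaT (f f' : ℝ → ℝ) (t x : ℝ) : ℝ :=
  (F.etaR f f' t x - F.m t x / F.r t x * F.mean 0 f' t x) * F.rt t x
    + F.mean 0 f' t x * F.mt t x

/-- The Hessian of the entropy, applied to the derivative of the state. -/
def hess (f'' : ℝ → ℝ) (t x : ℝ) : ℝ :=
  F.mean 0 f'' t x * (theta γ ^ 2 * (F.r t x ^ theta γ) ^ 2 / F.r t x * F.rx t x ^ 2
      + F.r t x * F.ux t x ^ 2)
    + 2 * (theta γ * F.r t x ^ theta γ) * F.mean 1 f'' t x * F.rx t x * F.ux t x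

/-- The second derivative of the entropy in `x`. -/
def etaXX (f f' f'' : ℝ → ℝ) (t x : ℝ) : ℝ :=
  (F.etaR f f' t x - F.m t x / F.r t x * F.mean 0 f' t x) * F.rxx t x
    + F.mean 0 f' t x * F.mxx t x + F.hess f'' t x

/-- The part of the entropy production which is bounded in `L¹`. -/
def production (f f' f'' : ℝ → ℝ) (t x : ℝ) : ℝ :=
  -(slope A x * (F.m t x * F.etaR f f' t x))
    - 2 * δ * F.r t x * F.rx t x * F.mean 0 f' t x
    + ε * (slope A x * F.etaX f f' t x + slope' A x * F.m t x * F.mean 0 f' t x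
      - F.hess f'' t x)

section
variable {L M : ℝ} {f f' f'' : ℝ → ℝ}

theorem cont_theta : Continuous fun z : ℝ × ℝ => F.r z.1 z.2 ^ theta γ := F.cont_rpow _

theorem cont_mean (hγ : 1 < γ) (h : IsBump L M f) (j : ℕ) :
    Continuous fun z : ℝ × ℝ => F.mean j f z.1 z.2 :=
  (h.continuous_kernelMean hγ j).comp (F.cont_u.prodMk F.cont_theta)

theorem cont_eta (hγ : 1 < γ) (h : IsGenerator L M f f' f'') :
    Continuous fun z : ℝ × ℝ => F.eta f z.1 z.2 :=
  F.cont_r.mul (F.cont_mean hγ h.b0 0)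

theorem cont_flux (hγ : 1 < γ) (h : IsGenerator L M f f' f'') :
    Continuous fun z : ℝ × ℝ => F.flux f z.1 z.2 := by
  have h1 := F.cont_r
  have h2 := F.cont_u
  have h3 := F.cont_theta
  have h4 := F.cont_mean hγ h.b0 0
  have h5 := F.cont_mean hγ h.b0 1
  unfold flux
  fun_prop

theorem cont_etaR (hγ : 1 < γ) (h : IsGenerator L M f f' f'') :
    Continuous fun z : ℝ × ℝ => F.etaR f f' z.1 z.2 := by
  have h3 := F.cont_theta
  have h4 := F.cont_mean hγ h.b0 0
  have h5 := F.cont_mean hγ h.b1 1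
  unfold etaR
  fun_prop

theorem cont_etaX (hγ : 1 < γ) (h : IsGenerator L M f f' f'') :
    Continuous fun z : ℝ × ℝ => F.etaX f f' z.1 z.2 := by
  have h1 := F.cont_etaR hγ h
  have h2 := F.cont_rx
  have h3 := F.cont_ux
  have h4 := F.cont_mean hγ h.b1 0
  have h5 := F.cont_r
  unfold etaX
  fun_prop

theorem cont_fluxX (hγ : 1 < γ) (h : IsGenerator L M f f' f'') :
    Continuous fun z : ℝ × ℝ => F.fluxX f f' z.1 z.2 := by
  have h1 := F.cont_etaR hγ h
  have h2 := F.cont_rx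
  have h3 := F.cont_ux
  have h4 := F.cont_mean hγ h.b1 0
  have h5 := F.cont_r
  have h6 := F.cont_u
  have h7 := F.cont_theta
  have h8 := F.cont_m
  unfold fluxX
  fun_prop

theorem cont_etaT (hγ : 1 < γ) (h : IsGenerator L M f f' f'') :
    Continuous fun z : ℝ × ℝ => F.etaT f f' z.1 z.2 := by
  have h1 := F.cont_etaR hγ h
  have h2 := F.cont_rt
  have h3 := F.cont_mt
  have h4 := F.cont_mean hγ h.b1 0
  have h6 := F.cont_u
  unfold etaT
  fun_prop

theorem cont_hess (hγ : 1 < γ) (h : IsGenerator L M f f' f'') :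
    Continuous fun z : ℝ × ℝ => F.hess f'' z.1 z.2 := by
  have h1 := F.cont_theta
  have h2 := F.cont_rx
  have h3 := F.cont_ux
  have h4 := F.cont_mean hγ h.b2 0
  have h5 := F.cont_r
  have h6 := F.cont_mean hγ h.b2 1
  have h7 : Continuous fun z : ℝ × ℝ => theta γ ^ 2 * (F.r z.1 z.2 ^ theta γ) ^ 2 / F.r z.1 z.2 :=
    (by fun_prop : Continuous fun z : ℝ × ℝ => theta γ ^ 2 * (F.r z.1 z.2 ^ theta γ) ^ 2).div h5
      fun _ => F.r_ne_zero _ _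
  unfold hess
  fun_prop

theorem cont_etaXX (hγ : 1 < γ) (h : IsGenerator L M f f' f'') :
    Continuous fun z : ℝ × ℝ => F.etaXX f f' f'' z.1 z.2 := by
  have h1 := F.cont_etaR hγ h
  have h2 := F.cont_rxx
  have h3 := F.cont_mxx
  have h4 := F.cont_mean hγ h.b1 0
  have h5 := F.cont_u
  have h6 := F.cont_hess hγ h
  unfold etaXX
  fun_prop

theorem cont_production (hγ : 1 < γ) (hA : IsArea A) (h : IsGenerator L M f f' f'') :
    Continuous fun z : ℝ × ℝ => F.production f f' f'' z.1 z.2 := by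
  have h1 := F.cont_etaR hγ h
  have h2 := F.cont_rx
  have h3 := F.cont_r
  have h4 := F.cont_mean hγ h.b1 0
  have h5 := F.cont_m
  have h6 := F.cont_hess hγ h
  have h7 := F.cont_etaX hγ h
  have h8 := hA.continuous_slope
  have h9 := hA.continuous_slope'
  unfold production
  fun_prop

end

variable {t x : ℝ}

theorem hasDerivAt_theta (ht : 0 < t) (hx : x ∈ Ioo a b) :
    HasDerivAt (fun y => F.r t y ^ theta γ)
      (theta γ * F.r t x ^ theta γ / F.r t x * F.rx t x) x := by
  have hp := F.pos t x
  refine ((F.hrx t ht x hx).rpow_const (p := theta γ) (Or.inl hp.ne')).congr_deriv ?_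
  rw [Real.rpow_sub_one hp.ne']
  ring

theorem hasDerivAt_velocity (ht : 0 < t) (hx : x ∈ Ioo a b) :
    HasDerivAt (fun y => F.m t y / F.r t y) (F.ux t x) x := by
  have hp := F.pos t x
  refine ((F.hmx t ht x hx).div (F.hrx t ht x hx) hp.ne').congr_deriv ?_
  unfold ux
  field_simp

variable {L M : ℝ} {f f' f'' : ℝ → ℝ}

theorem hasDerivAt_mean (hγ : 1 < γ) (h : IsBump L M f) (h' : IsBump L M f')
    (hf : ∀ x, HasDerivAt f (f' x) x) (j : ℕ) (ht : 0 < t) (hx : x ∈ Ioo a b) :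
    HasDerivAt (F.mean j f t) (F.ux t x * F.mean j f' t x
      + theta γ * F.r t x ^ theta γ / F.r t x * F.rx t x * F.mean (j + 1) f' t x) x :=
  h.hasDerivAt_kernelMean hγ h' hf j (F.hasDerivAt_velocity ht hx) (F.hasDerivAt_theta ht hx)

theorem hasDerivAt_eta_fst (hγ : 1 < γ) (h : IsGenerator L M f f' f'') (ht : 0 < t)
    (hx : x ∈ Ioo a b) : HasDerivAt (fun s => F.eta f s x) (F.etaT f f' t x) t := by
  have hp := F.pos t x
  have hr := F.hrt t ht x hx
  have hm := F.hmt t ht x hx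
  have h1 := h.b0.hasDerivAt_kernelMean hγ h.b1 h.d0 0 (hm.div hr hp.ne')
    (hr.rpow_const (p := theta γ) (Or.inl hp.ne'))
  refine (hr.mul h1).congr_deriv ?_
  rw [Real.rpow_sub_one hp.ne']
  simp only [Pi.div_apply]
  unfold etaT etaR mean
  field_simp
  ring

theorem hasDerivAt_eta (hγ : 1 < γ) (h : IsGenerator L M f f' f'') (ht : 0 < t)
    (hx : x ∈ Ioo a b) : HasDerivAt (F.eta f t) (F.etaX f f' t x) x := by
  have hp := F.pos t x
  refine ((F.hrx t ht x hx).mul (F.hasDerivAt_mean hγ h.b0 h.b1 h.d0 0 ht hx)).congr_deriv ?_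
  unfold etaX etaR
  field_simp
  ring

theorem mean_one_eq (hγ : 1 < γ) (h : IsBump L M f) (h' : IsBump L M f')
    (hf : ∀ x, HasDerivAt f (f' x) x) (t x : ℝ) :
    (1 + theta γ) * F.mean 1 f t x =
      theta γ * F.r t x ^ theta γ * (F.mean 0 f' t x - F.mean 2 f' t x) :=
  h.kernelMean_one_eq hγ h' hf _ _

/-- Differentiation yields averages with s and s². The integration by parts identity eliminates the
latter and gives the compatibility relations of an entropy pair in the variables (ρ, u): q_ρ = u η_ρ
+ θ² ρ^(2θ-1) η_u and q_u = ρ η_ρ + u η_u. -/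
theorem hasDerivAt_flux (hγ : 1 < γ) (h : IsGenerator L M f f' f'') (ht : 0 < t)
    (hx : x ∈ Ioo a b) : HasDerivAt (F.flux f t) (F.fluxX f f' t x) x := by
  have hp := F.pos t x
  have h1 := F.mean_one_eq hγ h.b0 h.b1 h.d0 t x
  refine ((F.hrx t ht x hx).mul (((F.hasDerivAt_velocity ht hx).mul
    (F.hasDerivAt_mean hγ h.b0 h.b1 h.d0 0 ht hx)).add
    (((F.hasDerivAt_theta ht hx).const_mul (theta γ)).mul
    (F.hasDerivAt_mean hγ h.b0 h.b1 h.d0 1 ht hx)))).congr_deriv ?_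
  simp only [Pi.mul_apply, Pi.add_apply]
  unfold fluxX etaR
  field_simp
  linear_combination (theta γ * F.r t x ^ theta γ * F.rx t x * F.r t x) * h1

/-- The same identity, one derivative higher, removes the average of s² f''. The Hessian is thereby
a quadratic form in (ρ_x, u_x) with only the averages of f'' and s f'' as coefficients. The
derivative is first rewritten in conservative variables, for which the second derivatives ρ_xx and
m_xx are at hand. -/
theorem hasDerivAt_etaX (hγ : 1 < γ) (h : IsGenerator L M f f' f'') (ht : 0 < t)
    (hx : x ∈ Ioo a b) : HasDerivAt (F.etaX f f' t) (F.etaXX f f' f'' t x) x := by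
  have hp := F.pos t x
  have h1 := F.mean_one_eq hγ h.b1 h.b2 h.d1 t x
  have hN := (F.hasDerivAt_mean hγ h.b0 h.b1 h.d0 0 ht hx).add
    (((F.hasDerivAt_theta ht hx).const_mul (theta γ)).mul
    (F.hasDerivAt_mean hγ h.b1 h.b2 h.d1 1 ht hx))
  have h0 := F.hasDerivAt_mean hγ h.b1 h.b2 h.d1 0 ht hx
  have hall := ((hN.sub ((F.hasDerivAt_velocity ht hx).mul h0)).mul (F.hrxx t ht x hx)).add
    (h0.mul (F.hmxx t ht x hx))
  refine (hall.congr_of_eventuallyEq (Eventually.of_forall fun y => ?_)).congr_deriv ?_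
  · have hy := F.pos t y
    simp only [Pi.mul_apply, Pi.add_apply, Pi.sub_apply]
    unfold etaX etaR ux
    field_simp
    ring
  · simp only [Pi.mul_apply, Pi.add_apply, Pi.sub_apply]
    unfold etaXX hess etaR
    have hm : F.mx t x = F.m t x / F.r t x * F.rx t x + F.r t x * F.ux t x := by
      unfold ux; field_simp; ring
    rw [hm]
    field_simp
    linear_combination (theta γ * F.r t x ^ theta γ * F.rx t x ^ 2 * F.r t x) * h1

/-- The entropy balance. -/
theorem etaT_add_fluxX (hγ : 1 < γ) (f f' f'' : ℝ → ℝ) (ht : 0 < t) (hx : x ∈ Ioo a b) :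
    F.etaT f f' t x + F.fluxX f f' t x =
      ε * F.etaXX f f' f'' t x + F.production f f' f'' t x := by
  have hp := F.pos t x
  -- The normalization of κ means κγ = θ², so the polytropic part matches the kernel. The remaining
  -- 2δ r is not compatible with the flux and ends up in the production.
  have hpr : pressure' γ δ (F.r t x) =
      theta γ ^ 2 * (F.r t x ^ theta γ) ^ 2 + 2 * δ * F.r t x := by
    have e : F.r t x ^ (γ - 1) = (F.r t x ^ theta γ) ^ 2 := by
      rw [← Real.rpow_natCast, ← Real.rpow_mul hp.le]
      congr 1
      unfold theta
      push_cast
      ring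
    have hγ0 : γ ≠ 0 := by linarith
    unfold pressure'
    rw [e]
    unfold kappa theta
    field_simp
    ring
  have hm : F.mx t x = F.m t x / F.r t x * F.rx t x + F.r t x * F.ux t x := by
    unfold ux; field_simp; ring
  unfold etaT
  rw [F.continuity t ht x hx, F.momentum t ht x hx, hpr, hm]
  unfold fluxX etaXX production etaX
  field_simp
  ring

end Flow

/-! ### Estimates for the entropy balance -/

/-- A common bound for the kernel averages of the generator. -/
def kernelBound (γ L M : ℝ) : ℝ := M * (kernelMeasure γ).real univ * (L + 1)

namespace IsBump
variable {γ L M : ℝ} {f : ℝ → ℝ}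

theorem kernelBound_nonneg (γ : ℝ) (h : IsBump L M f) : 0 ≤ kernelBound γ L M := by
  have := h.M_nonneg
  have := h.nonneg
  unfold kernelBound
  positivity

theorem abs_kernelMean_le_kernelBound (hγ : 1 < γ) (h : IsBump L M f) (j : ℕ) (U V : ℝ) :
    |kernelMean γ j f U V| ≤ kernelBound γ L M := by
  have h0 := h.M_nonneg
  have h1 := h.nonneg
  refine (h.abs_kernelMean_le' hγ j U V).trans ?_
  unfold kernelBound
  exact le_mul_of_one_le_right (by positivity) (by linarith)

theorem abs_mul_kernelMean_le_kernelBound (hγ : 1 < γ) (h : IsBump L M f) (j : ℕ) (U : ℝ) {V : ℝ}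
    (hV : 0 ≤ V) : |U * kernelMean γ j f U V| ≤ kernelBound γ L M * (1 + V) := by
  have := isFiniteMeasure_kernelMeasure hγ
  have h0 := h.M_nonneg
  have h1 := h.nonneg
  refine (h.abs_mul_kernelMean_le hγ j U V).trans ?_
  rw [abs_of_nonneg hV]
  unfold kernelBound
  have h2 : (kernelMeasure γ).real {s | |U + V * s| ≤ L} ≤ (kernelMeasure γ).real univ :=
    measureReal_mono (subset_univ _)
  have h3 : 0 ≤ (kernelMeasure γ).real univ := measureReal_nonneg
  calc _ ≤ M * (L * (kernelMeasure γ).real univ + V * (kernelMeasure γ).real univ) := by gcongr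
    _ ≤ M * (L * (kernelMeasure γ).real univ + V * (kernelMeasure γ).real univ)
        + M * (kernelMeasure γ).real univ * (1 + L * V) := le_add_of_nonneg_right (by positivity)
    _ = _ := by ring

end IsBump

/-- The part of a number which exceeds the size `k`. -/
def excess (k y : ℝ) : ℝ := y - max (-k) (min y k)

theorem excess_eq_zero {k y : ℝ} (h : |y| ≤ k) : excess k y = 0 := by
  obtain ⟨h1, h2⟩ := abs_le.1 h
  unfold excess
  rw [min_eq_left h2, max_eq_right h1, sub_self]

theorem abs_excess_le {k : ℝ} (hk : 0 ≤ k) (y : ℝ) : |excess k y| ≤ |y| := by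
  unfold excess
  rcases le_total y k with h | h
  · rw [min_eq_left h]
    rcases le_total (-k) y with h' | h'
    · rw [max_eq_right h']; simp
    · rw [max_eq_left h', abs_of_nonpos (by linarith), abs_of_nonpos (by linarith)]; linarith
  · rw [min_eq_right h, max_eq_right (by linarith), abs_of_nonneg (by linarith),
      abs_of_nonneg (by linarith)]
    linarith

/-- The entropy pair is of lower order than `r ^ ((γ + 1) / 2)` for large densities. -/
theorem exists_excess_le {γ L M : ℝ} {f : ℝ → ℝ} (hγ : 1 < γ) (h : IsBump L M f) {c : ℝ}
    (hc : 0 < c) : ∃ k, 0 < k ∧ ∀ r m : ℝ, 0 < r →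
      excess k (r * kernelMean γ 0 f (m / r) (r ^ theta γ)) ^ 2 ≤ c ^ 2 * r ^ (γ + 1) ∧
      excess k (r * (m / r * kernelMean γ 0 f (m / r) (r ^ theta γ)
        + theta γ * r ^ theta γ * kernelMean γ 1 f (m / r) (r ^ theta γ))) ^ 2 ≤
          c ^ 2 * r ^ (γ + 1) := by
  have := isFiniteMeasure_kernelMeasure hγ
  have hM := h.M_nonneg
  have hL := h.nonneg
  have hθ := theta_pos hγ
  set C := kernelBound γ L M with hC
  have hC0 : 0 ≤ C := h.kernelBound_nonneg γ
  -- Chosen so that the terms carrying the small measure add up to (1 + θ) M d ≤ c/2.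
  set d := c / (2 * (M + 1) * (1 + theta γ)) with hd
  have hd0 : 0 < d := by positivity
  obtain ⟨V₀, hV0, hV⟩ := exists_kernelMeasure_le hγ L hd0
  -- Above V₁ the kernel measure is at most d, and also C ≤ (c/2) V, so that bounded multiples of r
  -- are small compared with r V = r^((γ+1)/2).
  set V₁ := max V₀ (2 * (C + 1) / c) with hV1
  have hV1p : 0 < V₁ := hV0.trans_le (le_max_left _ _)
  set r₁ := V₁ ^ (theta γ)⁻¹ with hr1
  have hr1p : 0 < r₁ := Real.rpow_pos_of_pos hV1p _
  -- The level k bounds both functions where V ≤ V₁, so their excess is zero there and only large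
  -- densities matter.
  refine ⟨(C + 1) * (1 + theta γ) * r₁ * (1 + V₁), by positivity, fun r m hr => ?_⟩
  set V := r ^ theta γ with hVdef
  have hVp : 0 < V := Real.rpow_pos_of_pos hr _
  set U := m / r with hU
  have e2 : (r * V) ^ 2 = r ^ (γ + 1) := by
    rw [hVdef, mul_comm, ← Real.rpow_add_one hr.ne', ← Real.rpow_natCast, ← Real.rpow_mul hr.le]
    congr 1
    unfold theta
    push_cast
    ring
  have b0 : |kernelMean γ 0 f U V| ≤ C := h.abs_kernelMean_le_kernelBound hγ 0 U V
  have b1 : |kernelMean γ 1 f U V| ≤ C := h.abs_kernelMean_le_kernelBound hγ 1 U V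
  have b2 : |U * kernelMean γ 0 f U V| ≤ C * (1 + V) :=
    h.abs_mul_kernelMean_le_kernelBound hγ 0 U hVp.le
  have hk : 0 ≤ (C + 1) * (1 + theta γ) * r₁ * (1 + V₁) := by positivity
  have hfin : ∀ y, (V ≤ V₁ → |y| ≤ (C + 1) * (1 + theta γ) * r₁ * (1 + V₁)) →
      (V₁ ≤ V → |y| ≤ c * (r * V)) →
      excess ((C + 1) * (1 + theta γ) * r₁ * (1 + V₁)) y ^ 2 ≤ c ^ 2 * r ^ (γ + 1) := by
    intro y h1 h2
    rcases le_total V V₁ with hle | hle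
    · rw [excess_eq_zero (h1 hle), zero_pow two_ne_zero]
      positivity
    · rw [← e2, ← mul_pow, ← sq_abs]
      exact pow_le_pow_left₀ (abs_nonneg _) ((abs_excess_le hk y).trans (h2 hle)) 2
  have hr_le : V ≤ V₁ → r ≤ r₁ := by
    intro hle
    have : r = V ^ (theta γ)⁻¹ := (Real.rpow_rpow_inv hr.le hθ.ne').symm
    rw [this]
    exact Real.rpow_le_rpow hVp.le hle (by positivity)
  have hlarge : V₁ ≤ V → C ≤ c / 2 * V := by
    intro hle
    have h1 : 2 * (C + 1) / c ≤ V := (le_max_right _ _).trans hle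
    rw [div_le_iff₀ hc] at h1
    linarith
  constructor
  · refine hfin _ (fun hle => ?_) fun hle => ?_
    · have := hr_le hle
      rw [abs_mul, abs_of_pos hr]
      calc r * |kernelMean γ 0 f U V| ≤ r₁ * C := by gcongr
        _ ≤ (C + 1) * 1 * r₁ * 1 := by linarith
        _ ≤ _ := by gcongr <;> linarith
    · rw [abs_mul, abs_of_pos hr]
      have h1 := hlarge hle
      have h2 : 0 ≤ c * V := by positivity
      calc r * |kernelMean γ 0 f U V| ≤ r * C := by gcongr
        _ ≤ r * (c * V) := by gcongr; linarith
        _ = _ := by ring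
  · refine hfin _ (fun hle => ?_) fun hle => ?_
    · have := hr_le hle
      rw [abs_mul, abs_of_pos hr]
      calc r * |U * kernelMean γ 0 f U V + theta γ * V * kernelMean γ 1 f U V|
          ≤ r * (C * (1 + V) + theta γ * V * C) := by
            gcongr
            refine (abs_add_le _ _).trans (add_le_add b2 ?_)
            rw [abs_mul, abs_of_pos (by positivity : 0 < theta γ * V)]
            gcongr
        _ ≤ r₁ * ((C + 1) * (1 + V₁) + theta γ * (1 + V₁) * (C + 1)) := by
            gcongr <;> linarith
        _ = _ := by ring
    · have h3 := hV U V ((le_max_left _ _).trans hle)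
      have h1 := hlarge hle
      have b3 : |U * kernelMean γ 0 f U V| ≤ C + M * (V * d) := by
        refine (h.abs_mul_kernelMean_le hγ 0 U V).trans ?_
        rw [abs_of_pos hVp, mul_add]
        refine add_le_add ?_ (by gcongr)
        have h4 : 0 ≤ (kernelMeasure γ).real univ := measureReal_nonneg
        have h5 : 0 ≤ M * (kernelMeasure γ).real univ := by positivity
        rw [hC]
        unfold kernelBound
        linarith
      have b4 : |kernelMean γ 1 f U V| ≤ M * d :=
        (h.abs_kernelMean_le hγ 1 U V).trans (by gcongr)
      have hdM : (1 + theta γ) * (M * d) ≤ c / 2 := by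
        have : (1 + theta γ) * ((M + 1) * d) = c / 2 := by rw [hd]; field_simp
        have : 0 ≤ (1 + theta γ) * d := by positivity
        linarith
      rw [abs_mul, abs_of_pos hr]
      calc r * |U * kernelMean γ 0 f U V + theta γ * V * kernelMean γ 1 f U V|
          ≤ r * ((C + M * (V * d)) + theta γ * V * (M * d)) := by
            gcongr
            refine (abs_add_le _ _).trans (add_le_add b3 ?_)
            rw [abs_mul, abs_of_pos (by positivity : 0 < theta γ * V)]
            gcongr
        _ = r * (C + V * ((1 + theta γ) * (M * d))) := by ring
        _ ≤ r * (c / 2 * V + V * (c / 2)) := by gcongr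
        _ = _ := by ring

/-! ### Pointwise bounds for the terms of the entropy balance -/

namespace Flow
variable {γ : ℝ} {A : ℝ → ℝ} {ε δ a b : ℝ} (F : Flow γ A ε δ a b)
variable {L M : ℝ} {f f' f'' : ℝ → ℝ}

/-- A majorant for the derivatives of the entropy pair. -/
def gradient (t x : ℝ) : ℝ :=
  (1 + F.r t x ^ theta γ) ^ 2 * |F.rx t x| + F.r t x * (1 + F.r t x ^ theta γ) * |F.ux t x|

/-- A majorant for the entropy production, with `s = ε ^ (1 / 4)`. -/
def majorant (s t x : ℝ) : ℝ :=
  1 + F.r t x ^ (γ + 1) + F.sz t x + ε * F.dissipation t x + s ^ 6 * F.logGradient t x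

theorem theta_pos' (t x : ℝ) : 0 < F.r t x ^ theta γ := Real.rpow_pos_of_pos (F.pos t x) _

theorem sq_theta (t x : ℝ) : F.r t x * (F.r t x ^ theta γ) ^ 2 = F.r t x ^ γ := by
  have hr := F.pos t x
  rw [← Real.rpow_natCast, ← Real.rpow_mul hr.le, mul_comm, ← Real.rpow_add_one hr.ne']
  congr 1
  unfold theta
  push_cast
  ring

theorem sq_theta_div (t x : ℝ) :
    (F.r t x ^ theta γ) ^ 2 / F.r t x = F.r t x ^ (γ - 2) := by
  have hr := F.pos t x
  rw [← Real.rpow_natCast, ← Real.rpow_mul hr.le, ← Real.rpow_sub_one hr.ne']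
  congr 1
  unfold theta
  push_cast
  ring

/-- The dissipation is the diagonal form in (ρ_x, u_x) against which the Hessian of any weak entropy
is compared, plus the nonnegative contribution of δ. -/
theorem quadratic_add_eq_dissipation (hγ : 1 < γ) (t x : ℝ) :
    theta γ ^ 2 * (F.r t x ^ theta γ) ^ 2 / F.r t x * F.rx t x ^ 2 + F.r t x * F.ux t x ^ 2
      + 2 * δ * F.rx t x ^ 2 = F.dissipation t x := by
  have e : kappa γ * γ = theta γ ^ 2 := by
    have hγ0 : γ ≠ 0 := by linarith
    unfold kappa theta
    field_simp
    ring
  rw [mul_div_assoc, F.sq_theta_div]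
  unfold dissipation enthalpy'
  rw [← e]
  ring

theorem weight_le_size (hδ : 0 ≤ δ) (t x : ℝ) :
    F.r t x * (1 + F.r t x ^ theta γ) ^ 2 ≤ 2 * F.sz t x := by
  have hr := F.pos t x
  have hV := F.theta_pos' t x
  have h1 := F.sq_theta t x
  have h2 : F.r t x + F.r t x ^ γ ≤ F.sz t x := by
    unfold sz Nozzle.size
    have : 0 ≤ F.m t x ^ 2 / F.r t x := by positivity
    have : 0 ≤ δ * F.r t x ^ 2 := by positivity
    linarith
  have h3 : F.r t x * (1 + F.r t x ^ theta γ) ^ 2 = 2 * (F.r t x + F.r t x *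
      (F.r t x ^ theta γ) ^ 2) - F.r t x * (1 - F.r t x ^ theta γ) ^ 2 := by ring
  have h4 : 0 ≤ F.r t x * (1 - F.r t x ^ theta γ) ^ 2 := by positivity
  rw [h3, h1]
  linarith

theorem abs_etaR_le (hγ : 1 < γ) (h : IsGenerator L M f f' f'') (t x : ℝ) :
    |F.etaR f f' t x| ≤ kernelBound γ L M * (1 + theta γ) * (1 + F.r t x ^ theta γ) := by
  have hV := F.theta_pos' t x
  have hθ := theta_pos hγ
  have hC := h.b0.kernelBound_nonneg γ
  unfold etaR mean
  calc _ ≤ kernelBound γ L M + theta γ * F.r t x ^ theta γ * kernelBound γ L M := by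
        refine (abs_add_le _ _).trans (add_le_add (h.b0.abs_kernelMean_le_kernelBound hγ _ _ _) ?_)
        rw [abs_mul, abs_of_pos (by positivity : 0 < theta γ * F.r t x ^ theta γ)]
        gcongr
        exact h.b1.abs_kernelMean_le_kernelBound hγ _ _ _
    _ ≤ kernelBound γ L M + theta γ * F.r t x ^ theta γ * kernelBound γ L M
        + kernelBound γ L M * (theta γ + F.r t x ^ theta γ) :=
        le_add_of_nonneg_right (by positivity)
    _ = _ := by ring

/-- The velocity is not bounded; the compact support of the generator exchanges it for one more
factor 1 + r^θ. -/
theorem abs_velocity_mul_etaR_le (hγ : 1 < γ) (h : IsGenerator L M f f' f'') (t x : ℝ) :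
    |F.m t x / F.r t x * F.etaR f f' t x| ≤
      kernelBound γ L M * (1 + theta γ) * (1 + F.r t x ^ theta γ) ^ 2 := by
  have hV := F.theta_pos' t x
  have hθ := theta_pos hγ
  have hC := h.b0.kernelBound_nonneg γ
  have e : F.m t x / F.r t x * F.etaR f f' t x = F.m t x / F.r t x * F.mean 0 f t x
      + theta γ * F.r t x ^ theta γ * (F.m t x / F.r t x * F.mean 1 f' t x) := by
    unfold etaR; ring
  rw [e]
  unfold mean
  have hV1 : 1 ≤ 1 + F.r t x ^ theta γ := by linarith
  calc _ ≤ kernelBound γ L M * (1 + F.r t x ^ theta γ) + theta γ * F.r t x ^ theta γ *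
        (kernelBound γ L M * (1 + F.r t x ^ theta γ)) := by
        refine (abs_add_le _ _).trans (add_le_add
          (h.b0.abs_mul_kernelMean_le_kernelBound hγ _ _ hV.le) ?_)
        rw [abs_mul, abs_of_pos (by positivity : 0 < theta γ * F.r t x ^ theta γ)]
        gcongr
        exact h.b1.abs_mul_kernelMean_le_kernelBound hγ _ _ hV.le
    _ ≤ kernelBound γ L M * (1 + F.r t x ^ theta γ) + theta γ * F.r t x ^ theta γ *
        (kernelBound γ L M * (1 + F.r t x ^ theta γ)) + kernelBound γ L M *
        (1 + F.r t x ^ theta γ) * (theta γ + F.r t x ^ theta γ) :=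
        le_add_of_nonneg_right (by positivity)
    _ = _ := by ring

theorem abs_mean_le (hγ : 1 < γ) {g : ℝ → ℝ} (h : IsBump L M g) (j : ℕ) (t x : ℝ) :
    |F.mean j g t x| ≤ kernelBound γ L M :=
  h.abs_kernelMean_le_kernelBound hγ _ _ _

theorem abs_m_mul_mean_le (hγ : 1 < γ) {g : ℝ → ℝ} (h : IsBump L M g) (j : ℕ) (t x : ℝ) :
    |F.m t x * F.mean j g t x| ≤
      kernelBound γ L M * (F.r t x * (1 + F.r t x ^ theta γ)) := by
  have hr := F.pos t x
  have e : F.m t x * F.mean j g t x = F.r t x * (F.m t x / F.r t x * F.mean j g t x) := by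
    field_simp
  rw [e, abs_mul, abs_of_pos hr]
  calc _ ≤ F.r t x * (kernelBound γ L M * (1 + F.r t x ^ theta γ)) := by
        gcongr
        exact h.abs_mul_kernelMean_le_kernelBound hγ _ _ (F.theta_pos' t x).le
    _ = _ := by ring

theorem abs_etaX_le (hγ : 1 < γ) (h : IsGenerator L M f f' f'') (t x : ℝ) :
    |F.etaX f f' t x| ≤ kernelBound γ L M * (1 + theta γ) * F.gradient t x := by
  have hr := F.pos t x
  have hV := F.theta_pos' t x
  have hθ := theta_pos hγ
  have hC := h.b0.kernelBound_nonneg γ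
  unfold etaX gradient
  calc _ ≤ kernelBound γ L M * (1 + theta γ) * (1 + F.r t x ^ theta γ) * |F.rx t x|
        + F.r t x * kernelBound γ L M * |F.ux t x| := by
        refine (abs_add_le _ _).trans (add_le_add ?_ ?_)
        · rw [abs_mul]
          exact mul_le_mul_of_nonneg_right (F.abs_etaR_le hγ h t x) (abs_nonneg _)
        · rw [abs_mul, abs_mul, abs_of_pos hr]
          have := F.abs_mean_le hγ h.b1 0 t x
          gcongr
    _ = kernelBound γ L M * ((1 + theta γ) * ((1 + F.r t x ^ theta γ) * 1 * |F.rx t x|)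
        + 1 * (F.r t x * 1 * |F.ux t x|)) := by ring
    _ ≤ kernelBound γ L M * ((1 + theta γ) * ((1 + F.r t x ^ theta γ) *
        (1 + F.r t x ^ theta γ) * |F.rx t x|)
        + (1 + theta γ) * (F.r t x * (1 + F.r t x ^ theta γ) * |F.ux t x|)) := by
        gcongr <;> linarith
    _ = _ := by ring

theorem abs_fluxX_le (hγ : 1 < γ) (h : IsGenerator L M f f' f'') (t x : ℝ) :
    |F.fluxX f f' t x| ≤ kernelBound γ L M * (2 + theta γ + theta γ ^ 2) * F.gradient t x := by
  have hr := F.pos t x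
  have hV := F.theta_pos' t x
  have hθ := theta_pos hγ
  have hC := h.b0.kernelBound_nonneg γ
  unfold fluxX gradient
  set V := F.r t x ^ theta γ with hVd
  set C := kernelBound γ L M
  have h1 : |F.m t x / F.r t x * F.etaR f f' t x + theta γ ^ 2 * V ^ 2 * F.mean 0 f' t x| ≤
      C * (1 + theta γ) * (1 + V) ^ 2 + theta γ ^ 2 * (1 + V) ^ 2 * C := by
    refine (abs_add_le _ _).trans (add_le_add (F.abs_velocity_mul_etaR_le hγ h t x) ?_)
    rw [abs_mul, abs_of_pos (by positivity : 0 < theta γ ^ 2 * V ^ 2)]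
    have := F.abs_mean_le hγ h.b1 0 t x
    gcongr
    linarith
  have h2 : |F.r t x * F.etaR f f' t x + F.m t x * F.mean 0 f' t x| ≤
      F.r t x * (C * (1 + theta γ) * (1 + V)) + C * (F.r t x * (1 + V)) := by
    refine (abs_add_le _ _).trans (add_le_add ?_ (F.abs_m_mul_mean_le hγ h.b1 0 t x))
    rw [abs_mul, abs_of_pos hr]
    exact mul_le_mul_of_nonneg_left (F.abs_etaR_le hγ h t x) hr.le
  calc _ ≤ (C * (1 + theta γ) * (1 + V) ^ 2 + theta γ ^ 2 * (1 + V) ^ 2 * C) * |F.rx t x|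
        + (F.r t x * (C * (1 + theta γ) * (1 + V)) + C * (F.r t x * (1 + V))) * |F.ux t x| := by
        refine (abs_add_le _ _).trans (add_le_add ?_ ?_)
        · rw [abs_mul]; gcongr
        · rw [abs_mul]; gcongr
    _ ≤ (C * (1 + theta γ) * (1 + V) ^ 2 + theta γ ^ 2 * (1 + V) ^ 2 * C) * |F.rx t x|
        + (F.r t x * (C * (1 + theta γ) * (1 + V)) + C * (F.r t x * (1 + V))) * |F.ux t x|
        + (C * (1 + V) ^ 2 * |F.rx t x| + theta γ ^ 2 * C * (F.r t x * (1 + V)) * |F.ux t x|) :=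
        le_add_of_nonneg_right (by positivity)
    _ = _ := by ring

/-- By the arithmetic-geometric mean inequality the mixed term is dominated by the diagonal form of
the mechanical energy. The averages of f'' are bounded, so every weak entropy generated by such an f
dissipates no faster than a multiple of the energy. -/
theorem abs_hess_le (hγ : 1 < γ) (hδ : 0 ≤ δ) (h : IsGenerator L M f f' f'') (t x : ℝ) :
    |F.hess f'' t x| ≤ 2 * kernelBound γ L M * F.dissipation t x := by
  have hr := F.pos t x
  have hV := F.theta_pos' t x
  have hθ := theta_pos hγ
  have hC := h.b0.kernelBound_nonneg γ
  have hq := F.quadratic_add_eq_dissipation hγ t x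
  unfold hess
  set V := F.r t x ^ theta γ with hVd
  set C := kernelBound γ L M
  set q := theta γ ^ 2 * V ^ 2 / F.r t x * F.rx t x ^ 2 + F.r t x * F.ux t x ^ 2 with hqd
  have hq0 : 0 ≤ q := by positivity
  have hcross : 2 * (theta γ * V) * |F.rx t x| * |F.ux t x| ≤ q := by
    have e : q - 2 * (theta γ * V) * |F.rx t x| * |F.ux t x| =
        F.r t x * (theta γ * V / F.r t x * |F.rx t x| - |F.ux t x|) ^ 2 := by
      rw [hqd, ← sq_abs (F.rx t x), ← sq_abs (F.ux t x)]
      field_simp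
      ring
    have : 0 ≤ F.r t x * (theta γ * V / F.r t x * |F.rx t x| - |F.ux t x|) ^ 2 := by positivity
    linarith
  have hd : q ≤ F.dissipation t x := by
    have : 0 ≤ 2 * δ * F.rx t x ^ 2 := by positivity
    linarith
  calc _ ≤ C * q + C * (2 * (theta γ * V) * |F.rx t x| * |F.ux t x|) := by
        refine (abs_add_le _ _).trans (add_le_add ?_ ?_)
        · rw [abs_mul, abs_of_nonneg hq0]
          exact mul_le_mul_of_nonneg_right (F.abs_mean_le hγ h.b2 0 t x) hq0
        · rw [abs_mul, abs_mul, abs_mul, abs_of_pos (by positivity : 0 < 2 * (theta γ * V))]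
          have := F.abs_mean_le hγ h.b2 1 t x
          calc _ ≤ 2 * (theta γ * V) * C * |F.rx t x| * |F.ux t x| := by gcongr
            _ = _ := by ring
    _ ≤ C * q + C * q := by gcongr
    _ ≤ C * F.dissipation t x + C * F.dissipation t x := by gcongr
    _ = _ := by ring

theorem sq_le_majorant {r : ℝ} (hγ : 1 < γ) (hr : 0 < r) : r ^ 2 ≤ 1 + r ^ (γ + 1) := by
  rcases le_total r 1 with h | h
  · have : 0 < r ^ (γ + 1) := Real.rpow_pos_of_pos hr _
    have : r ^ 2 ≤ 1 := pow_le_one₀ hr.le h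
    linarith
  · have : r ^ (2 : ℝ) ≤ r ^ (γ + 1) := Real.rpow_le_rpow_of_exponent_le h (by linarith)
    rw [Real.rpow_two] at this
    linarith

/-- The three parts of the gradient are treated differently: |ρ_x| by the logarithmic gradient,
ρ^(2θ)|ρ_x| and ρ(1 + ρ^θ)|u_x| by the dissipation. The last two gain ε^(1/2) and the first only
ε^(1/4), which determines the power of s. -/
theorem mul_gradient_le (hγ : 1 < γ) (hδ : 0 ≤ δ) {s : ℝ} (hs : 0 < s) (hs1 : s ≤ 1)
    (hsε : s ^ 4 = ε) (t x : ℝ) :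
    ε * F.gradient t x ≤ (8 + (theta γ)⁻¹ ^ 2) * (s * F.majorant s t x) := by
  have hr := F.pos t x
  have hV := F.theta_pos' t x
  have hθ := theta_pos hγ
  have hε : 0 < ε := by rw [← hsε]; positivity
  have hq := F.quadratic_add_eq_dissipation hγ t x
  have hw := F.weight_le_size hδ t x
  have hsq := sq_le_majorant hγ hr
  have hrγ : F.r t x * (F.r t x ^ theta γ) ^ 2 ≤ F.sz t x := by
    rw [F.sq_theta]; exact F.rpow_le_size hδ t x
  have hG : F.logGradient t x * (1 + F.r t x) ^ 2 = |F.rx t x| ^ 2 := by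
    unfold logGradient
    rw [sq_abs, ← mul_pow]
    congr 1
    field_simp
  unfold gradient majorant
  have hsz : 0 ≤ F.sz t x := size_nonneg hδ hr _
  have hG0 : 0 ≤ F.logGradient t x := sq_nonneg _
  have hr1 : 0 < F.r t x ^ (γ + 1) := Real.rpow_pos_of_pos hr _
  generalize F.logGradient t x = G at *
  generalize F.sz t x = S at *
  generalize F.dissipation t x = D at *
  generalize F.r t x ^ (γ + 1) = P at *
  generalize F.r t x ^ theta γ = V at *
  generalize F.r t x = r at *
  have hD1 : V ^ 2 / r * |F.rx t x| ^ 2 ≤ (theta γ)⁻¹ ^ 2 * D := by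
    have h1 : theta γ ^ 2 * (V ^ 2 / r * |F.rx t x| ^ 2) ≤ D := by
      have e : theta γ ^ 2 * (V ^ 2 / r * |F.rx t x| ^ 2) =
        theta γ ^ 2 * V ^ 2 / r * F.rx t x ^ 2 := by rw [sq_abs]; ring
      have : 0 ≤ r * F.ux t x ^ 2 := by positivity
      have : 0 ≤ 2 * δ * F.rx t x ^ 2 := by positivity
      linarith
    rw [inv_pow, inv_mul_eq_div, le_div_iff₀ (by positivity)]
    linarith
  have hD2 : r * |F.ux t x| ^ 2 ≤ D := by
    rw [sq_abs]
    have : 0 ≤ theta γ ^ 2 * V ^ 2 / r * F.rx t x ^ 2 := by positivity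
    have : 0 ≤ 2 * δ * F.rx t x ^ 2 := by positivity
    linarith
  have hD0 : 0 ≤ D := le_trans (by positivity) hD2
  have hX0 := abs_nonneg (F.rx t x)
  have hY0 := abs_nonneg (F.ux t x)
  generalize |F.rx t x| = X at *
  generalize |F.ux t x| = Y at *
  subst hsε
  -- Here |ρ_x| = √G (1 + r), and Young's inequality pairs s³√G with 1 + r. The weight s⁶ = ε^(3/2)
  -- is exactly the one for which the logarithmic gradient is bounded.
  have g1 : 2 * (s ^ 4 * X) ≤ s * (s ^ 6 * G + (1 + r) ^ 2) := by
    have hX : X = √G * (1 + r) := by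
      have : X ^ 2 = (√G * (1 + r)) ^ 2 := by rw [mul_pow, Real.sq_sqrt hG0, hG]
      exact (pow_left_inj₀ hX0 (by positivity) (by norm_num)).1 this
    have e : s * (s ^ 6 * G + (1 + r) ^ 2) - 2 * (s ^ 4 * X) =
        s * (s ^ 3 * √G - (1 + r)) ^ 2 := by
      rw [hX]
      nth_rewrite 1 [← Real.sq_sqrt hG0]
      ring
    have : 0 ≤ s * (s ^ 3 * √G - (1 + r)) ^ 2 := by positivity
    linarith
  have g2 : 2 * (s ^ 4 * (V ^ 2 * X)) ≤ s * (s ^ 4 * ((theta γ)⁻¹ ^ 2 * D) + S) := by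
    have e : s ^ 2 * (s ^ 4 * (V ^ 2 / r * X ^ 2) + r * V ^ 2) - 2 * (s ^ 4 * (V ^ 2 * X)) =
        s ^ 2 * V ^ 2 / r * (s ^ 2 * X - r) ^ 2 := by
      field_simp
      ring
    have h1 : 0 ≤ s ^ 2 * V ^ 2 / r * (s ^ 2 * X - r) ^ 2 := by positivity
    calc _ ≤ s ^ 2 * (s ^ 4 * (V ^ 2 / r * X ^ 2) + r * V ^ 2) := by linarith
      _ ≤ s * (s ^ 4 * (V ^ 2 / r * X ^ 2) + r * V ^ 2) := by
          have : 0 ≤ s ^ 4 * (V ^ 2 / r * X ^ 2) + r * V ^ 2 := by positivity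
          refine mul_le_mul_of_nonneg_right ?_ this
          rw [sq]
          exact mul_le_of_le_one_left hs.le hs1
      _ ≤ _ := by gcongr
  have g3 : 2 * (s ^ 4 * (r * (1 + V) * Y)) ≤ s * (s ^ 4 * D + 2 * S) := by
    have e : s ^ 2 * (s ^ 4 * (r * Y ^ 2) + r * (1 + V) ^ 2) - 2 * (s ^ 4 * (r * (1 + V) * Y)) =
        s ^ 2 * r * (s ^ 2 * Y - (1 + V)) ^ 2 := by ring
    have h1 : 0 ≤ s ^ 2 * r * (s ^ 2 * Y - (1 + V)) ^ 2 := by positivity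
    calc _ ≤ s ^ 2 * (s ^ 4 * (r * Y ^ 2) + r * (1 + V) ^ 2) := by linarith
      _ ≤ s * (s ^ 4 * (r * Y ^ 2) + r * (1 + V) ^ 2) := by
          have : 0 ≤ s ^ 4 * (r * Y ^ 2) + r * (1 + V) ^ 2 := by positivity
          refine mul_le_mul_of_nonneg_right ?_ this
          rw [sq]
          exact mul_le_of_le_one_left hs.le hs1
      _ ≤ _ := by gcongr
  have g4 : (1 + V) ^ 2 * X ≤ 2 * X + 2 * (V ^ 2 * X) := by
    have : 0 ≤ (1 - V) ^ 2 * X := by positivity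
    linarith
  have g5 : (1 + r) ^ 2 ≤ 4 + 2 * P := by
    have : 0 ≤ (1 - r) ^ 2 := sq_nonneg _
    linarith
  calc s ^ 4 * ((1 + V) ^ 2 * X + r * (1 + V) * Y)
      ≤ s ^ 4 * (2 * X + 2 * (V ^ 2 * X) + r * (1 + V) * Y) := by gcongr
    _ ≤ s * (s ^ 6 * G + (1 + r) ^ 2) + s * (s ^ 4 * ((theta γ)⁻¹ ^ 2 * D) + S)
        + s * (s ^ 4 * D + 2 * S) := by
        have : 0 ≤ s * (s ^ 4 * D + 2 * S) := by positivity
        linarith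
    _ ≤ s * (s ^ 6 * G + (4 + 2 * P)) + s * (s ^ 4 * ((theta γ)⁻¹ ^ 2 * D) + S)
        + s * (s ^ 4 * D + 2 * S) := by gcongr
    _ ≤ s * (s ^ 6 * G + (4 + 2 * P)) + s * (s ^ 4 * ((theta γ)⁻¹ ^ 2 * D) + S)
        + s * (s ^ 4 * D + 2 * S) + s * (4 + 6 * P + 5 * S + 7 * (s ^ 4 * D) + 7 * (s ^ 6 * G)
          + (theta γ)⁻¹ ^ 2 * (1 + P + S + s ^ 6 * G)) := le_add_of_nonneg_right (by positivity)
    _ = _ := by ring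

/-- The entropy production is controlled by the majorant. -/
theorem abs_production_le (hγ : 1 < γ) (hδ : 0 ≤ δ) (h : IsGenerator L M f f' f'') {Qa B s : ℝ}
    (hQ : ∀ x, |slope A x| ≤ Qa) (hQ' : ∀ x, |slope' A x| ≤ Qa) (hB : δ / ε ≤ B) (hs : 0 < s)
    (hs1 : s ≤ 1) (hsε : s ^ 4 = ε) (t x : ℝ) :
    |F.production f f' f'' t x| ≤ kernelBound γ L M * (2 * Qa * (1 + theta γ) + (2 + B)
      + Qa * (1 + theta γ) * (8 + (theta γ)⁻¹ ^ 2) + 2 * Qa + 2) * F.majorant s t x := by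
  have hr := F.pos t x
  have hV := F.theta_pos' t x
  have hθ := theta_pos hγ
  have hC := h.b0.kernelBound_nonneg γ
  have hε : 0 < ε := by rw [← hsε]; positivity
  have hε1 : ε ≤ 1 := by rw [← hsε]; exact pow_le_one₀ hs.le hs1
  have hQa : 0 ≤ Qa := (abs_nonneg _).trans (hQ 0)
  have hB0 : 0 ≤ B := le_trans (by positivity) hB
  have hsz : 0 ≤ F.sz t x := size_nonneg hδ hr _
  have hD0 : 0 ≤ F.dissipation t x := F.dissipation_nonneg hγ hδ t x
  have hG0 : 0 ≤ F.logGradient t x := sq_nonneg _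
  have hP0 : 0 < F.r t x ^ (γ + 1) := Real.rpow_pos_of_pos hr _
  have hm1 : 1 + F.r t x ^ (γ + 1) ≤ F.majorant s t x := by
    unfold majorant
    have : 0 ≤ ε * F.dissipation t x := by positivity
    have : 0 ≤ s ^ 6 * F.logGradient t x := by positivity
    linarith
  have hm2 : F.sz t x ≤ F.majorant s t x := by
    unfold majorant
    have : 0 ≤ ε * F.dissipation t x := by positivity
    have : 0 ≤ s ^ 6 * F.logGradient t x := by positivity
    linarith
  have hm3 : ε * F.dissipation t x ≤ F.majorant s t x := by
    unfold majorant
    have : 0 ≤ s ^ 6 * F.logGradient t x := by positivity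
    linarith
  have hgr := F.mul_gradient_le hγ hδ hs hs1 hsε t x
  have hw := F.weight_le_size hδ t x
  have hM0 : 0 ≤ F.majorant s t x := hsz.trans hm2
  have p1 : |F.m t x * F.etaR f f' t x| ≤
      kernelBound γ L M * (1 + theta γ) * (2 * F.majorant s t x) := by
    have e : F.m t x * F.etaR f f' t x = F.r t x * (F.m t x / F.r t x * F.etaR f f' t x) := by
      field_simp
    rw [e, abs_mul, abs_of_pos hr]
    calc _ ≤ F.r t x * (kernelBound γ L M * (1 + theta γ) * (1 + F.r t x ^ theta γ) ^ 2) := by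
          gcongr; exact F.abs_velocity_mul_etaR_le hγ h t x
      _ = kernelBound γ L M * (1 + theta γ) * (F.r t x * (1 + F.r t x ^ theta γ) ^ 2) := by ring
      _ ≤ _ := mul_le_mul_of_nonneg_left (hw.trans (by linarith)) (by positivity)
  -- Young's inequality 2δ r|r_x| ≤ εδ r_x² + (δ/ε) r². The first term is dissipation; the second
  -- uses that δ/ε is bounded and that r² ≤ 1 + r^(γ+1).
  have p2 : |2 * δ * F.r t x * F.rx t x * F.mean 0 f' t x| ≤
      kernelBound γ L M * ((2 + B) * F.majorant s t x) := by
    have h1 : 2 * δ * F.r t x * |F.rx t x| ≤ (2 + B) * F.majorant s t x := by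
      have e : ε * (δ * F.rx t x ^ 2) + δ / ε * F.r t x ^ 2 - 2 * δ * F.r t x * |F.rx t x| =
          δ / ε * (ε * |F.rx t x| - F.r t x) ^ 2 := by
        rw [← sq_abs (F.rx t x)]
        field_simp
        ring
      have h2 : 0 ≤ δ / ε * (ε * |F.rx t x| - F.r t x) ^ 2 := by positivity
      have h3 : δ * F.rx t x ^ 2 ≤ F.dissipation t x := by
        rw [← F.quadratic_add_eq_dissipation hγ t x]
        have : 0 ≤ theta γ ^ 2 * (F.r t x ^ theta γ) ^ 2 / F.r t x * F.rx t x ^ 2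
          + F.r t x * F.ux t x ^ 2 := by positivity
        have : 0 ≤ δ * F.rx t x ^ 2 := by positivity
        linarith
      calc _ ≤ ε * (δ * F.rx t x ^ 2) + δ / ε * F.r t x ^ 2 := by linarith
        _ ≤ ε * F.dissipation t x + B * (1 + F.r t x ^ (γ + 1)) := by
            gcongr
            exact sq_le_majorant hγ hr
        _ ≤ F.majorant s t x + B * F.majorant s t x := by gcongr
        _ ≤ _ := by linarith
    rw [abs_mul, abs_mul, abs_of_nonneg (by positivity : 0 ≤ 2 * δ * F.r t x), mul_comm]
    exact mul_le_mul (F.abs_mean_le hγ h.b1 0 t x) h1 (by positivity) hC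
  have p3 : ε * |F.etaX f f' t x| ≤
      kernelBound γ L M * (1 + theta γ) * ((8 + (theta γ)⁻¹ ^ 2) * F.majorant s t x) := by
    calc _ ≤ ε * (kernelBound γ L M * (1 + theta γ) * F.gradient t x) := by
          gcongr; exact F.abs_etaX_le hγ h t x
      _ = kernelBound γ L M * (1 + theta γ) * (ε * F.gradient t x) := by ring
      _ ≤ kernelBound γ L M * (1 + theta γ) *
          ((8 + (theta γ)⁻¹ ^ 2) * (1 * F.majorant s t x)) := by
          refine mul_le_mul_of_nonneg_left (hgr.trans ?_) (by positivity)
          gcongr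
      _ = _ := by ring
  have p4 : |F.m t x * F.mean 0 f' t x| ≤ kernelBound γ L M * (2 * F.majorant s t x) := by
    refine (F.abs_m_mul_mean_le hγ h.b1 0 t x).trans ?_
    refine mul_le_mul_of_nonneg_left ?_ hC
    calc F.r t x * (1 + F.r t x ^ theta γ) = F.r t x * (1 + F.r t x ^ theta γ) ^ 1 := by ring
      _ ≤ F.r t x * (1 + F.r t x ^ theta γ) ^ 2 := by
          gcongr
          · linarith
          · norm_num
      _ ≤ _ := by linarith
  have p5 : ε * |F.hess f'' t x| ≤ kernelBound γ L M * (2 * F.majorant s t x) := by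
    calc _ ≤ ε * (2 * kernelBound γ L M * F.dissipation t x) := by
          gcongr; exact F.abs_hess_le hγ hδ h t x
      _ = kernelBound γ L M * (2 * (ε * F.dissipation t x)) := by ring
      _ ≤ _ := by gcongr
  unfold production
  set C := kernelBound γ L M
  set J := F.majorant s t x
  calc _ ≤ Qa * (C * (1 + theta γ) * (2 * J)) + C * ((2 + B) * J)
        + (Qa * (C * (1 + theta γ) * ((8 + (theta γ)⁻¹ ^ 2) * J)) + Qa * (C * (2 * J))
          + C * (2 * J)) := by
        refine (abs_add_le _ _).trans (add_le_add ((abs_sub _ _).trans (add_le_add ?_ p2)) ?_)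
        · rw [abs_neg, abs_mul]
          exact mul_le_mul (hQ x) p1 (abs_nonneg _) hQa
        · rw [abs_mul, abs_of_pos hε]
          calc _ ≤ ε * (Qa * |F.etaX f f' t x| + Qa * |F.m t x * F.mean 0 f' t x|
                + |F.hess f'' t x|) := by
                gcongr
                refine (abs_sub _ _).trans (add_le_add ((abs_add_le _ _).trans
                  (add_le_add ?_ ?_)) le_rfl)
                · rw [abs_mul]
                  exact mul_le_mul_of_nonneg_right (hQ x) (abs_nonneg _)
                · rw [mul_assoc, abs_mul]
                  exact mul_le_mul_of_nonneg_right (hQ' x) (abs_nonneg _)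
            _ = Qa * (ε * |F.etaX f f' t x|) + Qa * (ε * |F.m t x * F.mean 0 f' t x|)
                + ε * |F.hess f'' t x| := by ring
            _ ≤ Qa * (C * (1 + theta γ) * ((8 + (theta γ)⁻¹ ^ 2) * J))
                + Qa * (1 * (C * (2 * J))) + C * (2 * J) := by gcongr
            _ = _ := by ring
    _ = _ := by ring

theorem cont_majorant (s : ℝ) : Continuous fun z : ℝ × ℝ => F.majorant s z.1 z.2 := by
  have h1 := F.cont_rpow (γ + 1)
  have h2 := F.cont_sz
  have h3 := F.cont_dissipation
  have h4 := F.cont_logGradient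
  unfold majorant
  fun_prop

/-- Each summand of the majorant belongs to one a priori bound: the L^(γ+1) estimate, the energy,
the dissipation and the logarithmic gradient. The first and last hold only on the interval shortened
by 1. -/
theorem integral_majorant_le (hγ : 1 < γ) (hA : IsArea A) (C T R : ℝ) (hT : 0 ≤ T) (hR : 1 ≤ R) :
    ∃ C', 0 ≤ C' ∧ ∀ {ε δ a b : ℝ} (F : Flow γ A ε δ a b), 0 < ε → ε ≤ 1 → 0 ≤ δ →
      F.EnergyBounded T R C → ∀ s, 0 < s → s ^ 4 = ε →
      ∫ t in (0 : ℝ)..T, ∫ x in -(R - 1)..R - 1, F.majorant s t x ≤ C' := by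
  obtain ⟨C₁, hC₁, h1⟩ := integral_rpow_le hγ hA C T R hT hR
  obtain ⟨C₂, hC₂, h2⟩ := integral_logGradient_le hγ hA C T R hT hR
  refine ⟨T * (2 * (R - 1)) + C₁ + T * |C| + |C| + C₂, by
    have : 0 ≤ R - 1 := by linarith
    positivity, ?_⟩
  intro ε δ a b F hε hε1 hδ hE s hs hsε
  have hRR : -(R - 1) ≤ R - 1 := by linarith
  have k1 := F.cont_rpow (γ + 1)
  have k2 := F.cont_sz
  have k3 := F.cont_dissipation
  have k4 := F.cont_logGradient
  have i1 := continuous_integral_fst (f := fun t x => F.r t x ^ (γ + 1)) k1 (-(R - 1)) (R - 1)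
  have i2 := continuous_integral_fst k2 (-(R - 1)) (R - 1)
  have i3 := continuous_integral_fst k3 (-(R - 1)) (R - 1)
  have i4 := continuous_integral_fst k4 (-(R - 1)) (R - 1)
  have hin : ∀ t, ∫ x in -(R - 1)..R - 1, F.majorant s t x =
      2 * (R - 1) + (∫ x in -(R - 1)..R - 1, F.r t x ^ (γ + 1))
        + (∫ x in -(R - 1)..R - 1, F.sz t x) + ε * (∫ x in -(R - 1)..R - 1, F.dissipation t x)
        + s ^ 6 * ∫ x in -(R - 1)..R - 1, F.logGradient t x := by
    intro t
    have j1 := continuous_slice (f := fun t x => F.r t x ^ (γ + 1)) k1 t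
    have j2 := continuous_slice k2 t
    have j3 := continuous_slice k3 t
    have j4 := continuous_slice k4 t
    unfold majorant
    rw [intervalIntegral.integral_add (Continuous.intervalIntegrable (by fun_prop) _ _)
        (Continuous.intervalIntegrable (by fun_prop) _ _),
      intervalIntegral.integral_add (Continuous.intervalIntegrable (by fun_prop) _ _)
        (Continuous.intervalIntegrable (by fun_prop) _ _),
      intervalIntegral.integral_add (Continuous.intervalIntegrable (by fun_prop) _ _)
        (Continuous.intervalIntegrable (by fun_prop) _ _),
      intervalIntegral.integral_add (Continuous.intervalIntegrable (by fun_prop) _ _)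
        (Continuous.intervalIntegrable (by fun_prop) _ _),
      intervalIntegral.integral_const_mul, intervalIntegral.integral_const_mul,
      intervalIntegral.integral_const, smul_eq_mul]
    ring
  simp only [hin]
  rw [intervalIntegral.integral_add (Continuous.intervalIntegrable (by fun_prop) _ _)
        (Continuous.intervalIntegrable (by fun_prop) _ _),
      intervalIntegral.integral_add (Continuous.intervalIntegrable (by fun_prop) _ _)
        (Continuous.intervalIntegrable (by fun_prop) _ _),
      intervalIntegral.integral_add (Continuous.intervalIntegrable (by fun_prop) _ _)
        (Continuous.intervalIntegrable (by fun_prop) _ _),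
      intervalIntegral.integral_add (Continuous.intervalIntegrable (by fun_prop) _ _)
        (Continuous.intervalIntegrable (by fun_prop) _ _),
      intervalIntegral.integral_const_mul, intervalIntegral.integral_const_mul,
      intervalIntegral.integral_const_mul, intervalIntegral.integral_const, smul_eq_mul, sub_zero]
  have b1 := h1 F hε hε1 hδ hE
  have hmono : ∀ {g : ℝ → ℝ}, Continuous g → (∀ x, 0 ≤ g x) →
      ∫ x in -(R - 1)..R - 1, g x ≤ ∫ x in -R..R, g x := fun {g} hg h0 =>
    intervalIntegral.integral_mono_interval (by linarith) (by linarith) (by linarith)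
      (ae_of_all _ fun x => h0 x) (hg.intervalIntegrable _ _)
  have b2 : ∫ t in (0 : ℝ)..T, ∫ x in -(R - 1)..R - 1, F.sz t x ≤ T * |C| := by
    have : ∫ t in (0 : ℝ)..T, ∫ x in -(R - 1)..R - 1, F.sz t x ≤ ∫ t in (0 : ℝ)..T, |C| := by
      refine intervalIntegral.integral_mono_on hT (i2.intervalIntegrable _ _) (by simp)
        fun t ht => ?_
      refine (hmono (continuous_slice k2 t) fun x => size_nonneg hδ (F.pos t x) _).trans ?_
      exact (hE.size t ht).trans (le_abs_self C)
    simpa using this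
  have b3 : ε * ∫ t in (0 : ℝ)..T, ∫ x in -(R - 1)..R - 1, F.dissipation t x ≤ |C| := by
    refine le_trans (mul_le_mul_of_nonneg_left ?_ hε.le) (hE.diss.trans (le_abs_self C))
    refine intervalIntegral.integral_mono_on hT (i3.intervalIntegrable _ _)
      ((continuous_integral_fst k3 _ _).intervalIntegrable _ _) fun t _ => ?_
    exact hmono (continuous_slice k3 t) fun x => F.dissipation_nonneg hγ hδ t x
  -- The bound ε² ∫∫ G ≤ C₂ √ε reads s⁸ ∫∫ G ≤ C₂ s²; division by s² leaves the weight s⁶.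
  have b4 : s ^ 6 * ∫ t in (0 : ℝ)..T, ∫ x in -(R - 1)..R - 1, F.logGradient t x ≤ C₂ := by
    have h3 := h2 F hε hε1 hδ hE
    have e : √ε = s ^ 2 := by
      rw [← hsε, show s ^ 4 = (s ^ 2) ^ 2 by ring, Real.sqrt_sq (by positivity)]
    have e2 : ε ^ 2 = s ^ 8 := by rw [← hsε]; ring
    rw [e, e2] at h3
    have hs2 : 0 < s ^ 2 := by positivity
    refine le_of_mul_le_mul_left ?_ hs2
    linarith
  linarith

end Flow

/-! ### Integrals of continuous functions over compact sets -/

section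
variable {K S : Set (ℝ × ℝ)} {f g : ℝ × ℝ → ℝ}

theorem integrableOn_of_continuous (hK : IsCompact K) (hf : Continuous f) : IntegrableOn f K :=
  hf.continuousOn.integrableOn_compact hK

theorem abs_setIntegral_mul_le (hK : IsCompact K) (hf : Continuous f) (hg : Continuous g)
    {D E : ℝ} (hD : 0 ≤ D) (hE : 0 ≤ E) (h1 : ∫ z in K, f z ^ 2 ≤ D ^ 2)
    (h2 : ∫ z in K, g z ^ 2 ≤ E ^ 2) : |∫ z in K, f z * g z| ≤ D * E := by
  have i1 : IntegrableOn (fun z => f z ^ 2) K := integrableOn_of_continuous hK (by fun_prop)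
  have i2 : IntegrableOn (fun z => g z ^ 2) K := integrableOn_of_continuous hK (by fun_prop)
  have i3 : IntegrableOn (fun z => f z * g z) K := integrableOn_of_continuous hK (by fun_prop)
  have key : ∀ s : ℝ, 0 ≤ (∫ z in K, g z ^ 2) * (s * s) + (2 * ∫ z in K, f z * g z) * s
      + ∫ z in K, f z ^ 2 := by
    intro s
    have h0 : 0 ≤ ∫ z in K, (s ^ 2 * g z ^ 2 + 2 * s * (f z * g z) + f z ^ 2) :=
      integral_nonneg fun z => by
        have : s ^ 2 * g z ^ 2 + 2 * s * (f z * g z) + f z ^ 2 = (s * g z + f z) ^ 2 := by ring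
        show 0 ≤ s ^ 2 * g z ^ 2 + 2 * s * (f z * g z) + f z ^ 2
        rw [this]
        positivity
    rw [integral_add (integrableOn_of_continuous hK (by fun_prop)) i1, integral_add (i2.const_mul _)
      (i3.const_mul _), integral_const_mul, integral_const_mul] at h0
    linarith
  have hdis := discrim_le_zero key
  unfold discrim at hdis
  refine abs_le_of_sq_le_sq ?_ (by positivity)
  have h3 : 0 ≤ ∫ z in K, f z ^ 2 := integral_nonneg fun z => sq_nonneg _
  have h4 : (∫ z in K, g z ^ 2) * ∫ z in K, f z ^ 2 ≤ E ^ 2 * D ^ 2 := by gcongr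
  rw [mul_pow]
  linarith

/-- Extension by zero outside S and translation invariance of Lebesgue measure. -/
theorem setIntegral_shift_le (hK : IsCompact K) (hS : IsCompact S) (hf : Continuous f)
    (h0 : ∀ z, 0 ≤ f z) (v : ℝ × ℝ) (h : ∀ z ∈ K, z + v ∈ S) :
    ∫ z in K, f (z + v) ≤ ∫ z in S, f z := by
  have hSm := hS.measurableSet
  have hi : Integrable (S.indicator f) :=
    (integrable_indicator_iff hSm).2 (integrableOn_of_continuous hS hf)
  rw [← integral_indicator hSm, ← integral_add_right_eq_self (S.indicator f) v,
    ← integral_indicator hK.measurableSet]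
  refine integral_mono ((integrable_indicator_iff hK.measurableSet).2
    (integrableOn_of_continuous hK (by fun_prop))) (hi.comp_add_right v) fun z => ?_
  by_cases hz : z ∈ K
  · rw [indicator_of_mem hz, indicator_of_mem (h z hz)]
  · rw [indicator_of_notMem hz]
    exact indicator_nonneg (fun z _ => h0 z) _

/-- The `L¹` modulus of continuity of a differentiable function. -/
theorem setIntegral_sub_shift_le (hK : IsCompact K) (hS : IsCompact S) {f' : ℝ × ℝ → ℝ}
    (hf : Continuous f) (hf' : Continuous f') {y : ℝ}
    (hd : ∀ z ∈ K, ∀ s ∈ Icc (0 : ℝ) 1,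
      HasDerivAt (fun x => f (z.1, x)) (f' (z + (0, s * y))) (z.2 + s * y))
    (hKS : ∀ z ∈ K, ∀ s ∈ Icc (0 : ℝ) 1, z + (0, s * y) ∈ S) :
    ∫ z in K, |f (z + (0, y)) - f z| ≤ |y| * ∫ z in S, |f' z| := by
  have hIK : IsCompact (K ×ˢ Icc (0 : ℝ) 1) := hK.prod isCompact_Icc
  have c1 : Continuous fun p : (ℝ × ℝ) × ℝ => |f' (p.1 + (0, p.2 * y))| := by fun_prop
  have hint : Integrable (Function.uncurry fun (z : ℝ × ℝ) (s : ℝ) => |f' (z + (0, s * y))|)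
      ((volume.restrict K).prod (volume.restrict (Icc (0 : ℝ) 1))) := by
    rw [Measure.prod_restrict]
    exact c1.continuousOn.integrableOn_compact hIK
  have hpt : ∀ z ∈ K, |f (z + (0, y)) - f z| ≤ |y| * ∫ s in Icc (0 : ℝ) 1, |f' (z + (0, s * y))| := by
    intro z hz
    have c2 : Continuous fun s : ℝ => f' (z + (0, s * y)) := by fun_prop
    have e : ∫ s in (0 : ℝ)..1, f' (z + (0, s * y)) * y = f (z + (0, y)) - f z := by
      have := intervalIntegral.integral_eq_sub_of_hasDerivAt (a := 0) (b := 1)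
        (f := fun s : ℝ => f (z.1, z.2 + s * y)) (f' := fun s => f' (z + (0, s * y)) * y)
        (fun s hs => ?_) ((c2.mul continuous_const).intervalIntegrable _ _)
      · rw [this]
        congr 1
        · congr 1
          ext <;> simp
        · congr 1
          ext <;> simp
      · rw [uIcc_of_le zero_le_one] at hs
        have h1 : HasDerivAt (fun s : ℝ => z.2 + s * y) y s := by
          simpa using ((hasDerivAt_id s).mul_const y).const_add z.2
        exact (hd z hz s hs).comp s h1
    rw [← e, intervalIntegral.integral_mul_const, abs_mul, mul_comm]
    gcongr
    rw [intervalIntegral.integral_of_le zero_le_one, ← integral_Icc_eq_integral_Ioc]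
    exact abs_integral_le_integral_abs
  calc _ ≤ ∫ z in K, |y| * ∫ s in Icc (0 : ℝ) 1, |f' (z + (0, s * y))| := by
        refine setIntegral_mono_on (integrableOn_of_continuous hK (by fun_prop))
          (hint.integral_prod_left.const_mul |y|) hK.measurableSet hpt
    _ = |y| * ∫ s in Icc (0 : ℝ) 1, ∫ z in K, |f' (z + (0, s * y))| := by
        rw [integral_const_mul, integral_integral_swap hint]
    _ ≤ |y| * ∫ s in Icc (0 : ℝ) 1, ∫ z in S, |f' z| := by
        refine mul_le_mul_of_nonneg_left ?_ (abs_nonneg _)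
        refine setIntegral_mono_on hint.integral_prod_right (by simp) measurableSet_Icc
          fun s hs => ?_
        exact setIntegral_shift_le hK hS hf'.abs (fun z => abs_nonneg _) _ fun z hz => hKS z hz s hs
    _ = _ := by simp

end

/-! ### Weak form of the balance law -/

/-- A viscous balance law in the half-strip `(0, ∞) × (a, b)`. -/
structure Balance (ε a b : ℝ) (η q ηx qx μ : ℝ × ℝ → ℝ) : Prop where
  cont_η : Continuous η
  cont_q : Continuous q
  cont_ηx : Continuous ηx
  cont_qx : Continuous qx
  cont_μ : Continuous μ
  dη : ∀ z : ℝ × ℝ, 0 < z.1 → z.2 ∈ Ioo a b → HasDerivAt (fun x => η (z.1, x)) (ηx z) z.2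
  dq : ∀ z : ℝ × ℝ, 0 < z.1 → z.2 ∈ Ioo a b → HasDerivAt (fun x => q (z.1, x)) (qx z) z.2
  eq : ∃ ηt ηxx : ℝ × ℝ → ℝ, Continuous ηt ∧ Continuous ηxx ∧
    ∀ z : ℝ × ℝ, 0 < z.1 → z.2 ∈ Ioo a b →
      HasDerivAt (fun t => η (t, z.2)) (ηt z) z.1 ∧
      HasDerivAt (fun x => ηx (z.1, x)) (ηxx z) z.2 ∧
      ηt z + qx z = ε * ηxx z + μ z

/-- The law has constant coefficients, the area terms being part of μ, so it is invariant under
translations in x. -/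
theorem Balance.shift {ε a b : ℝ} {η q ηx qx μ : ℝ × ℝ → ℝ} (h : Balance ε a b η q ηx qx μ)
    (y : ℝ) : Balance ε (a - y) (b - y) (fun z => η (z + (0, y))) (fun z => q (z + (0, y)))
      (fun z => ηx (z + (0, y))) (fun z => qx (z + (0, y))) (fun z => μ (z + (0, y))) := by
  have h1 := h.cont_η
  have h2 := h.cont_q
  have h3 := h.cont_ηx
  have h4 := h.cont_qx
  have h5 := h.cont_μ
  have key : ∀ {f f' : ℝ × ℝ → ℝ} (z : ℝ × ℝ),
      HasDerivAt (fun x => f ((z + (0, y)).1, x)) (f' (z + (0, y))) (z + (0, y)).2 →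
      HasDerivAt (fun x => f ((z.1, x) + (0, y))) (f' (z + (0, y))) z.2 := by
    intro f f' z hz
    have := hz.comp_add_const z.2 y
    refine this.congr_of_eventuallyEq (Eventually.of_forall fun x => ?_)
    simp
  have hmem : ∀ z : ℝ × ℝ, 0 < z.1 → z.2 ∈ Ioo (a - y) (b - y) →
      0 < (z + (0, y)).1 ∧ (z + (0, y)).2 ∈ Ioo a b := by
    intro z hz hz2
    refine ⟨by simpa using hz, ?_, ?_⟩
    · have := hz2.1; simp; linarith
    · have := hz2.2; simp; linarith
  obtain ⟨ηt, ηxx, ct, cxx, he⟩ := h.eq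
  refine ⟨by fun_prop, by fun_prop, by fun_prop, by fun_prop, by fun_prop, fun z hz hz2 => ?_,
    fun z hz hz2 => ?_, fun z => ηt (z + (0, y)), fun z => ηxx (z + (0, y)), by fun_prop,
    by fun_prop, fun z hz hz2 => ?_⟩
  · exact key z (h.dη _ (hmem z hz hz2).1 (hmem z hz hz2).2)
  · exact key z (h.dq _ (hmem z hz hz2).1 (hmem z hz hz2).2)
  · obtain ⟨e1, e2, e3⟩ := he _ (hmem z hz hz2).1 (hmem z hz hz2).2
    refine ⟨?_, key z e2, e3⟩
    have e4 : (z + (0, y)).1 = z.1 := by simp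
    rw [e4] at e1
    refine e1.congr_of_eventuallyEq (Eventually.of_forall fun x => ?_)
    simp

section
variable {φ : ℝ × ℝ → ℝ}

theorem hasDerivAt_partialX (hφ : Differentiable ℝ φ) (t x : ℝ) :
    HasDerivAt (fun y => φ (t, y)) (partialX φ (t, x)) x := by
  have h1 : HasDerivAt (fun y : ℝ => (t, y)) ((0 : ℝ), (1 : ℝ)) x :=
    (hasDerivAt_const x t).prodMk (hasDerivAt_id x)
  exact (hφ (t, x)).hasFDerivAt.comp_hasDerivAt x h1

theorem hasDerivAt_partialT (hφ : Differentiable ℝ φ) (t x : ℝ) :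
    HasDerivAt (fun s => φ (s, x)) (partialT φ (t, x)) t := by
  have h1 : HasDerivAt (fun s : ℝ => (s, x)) ((1 : ℝ), (0 : ℝ)) t :=
    (hasDerivAt_id t).prodMk (hasDerivAt_const t x)
  exact (hφ (t, x)).hasFDerivAt.comp_hasDerivAt t h1

theorem continuous_partialX (hφ : ContDiff ℝ ∞ φ) : Continuous (partialX φ) :=
  (hφ.continuous_fderiv (by simp)).clm_apply continuous_const

theorem continuous_partialT (hφ : ContDiff ℝ ∞ φ) : Continuous (partialT φ) :=
  (hφ.continuous_fderiv (by simp)).clm_apply continuous_const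

theorem partialX_eq_zero {z : ℝ × ℝ} (hz : z ∉ tsupport φ) : partialX φ z = 0 := by
  unfold partialX
  rw [fderiv_of_notMem_tsupport (𝕜 := ℝ) hz]
  rfl

theorem partialT_eq_zero {z : ℝ × ℝ} (hz : z ∉ tsupport φ) : partialT φ z = 0 := by
  unfold partialT
  rw [fderiv_of_notMem_tsupport (𝕜 := ℝ) hz]
  rfl

theorem eventually_eq_zero {z : ℝ × ℝ} (hz : z ∉ tsupport φ) : ∀ᶠ w in 𝓝 z, φ w = 0 := by
  have := (isClosed_tsupport φ).isOpen_compl.mem_nhds hz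
  filter_upwards [this] with w hw
  exact image_eq_zero_of_notMem_tsupport hw

/-- A continuous function which vanishes off a compact set is integrable. -/
theorem integrable_of_vanishing {X : Type*} [TopologicalSpace X] [MeasurableSpace X]
    [OpensMeasurableSpace X] [T2Space X] {ν : Measure X} [IsFiniteMeasureOnCompacts ν]
    {K : Set X} (hK : IsCompact K) {g : X → ℝ} (hg : Continuous g) (h : ∀ z, z ∉ K → g z = 0) :
    Integrable g ν :=
  hg.integrable_of_hasCompactSupport (HasCompactSupport.intro hK h)

/-- Integration by parts when f is differentiable only on the support of φ: at the other points the
product f φ vanishes nearby, so its derivative is zero there and no extension of f' is needed. -/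
theorem integral_partialX_add (hφ : ContDiff ℝ ∞ φ) (hc : HasCompactSupport φ)
    {f f' : ℝ × ℝ → ℝ} (hf : Continuous f) (hf' : Continuous f')
    (hd : ∀ z ∈ tsupport φ, HasDerivAt (fun x => f (z.1, x)) (f' z) z.2) :
    ∫ z, (f z * partialX φ z + f' z * φ z) = 0 := by
  have c1 := continuous_partialX hφ
  have c2 := hφ.continuous
  have hdφ := hφ.differentiable (by simp)
  have hsl : ∀ t : ℝ, IsCompact (Prod.snd '' tsupport φ) := fun t => hc.isCompact.image continuous_snd
  have hv : ∀ z, z ∉ tsupport φ → f z * partialX φ z + f' z * φ z = 0 := fun z hz => by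
    rw [partialX_eq_zero hz, image_eq_zero_of_notMem_tsupport hz, mul_zero, mul_zero, add_zero]
  have hint : Integrable (fun z => f z * partialX φ z + f' z * φ z) :=
    integrable_of_vanishing hc.isCompact (by fun_prop) hv
  have hout : ∀ t x, x ∉ Prod.snd '' tsupport φ → (t, x) ∉ tsupport φ :=
    fun t x hx h => hx ⟨_, h, rfl⟩
  rw [Measure.volume_eq_prod] at hint ⊢
  rw [integral_prod _ hint]
  refine integral_eq_zero_of_ae (ae_of_all _ fun t => ?_)
  refine integral_eq_zero_of_hasDerivAt_of_integrable (f := fun x => f (t, x) * φ (t, x))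
    (fun x => ?_) ?_ ?_
  · by_cases hx : (t, x) ∈ tsupport φ
    · refine ((hd _ hx).mul (hasDerivAt_partialX hdφ t x)).congr_deriv ?_
      ring
    · rw [hv _ hx]
      refine (hasDerivAt_const x (0 : ℝ)).congr_of_eventuallyEq ?_
      have h1 : Tendsto (fun y : ℝ => (t, y)) (𝓝 x) (𝓝 (t, x)) :=
        (by fun_prop : Continuous fun y : ℝ => (t, y)).tendsto x
      filter_upwards [h1.eventually (eventually_eq_zero hx)] with y hy
      rw [hy, mul_zero]
  · exact integrable_of_vanishing (hsl t) (by fun_prop) fun x hx => hv _ (hout t x hx)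
  · exact integrable_of_vanishing (hsl t) (by fun_prop) fun x hx => by
      rw [image_eq_zero_of_notMem_tsupport (hout t x hx), mul_zero]

theorem integral_partialT_add (hφ : ContDiff ℝ ∞ φ) (hc : HasCompactSupport φ)
    {f f' : ℝ × ℝ → ℝ} (hf : Continuous f) (hf' : Continuous f')
    (hd : ∀ z ∈ tsupport φ, HasDerivAt (fun t => f (t, z.2)) (f' z) z.1) :
    ∫ z, (f z * partialT φ z + f' z * φ z) = 0 := by
  have c1 := continuous_partialT hφ
  have c2 := hφ.continuous
  have hdφ := hφ.differentiable (by simp)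
  have hsl : ∀ x : ℝ, IsCompact (Prod.fst '' tsupport φ) := fun x => hc.isCompact.image continuous_fst
  have hv : ∀ z, z ∉ tsupport φ → f z * partialT φ z + f' z * φ z = 0 := fun z hz => by
    rw [partialT_eq_zero hz, image_eq_zero_of_notMem_tsupport hz, mul_zero, mul_zero, add_zero]
  have hint : Integrable (fun z => f z * partialT φ z + f' z * φ z) :=
    integrable_of_vanishing hc.isCompact (by fun_prop) hv
  have hout : ∀ t x, t ∉ Prod.fst '' tsupport φ → (t, x) ∉ tsupport φ :=
    fun t x hx h => hx ⟨_, h, rfl⟩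
  rw [Measure.volume_eq_prod] at hint ⊢
  rw [integral_prod_symm _ hint]
  refine integral_eq_zero_of_ae (ae_of_all _ fun x => ?_)
  refine integral_eq_zero_of_hasDerivAt_of_integrable (f := fun t => f (t, x) * φ (t, x))
    (fun t => ?_) ?_ ?_
  · by_cases hx : (t, x) ∈ tsupport φ
    · refine ((hd _ hx).mul (hasDerivAt_partialT hdφ t x)).congr_deriv ?_
      ring
    · rw [hv _ hx]
      refine (hasDerivAt_const t (0 : ℝ)).congr_of_eventuallyEq ?_
      have h1 : Tendsto (fun y : ℝ => (y, x)) (𝓝 t) (𝓝 (t, x)) :=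
        (by fun_prop : Continuous fun y : ℝ => (y, x)).tendsto t
      filter_upwards [h1.eventually (eventually_eq_zero hx)] with y hy
      rw [hy, mul_zero]
  · exact integrable_of_vanishing (hsl x) (by fun_prop) fun t ht => hv _ (hout t x ht)
  · exact integrable_of_vanishing (hsl x) (by fun_prop) fun t ht => by
      rw [image_eq_zero_of_notMem_tsupport (hout t x ht), mul_zero]

theorem setIntegral_eq_of_vanishing {K : Set (ℝ × ℝ)} (hK : tsupport φ ⊆ K) {g : ℝ × ℝ → ℝ}
    (h : ∀ z, z ∉ tsupport φ → g z = 0) : ∫ z in K, g z = ∫ z, g z :=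
  setIntegral_eq_integral_of_forall_compl_eq_zero fun z hz => h z fun h' => hz (hK h')

/-- The weak form of the balance law. -/
theorem Balance.weak {ε a b : ℝ} {η q ηx qx μ : ℝ × ℝ → ℝ} (h : Balance ε a b η q ηx qx μ)
    (hφ : ContDiff ℝ ∞ φ) {K : Set (ℝ × ℝ)} (hK : IsCompact K) (hφK : tsupport φ ⊆ K)
    (hs : K ⊆ Ioi 0 ×ˢ Ioo a b) :
    -∫ z in K, (η z * partialT φ z + q z * partialX φ z) =
      (∫ z in K, μ z * φ z) - ε * ∫ z in K, ηx z * partialX φ z := by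
  have hc : HasCompactSupport φ := hK.of_isClosed_subset (isClosed_tsupport φ) hφK
  obtain ⟨ηt, ηxx, ct, cxx, he⟩ := h.eq
  have c1 := continuous_partialT hφ
  have c2 := continuous_partialX hφ
  have c3 := hφ.continuous
  have h1 := h.cont_η
  have h2 := h.cont_q
  have h3 := h.cont_ηx
  have h4 := h.cont_qx
  have h5 := h.cont_μ
  have e1 := integral_partialT_add hφ hc h1 ct fun z hz => (he z (hs (hφK hz)).1 (hs (hφK hz)).2).1
  have e2 := integral_partialX_add hφ hc h2 h4 fun z hz => h.dq z (hs (hφK hz)).1 (hs (hφK hz)).2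
  have e3 := integral_partialX_add hφ hc h3 cxx fun z hz => (he z (hs (hφK hz)).1 (hs (hφK hz)).2).2.1
  rw [← setIntegral_eq_of_vanishing hφK fun z hz => by
    rw [partialT_eq_zero hz, image_eq_zero_of_notMem_tsupport hz, mul_zero, mul_zero, add_zero]]
    at e1
  rw [← setIntegral_eq_of_vanishing hφK fun z hz => by
    rw [partialX_eq_zero hz, image_eq_zero_of_notMem_tsupport hz, mul_zero, mul_zero, add_zero]]
    at e2 e3
  have ii : ∀ {g : ℝ × ℝ → ℝ}, Continuous g → IntegrableOn g K := fun hg =>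
    integrableOn_of_continuous hK hg
  have e4 : ∫ z in K, (ηt z * φ z + qx z * φ z) = ∫ z in K, (ε * (ηxx z * φ z) + μ z * φ z) := by
    refine setIntegral_congr_fun hK.measurableSet fun z hz => ?_
    have := (he z (hs hz).1 (hs hz).2).2.2
    rw [← add_mul, this]
    ring
  rw [integral_add (ii (by fun_prop)) (ii (by fun_prop))] at e1 e2 e3 e4
  rw [integral_add (ii (by fun_prop)) (ii (by fun_prop)), integral_const_mul] at e4
  rw [integral_add (ii (by fun_prop)) (ii (by fun_prop))]
  linear_combination (-1 : ℝ) * e1 - e2 + ε * e3 + e4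

end

/-! ### Compactness of the entropy production -/

theorem continuous_excess (k : ℝ) : Continuous (excess k) := by
  unfold excess
  fun_prop

theorem abs_sub_excess_le {k : ℝ} (hk : 0 ≤ k) (y : ℝ) : |y - excess k y| ≤ k := by
  unfold excess
  rw [sub_sub_cancel, abs_le]
  exact ⟨le_max_left _ _, max_le (by linarith) (min_le_right _ _)⟩

theorem abs_truncate_sub_le (k x y : ℝ) :
    |(x - excess k x) - (y - excess k y)| ≤ |x - y| := by
  unfold excess
  rw [sub_sub_cancel, sub_sub_cancel]
  rw [max_comm (-k), max_comm (-k)]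
  refine (abs_max_sub_max_le_abs _ _ _).trans ((abs_min_sub_min_le_max x k y k).trans ?_)
  simp

/-- The truncated values differ by at most 2k and by at most |x - y|, so the square of their
difference is linear in |x - y|. This converts an L¹ modulus of continuity into an L² one, up to the
tails. -/
theorem sq_sub_le {k : ℝ} (hk : 0 ≤ k) (x y : ℝ) :
    (x - y) ^ 2 ≤ 6 * k * |x - y| + 3 * excess k x ^ 2 + 3 * excess k y ^ 2 := by
  have h1 := abs_truncate_sub_le k x y
  have h2 : |(x - excess k x) - (y - excess k y)| ≤ 2 * k := by
    have := abs_sub (x - excess k x) (y - excess k y)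
    have := abs_sub_excess_le hk x
    have := abs_sub_excess_le hk y
    linarith
  set p := (x - excess k x) - (y - excess k y) with hp
  have h3 : p ^ 2 ≤ 2 * k * |x - y| := by
    rw [← sq_abs, sq]
    exact mul_le_mul h2 h1 (abs_nonneg _) (by linarith)
  have h4 : x - y = p + excess k x - excess k y := by rw [hp]; ring
  rw [h4] at h3 ⊢
  generalize excess k x = u at *
  generalize excess k y = v at *
  nlinarith [sq_nonneg (p - u), sq_nonneg (p + v), sq_nonneg (u + v)]

section
variable {K S : Set (ℝ × ℝ)} {f f' : ℝ × ℝ → ℝ}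

/-- A shift by |y| ≤ ε changes f in L¹ by at most ε‖f'‖ ≤ σ. The tails of f and of its shift
contribute 3c² each. -/
theorem setIntegral_sq_sub_shift_le (hK : IsCompact K) (hS : IsCompact S) (hf : Continuous f)
    (hf' : Continuous f') (hKS : ∀ z ∈ K, ∀ y : ℝ, |y| ≤ 1 → z + (0, y) ∈ S)
    (hd : ∀ z ∈ K, ∀ y : ℝ, |y| ≤ 1 →
      HasDerivAt (fun x => f (z.1, x)) (f' (z + (0, y))) (z.2 + y))
    {ε σ c k : ℝ} (hε1 : ε ≤ 1) (hk : 0 ≤ k) (hσ : ε * ∫ z in S, |f' z| ≤ σ)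
    (hc : ∫ z in S, excess k (f z) ^ 2 ≤ c ^ 2) {y : ℝ} (hy : |y| ≤ ε) :
    ∫ z in K, (f (z + (0, y)) - f z) ^ 2 ≤ 6 * k * σ + 6 * c ^ 2 := by
  have ce := continuous_excess k
  have hy1 := hy.trans hε1
  have hsy : ∀ s ∈ Icc (0 : ℝ) 1, |s * y| ≤ 1 := fun s hs => by
    rw [abs_mul, abs_of_nonneg hs.1]
    exact mul_le_one₀ hs.2 (abs_nonneg _) hy1
  have h1 := setIntegral_sub_shift_le hK hS hf hf' (y := y) (fun z hz s hs => hd z hz _ (hsy s hs))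
    (fun z hz s hs => hKS z hz _ (hsy s hs))
  have h2 := setIntegral_shift_le hK hS (f := fun z => excess k (f z) ^ 2) (by fun_prop)
    (fun z => sq_nonneg _) (0, y) (fun z hz => hKS z hz y hy1)
  have h3 := setIntegral_shift_le hK hS (f := fun z => excess k (f z) ^ 2) (by fun_prop)
    (fun z => sq_nonneg _) (0, 0) (fun z hz => hKS z hz 0 (by simp))
  have e0 : ((0 : ℝ), (0 : ℝ)) = 0 := rfl
  simp only [e0, add_zero] at h3
  have ii : ∀ {g : ℝ × ℝ → ℝ}, Continuous g → IntegrableOn g K := fun hg =>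
    integrableOn_of_continuous hK hg
  have h4 : |y| * ∫ z in S, |f' z| ≤ σ :=
    (mul_le_mul_of_nonneg_right hy (integral_nonneg fun z => abs_nonneg _)).trans hσ
  calc _ ≤ ∫ z in K, (6 * k * |f (z + (0, y)) - f z| + 3 * excess k (f (z + (0, y))) ^ 2
        + 3 * excess k (f z) ^ 2) := by
        refine setIntegral_mono (ii (by fun_prop)) (ii (by fun_prop)) fun z => ?_
        exact sq_sub_le hk _ _
    _ = 6 * k * (∫ z in K, |f (z + (0, y)) - f z|)
        + 3 * (∫ z in K, excess k (f (z + (0, y))) ^ 2) + 3 * ∫ z in K, excess k (f z) ^ 2 := by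
        rw [integral_add (ii (by fun_prop)) (ii (by fun_prop)),
          integral_add (ii (by fun_prop)) (ii (by fun_prop)), integral_const_mul,
          integral_const_mul, integral_const_mul]
    _ ≤ 6 * k * σ + 3 * c ^ 2 + 3 * c ^ 2 := by
        gcongr
        · exact h1.trans h4
        · exact h2.trans hc
        · exact h3.trans hc
    _ = _ := by ring

theorem abs_one_sub_cos_le (y : ℝ) : |1 - Real.cos y| ≤ |y| := by
  have h1 : 1 - Real.cos y = 2 * Real.sin (y / 2) ^ 2 := by
    have e1 := Real.cos_two_mul (y / 2)
    have e2 := Real.sin_sq_add_cos_sq (y / 2)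
    rw [mul_div_cancel₀ y two_ne_zero] at e1
    linarith
  rw [h1, abs_of_nonneg (by positivity), ← sq_abs, sq]
  have h2 : |Real.sin (y / 2)| ≤ |y| / 2 := by
    have := Real.abs_sin_le_abs (x := y / 2)
    rwa [abs_div, abs_two] at this
  have h3 := Real.abs_sin_le_one (y / 2)
  have h4 : |Real.sin (y / 2)| * |Real.sin (y / 2)| ≤ 1 * (|y| / 2) :=
    mul_le_mul h3 h2 (abs_nonneg _) zero_le_one
  linarith

/-- Below height k the factor 1 - cos(φ/τ) is estimated by |φ|/τ, which brings in the L² norm of φ.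
The excess of f is small in L², and there the trivial bound 2 suffices. -/
theorem abs_setIntegral_mul_one_sub_cos_le (hK : IsCompact K) (hf : Continuous f)
    {φ g : ℝ × ℝ → ℝ} (hφ : Continuous φ) (hg : Continuous g) {k τ c N : ℝ} (hk : 0 ≤ k)
    (hτ : 0 < τ) (hc : 0 ≤ c) (hN : 0 ≤ N) (ht : ∫ z in K, excess k (f z) ^ 2 ≤ c ^ 2)
    (hg1 : ∫ z in K, g z ^ 2 ≤ 1) (hφN : ∫ z in K, φ z ^ 2 ≤ N ^ 2) :
    |∫ z in K, f z * ((1 - Real.cos (φ z / τ)) * g z)| ≤ k / τ * N + 2 * c := by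
  have ce := continuous_excess k
  have ii : ∀ {g : ℝ × ℝ → ℝ}, Continuous g → IntegrableOn g K := fun hg =>
    integrableOn_of_continuous hK hg
  have e : ∫ z in K, f z * ((1 - Real.cos (φ z / τ)) * g z) =
      (∫ z in K, ((f z - excess k (f z)) * (1 - Real.cos (φ z / τ))) * g z)
        + ∫ z in K, (excess k (f z) * (1 - Real.cos (φ z / τ))) * g z := by
    rw [← integral_add (ii (by fun_prop)) (ii (by fun_prop))]
    congr 1
    ext z
    ring
  have h1 := abs_setIntegral_mul_le hK
    (f := fun z => (f z - excess k (f z)) * (1 - Real.cos (φ z / τ))) (g := g) (D := k / τ * N)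
    (E := 1) (by fun_prop) hg (by positivity) zero_le_one (by
      rw [mul_pow]
      refine le_trans ?_ (mul_le_mul_of_nonneg_left hφN (by positivity))
      rw [← integral_const_mul]
      refine setIntegral_mono (ii (by fun_prop)) (ii (by fun_prop)) fun z => ?_
      simp only []
      rw [← mul_pow, ← sq_abs]
      rw [← sq_abs (k / τ * φ z)]
      refine pow_le_pow_left₀ (abs_nonneg _) ?_ 2
      rw [abs_mul, abs_mul, abs_of_nonneg (by positivity : 0 ≤ k / τ)]
      calc _ ≤ k * |φ z / τ| := mul_le_mul (abs_sub_excess_le hk _) (abs_one_sub_cos_le _)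
            (abs_nonneg _) hk
        _ = _ := by rw [abs_div, abs_of_pos hτ]; ring) (by simpa using hg1)
  have h2 := abs_setIntegral_mul_le hK
    (f := fun z => excess k (f z) * (1 - Real.cos (φ z / τ))) (g := g) (D := 2 * c)
    (E := 1) (by fun_prop) hg (by positivity) zero_le_one (by
      rw [mul_pow]
      refine le_trans ?_ (mul_le_mul_of_nonneg_left ht (by positivity))
      rw [← integral_const_mul]
      refine setIntegral_mono (ii (by fun_prop)) (ii (by fun_prop)) fun z => ?_
      simp only []
      rw [mul_pow, mul_comm]
      refine mul_le_mul_of_nonneg_right ?_ (sq_nonneg _)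
      have := Real.cos_le_one (φ z / τ)
      have := Real.neg_one_le_cos (φ z / τ)
      exact pow_le_pow_left₀ (by linarith) (by linarith) 2) (by simpa using hg1)
  rw [e]
  refine (abs_add_le _ _).trans ?_
  linarith

/-- A shift for which the average of the derivative is controlled by differences. -/
theorem exists_shift (hK : IsCompact K) (hS : IsCompact S) (hf : Continuous f)
    (hf' : Continuous f') (hKS : ∀ z ∈ K, ∀ y : ℝ, |y| ≤ 1 → z + (0, y) ∈ S)
    (hd : ∀ z ∈ K, ∀ y : ℝ, |y| ≤ 1 →
      HasDerivAt (fun x => f (z.1, x)) (f' (z + (0, y))) (z.2 + y))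
    {g : ℝ × ℝ → ℝ} (hg : Continuous g) {ε D : ℝ} (hε : 0 < ε) (hε1 : ε < 1) (hD : 0 ≤ D)
    (hg1 : ∫ z in K, g z ^ 2 ≤ 1)
    (hsh : ∀ y, |y| ≤ ε → ∫ z in K, (f (z + (0, y)) - f z) ^ 2 ≤ D ^ 2) :
    ∃ y, |y| ≤ ε ∧ |ε * ∫ z in K, f' (z + (0, y)) * g z| ≤ D := by
  have ii : ∀ {g : ℝ × ℝ → ℝ}, Continuous g → IntegrableOn g K := fun hg =>
    integrableOn_of_continuous hK hg
  obtain ⟨B, hB⟩ := hS.exists_bound_of_continuousOn hf'.continuousOn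
  set H : ℝ → ℝ := fun y => ∫ z in K, f (z + (0, y)) * g z with hH
  have hHd : ∀ y ∈ Ioo (-1 : ℝ) 1, HasDerivAt H (∫ z in K, f' (z + (0, y)) * g z) y := by
    intro y hy
    refine (hasDerivAt_integral_of_dominated_loc_of_deriv_le (μ := volume.restrict K)
      (F := fun y z => f (z + (0, y)) * g z) (F' := fun y z => f' (z + (0, y)) * g z)
      (s := Ioo (-1 : ℝ) 1) (bound := fun z => B * |g z|) (isOpen_Ioo.mem_nhds hy)
      (Eventually.of_forall fun y => (by fun_prop : Continuous _).aestronglyMeasurable)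
      (ii (by fun_prop)) (by fun_prop : Continuous _).aestronglyMeasurable ?_
      (ii (by fun_prop)) ?_).2
    · filter_upwards [ae_restrict_mem hK.measurableSet] with z hz w hw
      rw [norm_mul]
      refine mul_le_mul_of_nonneg_right (hB _ (hKS z hz w ?_)) (norm_nonneg _)
      exact abs_le.2 ⟨hw.1.le, hw.2.le⟩
    · filter_upwards [ae_restrict_mem hK.measurableSet] with z hz w hw
      have h1 := hd z hz w (abs_le.2 ⟨hw.1.le, hw.2.le⟩)
      have h2 := h1.comp_const_add z.2 w
      have h3 : HasDerivAt (fun y => f (z + (0, y))) (f' (z + (0, w))) w :=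
        h2.congr_of_eventuallyEq (Eventually.of_forall fun x => by
          show f (z + (0, x)) = f (z.1, z.2 + x)
          congr 1
          ext <;> simp)
      exact h3.mul_const _
  have hsub : ∀ y ∈ Icc (-ε) ε, y ∈ Ioo (-1 : ℝ) 1 := fun y hy =>
    ⟨by linarith [hy.1], by linarith [hy.2]⟩
  -- Since ε f' is small in L¹ only, it cannot be paired with g in L². At an intermediate y the
  -- pairing equals the slope (H(ε) - H(-ε))/(2ε), hence a difference of values of f, which is small
  -- in L².
  obtain ⟨y, hy, he⟩ := exists_hasDerivAt_eq_slope H (fun y => ∫ z in K, f' (z + (0, y)) * g z)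
    (by linarith : -ε < ε) (fun y hy => (hHd y (hsub y hy)).continuousAt.continuousWithinAt)
    (fun y hy => hHd y (hsub y ⟨hy.1.le, hy.2.le⟩))
  refine ⟨y, abs_le.2 ⟨hy.1.le, hy.2.le⟩, ?_⟩
  have hdiff : ∀ y, |y| ≤ ε → |H y - ∫ z in K, f z * g z| ≤ D := by
    intro y hy
    have e : H y - ∫ z in K, f z * g z = ∫ z in K, (f (z + (0, y)) - f z) * g z := by
      rw [hH, ← integral_sub (ii (by fun_prop)) (ii (by fun_prop))]
      congr 1
      ext z
      ring
    rw [e]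
    have := abs_setIntegral_mul_le hK (f := fun z => f (z + (0, y)) - f z) (g := g) (by fun_prop)
      hg hD zero_le_one (hsh y hy) (by simpa using hg1)
    simpa using this
  have h1 := hdiff ε (by rw [abs_of_pos hε])
  have h2 := hdiff (-ε) (by rw [abs_neg, abs_of_pos hε])
  have e2 : ε * ∫ z in K, f' (z + (0, y)) * g z = (H ε - H (-ε)) / 2 := by
    rw [he]
    field_simp
    ring
  rw [e2, abs_le]
  obtain ⟨h3, h4⟩ := abs_le.1 h1
  obtain ⟨h5, h6⟩ := abs_le.1 h2
  constructor <;> linarith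

end

/-! ### Soft truncation of test functions -/

section
variable {φ : ℝ × ℝ → ℝ} {τ : ℝ}

/-- A smooth truncation of a test function. -/
def softTruncate (τ : ℝ) (φ : ℝ × ℝ → ℝ) (z : ℝ × ℝ) : ℝ := τ * Real.sin (φ z / τ)

theorem contDiff_softTruncate (hφ : ContDiff ℝ ∞ φ) : ContDiff ℝ ∞ (softTruncate τ φ) :=
  contDiff_const.mul (Real.contDiff_sin.comp (hφ.div_const τ))

theorem tsupport_softTruncate : tsupport (softTruncate τ φ) ⊆ tsupport φ := by
  refine closure_mono fun z hz h => hz ?_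
  simp [softTruncate, h]

theorem fderiv_softTruncate (hτ : 0 < τ) (hφ : Differentiable ℝ φ) (z : ℝ × ℝ) :
    fderiv ℝ (softTruncate τ φ) z = Real.cos (φ z / τ) • fderiv ℝ φ z := by
  have h1 : HasDerivAt (fun y : ℝ => τ * Real.sin (y / τ)) (Real.cos (φ z / τ)) (φ z) := by
    refine ((((hasDerivAt_id (φ z)).div_const τ).sin).const_mul τ).congr_deriv ?_
    simp only [id]
    field_simp
  exact (h1.comp_hasFDerivAt z (hφ z).hasFDerivAt).fderiv

theorem partialT_softTruncate (hτ : 0 < τ) (hφ : Differentiable ℝ φ) (z : ℝ × ℝ) :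
    partialT (softTruncate τ φ) z = Real.cos (φ z / τ) * partialT φ z := by
  unfold partialT
  rw [fderiv_softTruncate hτ hφ]
  rfl

theorem partialX_softTruncate (hτ : 0 < τ) (hφ : Differentiable ℝ φ) (z : ℝ × ℝ) :
    partialX (softTruncate τ φ) z = Real.cos (φ z / τ) * partialX φ z := by
  unfold partialX
  rw [fderiv_softTruncate hτ hφ]
  rfl

theorem abs_softTruncate_le (hτ : 0 < τ) (z : ℝ × ℝ) : |softTruncate τ φ z| ≤ τ := by
  unfold softTruncate
  rw [abs_mul, abs_of_pos hτ]
  exact mul_le_of_le_one_right hτ.le (Real.abs_sin_le_one _)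

end

/-- The action of the entropy production on a test function. -/
theorem Balance.abs_action_le {ε a b : ℝ} {η q ηx qx μ : ℝ × ℝ → ℝ}
    (h : Balance ε a b η q ηx qx μ) (hε : 0 < ε) (hε1 : ε < 1) {φ : ℝ × ℝ → ℝ}
    (hφ : ContDiff ℝ ∞ φ) {K S : Set (ℝ × ℝ)} (hK : IsCompact K) (hS : IsCompact S)
    (hφK : tsupport φ ⊆ K) (hKS : ∀ z ∈ K, ∀ y : ℝ, |y| ≤ 1 → z + (0, y) ∈ S)
    (hK0 : ∀ z ∈ K, 0 < z.1) (hKx : ∀ z ∈ K, ∀ y : ℝ, |y| ≤ 1 → z.2 + y ∈ Ioo a b)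
    {C σ k c τ N : ℝ} (hk : 0 ≤ k) (hc : 0 ≤ c) (hτ : 0 < τ) (hN : 0 ≤ N) (hσ : 0 ≤ σ)
    (hμ : ∫ z in S, |μ z| ≤ C) (hη : ε * ∫ z in S, |ηx z| ≤ σ) (hq : ε * ∫ z in S, |qx z| ≤ σ)
    (hηt : ∫ z in S, excess k (η z) ^ 2 ≤ c ^ 2) (hqt : ∫ z in S, excess k (q z) ^ 2 ≤ c ^ 2)
    (hφt : ∫ z in K, partialT φ z ^ 2 ≤ 1) (hφx : ∫ z in K, partialX φ z ^ 2 ≤ 1)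
    (hφN : ∫ z in K, φ z ^ 2 ≤ N ^ 2) :
    |∫ z in K, (η z * partialT φ z + q z * partialX φ z)| ≤
      4 * c + 3 * √(6 * k * σ + 6 * c ^ 2) + C * τ + 2 * k / τ * N := by
  have h1 := h.cont_η
  have h2 := h.cont_q
  have h3 := h.cont_ηx
  have h4 := h.cont_qx
  have h5 := h.cont_μ
  have c0 := hφ.continuous
  have c1 := continuous_partialT hφ
  have c2 := continuous_partialX hφ
  have hdφ := hφ.differentiable (by simp)
  have ce := continuous_excess k
  have ii : ∀ {g : ℝ × ℝ → ℝ}, Continuous g → IntegrableOn g K := fun hg =>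
    integrableOn_of_continuous hK hg
  set D := √(6 * k * σ + 6 * c ^ 2) with hD
  have hD0 : 0 ≤ D := Real.sqrt_nonneg _
  have hD2 : 6 * k * σ + 6 * c ^ 2 = D ^ 2 := (Real.sq_sqrt (by positivity)).symm
  have htail : ∀ {f : ℝ × ℝ → ℝ}, Continuous f → ∫ z in S, excess k (f z) ^ 2 ≤ c ^ 2 →
      ∫ z in K, excess k (f z) ^ 2 ≤ c ^ 2 := by
    intro f hf hfc
    have := setIntegral_shift_le hK hS (f := fun z => excess k (f z) ^ 2) (by fun_prop)
      (fun z => sq_nonneg _) (0, 0) (fun z hz => hKS z hz 0 (by simp))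
    have e0 : ((0 : ℝ), (0 : ℝ)) = 0 := rfl
    simp only [e0, add_zero] at this
    exact this.trans hfc
  have hdd : ∀ {f f' : ℝ × ℝ → ℝ}, (∀ z : ℝ × ℝ, 0 < z.1 → z.2 ∈ Ioo a b →
      HasDerivAt (fun x => f (z.1, x)) (f' z) z.2) → ∀ z ∈ K, ∀ y : ℝ, |y| ≤ 1 →
      HasDerivAt (fun x => f (z.1, x)) (f' (z + (0, y))) (z.2 + y) := by
    intro f f' hff z hz y hy
    have := hff (z + (0, y)) (by simpa using hK0 z hz) (by simpa using hKx z hz y hy)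
    simpa using this
  have dη := hdd h.dη
  have dq := hdd h.dq
  have sη : ∀ y, |y| ≤ ε → ∫ z in K, (η (z + (0, y)) - η z) ^ 2 ≤ D ^ 2 := fun y hy => by
    rw [← hD2]
    exact setIntegral_sq_sub_shift_le hK hS h1 h3 hKS dη hε1.le hk hη hηt hy
  have sq : ∀ y, |y| ≤ ε → ∫ z in K, (q (z + (0, y)) - q z) ^ 2 ≤ D ^ 2 := fun y hy => by
    rw [← hD2]
    exact setIntegral_sq_sub_shift_le hK hS h2 h4 hKS dq hε1.le hk hq hqt hy
  set χ := softTruncate τ φ with hχ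
  have cχ : ContDiff ℝ ∞ χ := contDiff_softTruncate hφ
  have c3 := cχ.continuous
  have c4 := continuous_partialT cχ
  have c5 := continuous_partialX cχ
  have hcos : ∀ (z : ℝ × ℝ) (p : ℝ), (Real.cos (φ z / τ) * p) ^ 2 ≤ p ^ 2 := fun z p => by
    rw [mul_pow]
    refine mul_le_of_le_one_left (sq_nonneg _) ?_
    rw [← sq_abs]
    exact pow_le_one₀ (abs_nonneg _) (Real.abs_cos_le_one _)
  have hχt : ∫ z in K, partialT χ z ^ 2 ≤ 1 := by
    refine (setIntegral_mono (ii (by fun_prop)) (ii (by fun_prop)) fun z => ?_).trans hφt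
    simp only []
    rw [partialT_softTruncate hτ hdφ]
    exact hcos z _
  have hχx : ∫ z in K, partialX χ z ^ 2 ≤ 1 := by
    refine (setIntegral_mono (ii (by fun_prop)) (ii (by fun_prop)) fun z => ?_).trans hφx
    simp only []
    rw [partialX_softTruncate hτ hdφ]
    exact hcos z _
  -- The shift depends on the truncated test function and is selected for η, whose derivative
  -- appears in the viscous term. The same shift is then used for q, for which only smallness of the
  -- L² difference matters.
  obtain ⟨y, hy, hy2⟩ := exists_shift hK hS h1 h3 hKS dη c5 hε hε1 hD0 hχx sη
  have hy1 : |y| ≤ 1 := hy.trans hε1.le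
  have hw := (h.shift y).weak cχ hK (tsupport_softTruncate.trans hφK) (fun z hz => ⟨hK0 z hz, by
    have := hKx z hz y hy1
    exact ⟨by linarith [this.1], by linarith [this.2]⟩⟩)
  have p1 := abs_setIntegral_mul_one_sub_cos_le hK h1 c0 c1 hk hτ hc hN (htail h1 hηt) hφt hφN
  have p2 := abs_setIntegral_mul_one_sub_cos_le hK h2 c0 c2 hk hτ hc hN (htail h2 hqt) hφx hφN
  have p3 : |∫ z in K, (η (z + (0, y)) - η z) * partialT χ z| ≤ D := by
    simpa using abs_setIntegral_mul_le hK (f := fun z => η (z + (0, y)) - η z) (by fun_prop) c4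
      hD0 zero_le_one (sη y hy) (by simpa using hχt)
  have p4 : |∫ z in K, (q (z + (0, y)) - q z) * partialX χ z| ≤ D := by
    simpa using abs_setIntegral_mul_le hK (f := fun z => q (z + (0, y)) - q z) (by fun_prop) c5
      hD0 zero_le_one (sq y hy) (by simpa using hχx)
  have p5 : |∫ z in K, μ (z + (0, y)) * χ z| ≤ C * τ := by
    have e1 := setIntegral_shift_le hK hS h5.abs (fun z => abs_nonneg _) (0, y)
      (fun z hz => hKS z hz y hy1)
    calc _ ≤ ∫ z in K, |μ (z + (0, y)) * χ z| := abs_integral_le_integral_abs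
      _ ≤ ∫ z in K, |μ (z + (0, y))| * τ := by
          refine setIntegral_mono (ii (by fun_prop)) (ii (by fun_prop)) fun z => ?_
          simp only []
          rw [abs_mul]
          exact mul_le_mul_of_nonneg_left (abs_softTruncate_le hτ z) (abs_nonneg _)
      _ = (∫ z in K, |μ (z + (0, y))|) * τ := integral_mul_const _ _
      _ ≤ _ := mul_le_mul_of_nonneg_right (e1.trans hμ) hτ.le
  -- Truncation errors for η and q (each (k/τ)N + 2c), shift errors for η and q (each D), and the
  -- shifted balance law tested with χ, which contributes D from viscosity and Cτ from μ.
  have e : ∫ z in K, (η z * partialT φ z + q z * partialX φ z) =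
      (∫ z in K, η z * ((1 - Real.cos (φ z / τ)) * partialT φ z))
      + (∫ z in K, q z * ((1 - Real.cos (φ z / τ)) * partialX φ z))
      - (∫ z in K, (η (z + (0, y)) - η z) * partialT χ z)
      - (∫ z in K, (q (z + (0, y)) - q z) * partialX χ z)
      + ∫ z in K, (η (z + (0, y)) * partialT χ z + q (z + (0, y)) * partialX χ z) := by
    rw [← integral_add (ii (by fun_prop)) (ii (by fun_prop)),
      ← integral_sub (ii (by fun_prop)) (ii (by fun_prop)),
      ← integral_sub (ii (by fun_prop)) (ii (by fun_prop)),
      ← integral_add (ii (by fun_prop)) (ii (by fun_prop))]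
    congr 1
    ext z
    rw [partialT_softTruncate hτ hdφ, partialX_softTruncate hτ hdφ]
    ring
  have e5 : ∫ z in K, (η (z + (0, y)) * partialT χ z + q (z + (0, y)) * partialX χ z) =
      ε * (∫ z in K, ηx (z + (0, y)) * partialX χ z) - ∫ z in K, μ (z + (0, y)) * χ z := by
    linarith
  rw [e, e5]
  have p6 : 2 * k / τ * N = 2 * (k / τ * N) := by ring
  rw [p6]
  generalize ∫ z in K, η z * ((1 - Real.cos (φ z / τ)) * partialT φ z) = x1 at *
  generalize ∫ z in K, q z * ((1 - Real.cos (φ z / τ)) * partialX φ z) = x2 at *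
  generalize ∫ z in K, (η (z + (0, y)) - η z) * partialT χ z = x3 at *
  generalize ∫ z in K, (q (z + (0, y)) - q z) * partialX χ z = x4 at *
  generalize ∫ z in K, μ (z + (0, y)) * χ z = x5 at *
  generalize ε * ∫ z in K, ηx (z + (0, y)) * partialX χ z = x6 at *
  rw [abs_le] at *
  constructor <;> linarith [p1.1, p1.2, p2.1, p2.2, p3.1, p3.2, p4.1, p4.2, p5.1, p5.2, hy2.1, hy2.2]

/-! ### A Poincaré inequality on a grid -/

section
variable {f f' : ℝ → ℝ} {a b : ℝ}

theorem sq_integral_le (hf : Continuous f) (hab : a ≤ b) :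
    (∫ x in a..b, f x) ^ 2 ≤ (b - a) * ∫ x in a..b, f x ^ 2 := by
  have i1 : IntervalIntegrable (fun x => f x ^ 2) volume a b :=
    (hf.pow 2).intervalIntegrable _ _
  have key : ∀ s : ℝ, 0 ≤ (b - a) * (s * s) + (2 * ∫ x in a..b, f x) * s
      + ∫ x in a..b, f x ^ 2 := by
    intro s
    have h0 : 0 ≤ ∫ x in a..b, (s ^ 2 + 2 * s * f x + f x ^ 2) :=
      intervalIntegral.integral_nonneg hab fun x _ => by
        have : s ^ 2 + 2 * s * f x + f x ^ 2 = (s + f x) ^ 2 := by ring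
        rw [this]
        positivity
    rw [intervalIntegral.integral_add (Continuous.intervalIntegrable (by fun_prop) _ _) i1,
      intervalIntegral.integral_add (by simp) (Continuous.intervalIntegrable (by fun_prop) _ _),
      intervalIntegral.integral_const, intervalIntegral.integral_const_mul, smul_eq_mul] at h0
    linarith
  have := discrim_le_zero key
  unfold discrim at this
  linarith

theorem sq_sub_le_integral (hf' : Continuous f') (hd : ∀ x, HasDerivAt f (f' x) x) {x y : ℝ}
    (hx : x ∈ Icc a b) (hy : y ∈ Icc a b) :
    (f x - f y) ^ 2 ≤ (b - a) * ∫ s in a..b, f' s ^ 2 := by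
  wlog h : y ≤ x generalizing x y
  · rw [← neg_sq, neg_sub]
    exact this hy hx (le_of_not_ge h)
  have e : ∫ s in y..x, f' s = f x - f y :=
    intervalIntegral.integral_eq_sub_of_hasDerivAt (fun s _ => hd s) (hf'.intervalIntegrable _ _)
  have h0 : ∀ s, 0 ≤ f' s ^ 2 := fun s => sq_nonneg _
  rw [← e]
  refine (sq_integral_le hf' h).trans ?_
  refine mul_le_mul (by linarith [hx.2, hy.1]) ?_
    (intervalIntegral.integral_nonneg h fun s _ => h0 s) (by linarith [hx.1, hx.2])
  exact intervalIntegral.integral_mono_interval hy.1 h hx.2 (ae_of_all _ h0)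
    ((hf'.pow 2).intervalIntegrable _ _)

/-- The distance from f to its mean is an average of differences of f, so f² is at most twice the
oscillation bound plus twice the squared mean. -/
theorem integral_sq_le_of_oscillation (hf : Continuous f) (hab : a < b) {D : ℝ}
    (h : ∀ x ∈ Icc a b, ∀ y ∈ Icc a b, (f x - f y) ^ 2 ≤ D) :
    ∫ x in a..b, f x ^ 2 ≤ 2 * (b - a) * D + 2 / (b - a) * (∫ x in a..b, f x) ^ 2 := by
  have hba : 0 < b - a := by linarith
  set m := (b - a)⁻¹ * ∫ x in a..b, f x with hm
  have hpt : ∀ x ∈ Icc a b, f x ^ 2 ≤ 2 * D + 2 * m ^ 2 := by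
    intro x hx
    have h1 : f x - m = (b - a)⁻¹ * ∫ y in a..b, (f x - f y) := by
      rw [intervalIntegral.integral_sub (by simp) (hf.intervalIntegrable _ _),
        intervalIntegral.integral_const, smul_eq_mul, hm]
      field_simp
    have h2 : (f x - m) ^ 2 ≤ D := by
      have h3 := sq_integral_le (f := fun y => f x - f y) (by fun_prop) hab.le
      have h4 : ∫ y in a..b, (f x - f y) ^ 2 ≤ ∫ _ in a..b, D :=
        intervalIntegral.integral_mono_on hab.le (Continuous.intervalIntegrable (by fun_prop) _ _)
          (by simp) fun y hy => h x hx y hy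
      rw [intervalIntegral.integral_const, smul_eq_mul] at h4
      rw [h1, mul_pow, inv_pow, inv_mul_le_iff₀ (by positivity)]
      calc _ ≤ (b - a) * ((b - a) * D) := h3.trans (by gcongr)
        _ = _ := by ring
    nlinarith [sq_nonneg (f x - m - m)]
  calc _ ≤ ∫ _ in a..b, (2 * D + 2 * m ^ 2) :=
        intervalIntegral.integral_mono_on hab.le ((hf.pow 2).intervalIntegrable _ _) (by simp) hpt
    _ = _ := by
        rw [intervalIntegral.integral_const, smul_eq_mul, hm]
        field_simp

end

/-- The one-dimensional inequality is applied in x on each time slice, and then in t to the slice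
integrals ∫ f dx, so that only the integral over the whole square remains. -/
theorem integral_integral_sq_le {f ft fx : ℝ → ℝ → ℝ} (hf : Continuous fun z : ℝ × ℝ => f z.1 z.2)
    (hft : Continuous fun z : ℝ × ℝ => ft z.1 z.2) (hfx : Continuous fun z : ℝ × ℝ => fx z.1 z.2)
    (dt : ∀ t x, HasDerivAt (fun s => f s x) (ft t x) t) (dx : ∀ t x, HasDerivAt (f t) (fx t x) x)
    {a b c d h : ℝ} (hh : 0 < h) (hab : b - a = h) (hcd : d - c = h) :
    ∫ t in a..b, ∫ x in c..d, f t x ^ 2 ≤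
      2 * h ^ 2 * (∫ t in a..b, ∫ x in c..d, fx t x ^ 2)
        + 4 * h ^ 2 * (∫ t in a..b, ∫ x in c..d, ft t x ^ 2)
        + 4 / h ^ 2 * (∫ t in a..b, ∫ x in c..d, f t x) ^ 2 := by
  have hab' : a < b := by linarith
  have hcd' : c < d := by linarith
  have c1 := continuous_integral_fst hf c d
  have c2 := continuous_integral_fst (f := fun t x => fx t x ^ 2) (hfx.pow 2) c d
  have c3 := continuous_integral_fst (f := fun t x => f t x ^ 2) (hf.pow 2) c d
  have c4 := continuous_integral_fst (f := fun t x => ft t x ^ 2) (hft.pow 2) c d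
  have hslice : ∀ {g : ℝ → ℝ → ℝ}, (Continuous fun z : ℝ × ℝ => g z.1 z.2) → ∀ t,
      Continuous (g t) := fun hg t => Flow.continuous_slice hg t
  have hslice' : ∀ {g : ℝ → ℝ → ℝ}, (Continuous fun z : ℝ × ℝ => g z.1 z.2) → ∀ x,
      Continuous fun t => g t x := fun hg x =>
    hg.comp (by fun_prop : Continuous fun t : ℝ => (t, x))
  have h1 : ∀ t, ∫ x in c..d, f t x ^ 2 ≤ 2 * h ^ 2 * (∫ x in c..d, fx t x ^ 2)
      + 2 / h * (∫ x in c..d, f t x) ^ 2 := by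
    intro t
    have := integral_sq_le_of_oscillation (hslice hf t) hcd' fun x hx y hy =>
      sq_sub_le_integral (hslice hfx t) (dx t) hx hy
    rw [hcd] at this
    refine this.trans (le_of_eq ?_)
    ring
  have h2 : ∫ t in a..b, (∫ x in c..d, f t x) ^ 2 ≤
      2 * h * (h ^ 2 * ∫ t in a..b, ∫ x in c..d, ft t x ^ 2)
        + 2 / h * (∫ t in a..b, ∫ x in c..d, f t x) ^ 2 := by
    have := integral_sq_le_of_oscillation c1 hab'
      (D := h ^ 2 * ∫ t in a..b, ∫ x in c..d, ft t x ^ 2) fun s hs t ht => by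
        have e : (∫ x in c..d, f s x) - ∫ x in c..d, f t x = ∫ x in c..d, (f s x - f t x) :=
          (intervalIntegral.integral_sub ((hslice hf s).intervalIntegrable _ _)
            ((hslice hf t).intervalIntegrable _ _)).symm
        rw [e]
        have k1 := hslice hf s
        have k2 := hslice hf t
        refine (sq_integral_le (by fun_prop) hcd'.le).trans ?_
        have k4 : Continuous fun x => ∫ τ in a..b, ft τ x ^ 2 :=
          continuous_integral_fst (f := fun x τ => ft τ x ^ 2)
            ((hft.comp (by fun_prop : Continuous fun z : ℝ × ℝ => (z.2, z.1))).pow 2) a b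
        have k3 : ∫ x in c..d, (f s x - f t x) ^ 2 ≤ ∫ x in c..d, h * ∫ τ in a..b, ft τ x ^ 2 := by
          refine intervalIntegral.integral_mono_on hcd'.le
            (Continuous.intervalIntegrable (by fun_prop) _ _)
            (Continuous.intervalIntegrable (by fun_prop) _ _) fun x _ => ?_
          have := sq_sub_le_integral (hslice' hft x) (fun τ => dt τ x) hs ht
          rwa [hab] at this
        rw [intervalIntegral.integral_const_mul,
          integral_swap_of_continuous (f := fun x τ => ft τ x ^ 2)
            ((hft.comp (by fun_prop : Continuous fun z : ℝ × ℝ => (z.2, z.1))).pow 2)] at k3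
        rw [hcd]
        calc _ ≤ h * (h * ∫ t in a..b, ∫ x in c..d, ft t x ^ 2) := by gcongr
          _ = _ := by ring
    rwa [hab] at this
  calc _ ≤ ∫ t in a..b, (2 * h ^ 2 * (∫ x in c..d, fx t x ^ 2)
        + 2 / h * (∫ x in c..d, f t x) ^ 2) :=
        intervalIntegral.integral_mono_on hab'.le (c3.intervalIntegrable _ _)
          (Continuous.intervalIntegrable (by fun_prop) _ _) fun t _ => h1 t
    _ = 2 * h ^ 2 * (∫ t in a..b, ∫ x in c..d, fx t x ^ 2)
        + 2 / h * ∫ t in a..b, (∫ x in c..d, f t x) ^ 2 := by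
        rw [intervalIntegral.integral_add (Continuous.intervalIntegrable (by fun_prop) _ _)
          (Continuous.intervalIntegrable (by fun_prop) _ _), intervalIntegral.integral_const_mul,
          intervalIntegral.integral_const_mul]
    _ ≤ 2 * h ^ 2 * (∫ t in a..b, ∫ x in c..d, fx t x ^ 2)
        + 2 / h * (2 * h * (h ^ 2 * ∫ t in a..b, ∫ x in c..d, ft t x ^ 2)
        + 2 / h * (∫ t in a..b, ∫ x in c..d, f t x) ^ 2) := by gcongr
    _ = _ := by
        field_simp
        ring

/-- The nodes of a uniform grid on `[-l, l]`. -/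
def node (l : ℝ) (m i : ℕ) : ℝ := -l + i * (2 * l / m)

theorem node_sub (l : ℝ) (m i : ℕ) : node l m (i + 1) - node l m i = 2 * l / m := by
  unfold node
  push_cast
  ring

theorem node_le (l : ℝ) (hl : 0 ≤ l) (m i : ℕ) : node l m i ≤ node l m (i + 1) := by
  have := node_sub l m i
  have : 0 ≤ 2 * l / m := by positivity
  linarith

theorem integral_integral_grid {g : ℝ → ℝ → ℝ} (hg : Continuous fun z : ℝ × ℝ => g z.1 z.2)
    (l : ℝ) {m : ℕ} (hm : 0 < m) :
    ∫ t in -l..l, ∫ x in -l..l, g t x = ∑ i ∈ Finset.range m, ∑ j ∈ Finset.range m,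
      ∫ t in node l m i..node l m (i + 1), ∫ x in node l m j..node l m (j + 1), g t x := by
  have hm' : (m : ℝ) ≠ 0 := by positivity
  have e0 : node l m 0 = -l := by simp [node]
  have e1 : node l m m = l := by unfold node; field_simp; ring
  have hc : ∀ j, Continuous fun t => ∫ x in node l m j..node l m (j + 1), g t x := fun j =>
    continuous_integral_fst hg _ _
  have h1 : ∀ t, ∫ x in -l..l, g t x = ∑ j ∈ Finset.range m,
      ∫ x in node l m j..node l m (j + 1), g t x := by
    intro t
    have := intervalIntegral.sum_integral_adjacent_intervals (μ := volume) (a := node l m) (n := m)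
      (f := g t) fun k _ => (Flow.continuous_slice hg t).intervalIntegrable _ _
    rw [this, e0, e1]
  simp only [h1]
  have hcs : Continuous fun t => ∑ j ∈ Finset.range m,
      ∫ x in node l m j..node l m (j + 1), g t x := continuous_finsetSum _ fun j _ => hc j
  have := intervalIntegral.sum_integral_adjacent_intervals (μ := volume) (a := node l m) (n := m)
    (f := fun t => ∑ j ∈ Finset.range m, ∫ x in node l m j..node l m (j + 1), g t x)
    fun k _ => hcs.intervalIntegrable _ _
  rw [e0, e1] at this
  rw [← this]
  refine Finset.sum_congr rfl fun i _ => ?_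
  exact intervalIntegral.integral_finsetSum fun j _ => (hc j).intervalIntegrable _ _

/-- The cells of a uniform grid on `[-l, l]²`. -/
def cell (l : ℝ) (m i j : ℕ) : Set (ℝ × ℝ) :=
  Ioc (node l m i) (node l m (i + 1)) ×ˢ Ioc (node l m j) (node l m (j + 1))

theorem setIntegral_prod_Ioc {g : ℝ × ℝ → ℝ} (hg : Continuous g) {a b c d : ℝ} (hab : a ≤ b)
    (hcd : c ≤ d) : ∫ z in Ioc a b ×ˢ Ioc c d, g z = ∫ t in a..b, ∫ x in c..d, g (t, x) := by
  have hi : IntegrableOn g (Ioc a b ×ˢ Ioc c d) :=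
    (integrableOn_of_continuous (isCompact_Icc.prod isCompact_Icc) hg).mono_set
      (prod_mono Ioc_subset_Icc_self Ioc_subset_Icc_self)
  rw [Measure.volume_eq_prod] at hi ⊢
  rw [setIntegral_prod _ hi, intervalIntegral.integral_of_le hab]
  simp only [intervalIntegral.integral_of_le hcd]

theorem integral_eq_of_square {g : ℝ × ℝ → ℝ} (hg : Continuous g) {l : ℝ} (hl : 0 ≤ l)
    (h : ∀ z, z ∉ Ioc (-l) l ×ˢ Ioc (-l) l → g z = 0) :
    ∫ z, g z = ∫ t in -l..l, ∫ x in -l..l, g (t, x) := by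
  rw [← setIntegral_prod_Ioc hg (by linarith) (by linarith)]
  exact (setIntegral_eq_integral_of_forall_compl_eq_zero h).symm

/-- A Poincaré inequality for test functions in a square, with finitely many averages. -/
theorem exists_poincare (l : ℝ) (hl : 0 < l) {c : ℝ} (hc : 0 < c) :
    ∃ (m : ℕ) (C : ℝ), 0 ≤ C ∧ ∀ φ : ℝ × ℝ → ℝ, ContDiff ℝ ∞ φ →
      tsupport φ ⊆ Ioc (-l) l ×ˢ Ioc (-l) l →
      ∫ z, φ z ^ 2 ≤ c ^ 2 * (∫ z, partialT φ z ^ 2) + c ^ 2 * (∫ z, partialX φ z ^ 2)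
        + C * ∑ i ∈ Finset.range m, ∑ j ∈ Finset.range m, (∫ z in cell l m i j, φ z) ^ 2 := by
  -- The mesh h = 2l/m must satisfy 2h ≤ c, because the cell inequality has constants at most 4h².
  obtain ⟨m, hm⟩ := exists_nat_gt (4 * l / c)
  have hm0 : (0 : ℝ) < m := lt_trans (by positivity) hm
  have hm1 : 0 < m := by exact_mod_cast hm0
  set h := 2 * l / m with hh
  have hh0 : 0 < h := by positivity
  have hhc : 4 * h ^ 2 ≤ c ^ 2 := by
    have : 2 * h ≤ c := by
      rw [hh, ← mul_div_assoc, div_le_iff₀ hm0]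
      rw [div_lt_iff₀ hc] at hm
      linarith
    calc 4 * h ^ 2 = (2 * h) ^ 2 := by ring
      _ ≤ c ^ 2 := by gcongr
  refine ⟨m, 4 / h ^ 2, by positivity, fun φ hφ hs => ?_⟩
  have c0 := hφ.continuous
  have c1 := continuous_partialT hφ
  have c2 := continuous_partialX hφ
  have hd := hφ.differentiable (by simp)
  have hz : ∀ z, z ∉ Ioc (-l) l ×ˢ Ioc (-l) l → z ∉ tsupport φ := fun z hz h => hz (hs h)
  rw [integral_eq_of_square (g := fun z => φ z ^ 2) (by fun_prop) hl.le fun z h => by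
      simp [image_eq_zero_of_notMem_tsupport (hz z h)],
    integral_eq_of_square (g := fun z => partialT φ z ^ 2) (by fun_prop) hl.le fun z h => by
      simp [partialT_eq_zero (hz z h)],
    integral_eq_of_square (g := fun z => partialX φ z ^ 2) (by fun_prop) hl.le fun z h => by
      simp [partialX_eq_zero (hz z h)],
    integral_integral_grid (g := fun t x => φ (t, x) ^ 2) (by fun_prop) l hm1,
    integral_integral_grid (g := fun t x => partialT φ (t, x) ^ 2) (by fun_prop) l hm1,
    integral_integral_grid (g := fun t x => partialX φ (t, x) ^ 2) (by fun_prop) l hm1]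
  simp only [Finset.mul_sum, ← Finset.sum_add_distrib]
  refine Finset.sum_le_sum fun i _ => Finset.sum_le_sum fun j _ => ?_
  have key := integral_integral_sq_le (f := fun t x => φ (t, x)) (ft := fun t x => partialT φ (t, x))
    (fx := fun t x => partialX φ (t, x)) (by fun_prop) (by fun_prop) (by fun_prop)
    (fun t x => hasDerivAt_partialT hd t x) (fun t x => hasDerivAt_partialX hd t x) hh0
    (node_sub l m i) (node_sub l m j)
  unfold cell
  rw [setIntegral_prod_Ioc c0 (node_le l hl.le m i) (node_le l hl.le m j)]
  refine key.trans ?_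
  have n1 : ∀ g : ℝ × ℝ → ℝ, 0 ≤ ∫ t in node l m i..node l m (i + 1),
      ∫ x in node l m j..node l m (j + 1), g (t, x) ^ 2 := fun g =>
    intervalIntegral.integral_nonneg (node_le l hl.le m i) fun t _ =>
      intervalIntegral.integral_nonneg (node_le l hl.le m j) fun x _ => sq_nonneg _
  have n2 := n1 (partialT φ)
  have n3 := n1 (partialX φ)
  have m1 := mul_le_mul_of_nonneg_right hhc n2
  have m2 := mul_le_mul_of_nonneg_right hhc n3
  have m3 : 0 ≤ h ^ 2 * ∫ t in node l m i..node l m (i + 1),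
      ∫ x in node l m j..node l m (j + 1), partialX φ (t, x) ^ 2 := by positivity
  linarith

/-! ### Compact sets of functionals -/

section
variable {X : Type*} [NormedAddCommGroup X] [InnerProductSpace ℝ X] [CompleteSpace X]

/-- A bounded family of functionals which are small on the common kernel of finitely many
functionals is close to a totally bounded set. -/
theorem exists_totallyBounded_near {ι : Type*} (s : Finset ι) (l : ι → StrongDual ℝ X) {c C : ℝ}
    (hc : 0 ≤ c) (hC : 0 ≤ C) :
    ∃ Y : Set (StrongDual ℝ X), TotallyBounded Y ∧ ∀ T : StrongDual ℝ X,
      (∀ v, |T v| ≤ c * ‖v‖ + C * ∑ i ∈ s, |l i v|) → ∃ S ∈ Y, ‖T - S‖ ≤ c := by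
  classical
  let e := InnerProductSpace.toDual ℝ X
  -- The span of the Riesz representers; its orthogonal complement is the common kernel of the l i.
  let L : Submodule ℝ X := Submodule.span ℝ (s.image fun i => e.symm (l i))
  have hL : FiniteDimensional ℝ L := FiniteDimensional.span_finset ℝ _
  have hfd : FiniteDimensional ℝ (StrongDual ℝ L) :=
    inferInstanceAs (FiniteDimensional ℝ (L →L[ℝ] ℝ))
  have hpr : ProperSpace (StrongDual ℝ L) :=
    FiniteDimensional.proper ℝ (StrongDual ℝ L)
  let P : X →L[ℝ] L := L.orthogonalProjectionOnto
  let B := c + C * ∑ i ∈ s, ‖l i‖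
  let Φ : StrongDual ℝ L →L[ℝ] StrongDual ℝ X :=
    (ContinuousLinearMap.compL ℝ X L ℝ).flip P
  have hB : 0 ≤ B := by positivity
  -- A ball in the dual of the finite-dimensional space L is compact, and Φ, precomposition with the
  -- projection onto L, carries it to a compact set of functionals on X. Each T is approximated by
  -- its restriction to L composed with the projection.
  refine ⟨Φ '' Metric.closedBall 0 B,
    (isCompact_closedBall 0 B).totallyBounded.image Φ.uniformContinuous, fun T hT => ?_⟩
  have hTB : ‖T‖ ≤ B := by
    refine T.opNorm_le_bound hB fun v => ?_
    refine (hT v).trans ?_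
    have : ∑ i ∈ s, |l i v| ≤ (∑ i ∈ s, ‖l i‖) * ‖v‖ := by
      rw [Finset.sum_mul]
      exact Finset.sum_le_sum fun i _ => (l i).le_opNorm v
    calc _ ≤ c * ‖v‖ + C * ((∑ i ∈ s, ‖l i‖) * ‖v‖) := by gcongr
      _ = _ := by ring
  refine ⟨Φ (T.comp L.subtypeL), mem_image_of_mem _ ?_, ?_⟩
  · refine (mem_closedBall_zero_iff (E := StrongDual ℝ L)).2 ?_
    refine (T.opNorm_comp_le _).trans ?_
    have : ‖L.subtypeL‖ ≤ 1 := L.norm_subtypeL_le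
    calc _ ≤ B * 1 := by gcongr
      _ = B := mul_one B
  · refine ContinuousLinearMap.opNorm_le_bound _ hc fun v => ?_
    have e1 : (T - Φ (T.comp L.subtypeL)) v = T (v - L.starProjection v) := by
      rw [map_sub]
      rfl
    -- The error is T on the component orthogonal to L. All l i vanish there, and the hypothesis on
    -- T reduces to |T v| ≤ c‖v‖.
    have horth := Submodule.sub_starProjection_mem_orthogonal (K := L) v
    rw [e1]
    have h0 : ∀ i ∈ s, l i (v - L.starProjection v) = 0 := by
      intro i hi
      have hm : e.symm (l i) ∈ L := Submodule.subset_span (Finset.mem_coe.2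
        (Finset.mem_image_of_mem _ hi))
      have := (Submodule.mem_orthogonal _ _).1 horth _ hm
      rwa [InnerProductSpace.toDual_symm_apply] at this
    have h1 := hT (v - L.starProjection v)
    rw [Finset.sum_eq_zero fun i hi => by rw [h0 i hi, abs_zero], mul_zero, add_zero] at h1
    have h2 : ‖v - L.starProjection v‖ ≤ ‖v‖ := by
      have h3 := Submodule.starProjection_add_starProjection_orthogonal (K := L) v
      have h4 : v - L.starProjection v = Lᗮ.starProjection v := by
        rw [← h3]
        simp
      rw [h4]
      exact Submodule.norm_starProjection_apply_le _ _
    exact h1.trans (by gcongr)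

/-- A compactness criterion for sequences of functionals. -/
theorem isCompact_closure_of_near {T : ℕ → StrongDual ℝ X} {I : Set ℕ} {V : Submodule ℝ X}
    (hV : Dense (V : Set X))
    (h : ∀ c, 0 < c → ∃ (N : ℕ) (s : Finset (ℕ × ℕ)) (l : ℕ × ℕ → StrongDual ℝ X) (C : ℝ), 0 ≤ C ∧
      ∀ n ∈ I, N ≤ n → ∀ v ∈ V, ‖v‖ ≤ 1 → |T n v| ≤ c + C * ∑ i ∈ s, |l i v|) :
    IsCompact (closure (T '' I)) := by
  refine TotallyBounded.isCompact_of_isClosed (TotallyBounded.closure ?_) isClosed_closure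
  rw [Metric.totallyBounded_iff]
  intro r hr
  obtain ⟨N, s, l, C, hC, hT⟩ := h (r / 4) (by positivity)
  obtain ⟨Y, hY, hnear⟩ := exists_totallyBounded_near s l (by positivity : 0 ≤ r / 4) hC
  -- Homogeneity removes the normalization ‖v‖ ≤ 1, and both sides are continuous, so the estimate
  -- extends from the dense subspace.
  have hall : ∀ n ∈ I, N ≤ n → ∀ v, |T n v| ≤ r / 4 * ‖v‖ + C * ∑ i ∈ s, |l i v| := by
    intro n hn hNn v
    have hcl : IsClosed {v : X | |T n v| ≤ r / 4 * ‖v‖ + C * ∑ i ∈ s, |l i v|} :=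
      isClosed_le (by fun_prop) (by fun_prop)
    have hsub : (V : Set X) ⊆ {v : X | |T n v| ≤ r / 4 * ‖v‖ + C * ∑ i ∈ s, |l i v|} := by
      intro v hv
      rcases eq_or_ne v 0 with rfl | hne
      · simp
      have hv0 : 0 < ‖v‖ := norm_pos_iff.2 hne
      have := hT n hn hNn (‖v‖⁻¹ • v) (V.smul_mem _ hv) (by
        rw [norm_smul, norm_inv, norm_norm, inv_mul_cancel₀ hv0.ne'])
      simp only [map_smul, smul_eq_mul, abs_mul, abs_of_pos (inv_pos.2 hv0)] at this
      rw [← Finset.mul_sum, inv_mul_le_iff₀ hv0] at this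
      refine this.trans (le_of_eq ?_)
      field_simp
    exact hcl.closure_subset_iff.2 hsub (hV v)
  obtain ⟨t, ht, hYt⟩ := Metric.totallyBounded_iff.1 hY (r / 2) (by positivity)
  -- The finitely many functionals with n < N are simply added to the net.
  refine ⟨t ∪ T '' Iio N, ht.union ((finite_Iio N).image T), ?_⟩
  rintro _ ⟨n, hn, rfl⟩
  rw [mem_iUnion₂]
  rcases lt_or_ge n N with hlt | hge
  · exact ⟨T n, Or.inr ⟨n, hlt, rfl⟩, Metric.mem_ball_self hr⟩
  · obtain ⟨S, hS, hTS⟩ := hnear (T n) (hall n hn hge)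
    obtain ⟨y, hy, hSy⟩ := mem_iUnion₂.1 (hYt hS)
    refine ⟨y, Or.inl hy, ?_⟩
    rw [Metric.mem_ball] at hSy ⊢
    have h1 : dist (T n) S ≤ r / 4 := by rwa [dist_eq_norm]
    have := dist_triangle (T n) S y
    linarith

end

/-! ### Functionals on the Sobolev space -/

section
variable {Ω : Set (ℝ × ℝ)}

instance completeSpace_H10 (Ω : Set (ℝ × ℝ)) : CompleteSpace (H10 Ω) :=
  (Submodule.isClosed_topologicalClosure _).completeSpace_coe

/-- The test functions, as a subspace of `H¹₀`. -/
def testSubmodule (Ω : Set (ℝ × ℝ)) : Submodule ℝ (H10 Ω) :=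
  (testJets Ω).comap (H10 Ω).subtype

theorem dense_testSubmodule (Ω : Set (ℝ × ℝ)) : Dense (testSubmodule Ω : Set (H10 Ω)) := by
  intro v
  obtain ⟨u, hu, hlim⟩ := mem_closure_iff_seq_limit.1 v.2
  rw [mem_closure_iff_seq_limit]
  refine ⟨fun n => ⟨u n, (testJets Ω).le_topologicalClosure (hu n)⟩, fun n => hu n, ?_⟩
  exact tendsto_subtype_rng.2 hlim

/-- The functional `v ↦ ⟪w, v⟫` on `H¹₀`. -/
def innerFunctional (Ω : Set (ℝ × ℝ))
    (w : Lp (EuclideanSpace ℝ (Fin 3)) 2 (volume : Measure (ℝ × ℝ))) : Hm1 Ω :=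
  (innerSL ℝ w).comp (H10 Ω).subtypeL

theorem innerFunctional_apply {W : ℝ × ℝ → EuclideanSpace ℝ (Fin 3)} (hW : MemLp W 2) {v : H10 Ω}
    {φ : ℝ × ℝ → ℝ}
    (hv : (v : Lp (EuclideanSpace ℝ (Fin 3)) 2 (volume : Measure (ℝ × ℝ))) =ᵐ[volume] jet φ) :
    innerFunctional Ω (hW.toLp W) v =
      ∫ z, (W z 0 * φ z + W z 1 * partialT φ z + W z 2 * partialX φ z) := by
  show inner ℝ (hW.toLp W) (v : Lp (EuclideanSpace ℝ (Fin 3)) 2 (volume : Measure (ℝ × ℝ))) = _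
  rw [L2.inner_def]
  refine integral_congr_ae ?_
  filter_upwards [hW.coeFn_toLp, hv] with z h1 h2
  rw [h1, h2, PiLp.inner_apply, Fin.sum_univ_three]
  simp [jet]
  ring

theorem norm_sq_eq {v : H10 Ω} {φ : ℝ × ℝ → ℝ} (hφ : ContDiff ℝ ∞ φ) (hc : HasCompactSupport φ)
    (hv : (v : Lp (EuclideanSpace ℝ (Fin 3)) 2 (volume : Measure (ℝ × ℝ))) =ᵐ[volume] jet φ) :
    ‖v‖ ^ 2 = (∫ z, φ z ^ 2) + (∫ z, partialT φ z ^ 2) + ∫ z, partialX φ z ^ 2 := by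
  have c0 := hφ.continuous
  have c1 := continuous_partialT hφ
  have c2 := continuous_partialX hφ
  have i0 : Integrable fun z => φ z ^ 2 := integrable_of_vanishing hc.isCompact (by fun_prop)
    fun z hz => by simp [image_eq_zero_of_notMem_tsupport hz]
  have i1 : Integrable fun z => partialT φ z ^ 2 :=
    integrable_of_vanishing hc.isCompact (by fun_prop) fun z hz => by simp [partialT_eq_zero hz]
  have i2 : Integrable fun z => partialX φ z ^ 2 :=
    integrable_of_vanishing hc.isCompact (by fun_prop) fun z hz => by simp [partialX_eq_zero hz]
  have i01 : Integrable fun z => φ z ^ 2 + partialT φ z ^ 2 := i0.add i1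
  rw [← integral_add i0 i1, ← integral_add i01 i2, ← Submodule.norm_coe,
    ← real_inner_self_eq_norm_sq, L2.inner_def]
  refine integral_congr_ae ?_
  filter_upwards [hv] with z h1
  rw [h1, PiLp.inner_apply, Fin.sum_univ_three]
  simp [jet]

/-- The integral over a bounded set, as a functional on `H¹₀`. -/
theorem exists_average (Ω : Set (ℝ × ℝ)) {Q : Set (ℝ × ℝ)} (hQ : MeasurableSet Q)
    (hb : volume Q ≠ ⊤) : ∃ l : Hm1 Ω, ∀ (v : H10 Ω) (φ : ℝ × ℝ → ℝ),
      ((v : Lp (EuclideanSpace ℝ (Fin 3)) 2 (volume : Measure (ℝ × ℝ))) =ᵐ[volume] jet φ) →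
      l v = ∫ z in Q, φ z := by
  have hW : MemLp (Q.indicator fun _ => (!₂[1, 0, 0] : EuclideanSpace ℝ (Fin 3))) 2
    (volume : Measure (ℝ × ℝ)) := memLp_indicator_const 2 hQ _ (Or.inr hb)
  refine ⟨innerFunctional Ω (hW.toLp _), fun v φ hv => ?_⟩
  rw [innerFunctional_apply hW hv, ← integral_indicator hQ]
  refine integral_congr_ae (ae_of_all _ fun z => ?_)
  by_cases hz : z ∈ Q <;> simp [hz]

/-- The divergence of a bounded field lies in `H⁻¹`. -/
theorem exists_isDivergence (hΩ : MeasurableSet Ω) (hb : Bornology.IsBounded Ω)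
    {η q : ℝ × ℝ → ℝ} (hη : Continuous η) (hq : Continuous q) :
    ∃ T : Hm1 Ω, IsDivergence Ω η q T := by
  have hcl : IsCompact (closure Ω) := hb.isCompact_closure
  have hc : Continuous fun z => (!₂[0, -η z, -q z] : EuclideanSpace ℝ (Fin 3)) := by
    refine (PiLp.continuous_toLp 2 _).comp (continuous_pi fun i => ?_)
    fin_cases i
    · exact continuous_const
    · exact hη.neg
    · exact hq.neg
  obtain ⟨B, hB⟩ := hcl.exists_bound_of_continuousOn hc.continuousOn
  have hfin : volume Ω ≠ ⊤ := hb.measure_lt_top.ne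
  have hW : MemLp (Ω.indicator fun z => (!₂[0, -η z, -q z] : EuclideanSpace ℝ (Fin 3))) 2
      (volume : Measure (ℝ × ℝ)) := by
    refine (memLp_indicator_iff_restrict hΩ).2 ?_
    have : IsFiniteMeasure (volume.restrict Ω) := ⟨by simpa using hb.measure_lt_top⟩
    refine MemLp.of_bound hc.aestronglyMeasurable B ?_
    filter_upwards [ae_restrict_mem hΩ] with z hz
    exact hB z (subset_closure hz)
  refine ⟨innerFunctional Ω (hW.toLp _), fun φ _ v hv => ?_⟩
  rw [innerFunctional_apply hW hv, ← integral_neg, ← integral_indicator hΩ]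
  refine integral_congr_ae (ae_of_all _ fun z => ?_)
  by_cases hz : z ∈ Ω <;> simp [hz]
  ring

end

/-! ### Compactness of the entropy production of viscous balance laws -/

theorem volume_cell_ne_top (l : ℝ) (m i j : ℕ) : volume (cell l m i j) ≠ ⊤ :=
  ((Metric.isBounded_Ioc _ _).prod (Metric.isBounded_Ioc _ _)).measure_lt_top.ne

/-- A version of Murat's lemma in which uniform integrability of the squares replaces an L^p bound
with p > 2. The integrals are taken over a rectangle wider than Ω by 1 on both sides in x, to make
room for the shifts. -/
theorem isCompact_closure_of_balance {Ω : Set (ℝ × ℝ)} (hΩ0 : Ω ⊆ Ioi 0 ×ˢ univ) {l : ℝ}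
    (hl : 0 < l) (hΩl : Ω ⊆ Ioc (-l) l ×ˢ Ioc (-l) l) {ε a b σ : ℕ → ℝ}
    {η q ηx qx μ : ℕ → ℝ × ℝ → ℝ} {I : Set ℕ} {N₀ : ℕ} {T : ℕ → Hm1 Ω} {C : ℝ}
    (hT : ∀ n, IsDivergence Ω (η n) (q n) (T n))
    (hbal : ∀ n, N₀ ≤ n → Balance (ε n) (a n) (b n) (η n) (q n) (ηx n) (qx n) (μ n))
    (hε : ∀ n, N₀ ≤ n → 0 < ε n ∧ ε n < 1) (hab : ∀ n, N₀ ≤ n → a n < -(l + 1) ∧ l + 1 < b n)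
    (hσ : Tendsto σ atTop (𝓝 0)) (hσ0 : ∀ n, 0 ≤ σ n)
    (hμ : ∀ n, N₀ ≤ n → ∫ z in Icc 0 l ×ˢ Icc (-(l + 1)) (l + 1), |μ n z| ≤ C)
    (hη : ∀ n, N₀ ≤ n → ε n * ∫ z in Icc 0 l ×ˢ Icc (-(l + 1)) (l + 1), |ηx n z| ≤ σ n)
    (hq : ∀ n, N₀ ≤ n → ε n * ∫ z in Icc 0 l ×ˢ Icc (-(l + 1)) (l + 1), |qx n z| ≤ σ n)
    (htail : ∀ c, 0 < c → ∃ k, 0 ≤ k ∧ ∀ n, N₀ ≤ n →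
      ∫ z in Icc 0 l ×ˢ Icc (-(l + 1)) (l + 1), excess k (η n z) ^ 2 ≤ c ^ 2 ∧
      ∫ z in Icc 0 l ×ˢ Icc (-(l + 1)) (l + 1), excess k (q n z) ^ 2 ≤ c ^ 2) :
    IsCompact (closure (T '' I)) := by
  refine isCompact_closure_of_near (dense_testSubmodule Ω) fun c hc => ?_
  -- The order of choices: the height k for tails c/32, then τ with Cτ ≤ c/4, then the Poincaré
  -- scale p with (2k/τ)p ≤ c/4, and finally n so large that the square root is at most c/8. The
  -- total is 4(c/32) + 3(c/8) + c/4 + c/4 = c.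
  have hc1 : 0 < c / 32 := by positivity
  obtain ⟨k, hk, htail⟩ := htail (c / 32) hc1
  set τ := c / (4 * (|C| + 1)) with hτ
  have hτ0 : 0 < τ := by positivity
  have hCτ : C * τ ≤ c / 4 := by
    calc C * τ ≤ (|C| + 1) * τ := by gcongr; linarith [le_abs_self C]
      _ = c / 4 := by rw [hτ]; field_simp
  set p := c * τ / (8 * (k + 1)) with hp
  have hp0 : 0 < p := by positivity
  have hpc : 2 * k / τ * p ≤ c / 4 := by
    calc 2 * k / τ * p ≤ 2 * (k + 1) / τ * p := by gcongr; linarith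
      _ = c / 4 := by rw [hp]; field_simp; norm_num
  obtain ⟨m, P, hP, hpoin⟩ := exists_poincare l hl hp0
  choose L hL using fun i : ℕ × ℕ => exists_average Ω (Q := cell l m i.1 i.2)
    (measurableSet_Ioc.prod measurableSet_Ioc) (volume_cell_ne_top l m i.1 i.2)
  have hev : ∀ᶠ n in atTop, 6 * k * σ n ≤ 10 * (c / 32) ^ 2 := by
    have h1 : Tendsto (fun n => 6 * k * σ n) atTop (𝓝 (6 * k * 0)) := hσ.const_mul _
    rw [mul_zero] at h1
    exact h1.eventually_le_const (by positivity)
  obtain ⟨N₁, hN₁⟩ := eventually_atTop.1 hev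
  -- The test functionals are the averages over the grid cells. Their constant is (2k/τ)√P because
  -- ‖φ‖ ≤ p + √P W enters with the factor 2k/τ.
  refine ⟨max N₀ N₁, Finset.range m ×ˢ Finset.range m, L, 2 * k / τ * √P, by positivity,
    fun n _ hn v ⟨φ, hφ, hvφ⟩ hv1 => ?_⟩
  have hn0 : N₀ ≤ n := (le_max_left _ _).trans hn
  have hvφ : (v : Lp (EuclideanSpace ℝ (Fin 3)) 2 (volume : Measure (ℝ × ℝ))) =ᵐ[volume] jet φ :=
    hvφ
  have c0 := hφ.contDiff.continuous
  have hnorm := norm_sq_eq hφ.contDiff hφ.compact hvφ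
  have hv2 : ‖v‖ ^ 2 ≤ 1 := pow_le_one₀ (norm_nonneg _) hv1
  have g0 : 0 ≤ ∫ z, φ z ^ 2 := integral_nonneg fun z => sq_nonneg _
  have g1 : 0 ≤ ∫ z, partialT φ z ^ 2 := integral_nonneg fun z => sq_nonneg _
  have g2 : 0 ≤ ∫ z, partialX φ z ^ 2 := integral_nonneg fun z => sq_nonneg _
  have e0 : ∫ z in tsupport φ, φ z ^ 2 = ∫ z, φ z ^ 2 :=
    setIntegral_eq_of_vanishing subset_rfl fun z hz => by simp [image_eq_zero_of_notMem_tsupport hz]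
  have e1 : ∫ z in tsupport φ, partialT φ z ^ 2 = ∫ z, partialT φ z ^ 2 :=
    setIntegral_eq_of_vanishing subset_rfl fun z hz => by simp [partialT_eq_zero hz]
  have e2 : ∫ z in tsupport φ, partialX φ z ^ 2 = ∫ z, partialX φ z ^ 2 :=
    setIntegral_eq_of_vanishing subset_rfl fun z hz => by simp [partialX_eq_zero hz]
  have hTv : |T n v| =
      |∫ z in tsupport φ, (η n z * partialT φ z + q n z * partialX φ z)| := by
    rw [hT n φ hφ v hvφ, abs_neg]
    have hz : ∀ z, z ∉ tsupport φ → η n z * partialT φ z + q n z * partialX φ z = 0 :=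
      fun z hz => by rw [partialT_eq_zero hz, partialX_eq_zero hz, mul_zero, mul_zero, add_zero]
    rw [setIntegral_eq_of_vanishing hφ.subset hz, setIntegral_eq_of_vanishing subset_rfl hz]
  set W := ∑ i ∈ Finset.range m ×ˢ Finset.range m, |L i v| with hW
  have hW0 : 0 ≤ W := Finset.sum_nonneg fun i _ => abs_nonneg _
  have hφN : ∫ z in tsupport φ, φ z ^ 2 ≤ (p + √P * W) ^ 2 := by
    have h1 := hpoin φ hφ.contDiff (hφ.subset.trans hΩl)
    have h2 : ∑ i ∈ Finset.range m, ∑ j ∈ Finset.range m, (∫ z in cell l m i j, φ z) ^ 2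
        ≤ W ^ 2 := by
      rw [← Finset.sum_product' (f := fun i j => (∫ z in cell l m i j, φ z) ^ 2)]
      refine le_trans (le_of_eq (Finset.sum_congr rfl fun i _ => ?_))
        (Finset.sum_sq_le_sq_sum_of_nonneg fun i _ => abs_nonneg (L i v))
      rw [sq_abs, hL i v φ hvφ]
    have h3 : P * ∑ i ∈ Finset.range m, ∑ j ∈ Finset.range m, (∫ z in cell l m i j, φ z) ^ 2
        ≤ P * W ^ 2 := by gcongr
    have h4 : p ^ 2 * ((∫ z, partialT φ z ^ 2) + ∫ z, partialX φ z ^ 2) ≤ p ^ 2 * 1 := by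
      gcongr
      linarith
    have h5 : 0 ≤ 2 * p * (√P * W) := by positivity
    have h6 : (p + √P * W) ^ 2 = p ^ 2 + 2 * p * (√P * W) + P * W ^ 2 := by
      rw [add_sq, mul_pow, Real.sq_sqrt hP]
    rw [e0, h6]
    linarith
  have hmem : ∀ z ∈ tsupport φ, 0 < z.1 ∧ z.1 ≤ l ∧ -l < z.2 ∧ z.2 ≤ l := fun z hz =>
    ⟨(hΩ0 (hφ.subset hz)).1, (hΩl (hφ.subset hz)).1.2, (hΩl (hφ.subset hz)).2.1,
      (hΩl (hφ.subset hz)).2.2⟩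
  -- The compact set is the support of the test function, not the closure of Ω: the balance law is
  -- available at positive times only, and the closure of Ω may touch t = 0.
  have key := (hbal n hn0).abs_action_le (hε n hn0).1 (hε n hn0).2 hφ.contDiff
    (K := tsupport φ) (S := Icc 0 l ×ˢ Icc (-(l + 1)) (l + 1)) hφ.compact.isCompact
    (isCompact_Icc.prod isCompact_Icc) subset_rfl
    (fun z hz y hy => by
      obtain ⟨h1, h2, h3, h4⟩ := hmem z hz
      obtain ⟨h5, h6⟩ := abs_le.1 hy
      simp only [mem_prod, mem_Icc, Prod.fst_add, Prod.snd_add, add_zero]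
      exact ⟨⟨h1.le, h2⟩, by linarith, by linarith⟩)
    (fun z hz => (hmem z hz).1)
    (fun z hz y hy => by
      obtain ⟨h1, h2, h3, h4⟩ := hmem z hz
      obtain ⟨h5, h6⟩ := abs_le.1 hy
      obtain ⟨h7, h8⟩ := hab n hn0
      exact ⟨by linarith, by linarith⟩)
    hk hc1.le hτ0 (by positivity : 0 ≤ p + √P * W) (hσ0 n) (hμ n hn0) (hη n hn0) (hq n hn0)
    (htail n hn0).1 (htail n hn0).2 (by linarith) (by linarith) hφN
  have hroot : √(6 * k * σ n + 6 * (c / 32) ^ 2) ≤ 4 * (c / 32) := by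
    refine Real.sqrt_le_iff.2 ⟨by positivity, ?_⟩
    have := hN₁ n ((le_max_right _ _).trans hn)
    linarith
  rw [hTv]
  refine key.trans ?_
  rw [mul_add]
  have e3 : 2 * k / τ * √P * W = 2 * k / τ * (√P * W) := mul_assoc _ _ _
  rw [e3]
  linarith

/-! ### Uniform estimates for the entropy pairs of the approximate solutions -/

theorem setIntegral_Icc_prod {g : ℝ × ℝ → ℝ} (hg : Continuous g) {a b c d : ℝ} (hab : a ≤ b)
    (hcd : c ≤ d) : ∫ z in Icc a b ×ˢ Icc c d, g z = ∫ t in a..b, ∫ x in c..d, g (t, x) := by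
  have hi : IntegrableOn g (Icc a b ×ˢ Icc c d) :=
    integrableOn_of_continuous (isCompact_Icc.prod isCompact_Icc) hg
  rw [Measure.volume_eq_prod] at hi ⊢
  rw [setIntegral_prod _ hi, intervalIntegral.integral_of_le hab, integral_Icc_eq_integral_Ioc]
  simp only [intervalIntegral.integral_of_le hcd, integral_Icc_eq_integral_Ioc]

namespace Flow
variable {γ : ℝ} {A : ℝ → ℝ} {ε δ a b : ℝ} (F : Flow γ A ε δ a b)
variable {L M : ℝ} {f f' f'' : ℝ → ℝ}

theorem balance (hγ : 1 < γ) (hA : IsArea A) (h : IsGenerator L M f f' f'') :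
    Balance ε a b (fun z => F.eta f z.1 z.2) (fun z => F.flux f z.1 z.2)
      (fun z => F.etaX f f' z.1 z.2) (fun z => F.fluxX f f' z.1 z.2)
      (fun z => F.production f f' f'' z.1 z.2) where
  cont_η := F.cont_eta hγ h
  cont_q := F.cont_flux hγ h
  cont_ηx := F.cont_etaX hγ h
  cont_qx := F.cont_fluxX hγ h
  cont_μ := F.cont_production hγ hA h
  dη _ ht hx := F.hasDerivAt_eta hγ h ht hx
  dq _ ht hx := F.hasDerivAt_flux hγ h ht hx
  eq := ⟨fun z => F.etaT f f' z.1 z.2, fun z => F.etaXX f f' f'' z.1 z.2, F.cont_etaT hγ h,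
    F.cont_etaXX hγ h, fun _ ht hx => ⟨F.hasDerivAt_eta_fst hγ h ht hx,
      F.hasDerivAt_etaX hγ h ht hx, F.etaT_add_fluxX hγ f f' f'' ht hx⟩⟩

theorem rpow_le_majorant (hγ : 1 < γ) (hε : 0 < ε) (hδ : 0 ≤ δ) {s : ℝ} (hs : 0 < s) (t x : ℝ) :
    F.r t x ^ (γ + 1) ≤ F.majorant s t x := by
  have h1 : 0 ≤ F.sz t x := size_nonneg hδ (F.pos t x) _
  have h2 := mul_nonneg hε.le (F.dissipation_nonneg hγ hδ t x)
  have h3 : 0 ≤ s ^ 6 * F.logGradient t x := mul_nonneg (by positivity) (sq_nonneg _)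
  unfold majorant
  linarith

/-- The rate is s = ε^(1/4): the derivatives of the pair are compared with s times the majorant,
after division by s, whereas the production is compared with the majorant itself. -/
theorem exists_estimates (hγ : 1 < γ) (hA : IsArea A) (h : IsGenerator L M f f' f'')
    (B C T R : ℝ) (hT : 0 ≤ T) (hR : 1 ≤ R) :
    ∃ K, 0 ≤ K ∧ ∀ {ε δ a b : ℝ} (F : Flow γ A ε δ a b), 0 < ε → ε ≤ 1 → 0 ≤ δ → δ / ε ≤ B →
      F.EnergyBounded T R C → ∀ s, 0 < s → s ^ 4 = ε →
      ∫ z in Icc 0 T ×ˢ Icc (-(R - 1)) (R - 1), |F.production f f' f'' z.1 z.2| ≤ K ∧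
      ε * ∫ z in Icc 0 T ×ˢ Icc (-(R - 1)) (R - 1), |F.etaX f f' z.1 z.2| ≤ K * s ∧
      ε * ∫ z in Icc 0 T ×ˢ Icc (-(R - 1)) (R - 1), |F.fluxX f f' z.1 z.2| ≤ K * s ∧
      ∫ z in Icc 0 T ×ˢ Icc (-(R - 1)) (R - 1), F.r z.1 z.2 ^ (γ + 1) ≤ K := by
  obtain ⟨A₀, Qa, -, -, -, -, -, hQ, hQ', -⟩ := hA.exists_bounds
  obtain ⟨C', hC', hmaj⟩ := integral_majorant_le hγ hA C T R hT hR
  have hk := h.b0.kernelBound_nonneg γ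
  have hθ := theta_pos hγ
  set c₁ := kernelBound γ L M * (2 * Qa * (1 + theta γ) + (2 + B)
      + Qa * (1 + theta γ) * (8 + (theta γ)⁻¹ ^ 2) + 2 * Qa + 2) with hc₁
  set c₂ := kernelBound γ L M * (1 + theta γ) * (8 + (theta γ)⁻¹ ^ 2) with hc₂
  set c₃ := kernelBound γ L M * (2 + theta γ + theta γ ^ 2) * (8 + (theta γ)⁻¹ ^ 2) with hc₃
  have hc20 : 0 ≤ c₂ := by positivity
  have hc30 : 0 ≤ c₃ := by positivity
  set K := (|c₁| + c₂ + c₃ + 1) * C' with hK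
  have hc10 := abs_nonneg c₁
  refine ⟨K, by positivity, fun {ε δ a b} F hε hε1 hδ hB hE s hs hsε => ?_⟩
  have hs1 : s ≤ 1 := by
    by_contra hcon
    have := one_lt_pow₀ (not_le.1 hcon) (n := 4) (by norm_num)
    linarith
  have hJ := hmaj F hε hε1 hδ hE s hs hsε
  have hS : IsCompact (Icc 0 T ×ˢ Icc (-(R - 1)) (R - 1)) := isCompact_Icc.prod isCompact_Icc
  have cJ := F.cont_majorant s
  rw [← setIntegral_Icc_prod (g := fun z => F.majorant s z.1 z.2) cJ hT (by linarith)] at hJ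
  have hpow := F.rpow_le_majorant hγ hε hδ hs
  have hJ0 : ∀ t x, 0 ≤ F.majorant s t x := fun t x =>
    (Real.rpow_nonneg (F.pos t x).le _).trans (hpow t x)
  have key : ∀ (g : ℝ × ℝ → ℝ) (c : ℝ), Continuous g → 0 ≤ c → c ≤ |c₁| + c₂ + c₃ + 1 →
      (∀ z, g z ≤ c * F.majorant s z.1 z.2) →
      ∫ z in Icc 0 T ×ˢ Icc (-(R - 1)) (R - 1), g z ≤ K := by
    intro g c hg hc0 hc hle
    have h1 := setIntegral_mono (integrableOn_of_continuous hS hg)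
      (integrableOn_of_continuous hS (cJ.const_mul c)) hle
    rw [integral_const_mul] at h1
    refine h1.trans ?_
    rw [hK]
    exact mul_le_mul hc hJ (integral_nonneg fun z => hJ0 _ _) (by positivity)
  have hmul : ∀ (g : ℝ → ℝ → ℝ) (c : ℝ), 0 ≤ c → (∀ t x, |g t x| ≤ c * F.gradient t x) →
      ∀ z : ℝ × ℝ, s⁻¹ * ε * |g z.1 z.2| ≤ c * (8 + (theta γ)⁻¹ ^ 2) * F.majorant s z.1 z.2 := by
    intro g c hc hg z
    have h1 := F.mul_gradient_le hγ hδ hs hs1 hsε z.1 z.2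
    calc s⁻¹ * ε * |g z.1 z.2| ≤ s⁻¹ * ε * (c * F.gradient z.1 z.2) := by gcongr; exact hg _ _
      _ = s⁻¹ * c * (ε * F.gradient z.1 z.2) := by ring
      _ ≤ s⁻¹ * c * ((8 + (theta γ)⁻¹ ^ 2) * (s * F.majorant s z.1 z.2)) := by gcongr
      _ = _ := by field_simp
  have hfin : ∀ y : ℝ, s⁻¹ * ε * y ≤ K → ε * y ≤ K * s := by
    intro y hy
    rw [mul_assoc, inv_mul_le_iff₀ hs] at hy
    linarith
  refine ⟨?_, hfin _ ?_, hfin _ ?_, ?_⟩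
  · refine key _ |c₁| (F.cont_production hγ hA h).abs hc10 (by linarith) fun z => ?_
    exact (F.abs_production_le hγ hδ h hQ hQ' hB hs hs1 hsε z.1 z.2).trans
      (mul_le_mul_of_nonneg_right (le_abs_self _) (hJ0 _ _))
  · rw [← integral_const_mul]
    exact key _ c₂ ((F.cont_etaX hγ h).abs.const_mul _) hc20 (by linarith)
      (hmul _ _ (by positivity) (F.abs_etaX_le hγ h))
  · rw [← integral_const_mul]
    exact key _ c₃ ((F.cont_fluxX hγ h).abs.const_mul _) hc30 (by linarith)
      (hmul _ _ (by positivity) (F.abs_fluxX_le hγ h))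
  · exact key _ 1 (F.cont_rpow _) zero_le_one (by linarith) fun z => by
      rw [one_mul]; exact hpow _ _

end Flow

/-! ### Energy bounds along the sequence of approximate solutions -/

theorem IsProfile.bounds {L₀ l r : ℝ} {f : ℝ → ℝ} (h : IsProfile L₀ l r f) (x : ℝ) :
    l ≤ f x ∧ f x ≤ r ∨ r ≤ f x ∧ f x ≤ l := by
  have hl := h.left (min x (-L₀)) (min_le_right _ _)
  have hr := h.right (max x L₀) (le_max_right _ _)
  rw [← hl, ← hr]
  exact h.monotone.imp (fun hm => ⟨hm (min_le_left _ _), hm (le_max_left _ _)⟩)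
    (fun hm => ⟨hm (le_max_left _ _), hm (min_le_left _ _)⟩)

/-- The energy estimate on [a, b] is restricted to [-R, R]. The hypothesis R ≥ 2 guarantees a ≤ -1
and b ≥ 2, which keeps the three transition layers of the reference ordered. -/
theorem exists_energyBounded {γ : ℝ} (hγ : 1 < γ) {A : ℝ → ℝ} (hA : IsArea A)
    {ρminus uminus ρplus uplus L₀ : ℝ} {ρbar ubar : ℝ → ℝ} (hminus : 0 ≤ ρminus)
    (hplus : 0 ≤ ρplus) (hL : 1 ≤ L₀) (hρbar : IsProfile L₀ ρminus ρplus ρbar)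
    (hubar : IsProfile L₀ uminus uplus ubar) {ε δ a b : ℕ → ℝ} (hε : ∀ n, 0 < ε n)
    (hδ : ∀ n, 0 < δ n) {B : ℝ} (hδB : ∀ n, δ n ≤ B) (hεab : ∀ n, ε n * |b n - a n| ≤ B)
    {ρl ml ρr mr : ℕ → ℝ} (hρl : ∀ n, 0 < ρl n) (hρr : ∀ n, 0 < ρr n) (hρlB : ∀ n, ρl n ≤ B)
    (hρrB : ∀ n, ρr n ≤ B) (hU : ∀ n, |ml n / ρl n| ≤ B ∧ |mr n / ρr n| ≤ B)
    (F : ∀ n, Flow γ A (ε n) (δ n) (a n) (b n))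
    (hE : ∀ n, ∫ x in a n..b n,
      relEnergy γ (δ n) ((F n).r 0 x) ((F n).m 0 x) (ρbar x) (ubar x) * A x ≤ B)
    (hl : ∀ n t, 0 < t → (F n).r t (a n) = ρl n ∧ (F n).m t (a n) = ml n)
    (hr : ∀ n t, 0 < t → (F n).r t (b n) = ρr n ∧ (F n).m t (b n) = mr n)
    {T R : ℝ} (hT : 0 ≤ T) (hR : 2 ≤ R) :
    ∃ C, ∀ n, ε n ≤ 1 → a n ≤ -R → R ≤ b n → (F n).EnergyBounded T R C := by
  set B' := |B| + ρminus + ρplus + |uminus| + |uplus| with hB'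
  have n1 := le_abs_self B
  have n2 := abs_nonneg uminus
  have n3 := abs_nonneg uplus
  have n4 := abs_nonneg B
  have hBB : B ≤ B' := by linarith
  have hρ0 : ∀ x, 0 ≤ ρbar x := fun x => by
    obtain h | h := hρbar.bounds x
    · exact hminus.trans h.1
    · exact hplus.trans h.1
  have hρB : ∀ x, ρbar x ≤ B' := fun x => by
    obtain h | h := hρbar.bounds x <;> linarith
  have huB : ∀ x, |ubar x| ≤ B' := fun x => by
    obtain h | h := hubar.bounds x
    · exact (abs_le_max_abs_abs h.1 h.2).trans (max_le (by linarith) (by linarith))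
    · exact (abs_le_max_abs_abs h.1 h.2).trans (max_le (by linarith) (by linarith))
  obtain ⟨C, hC, hmain⟩ := Flow.energy_bounds hγ hA B' L₀ T hT hL
  refine ⟨C * (1 + (R - -R)) + C, fun n hε1 haR hbR => ?_⟩
  have h0R : 0 ≤ C * (1 + (R - -R)) := mul_nonneg hC (by linarith)
  -- The outer reference states are the actual Dirichlet data for this n, which differ in general
  -- from the limit states used inside. Bounded boundary velocities make all four uniformly bounded.
  obtain ⟨h1, h2⟩ := hmain (F n) ![ρl n, ρminus, ρplus, ρr n]
    ![ml n / ρl n, uminus, uplus, mr n / ρr n] ρbar ubar (hε n) hε1 (hδ n)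
    ((hδB n).trans hBB) (by linarith) (by linarith)
    (((mul_le_mul_of_nonneg_left (le_abs_self _) (hε n).le).trans (hεab n)).trans hBB)
    (fun i => by
      fin_cases i
      exacts [(hρl n).le, hminus, hplus, (hρr n).le])
    (fun i => by
      fin_cases i
      exacts [(hρlB n).trans hBB, by show ρminus ≤ B'; linarith, by show ρplus ≤ B'; linarith,
        (hρrB n).trans hBB])
    (fun i => by
      fin_cases i
      exacts [(hU n).1.trans hBB, by show |uminus| ≤ B'; linarith,
        by show |uplus| ≤ B'; linarith, (hU n).2.trans hBB])
    hρbar.contDiff.continuous hubar.contDiff.continuous hρ0 hρB huB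
    (fun x hx => ⟨hρbar.left x hx, hubar.left x hx⟩)
    (fun x hx => ⟨hρbar.right x hx, hubar.right x hx⟩)
    (fun t ht => ⟨(hl n t ht).1, (hl n t ht).2.trans (mul_div_cancel₀ _ (hρl n).ne').symm⟩)
    (fun t ht => ⟨(hr n t ht).1, (hr n t ht).2.trans (mul_div_cancel₀ _ (hρr n).ne').symm⟩)
    ((hE n).trans hBB)
  refine ⟨haR, hbR, fun t ht => (h1 t ht (-R) R haR (by linarith) hbR).trans (by linarith), ?_⟩
  refine le_trans (mul_le_mul_of_nonneg_left ?_ (hε n).le) (h2.trans (by linarith))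
  have cd := (F n).cont_dissipation
  refine intervalIntegral.integral_mono_on hT
    ((continuous_integral_fst cd _ _).intervalIntegrable _ _)
    ((continuous_integral_fst cd _ _).intervalIntegrable _ _) fun t _ => ?_
  refine intervalIntegral.integral_mono_interval haR (by linarith) hbR
    (ae_of_all _ fun x => (F n).dissipation_nonneg hγ (hδ n).le t x)
    ((Flow.continuous_slice cd t).intervalIntegrable _ _)

/-- The entropy pairs of a sequence of flows with uniform energy bounds have compact production. -/
theorem isCompact_closure_of_energyBounded {γ : ℝ} (hγ : 1 < γ) {A : ℝ → ℝ} (hA : IsArea A)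
    {L M : ℝ} {f f' f'' : ℝ → ℝ} (h : IsGenerator L M f f' f'') {ε δ a b : ℕ → ℝ}
    (hε : ∀ n, 0 < ε n) (hε0 : Tendsto ε atTop (𝓝 0)) (hδ : ∀ n, 0 < δ n)
    (ha : Tendsto a atTop atBot) (hb : Tendsto b atTop atTop) {B : ℝ} (hB : ∀ n, δ n / ε n ≤ B)
    (F : ∀ n, Flow γ A (ε n) (δ n) (a n) (b n))
    (hF : ∀ T R : ℝ, 0 ≤ T → 2 ≤ R →
      ∃ C, ∀ n, ε n ≤ 1 → a n ≤ -R → R ≤ b n → (F n).EnergyBounded T R C)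
    {Ω : Set (ℝ × ℝ)} (hbd : Bornology.IsBounded Ω) (hΩ0 : Ω ⊆ Ioi 0 ×ˢ univ) {T : ℕ → Hm1 Ω}
    (hT : ∀ n, IsDivergence Ω (fun z => (F n).eta f z.1 z.2) (fun z => (F n).flux f z.1 z.2) (T n))
    (I : Set ℕ) : IsCompact (closure (T '' I)) := by
  obtain ⟨l, hl, hΩl⟩ := hbd.subset_ball_lt 0 (0 : ℝ × ℝ)
  have hΩl' : Ω ⊆ Ioc (-l) l ×ˢ Ioc (-l) l := fun z hz => by
    have h1 : ‖z‖ < l := by simpa using hΩl hz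
    have h2 := abs_lt.1 ((norm_fst_le z).trans_lt h1)
    have h3 := abs_lt.1 ((norm_snd_le z).trans_lt h1)
    exact ⟨⟨h2.1, h2.2.le⟩, h3.1, h3.2.le⟩
  -- One unit of length is lost to the cutoffs in the density estimates and one to the shifts by |y|
  -- ≤ ε < 1; so bounds on [-(l + 2), l + 2] serve a set Ω inside [-l, l].
  obtain ⟨C, hC⟩ := hF l (l + 2) hl.le (by linarith)
  obtain ⟨K, hK, hest⟩ := Flow.exists_estimates hγ hA h B C l (l + 2) hl.le (by linarith)
  have hev : ∀ᶠ n in atTop, ε n < 1 ∧ a n ≤ -(l + 2) ∧ l + 2 ≤ b n :=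
    (hε0.eventually_lt_const one_pos).and
      ((ha.eventually_le_atBot _).and (hb.eventually_ge_atTop _))
  obtain ⟨N₀, hN₀⟩ := eventually_atTop.1 hev
  have hs : Tendsto (fun n => √√(ε n)) atTop (𝓝 0) := by
    simpa using hε0.sqrt.sqrt
  have hs4 : ∀ n, √√(ε n) ^ 4 = ε n := fun n => by
    rw [show 4 = 2 * 2 from rfl, pow_mul, Real.sq_sqrt (Real.sqrt_nonneg _),
      Real.sq_sqrt (hε n).le]
  have hmain := fun n (hn : N₀ ≤ n) => hest (F n) (hε n) (hN₀ n hn).1.le (hδ n).le (hB n)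
    (hC n (hN₀ n hn).1.le (hN₀ n hn).2.1 (hN₀ n hn).2.2) _
    (Real.sqrt_pos.2 (Real.sqrt_pos.2 (hε n))) (hs4 n)
  have e : l + 2 - 1 = l + 1 := by ring
  rw [e] at hmain
  refine isCompact_closure_of_balance hΩ0 hl hΩl' (σ := fun n => K * √√(ε n)) hT
    (fun n _ => (F n).balance hγ hA h) (fun n hn => ⟨hε n, (hN₀ n hn).1⟩)
    (fun n hn => ⟨by linarith [(hN₀ n hn).2.1], by linarith [(hN₀ n hn).2.2]⟩)
    (by simpa using hs.const_mul K) (fun n => by positivity) (fun n hn => (hmain n hn).1)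
    (fun n hn => (hmain n hn).2.1) (fun n hn => (hmain n hn).2.2.1) fun c hc => ?_
  -- The factor c/(K + 1) is enough: the integral of r^(γ+1) is at most K ≤ (K + 1)².
  obtain ⟨k, hk, htail⟩ := exists_excess_le hγ h.b0 (c := c / (K + 1)) (by positivity)
  refine ⟨k, hk.le, fun n hn => ?_⟩
  have hS : IsCompact (Icc 0 l ×ˢ Icc (-(l + 1)) (l + 1)) := isCompact_Icc.prod isCompact_Icc
  have key : ∀ g : ℝ × ℝ → ℝ, Continuous g →
      (∀ z, g z ≤ (c / (K + 1)) ^ 2 * (F n).r z.1 z.2 ^ (γ + 1)) →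
      ∫ z in Icc 0 l ×ˢ Icc (-(l + 1)) (l + 1), g z ≤ c ^ 2 := by
    intro g hg hle
    have h1 := setIntegral_mono (integrableOn_of_continuous hS hg)
      (integrableOn_of_continuous hS (((F n).cont_rpow (γ + 1)).const_mul _)) hle
    rw [integral_const_mul] at h1
    calc _ ≤ _ := h1
      _ ≤ (c / (K + 1)) ^ 2 * (K + 1) ^ 2 := by
          gcongr
          exact (hmain n hn).2.2.2.trans (by nlinarith)
      _ = c ^ 2 := by field_simp
  have ce := continuous_excess k
  have c1 := (F n).cont_eta hγ h
  have c2 := (F n).cont_flux hγ h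
  exact ⟨key (fun z => excess k ((F n).eta f z.1 z.2) ^ 2) ((ce.comp c1).pow 2)
      fun z => (htail _ _ ((F n).pos z.1 z.2)).1,
    key (fun z => excess k ((F n).flux f z.1 z.2) ^ 2) ((ce.comp c2).pow 2)
      fun z => (htail _ _ ((F n).pos z.1 z.2)).2⟩

end Nozzle
end

/-! ### The compactness theorem -/

theorem proposition4p1 (γ : ℝ) (hγ : 1 < γ) :
    -- the exponent in the condition that couples `δ`, `a` and `ε` depends on `γ` only
    ∃ β : ℝ, 2 < β ∧
      -- the area, the end-states and the reference profiles between them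
      ∀ (A : ℝ → ℝ), Nozzle.IsArea A →
      ∀ (ρminus mminus ρplus mplus L₀ : ℝ) (ρbar ubar : ℝ → ℝ),
        0 ≤ ρminus → 0 ≤ ρplus → 1 < L₀ →
        Nozzle.IsProfile L₀ ρminus ρplus ρbar →
        Nozzle.IsProfile L₀ (mminus / ρminus) (mplus / ρplus) ubar →
      -- the parameters of the approximation, with `ε n → 0`
      ∀ (ε δ a b : ℕ → ℝ),
        (∀ n, 0 < ε n) → Filter.Tendsto ε Filter.atTop (nhds 0) →
        (∀ n, 0 < δ n) → Filter.Tendsto δ Filter.atTop (nhds 0) →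
        (∀ n, a n < -L₀) → Filter.Tendsto a Filter.atTop Filter.atBot →
        (∀ n, L₀ < b n) → Filter.Tendsto b Filter.atTop Filter.atTop →
        (∃ M : ℝ, ∀ n, δ n * |a n| ^ β / ε n ≤ M) →
        (∃ M : ℝ, ∀ n, ε n * |b n - a n| ≤ M) →
      -- the boundary data
      ∀ (ρl ml ρr mr : ℕ → ℝ),
        (∀ n, 0 < ρl n) → (∀ n, 0 < ρr n) →
        Filter.Tendsto ρl Filter.atTop (nhds ρminus) →
        Filter.Tendsto ml Filter.atTop (nhds mminus) →
        Filter.Tendsto ρr Filter.atTop (nhds ρplus) →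
        Filter.Tendsto mr Filter.atTop (nhds mplus) →
        (∃ U : ℝ, ∀ n, |ml n / ρl n| ≤ U ∧ |mr n / ρr n| ≤ U) →
      -- the initial data, of uniformly bounded relative energy, and the approximate solutions
      ∀ (ρ₀ m₀ : ℕ → ℝ → ℝ) (ρ m : ℕ → ℝ → ℝ → ℝ),
        (∃ E₀ : ℝ, ∀ n,
          ∫ x in a n..b n,
            Nozzle.relEnergy γ (δ n) (ρ₀ n x) (m₀ n x) (ρbar x) (ubar x) * A x ≤ E₀) →
        (∀ n, Nozzle.IsApproxSolution γ A (ε n) (δ n) (a n) (b n) (ρ₀ n) (m₀ n)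
          (ρl n) (ml n) (ρr n) (mr n) (ρ n) (m n)) →
      -- the generator of the entropy pair
      ∀ (ψ : ℝ → ℝ), ContDiff ℝ ∞ ψ → HasCompactSupport ψ →
      -- on each bounded open set, the dissipation measures lie in a compact subset of `H⁻¹`
      ∀ (Ω : Set (ℝ × ℝ)), IsOpen Ω → Bornology.IsBounded Ω →
        Ω ⊆ Set.Ioi 0 ×ˢ Set.univ →
        ∃ 𝒦 : Set (Nozzle.Hm1 Ω), IsCompact 𝒦 ∧
          ∀ n, Ω ⊆ Set.Ioi 0 ×ˢ Set.Ioo (a n) (b n) →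
            ∃ T ∈ 𝒦, Nozzle.IsDivergence Ω
              (fun z => Nozzle.entropy γ ψ (ρ n z.1 z.2) (m n z.1 z.2))
              (fun z => Nozzle.entropyFlux γ ψ (ρ n z.1 z.2) (m n z.1 z.2)) T := by
  -- The coupling enters through the boundedness of δ/ε, which follows from |a| ≥ 1 and a
  -- nonnegative exponent; 3 is a convenient value above 2.
  refine ⟨3, by norm_num, ?_⟩
  intro A hA ρminus mminus ρplus mplus L₀ ρbar ubar hminus hplus hL hρbar hubar ε δ a b hε hε0 hδ
    hδ0 ha haT hb hbT ⟨M₁, hM₁⟩ ⟨M₂, hM₂⟩ ρl ml ρr mr hρl hρr hρlT _ hρrT _ ⟨U, hU⟩ ρ₀ m₀ ρ m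
    ⟨E₀, hE₀⟩ hsol ψ hψ hψc Ω hΩ hbd hΩ0
  obtain ⟨L, M, hgen⟩ := Nozzle.exists_isGenerator hψ hψc
  have hab : ∀ n, a n ≤ b n := fun n => by linarith [ha n, hb n]
  choose F hF using fun n => Nozzle.IsApproxSolution.exists_flow hA (hab n) (hsol n)
  choose T hT using fun n => Nozzle.exists_isDivergence hΩ.measurableSet hbd
    ((F n).cont_eta hγ hgen) ((F n).cont_flux hγ hgen)
  obtain ⟨B₁, hB₁⟩ := hδ0.bddAbove_range
  obtain ⟨B₂, hB₂⟩ := hρlT.bddAbove_range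
  obtain ⟨B₃, hB₃⟩ := hρrT.bddAbove_range
  have hδε : ∀ n, δ n / ε n ≤ M₁ := fun n => by
    refine le_trans ?_ (hM₁ n)
    have h1 : 1 ≤ |a n| := by
      rw [abs_of_neg (by linarith [ha n])]
      linarith [ha n]
    have h2 := Real.one_le_rpow h1 (by norm_num : (0 : ℝ) ≤ 3)
    exact div_le_div_of_nonneg_right (le_mul_of_one_le_right (hδ n).le h2) (hε n).le
  set B := max (max (max B₁ B₂) (max B₃ U)) (max M₂ E₀) with hB
  have hle : B₁ ≤ B ∧ B₂ ≤ B ∧ B₃ ≤ B ∧ U ≤ B ∧ M₂ ≤ B ∧ E₀ ≤ B := by simp [hB]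
  obtain ⟨l1, l2, l3, l4, l5, l6⟩ := hle
  have hini : ∀ n, ∀ x ∈ Icc (a n) (b n), (F n).r 0 x = ρ₀ n x ∧ (F n).m 0 x = m₀ n x :=
    fun n x hx => ⟨((hF n 0 le_rfl x hx).1).trans ((hsol n).initial x hx).1,
      ((hF n 0 le_rfl x hx).2).trans ((hsol n).initial x hx).2⟩
  -- The functionals are built from the extended flows and exist for every n; only those n for which
  -- Ω lies in the strip represent the distributions of the statement.
  refine ⟨closure (T '' {n | Ω ⊆ Ioi 0 ×ˢ Ioo (a n) (b n)}),
    Nozzle.isCompact_closure_of_energyBounded hγ hA hgen hε hε0 hδ haT hbT hδε F ?_ hbd hΩ0 hT _,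
    fun n hn => ⟨T n, subset_closure ⟨n, hn, rfl⟩, fun φ hφ v hv => ?_⟩⟩
  · intro τ R hτ hR
    refine Nozzle.exists_energyBounded hγ hA (B := B) hminus hplus hL.le hρbar hubar hε hδ
      (fun n => (hB₁ (mem_range_self n)).trans l1) (fun n => (hM₂ n).trans l5) hρl hρr
      (fun n => (hB₂ (mem_range_self n)).trans l2) (fun n => (hB₃ (mem_range_self n)).trans l3)
      (fun n => ⟨(hU n).1.trans l4, (hU n).2.trans l4⟩) F (fun n => ?_) (fun n t ht => ?_)
      (fun n t ht => ?_) hτ hR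
    · refine le_trans (le_of_eq ?_) ((hE₀ n).trans l6)
      refine intervalIntegral.integral_congr fun x hx => ?_
      rw [uIcc_of_le (hab n)] at hx
      simp only [(hini n x hx).1, (hini n x hx).2]
    · obtain ⟨h1, h2⟩ := hF n t ht.le (a n) (left_mem_Icc.2 (hab n))
      exact ⟨h1.trans ((hsol n).left t ht.le).1, h2.trans ((hsol n).left t ht.le).2⟩
    · obtain ⟨h1, h2⟩ := hF n t ht.le (b n) (right_mem_Icc.2 (hab n))
      exact ⟨h1.trans ((hsol n).right t ht.le).1, h2.trans ((hsol n).right t ht.le).2⟩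
  -- On Ω, contained in the open strip for this n, the extended flow coincides with the solution, so
  -- both divergences have the same integrand.
  · rw [hT n φ hφ v hv]
    congr 1
    refine setIntegral_congr_fun hΩ.measurableSet fun z hz => ?_
    obtain ⟨h1, h2⟩ := hF n z.1 (hn hz).1.le z.2 (Ioo_subset_Icc_self (hn hz).2)
    simp only [Nozzle.entropy_eq, Nozzle.entropyFlux_eq hγ hgen.b0, ← h1, ← h2]
    rfl
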